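/- **Conventions.** Let $k$ be a field of characteristic $0$ and let $A=A_0\oplus A_1$ be a finite-dimensional $\mathbb Z/2$-graded vector space over $k$ with an odd scalar product $\beta$ (nondegenerate, symmetric, $\beta(a,b)=0$ unless $a,b$ have opposite parities). $\Pi A$ is $A$ with reversed parity; Koszul signs are those of letters in $\Pi A$. Let $\beta^\vee=\sum_j e^j\otimes e_j$, where $\beta(e^i,e_j)=\delta_{ij}$. *Functionals.* For a space $V$ with odd scalar product, an element $f$ of $\mathrm{Symm}(\bigoplus_{j\ge1}((\Pi V)^{\otimes j})^{\mathbb Z/j})^\vee$ is a family of multilinear functionals $f_\sigma$ on $(\Pi V)^{\otimes n}$, $n\ge 0$, $\sigma\in\mathbb S_n$, equivariant under relabelling with Koszul signs; the cycles of $\sigma$ are the cyclic words in which the $n$ letters are arranged. On even functionals define: * $\Delta f=\frac12\sum f(\beta^\vee\otimes a)$, summed over all ways to glue (dissection-gluing of words) an ordered pair of letters of $f$, the pair being contracted with $\beta^\vee$, such that no empty word arises: neighbours in one word, and the letters of two one-letter words, are not glued; * $\{f,g\}$ is the same sum for $f\otimes g$, with the first glued letter in $f$ and the second in $g$ (no factor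 $\frac12$), i.e. $\{f,g\}=\Delta(fg)-\Delta(f)g-f\Delta(g)$; * for an odd operator $I$, $(I^\vee f)(a_1,\dots,a_n)=-\sum_i(-1)^{\bar a_1+\dots+\bar a_{i-1}}f(a_1,\dots,Ia_i,\dots,a_n)$ with parities taken in $\Pi V$. They are extended coefficientwise to power series in $\hbar$. **Data.** * An odd operator $I$ on $A$ (possibly $I^2\ne0$) with $\beta(Ia,b)+(-1)^{\bar a}\beta(a,Ib)=0$. * Even cyclically invariant tensors $m_n\in((\Pi A)^{\otimes n+1})^\vee$, $n\ge2$. Let $m=\sum_{n\ge2}m_n$, a functional on single cyclic words of length at least $3$, and assume $$I^\vee m+\tfrac12\{m,m\}=0,\qquad \Delta m=0 .$$ * An odd operator $H$ on $A$, selfadjoint ($\beta(Ha,b)=(-1)^{\bar a}\beta(a,Hb)$), commuting with $I^2$, such that $P=\mathrm{Id}-[I,H]=\mathrm{Id}-(IH+HI)$ is idempotent. Let $B=P(A)$, with the scalar product $\beta|_B$, the restriction of $\beta$; the operator $I$ preserves $B$. For a ribbon graph $\Gamma$ with all vertices of valence at least $3$ and legs labelled by letters $a_l\in\Pi B$ put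 $$W_\Gamma\Big(\bigotimes_l a_l\Big)=\Big\langle\bigotimes_v m_{n(v)-1},\ \Big(\bigotimes_e\beta_H^{\vee}\Big)\otimes\bigotimes_l a_l\Big\rangle,\qquad \beta_H^{\vee}=(H\otimes1)\beta^\vee=\sum_j He^j\otimes e_j ,$$ where $n(v)$ is the valence of $v$, and let $\chi(\Sigma_\Gamma)=|\mathrm{Vert}(\Gamma)|-|\mathrm{Edge}(\Gamma)|$ be the Euler characteristic of the associated surface. Put $$S=\sum_\Gamma\hbar^{1-\chi(\Sigma_\Gamma)}W_\Gamma ,$$ where the value of $S$ on a product of cyclic words is the sum over isomorphism classes of connected ribbon graphs with all vertices of valence at least $3$, whose legs are labelled by the letters so that the boundary components of $\Sigma_\Gamma$, with the cyclic orders of their legs, are exactly the given (nonempty) words; this sum is finite for each power of $\hbar$. **Theorem.** $S$ is a power series in $\hbar$ with coefficients even elements of $\mathrm{Symm}(\bigoplus_{j\ge1}((\Pi B)^{\otimes j})^{\mathbb Z/j})^\vee$, and it satisfies the equivariant noncommutative Batalin–Vilkovisky equation of $(B,\beta|_B)$: $$\hbar\Delta S+\tfrac12\{S,S\}+I^\vee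 S=0 .$$ In particular, if $I|_B=0$, then $\hbar\Delta S+\frac12\{S,S\}=0$. If $I^2|_B=0$, then $S+S_{0,2}$ has even coefficients in the same space and satisfies $\hbar\Delta(S+S_{0,2})+\frac12\{S+S_{0,2},S+S_{0,2}\}=0$, where $S_{0,2}(\pi a,\pi b)=(-1)^{\bar a}\beta(Ia,b)$, $a,b\in B$ (with $\bar a$ the parity in $A$), is the quadratic term corresponding to $I|_B$. -/

import Mathlib

open Equiv Finset

noncomputable section

namespace NCBV

variable {k : Type*} [Field k] {V : Type*} [AddCommGroup V] [Module k V]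

/-! ### Super vector spaces and Koszul signs

A super vector space is a vector space `V` with a decomposition `𝒱 : ZMod 2 → Submodule k V`.
The space `ΠV` has the same underlying vector space, and a vector of parity `ε` in `V` has
parity `ε + 1` as a letter of `ΠV`. Multilinear functionals on `ΠV` are written as functions of
vectors of `V`; all Koszul signs below are those of the letters of `ΠV`. -/

/-- The homogeneous component of parity `ε`. -/
def component (𝒱 : ZMod 2 → Submodule k V) [DirectSum.Decomposition 𝒱] (ε : ZMod 2) (v : V) : V :=
  (DirectSum.decompose 𝒱 v ε : V)

/-- The sign of parity in `ΠV`: multiplication by `(-1)^(ε+1)` on vectors of parity `ε` in `V`. -/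
def piSign (𝒱 : ZMod 2 → Submodule k V) [DirectSum.Decomposition 𝒱] (v : V) : V :=
  component 𝒱 1 v - component 𝒱 0 v

/-- The Koszul sign of the rearrangement of letters `x₀, …, x_{N-1}` (written in this order, with
parities `q`) in order of increasing rank `r`; letters of equal rank keep their order. -/
def koszul {N : ℕ} (q : Fin N → ZMod 2) (r : Fin N → ℕ) : k :=
  ∏ x : Fin N, ∏ y : Fin N,
    if x < y ∧ r y < r x ∧ q x = 1 ∧ q y = 1 then -1 else 1

/-! ### Odd scalar products -/

/-- A (nondegenerate, symmetric) odd scalar product. As `β(a, b) = 0` unless `a`, `b` have opposite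
parities, the sign in `β(a,b) = (-1)^{|a||b|} β(b,a)` is always `1`. -/
structure OddScalarProduct (𝒱 : ZMod 2 → Submodule k V) where
  form : LinearMap.BilinForm k V
  symm : ∀ a b, form a b = form b a
  odd : ∀ ε, ∀ a ∈ 𝒱 ε, ∀ b ∈ 𝒱 ε, form a b = 0
  nondegenerate : form.Nondegenerate

/-- The basis `(eʲ)` dual to the basis `(e_j) = Module.finBasis k V`: `β(eⁱ, e_j) = δ_{ij}`.
The tensor of the scalar product on the dual space is `β^∨ = ∑ⱼ eʲ ⊗ e_j`. -/
def OddScalarProduct.dual [FiniteDimensional k V] {𝒱 : ZMod 2 → Submodule k V}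
    (β : OddScalarProduct 𝒱) : Module.Basis (Fin (Module.finrank k V)) k V :=
  β.form.dualBasis β.nondegenerate (Module.finBasis k V)

/-- An odd operator `I` on `V` that preserves the scalar product; `I² ≠ 0` is allowed. -/
structure OddSymmetry {𝒱 : ZMod 2 → Submodule k V} (β : OddScalarProduct 𝒱) where
  I : Module.End k V
  odd : ∀ ε, ∀ a ∈ 𝒱 ε, I a ∈ 𝒱 (ε + 1)
  invariant : ∀ ε, ∀ a ∈ 𝒱 ε, ∀ b, β.form (I a) b + (-1) ^ ε.val * β.form a (I b) = 0

/-- An odd selfadjoint operator `H` that commutes with `I²` and for which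
`P = Id - [I, H] = Id - (IH + HI)` is idempotent. -/
structure OddHomotopy {𝒱 : ZMod 2 → Submodule k V} {β : OddScalarProduct 𝒱}
    (I : OddSymmetry β) where
  H : Module.End k V
  odd : ∀ ε, ∀ a ∈ 𝒱 ε, H a ∈ 𝒱 (ε + 1)
  selfadjoint : ∀ ε, ∀ a ∈ 𝒱 ε, ∀ b, β.form (H a) b = (-1) ^ ε.val * β.form a (H b)
  commute : Commute H (I.I * I.I)
  idempotent : IsIdempotentElem (1 - (I.I * H + H * I.I))

/-! ### Functionals on products of cyclic words

A way to arrange the letters `x₀, …, x_{n-1}` into an (unordered) product of nonempty cyclic words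
is the same as a permutation `σ` of `Fin n`: its cycles (fixed points included) are the words, and
the letter after `x_i` in its word is `x_{σ i}`. Hence
`Symm(⊕_{j ≥ 1} ((ΠV)^{⊗j})^{ℤ/j})^∨` consists of the families of multilinear functionals `f_σ` on
`(ΠV)^{⊗n}`, one for every `n` and every permutation `σ` of `Fin n`, that are equivariant
(with Koszul signs) under relabelling of the letters. -/

/-- Families of functions, one for every arrangement `σ` of `n` letters into cyclic words. -/
abbrev Functional (k V : Type*) := (n : ℕ) → Perm (Fin n) → (Fin n → V) → k

/-- `f` is an even element of `Symm(⊕_{j ≥ 1} ((ΠV)^{⊗j})^{ℤ/j})^∨`. -/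
structure IsEvenFunctional (𝒱 : ZMod 2 → Submodule k V) (f : Functional k V) : Prop where
  multilinear : ∀ n σ, ∃ g : MultilinearMap k (fun _ : Fin n => V) k, ∀ a, f n σ a = g a
  even : ∀ n σ (p : Fin n → ZMod 2) (a : Fin n → V), (∀ i, a i ∈ 𝒱 (p i)) →
    ∑ i, (p i + 1) ≠ 0 → f n σ a = 0
  equivariant : ∀ n (σ ρ : Perm (Fin n)) (p : Fin n → ZMod 2) (a : Fin n → V),
    (∀ i, a i ∈ 𝒱 (p i)) →
    f n (ρ * σ * ρ⁻¹) a
      = koszul (fun i => p i + 1) (fun i => (ρ⁻¹ i : ℕ)) * f n σ (fun i => a (ρ i))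

/-! ### Gluing -/

/-- Let `φ` be the permutation `τ ∘ ι` of the flags of a ribbon graph, where `τ` is the permutation
"next flag at the same vertex" and `ι` is the involution exchanging the two flags of every edge and
fixing the legs. The cycles of `φ` are the boundary components of the ribbon surface, and the leg
after a given leg on its boundary component is the first one met by iterating `φ`.
`IsBoundary φ leg σ` says that every boundary component carries a leg and that on the legs,
labelled by `leg`, the permutation "next leg on the same boundary component" is `σ`. -/
def IsBoundary {F : Type*} {n : ℕ} (φ : Perm F) (leg : Fin n → F) (σ : Perm (Fin n)) : Prop :=
  (∀ x : F, ∃ (r : ℕ) (i : Fin n), (φ ^ r) x = leg i) ∧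
  ∀ i : Fin n, ∃ r : ℕ, (φ ^ (r + 1)) (leg i) = leg (σ i) ∧
    ∀ s < r, ∀ j : Fin n, (φ ^ (s + 1)) (leg i) ≠ leg j

/-- Gluing the first two of `n + 2` letters arranged in cyclic words by `τ` (a strip is attached at
these two points of the boundary circles) leaves the other letters arranged by `σ`, and leaves no
empty word. In particular neighbours on the same circle, or two one-letter words, are not glued. -/
def Glues {n : ℕ} (τ : Perm (Fin (n + 2))) (σ : Perm (Fin n)) : Prop :=
  IsBoundary (τ * swap 0 1) (fun i : Fin n => i.succ.succ) σ

/-! ### The operators of the noncommutative Batalin-Vilkovisky equation -/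

/-- The action `I^∨` of an odd operator `I` on (even) functionals, as a derivation:
`(I^∨ f)(a₁, …, a_n) = -∑_i (-1)^{|a₁| + ⋯ + |a_{i-1}|} f(a₁, …, I a_i, …, a_n)`,
with the parities of the letters in `ΠV`. -/
def dualAction (𝒱 : ZMod 2 → Submodule k V) [DirectSum.Decomposition 𝒱] (I : Module.End k V)
    (f : Functional k V) : Functional k V :=
  fun n σ a => - ∑ i : Fin n,
    f n σ (fun j => if j < i then piSign 𝒱 (a j) else if j = i then I (a j) else a j)

open Classical in
/-- The Batalin-Vilkovisky operator `Δ`: contraction with `β^∨` of every unordered pair of letters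
(the sum is over ordered pairs, whence the factor `1/2`), with gluing of the words. -/
def laplacian [FiniteDimensional k V] {𝒱 : ZMod 2 → Submodule k V} (β : OddScalarProduct 𝒱)
    (f : Functional k V) : Functional k V :=
  fun n σ a => (2 : k)⁻¹ * ∑ τ : Perm (Fin (n + 2)), if Glues τ σ then
    ∑ j, f (n + 2) τ (Fin.cons (β.dual j) (Fin.cons (Module.finBasis k V j) a)) else 0

/-- `T` is a union of words of the arrangement `τ`. -/
def IsUnionOfWords {N : ℕ} (τ : Perm (Fin N)) (T : Finset (Fin N)) : Prop :=
  ∀ x, τ x ∈ T ↔ x ∈ T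

open Classical in
/-- The words of `τ` contained in `T`, with the letters of `T` renumbered in increasing order. -/
def restrictWords {N : ℕ} (τ : Perm (Fin N)) (T : Finset (Fin N)) : Perm (Fin T.card) :=
  if h : IsUnionOfWords τ T then
    (T.orderIsoOfFin rfl).symm.toEquiv.permCongr (τ.subtypePerm h) else 1

/-- `f ⊗ g` evaluated on the letters `a` with the words of `τ` in `T` fed to `f` and the other words
fed to `g`. The sum over `p` decomposes the letters into homogeneous components. -/
def splitProduct (𝒱 : ZMod 2 → Submodule k V) [DirectSum.Decomposition 𝒱] (f g : Functional k V)
    {N : ℕ} (τ : Perm (Fin N)) (T : Finset (Fin N)) (a : Fin N → V) : k :=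
  ∑ p : Fin N → ZMod 2,
    koszul (fun x => p x + 1) (fun x => if x ∈ T then 0 else 1) *
    f T.card (restrictWords τ T)
      (fun i => component 𝒱 (p (T.orderEmbOfFin rfl i)) (a (T.orderEmbOfFin rfl i))) *
    g Tᶜ.card (restrictWords τ Tᶜ)
      (fun i => component 𝒱 (p (Tᶜ.orderEmbOfFin rfl i)) (a (Tᶜ.orderEmbOfFin rfl i)))

open Classical in
/-- The odd Poisson bracket `{f, g}` of (even) functionals: contraction with `β^∨` of a letter of
`f` with a letter of `g`, with gluing of the two words that contain them. It is the deviation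
`Δ(fg) - Δ(f) g - f Δ(g)` of `Δ` from a derivation. -/
def bracket [FiniteDimensional k V] {𝒱 : ZMod 2 → Submodule k V} [DirectSum.Decomposition 𝒱]
    (β : OddScalarProduct 𝒱) (f g : Functional k V) : Functional k V :=
  fun n σ a => ∑ τ : Perm (Fin (n + 2)), if Glues τ σ then
    ∑ T : Finset (Fin (n + 2)), if IsUnionOfWords τ T ∧ 0 ∈ T ∧ 1 ∉ T then
      ∑ j, splitProduct 𝒱 f g τ T (Fin.cons (β.dual j) (Fin.cons (Module.finBasis k V j) a))
    else 0 else 0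

/-! ### Power series in `ħ` with coefficients in functionals -/

/-- `S = ∑_b ħ^b S_b`. -/
abbrev Series (k V : Type*) := ℕ → Functional k V

/-- Multiplication by `ħ`. -/
def hbar (S : Series k V) : Series k V
  | 0 => 0
  | b + 1 => S b

def laplacianSeries [FiniteDimensional k V] {𝒱 : ZMod 2 → Submodule k V}
    (β : OddScalarProduct 𝒱) (S : Series k V) : Series k V :=
  fun b => laplacian β (S b)

def bracketSeries [FiniteDimensional k V] {𝒱 : ZMod 2 → Submodule k V} [DirectSum.Decomposition 𝒱]
    (β : OddScalarProduct 𝒱) (S T : Series k V) : Series k V :=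
  fun b => ∑ c ∈ antidiagonal b, bracket β (S c.1) (T c.2)

def dualActionSeries (𝒱 : ZMod 2 → Submodule k V) [DirectSum.Decomposition 𝒱]
    (I : Module.End k V) (S : Series k V) : Series k V :=
  fun b => dualAction 𝒱 I (S b)

/-- `S` is a series of even functionals with `ħΔS + ½{S,S} + I^∨ S = 0`. -/
def SolvesEquivariantBV [FiniteDimensional k V] {𝒱 : ZMod 2 → Submodule k V}
    [DirectSum.Decomposition 𝒱] {β : OddScalarProduct 𝒱} (I : OddSymmetry β)
    (S : Series k V) : Prop :=
  (∀ b, IsEvenFunctional 𝒱 (S b)) ∧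
  hbar (laplacianSeries β S) + (2 : k)⁻¹ • bracketSeries β S S + dualActionSeries 𝒱 I.I S = 0

/-- `S` is a series of even functionals with `ħΔS + ½{S,S} = 0`. -/
def SolvesBV [FiniteDimensional k V] {𝒱 : ZMod 2 → Submodule k V} [DirectSum.Decomposition 𝒱]
    (β : OddScalarProduct 𝒱) (S : Series k V) : Prop :=
  (∀ b, IsEvenFunctional 𝒱 (S b)) ∧
  hbar (laplacianSeries β S) + (2 : k)⁻¹ • bracketSeries β S S = 0

open Classical in
/-- The quadratic term `S_{0,2}(πa, πb) = (-1)^{|a|} β(I a, b)`, a functional on single cyclic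
words of length two, in degree zero in `ħ`. (Here `-piSign` is the sign of the parity in `V`.) -/
def quadraticTerm {𝒱 : ZMod 2 → Submodule k V} [DirectSum.Decomposition 𝒱]
    {β : OddScalarProduct 𝒱} (I : OddSymmetry β) : Series k V
  | 0 => fun n σ a =>
      if h : n = 2 then
        if ∀ i, σ i ≠ i then
          β.form (I.I (-piSign 𝒱 (a ⟨0, by omega⟩))) (a ⟨1, by omega⟩) else 0
      else 0
  | _ + 1 => 0

/-! ### Cyclic tensors and their products -/

/-- Even, cyclically invariant tensors on `ΠV`. The tensor `tensor n` has `n` arguments, so for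
`n ≥ 3` it is `β(m_{n-1}(a₁, …, a_{n-1}), a_n)` up to sign, where `m_{n-1}` is the operation with
`n - 1` inputs; the cases `n < 3` are not used. -/
structure CyclicTensors (𝒱 : ZMod 2 → Submodule k V) where
  tensor : (n : ℕ) → MultilinearMap k (fun _ : Fin n => V) k
  even : ∀ n, 3 ≤ n → ∀ (p : Fin n → ZMod 2) (a : Fin n → V), (∀ i, a i ∈ 𝒱 (p i)) →
    ∑ i, (p i + 1) ≠ 0 → tensor n a = 0
  cyclic : ∀ n, 3 ≤ n → ∀ (p : Fin n → ZMod 2) (a : Fin n → V), (∀ i, a i ∈ 𝒱 (p i)) →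
    tensor n a = koszul (fun i => p i + 1) (fun i => ((finRotate n)⁻¹ i : ℕ)) *
      tensor n (fun i => a (finRotate n i))

open Classical in
/-- The cycles of `τ` (fixed points included), each written as a list `[x, τ x, τ² x, …]` that
starts at the least element of the cycle. -/
def cycleLists {N : ℕ} (τ : Perm (Fin N)) : List (List (Fin N)) :=
  ((List.finRange N).filter (fun x => ∀ y, τ.SameCycle x y → x ≤ y)).map
    (fun x => (List.range (Function.minimalPeriod τ x)).map (fun i => (τ ^ i) x))

/-- The tensor product `⊗_v m^v` over the cycles `v` of `τ`, evaluated on the letters `x`.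
The sum over `p` decomposes the letters into homogeneous components. -/
def vertexProduct {𝒱 : ZMod 2 → Submodule k V} [DirectSum.Decomposition 𝒱] (m : CyclicTensors 𝒱)
    {N : ℕ} (τ : Perm (Fin N)) (x : Fin N → V) : k :=
  ∑ p : Fin N → ZMod 2,
    koszul (fun y => p y + 1) (fun y => (cycleLists τ).flatten.idxOf y) *
    ((cycleLists τ).map (fun w =>
      m.tensor w.length (fun i => component 𝒱 (p (w.get i)) (x (w.get i))))).prod

open Classical in
/-- The functional `m = ∑_{n ≥ 3} m^{(n)}` on single cyclic words of length at least three. -/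
def CyclicTensors.functional {𝒱 : ZMod 2 → Submodule k V} [DirectSum.Decomposition 𝒱]
    (m : CyclicTensors 𝒱) : Functional k V :=
  fun n σ a => if 3 ≤ n ∧ ∀ i j, σ.SameCycle i j then vertexProduct m σ a else 0

/-! ### Ribbon graphs -/

/-- A ribbon graph with `n` legs labelled by `Fin n`: its flags are the two halves of each of the
`edges` edges and the legs, and `next` is the permutation whose cycles are the cyclically ordered
vertices. Up to isomorphism every ribbon graph with `n` labelled legs is of this form. -/
structure RibbonGraph (n : ℕ) where
  edges : ℕ
  next : Perm ((Fin edges × Fin 2) ⊕ Fin n)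

namespace RibbonGraph

variable {n : ℕ}

abbrev Flag (Γ : RibbonGraph n) := (Fin Γ.edges × Fin 2) ⊕ Fin n

/-- The involution that exchanges the two halves of every edge and fixes the legs. -/
def flip (Γ : RibbonGraph n) : Perm Γ.Flag :=
  Equiv.sumCongr (Equiv.prodCongr (Equiv.refl _) (swap 0 1)) (Equiv.refl _)

def Vertex (Γ : RibbonGraph n) := Quotient (Perm.SameCycle.setoid Γ.next)

/-- Isomorphisms of ribbon graphs, preserving the labels of the legs. -/
def IsIso (Γ Γ' : RibbonGraph n) (φ : Γ.Flag ≃ Γ'.Flag) : Prop :=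
  (∀ x, φ (Γ.next x) = Γ'.next (φ x)) ∧ (∀ x, φ (Γ.flip x) = Γ'.flip (φ x)) ∧
  ∀ i : Fin n, φ (Sum.inr i) = Sum.inr i

def isoSetoid (n : ℕ) : Setoid (RibbonGraph n) where
  r Γ Γ' := ∃ φ, IsIso Γ Γ' φ
  iseqv :=
    { refl := fun Γ => ⟨Equiv.refl _, fun _ => rfl, fun _ => rfl, fun _ => rfl⟩
      symm := by
        rintro Γ Γ' ⟨φ, h1, h2, h3⟩
        refine ⟨φ.symm, fun x => ?_, fun x => ?_, fun i => ?_⟩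
        · rw [Equiv.symm_apply_eq, h1, Equiv.apply_symm_apply]
        · rw [Equiv.symm_apply_eq, h2, Equiv.apply_symm_apply]
        · rw [Equiv.symm_apply_eq, h3]
      trans := by
        rintro Γ Γ' Γ'' ⟨φ, h1, h2, h3⟩ ⟨ψ, g1, g2, g3⟩
        refine ⟨φ.trans ψ, fun x => ?_, fun x => ?_, fun i => ?_⟩
        · simp [h1, g1]
        · simp [h2, g2]
        · simp [h3, g3] }

/-- Isomorphism classes of ribbon graphs with `n` labelled legs. -/
def IsoClass (n : ℕ) := Quotient (isoSetoid n)

def Connected (Γ : RibbonGraph n) : Prop :=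
  Nonempty Γ.Flag ∧ ∀ x y : Γ.Flag, ∃ π ∈ Subgroup.closure {Γ.next, Γ.flip}, π x = y

/-- `Γ` is connected, all its vertices have valence at least three, `1 - χ(Σ_Γ) = b` where
`χ(Σ_Γ) = |Vert(Γ)| - |Edge(Γ)|`, every boundary component of `Σ_Γ` carries a leg, and the legs are
distributed over the boundary components as the letters over the words of `σ`. -/
structure Contributes (Γ : RibbonGraph n) (b : ℕ) (σ : Perm (Fin n)) : Prop where
  connected : Γ.Connected
  valence : ∀ x : Γ.Flag, 3 ≤ Function.minimalPeriod Γ.next x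
  euler : 1 + Γ.edges = b + Nat.card Γ.Vertex
  boundary : IsBoundary (Γ.next * Γ.flip) (fun i => Sum.inr i) σ

/-- The numbering of the flags: the two halves of every edge in turn, then the legs. -/
def numbering (Γ : RibbonGraph n) : Γ.Flag ≃ Fin (Γ.edges * 2 + n) :=
  (Equiv.sumCongr finProdFinEquiv (Equiv.refl _)).trans finSumFinEquiv

/-- The contraction `⟨⊗_v m^v, (⊗_e β_H^{∨,e}) ⊗ (⊗_l a_l)⟩`, where
`β_H^∨ = (H ⊗ 1) β^∨ = ∑ⱼ H eʲ ⊗ e_j`. -/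
def weight [FiniteDimensional k V] {𝒱 : ZMod 2 → Submodule k V} [DirectSum.Decomposition 𝒱]
    {β : OddScalarProduct 𝒱} {I : OddSymmetry β} (h : OddHomotopy I) (m : CyclicTensors 𝒱)
    (Γ : RibbonGraph n) (a : Fin n → V) : k :=
  ∑ j : Fin Γ.edges → Fin (Module.finrank k V),
    vertexProduct m (Γ.numbering.permCongr Γ.next) (fun x =>
      match Γ.numbering.symm x with
      | Sum.inl (e, s) =>
          if s = 0 then h.H (β.dual (j e)) else Module.finBasis k V (j e)
      | Sum.inr l => a l)

/-- The sums over ribbon graphs below are finite. -/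
theorem finite_contributes (b : ℕ) (σ : Perm (Fin n)) :
    {c : IsoClass n | (Quotient.out c).Contributes b σ}.Finite := by
  classical
  have bound : ∀ Γ : RibbonGraph n, Γ.Contributes b σ → Γ.edges ≤ 3 * b + n := by
    intro Γ hΓ
    have : Fintype Γ.Vertex := Fintype.ofFinite (Quotient (Perm.SameCycle.setoid Γ.next))
    have hcard : Fintype.card Γ.Vertex * 3 ≤ Fintype.card Γ.Flag := by
      rw [← Finset.card_univ, ← Finset.card_univ, mul_comm]
      let q : Γ.Flag → Γ.Vertex := Quotient.mk (Perm.SameCycle.setoid Γ.next)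
      refine Finset.mul_card_image_le_card_of_maps_to (β := Γ.Vertex) (f := q)
        (fun _ _ => Finset.mem_univ _) 3 fun v _ => ?_
      obtain ⟨x, rfl⟩ := Quotient.exists_rep v
      have hx := hΓ.valence x
      have hin : Function.Injective (fun i : Fin 3 => Γ.next^[(i : ℕ)] x) := by
        intro i j hij
        exact Fin.ext (Function.iterate_injOn_Iio_minimalPeriod
          (Set.mem_Iio.2 (by omega)) (Set.mem_Iio.2 (by omega)) hij)
      rw [show 3 = (Finset.univ.image (fun i : Fin 3 => Γ.next^[(i : ℕ)] x)).card by
        rw [Finset.card_image_of_injective _ hin]; simp]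
      refine Finset.card_le_card fun y hy => ?_
      obtain ⟨i, -, rfl⟩ := Finset.mem_image.1 hy
      refine Finset.mem_filter.2 ⟨Finset.mem_univ _, Quotient.sound ?_⟩
      change Γ.next.SameCycle _ x
      exact Perm.SameCycle.symm ⟨(i : ℕ), by simp [Perm.iterate_eq_pow]⟩
    have he := hΓ.euler
    rw [Nat.card_eq_fintype_card] at he
    simp only [Flag, Fintype.card_sum, Fintype.card_prod, Fintype.card_fin] at hcard
    omega
  have hfin : {Γ : RibbonGraph n | Γ.edges ≤ 3 * b + n}.Finite := by
    let g : (Σ e : Fin (3 * b + n + 1), Perm ((Fin e × Fin 2) ⊕ Fin n)) → RibbonGraph n :=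
      fun x => ⟨x.1, x.2⟩
    refine (Set.finite_range g).subset ?_
    rintro ⟨e, τ⟩ he
    exact ⟨⟨⟨e, Nat.lt_succ_of_le he⟩, τ⟩, rfl⟩
  have hinj : Function.Injective (fun c : IsoClass n => (Quotient.out c : RibbonGraph n)) :=
    fun c c' h => Quotient.out_injective h
  exact (hfin.preimage hinj.injOn).subset fun c hc => bound _ hc

end RibbonGraph

/-! ### The image of the idempotent -/

namespace OddHomotopy

variable {𝒱 : ZMod 2 → Submodule k V} {β : OddScalarProduct 𝒱} {I : OddSymmetry β}

/-- `P = Id - [I, H]`. -/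
def proj (h : OddHomotopy I) : Module.End k V := 1 - (I.I * h.H + h.H * I.I)

/-- The space `B`, the image of `P`. -/
abbrev image (h : OddHomotopy I) : Submodule k V := LinearMap.range h.proj

/-- The grading of `B`. -/
def grading (h : OddHomotopy I) (ε : ZMod 2) : Submodule k h.image :=
  (𝒱 ε).comap h.image.subtype

theorem proj_proj (h : OddHomotopy I) (x : V) : h.proj (h.proj x) = h.proj x := by
  have := h.idempotent
  exact congrArg (fun f : Module.End k V => f x) this

theorem proj_of_mem (h : OddHomotopy I) {x : V} (hx : x ∈ h.image) : h.proj x = x := by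
  obtain ⟨y, rfl⟩ := hx
  exact h.proj_proj y

theorem proj_mem (h : OddHomotopy I) (ε : ZMod 2) (a : V) (ha : a ∈ 𝒱 ε) : h.proj a ∈ 𝒱 ε := by
  have e2 : ε + 1 + 1 = ε := by rw [add_assoc]; simp [CharTwo.add_self_eq_zero]
  have h1 := I.odd _ _ (h.odd _ _ ha)
  have h2 := h.odd _ _ (I.odd _ _ ha)
  rw [e2] at h1 h2
  simpa [proj] using sub_mem ha (add_mem h1 h2)

theorem proj_selfadjoint [DirectSum.Decomposition 𝒱] (h : OddHomotopy I) (a b : V) :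
    β.form (h.proj a) b = β.form a (h.proj b) := by
  have key : ∀ ε, ∀ a ∈ 𝒱 ε, β.form (h.proj a) b = β.form a (h.proj b) := by
    intro ε a ha
    have h1 := I.invariant _ _ (h.odd _ _ ha) b
    have h2 := h.selfadjoint _ _ ha (I.I b)
    have h3 := h.selfadjoint _ _ (I.odd _ _ ha) b
    have h4 := I.invariant _ _ ha (h.H b)
    have hs : ((-1 : k) ^ (ε + 1).val) = -((-1) ^ ε.val) := by
      obtain rfl | rfl : ε = 0 ∨ ε = 1 := (by decide : ∀ ε : ZMod 2, ε = 0 ∨ ε = 1) ε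
      · rw [show (0 + 1 : ZMod 2).val = 1 from rfl, show (0 : ZMod 2).val = 0 from rfl]
        simp
      · rw [show (1 + 1 : ZMod 2).val = 0 from rfl, show (1 : ZMod 2).val = 1 from rfl]
        simp
    have hq : ((-1 : k) ^ ε.val) * ((-1) ^ ε.val) = 1 := by
      rw [← mul_pow]; simp
    rw [hs] at h1 h3
    simp only [proj, LinearMap.sub_apply, LinearMap.add_apply, Module.End.mul_apply,
      Module.End.one_apply, map_sub, map_add]
    linear_combination (-1 : k) * h1 - ((-1) ^ ε.val) * h2 - h3 + ((-1) ^ ε.val) * h4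
      - β.form a (h.H (I.I b)) * hq - β.form a (I.I (h.H b)) * hq
  induction a using DirectSum.Decomposition.inductionOn 𝒱 with
  | zero => simp
  | homogeneous a => exact key _ _ a.2
  | add a a' h1 h2 => simp [h1, h2]

theorem component_mem [DirectSum.Decomposition 𝒱] (h : OddHomotopy I) (ε : ZMod 2) {x : V}
    (hx : x ∈ h.image) : component 𝒱 ε x ∈ h.image := by
  have key : ∀ x, component 𝒱 ε (h.proj x) = h.proj (component 𝒱 ε x) := by
    intro x
    induction x using DirectSum.Decomposition.inductionOn 𝒱 with
    | zero => simp [component]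
    | @homogeneous δ a =>
      by_cases e : δ = ε
      · subst e
        simp only [component]
        rw [DirectSum.decompose_of_mem_same 𝒱 (h.proj_mem _ _ a.2),
          DirectSum.decompose_of_mem_same 𝒱 a.2]
      · simp only [component]
        rw [DirectSum.decompose_of_mem_ne 𝒱 (h.proj_mem _ _ a.2) e,
          DirectSum.decompose_of_mem_ne 𝒱 a.2 e, map_zero]
    | add a a' h1 h2 =>
      simp only [component] at h1 h2 ⊢
      simp [DirectSum.decompose_add, h1, h2]
  refine ⟨component 𝒱 ε x, ?_⟩
  rw [← key, h.proj_of_mem hx]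

instance [DirectSum.Decomposition 𝒱] (h : OddHomotopy I) : DirectSum.Decomposition h.grading where
  decompose' x := ∑ ε, DirectSum.of (fun ε => h.grading ε) ε
    ⟨⟨component 𝒱 ε x, h.component_mem ε x.2⟩, (DirectSum.decompose 𝒱 (x : V) ε).2⟩
  left_inv x := by
    apply Subtype.ext
    conv_rhs => rw [← (DirectSum.decompose 𝒱).symm_apply_apply (x : V)]
    rw [map_sum]
    simp only [DirectSum.coeAddMonoidHom_of]
    rw [AddSubmonoidClass.coe_finsetSum]
    conv_rhs => rw [← DirectSum.sum_univ_of (DirectSum.decompose 𝒱 (x : V))]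
    rw [DirectSum.decompose_symm_sum]
    exact Finset.sum_congr rfl fun ε _ => (DirectSum.decompose_symm_of 𝒱 _).symm
  right_inv x := by
    have key : ∀ (δ ε : ZMod 2) (y : h.grading δ),
        component 𝒱 ε ((y : h.image) : V) = if δ = ε then ((y : h.image) : V) else 0 := by
      intro δ ε y
      split_ifs with e
      · subst e
        exact DirectSum.decompose_of_mem_same 𝒱 y.2
      · exact DirectSum.decompose_of_mem_ne 𝒱 y.2 e
    have hx : ∀ ε, component 𝒱 ε
        ((DirectSum.coeAddMonoidHom (fun ε => h.grading ε) x : h.image) : V)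
          = ((x ε : h.image) : V) := by
      intro ε
      induction x using DirectSum.induction_on with
      | zero => simp [component]
      | of δ y =>
        rw [DirectSum.coeAddMonoidHom_of, key]
        split_ifs with e
        · subst e
          rw [DirectSum.of_eq_same]
        · rw [DirectSum.of_eq_of_ne _ _ _ (Ne.symm e)]
          rfl
      | add x y h1 h2 =>
        simp only [component] at h1 h2 ⊢
        simp [DirectSum.decompose_add, h1, h2]
    conv_rhs => rw [← DirectSum.sum_univ_of x]
    refine Finset.sum_congr rfl fun ε _ => congrArg _ ?_
    exact Subtype.ext (Subtype.ext (hx ε))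

/-- The restriction of the scalar product to `B`. -/
def form [DirectSum.Decomposition 𝒱] (h : OddHomotopy I) : OddScalarProduct h.grading where
  form := β.form.restrict h.image
  symm a b := β.symm _ _
  odd ε a ha b hb := β.odd ε a ha b hb
  nondegenerate := by
    have hl : ∀ x : h.image, (∀ y : h.image, β.form x y = 0) → x = 0 := by
      intro x hx
      apply Subtype.ext
      refine β.nondegenerate.1 _ fun a => ?_
      rw [← h.proj_of_mem x.2, h.proj_selfadjoint]
      exact hx ⟨h.proj a, a, rfl⟩
    refine ⟨fun x hx => hl x hx, fun x hx => hl x fun y => ?_⟩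
    rw [β.symm]
    exact hx y

theorem I_mem (h : OddHomotopy I) {x : V} (hx : x ∈ h.image) : I.I x ∈ h.image := by
  obtain ⟨y, rfl⟩ := hx
  refine ⟨I.I y, ?_⟩
  have hc := congrArg (fun f : Module.End k V => f y) h.commute.eq
  simp only [Module.End.mul_apply] at hc
  simp [proj, hc, add_comm]

/-- The restriction of `I` to `B`. -/
def restrictI [DirectSum.Decomposition 𝒱] (h : OddHomotopy I) : OddSymmetry h.form where
  I := I.I.restrict (fun _ hx => h.I_mem hx)
  odd ε a ha := I.odd ε a ha
  invariant ε a ha b := I.invariant ε a ha b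

/-- The sum `S = ∑_Γ ħ^{1 - χ(Σ_Γ)} W_Γ` over isomorphism classes of connected ribbon graphs with
vertices of valence at least three and with a leg on every boundary component; the legs are labelled
by the letters, arranged on the boundary components in the given cyclic words. -/
def graphSum [FiniteDimensional k V] [DirectSum.Decomposition 𝒱] (h : OddHomotopy I)
    (m : CyclicTensors 𝒱) : Series k h.image :=
  fun b n σ a => ∑ᶠ c ∈ {c : RibbonGraph.IsoClass n | (Quotient.out c).Contributes b σ},
    (Quotient.out c).weight h m (fun i => (a i : V))

end OddHomotopy

end NCBV

end

open NCBV

/-! The argument is a Feynman-diagram computation. A graph value is a full contraction, so letting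
`I` act on the legs equals letting it act on all flags minus letting it act on the halves of the
edges. The first part is `I` acting at the vertices. In the second, the invariance of $\beta$ turns
the two actions on an edge into $IH+HI=1-P$ in place of $H$. Every edge thus yields the contraction
with $\beta^\vee$ of $A$ minus the contraction with $(P\otimes1)\beta^\vee$, which is $\beta^\vee$
of $B$ (`dualAction_contractEdges`, `HomogeneousBasis.sum_proj`).

An edge carrying the identity is removed by the equations for $m$. Fix the surface and sum over all
ways in which such an edge can arise: this is a sum over gluings of two letters of $\exp(m)$. If the
ends lie at different vertices, contracting the edge gives $\frac12\{m,m\}=-I^\vee m$ at the merged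
vertex; loops at one vertex give $\Delta m=0$. So the identity edges of graphs with $E+1$ edges
cancel the vertex terms of graphs with $E$ edges (`sum_contract`, `sum_markedTerm_one`).

An edge carrying $P$ is cut, and its ends become two letters contracted by the tensor of $B$. If the
graph stays connected this is a term of $\hbar\Delta S$; if it falls apart, a term of
$\frac12\{S,S\}$ (`sum_markedTerm_proj`). Together these give an identity whose right side
telescopes in the number of edges (`dualAction_edgeSum_succ`). As valences are at least three, only
finitely many numbers of edges matter for given legs and power of $\hbar$, and the sum collapses to
zero (`graphSum_equation_apply`).

To make this precise, isomorphism classes are replaced by all permutations of a fixed set of flags,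
divided by $E!\,2^E$; a connected graph with a leg has no automorphisms, so this is the same sum
(`sum_contributes`). Vertices are cycles, and boundary words are first-return permutations on the
legs (`Induces`). First returns can be taken in stages (`Induces.trans_iff`), and this is what makes
contracting and cutting edges compatible with boundary words. Signs are handled by `reorderSign`, a
cocycle on orderings. The two halves of an edge carry letters of equal parity, so edges move past
everything freely and only the legs produce signs (`contractEdges_reorder`).

For the last assertion, the bracket with $S_{0,2}$ from either side is $I^\vee$
(`bracket_quadraticTerm_left`, `bracket_quadraticTerm_right`), $\Delta S_{0,2}=0$, and
$\{S_{0,2},S_{0,2}\}=I^\vee S_{0,2}$ vanishes when $I^2=0$ on $B$. -/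

noncomputable section

namespace NCBV

section

/-! ### Induced permutations -/

/-- `y` is the first element of `P` met by iterating `φ` at least once, starting at `x`. -/
inductive FirstHit {F : Type*} (φ : Perm F) (P : Set F) : F → F → Prop
  | hit {x : F} : φ x ∈ P → FirstHit φ P x (φ x)
  | step {x z : F} : φ x ∉ P → FirstHit φ P (φ x) z → FirstHit φ P x z

namespace FirstHit

variable {F F' : Type*} {φ : Perm F} {φ' : Perm F'} {P : Set F} {P' : Set F'} {x y z : F}

theorem mem (h : FirstHit φ P x y) : y ∈ P := by
  induction h with
  | hit h => exact h
  | step _ _ ih => exact ih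

theorem det (h : FirstHit φ P x y) (h' : FirstHit φ P x z) : y = z := by
  induction h with
  | hit h =>
    cases h' with
    | hit => rfl
    | step h1 => exact absurd h h1
  | step h _ ih =>
    cases h' with
    | hit h1 => exact absurd h1 h
    | step _ h2 => exact ih h2

theorem sameCycle (h : FirstHit φ P x y) : φ.SameCycle x y := by
  induction h with
  | hit h => exact ⟨1, by simp⟩
  | step _ _ ih => exact Perm.sameCycle_apply_left.1 ih

theorem iff_pow : FirstHit φ P x y ↔
    ∃ r : ℕ, (φ ^ (r + 1)) x = y ∧ y ∈ P ∧ ∀ s < r, (φ ^ (s + 1)) x ∉ P := by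
  constructor
  · intro h
    induction h with
    | hit h => exact ⟨0, by simp, h, by simp⟩
    | @step x z h _ ih =>
      obtain ⟨r, h1, h2, h3⟩ := ih
      refine ⟨r + 1, by rw [pow_succ, Perm.mul_apply, h1], h2, fun s hs => ?_⟩
      cases s with
      | zero => simpa using h
      | succ s =>
        rw [pow_succ, Perm.mul_apply]
        exact h3 s (by omega)
  · rintro ⟨r, h1, h2, h3⟩
    induction r generalizing x with
    | zero =>
      simp only [zero_add, pow_one] at h1
      subst h1
      exact hit h2
    | succ r ih =>
      refine step (by simpa using h3 0 (by omega)) (ih ?_ fun s hs => ?_)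
      · rw [← Perm.mul_apply, ← pow_succ, h1]
      · rw [← Perm.mul_apply, ← pow_succ]
        exact h3 _ (by omega)

theorem exists_of_pow (r : ℕ) (h : (φ ^ (r + 1)) x ∈ P) : ∃ y, FirstHit φ P x y := by
  induction r generalizing x with
  | zero => exact ⟨_, hit (by simpa using h)⟩
  | succ r ih =>
    by_cases hx : φ x ∈ P
    · exact ⟨_, hit hx⟩
    · rw [pow_succ, Perm.mul_apply] at h
      obtain ⟨y, hy⟩ := ih h
      exact ⟨y, step hx hy⟩

theorem exists_of_sameCycle [Finite F] (h : φ.SameCycle x z) (hz : z ∈ P) :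
    ∃ y, FirstHit φ P x y := by
  obtain ⟨i, hi, -, rfl⟩ := h.exists_pow_eq''
  obtain ⟨j, rfl⟩ : ∃ j, i = j + 1 := ⟨i - 1, by omega⟩
  exact exists_of_pow j hz

theorem map {j : F → F'} (hj : ∀ x, j (φ x) = φ' (j x)) (hP : ∀ x, j x ∈ P' ↔ x ∈ P)
    (h : FirstHit φ P x y) : FirstHit φ' P' (j x) (j y) := by
  induction h with
  | hit h =>
    rw [hj]
    exact hit (by rwa [← hj, hP])
  | step h _ ih => exact step (by rwa [← hj, hP]) (by rwa [← hj])

theorem of_map {j : F → F'} (hj : ∀ x, j (φ x) = φ' (j x)) (hP : ∀ x, j x ∈ P' ↔ x ∈ P)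
    {z : F'} (h : FirstHit φ' P' (j x) z) : ∃ y, z = j y ∧ FirstHit φ P x y := by
  generalize hw : j x = w at h
  induction h generalizing x with
  | hit h =>
    subst hw
    exact ⟨φ x, (hj x).symm, hit (by rwa [← hP, hj])⟩
  | step h _ ih =>
    subst hw
    obtain ⟨y, h1, h2⟩ := ih (hj x)
    exact ⟨y, h1, step (by rwa [← hP, hj]) h2⟩

theorem trans {Q : Set F} (hQ : Q ⊆ P) (h : FirstHit φ P x y) (hy : y ∉ Q)
    (h' : FirstHit φ Q y z) : FirstHit φ Q x z := by
  induction h with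
  | hit h => exact step hy h'
  | step h _ ih => exact step (fun h1 => h (hQ h1)) (ih hy h')

theorem mono {Q : Set F} (hQ : Q ⊆ P) (h : FirstHit φ P x y) (hy : y ∈ Q) :
    FirstHit φ Q x y := by
  induction h with
  | hit h => exact hit hy
  | step h _ ih => exact step (fun h1 => h (hQ h1)) (ih hy)

end FirstHit

/-- Every cycle of `φ` meets the legs, and `σ` sends a leg to the next one on its cycle. -/
def Induces {F L : Type*} (φ : Perm F) (leg : L → F) (σ : Perm L) : Prop :=
  (∀ x, ∃ i, FirstHit φ (Set.range leg) x (leg i)) ∧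
    ∀ i, FirstHit φ (Set.range leg) (leg i) (leg (σ i))

/-- The definition in terms of powers allows zero steps in its first clause, while `FirstHit` takes
at least one. The difference is harmless: a point that is already a leg has a next leg by the second
clause. -/
theorem isBoundary_iff {F : Type*} {n : ℕ} (φ : Perm F) (leg : Fin n → F) (σ : Perm (Fin n)) :
    IsBoundary φ leg σ ↔ Induces φ leg σ := by
  have h2 : (∀ i, FirstHit φ (Set.range leg) (leg i) (leg (σ i))) ↔
      ∀ i : Fin n, ∃ r : ℕ, (φ ^ (r + 1)) (leg i) = leg (σ i) ∧
        ∀ s < r, ∀ j : Fin n, (φ ^ (s + 1)) (leg i) ≠ leg j := by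
    refine forall_congr' fun i => ?_
    rw [FirstHit.iff_pow]
    refine exists_congr fun r => and_congr_right fun _ => ?_
    simp only [Set.mem_range_self, true_and]
    exact forall_congr' fun s => forall_congr' fun _ =>
      ⟨fun h j e => h ⟨j, e.symm⟩, fun h ⟨j, e⟩ => h j e.symm⟩
  unfold IsBoundary Induces
  rw [h2]
  refine and_congr_left fun h => ⟨fun h1 x => ?_, fun h1 x => ?_⟩
  · obtain ⟨r, i, hr⟩ := h1 x
    cases r with
    | zero =>
      simp only [pow_zero, Perm.coe_one, id_eq] at hr
      subst hr
      exact ⟨_, h2.2 h i⟩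
    | succ r =>
      obtain ⟨y, hy⟩ := FirstHit.exists_of_pow (P := Set.range leg) r ⟨i, hr.symm⟩
      obtain ⟨j, rfl⟩ := hy.mem
      exact ⟨j, hy⟩
  · obtain ⟨i, hi⟩ := h1 x
    obtain ⟨r, h3, -⟩ := FirstHit.iff_pow.1 hi
    exact ⟨r + 1, i, h3⟩

namespace Induces

variable {F F' L L' : Type*} {φ : Perm F} {leg : L → F} {σ σ' : Perm L}

theorem unique (hl : Function.Injective leg) (h : Induces φ leg σ) (h' : Induces φ leg σ') :
    σ = σ' :=
  Equiv.ext fun i => hl ((h.2 i).det (h'.2 i))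

theorem exists_of_meets [Finite F] [Finite L] (hl : Function.Injective leg)
    (h : ∀ x, ∃ i, φ.SameCycle x (leg i)) : ∃ σ, Induces φ leg σ := by
  have h1 : ∀ x, ∃ i, FirstHit φ (Set.range leg) x (leg i) := by
    intro x
    obtain ⟨i, hi⟩ := h x
    obtain ⟨y, hy⟩ := FirstHit.exists_of_sameCycle (P := Set.range leg) hi ⟨i, rfl⟩
    obtain ⟨j, rfl⟩ := hy.mem
    exact ⟨j, hy⟩
  choose s hs using fun i => h1 (leg i)
  -- Two legs with the same next leg: if the paths had different lengths, cancelling the shorter one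
  -- would exhibit a leg in the interior of the longer one.
  have hinj : Function.Injective s := by
    intro i j hij
    obtain ⟨r, h2, -, h3⟩ := FirstHit.iff_pow.1 (hs i)
    obtain ⟨t, h4, -, h5⟩ := FirstHit.iff_pow.1 (hs j)
    rw [hij, ← h4] at h2
    obtain h | h | h := lt_trichotomy r t
    · have e : t + 1 = (r + 1) + (t - r - 1 + 1) := by omega
      rw [e, pow_add φ (r + 1), Perm.mul_apply] at h2
      exact absurd ⟨i, (φ ^ (r + 1)).injective h2⟩ (h5 _ (by omega))
    · subst h
      exact hl ((φ ^ (r + 1)).injective h2)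
    · have e : r + 1 = (t + 1) + (r - t - 1 + 1) := by omega
      rw [e, pow_add φ (t + 1), Perm.mul_apply] at h2
      exact absurd ⟨j, ((φ ^ (t + 1)).injective h2).symm⟩ (h3 _ (by omega))
  exact ⟨Equiv.ofBijective s (Finite.injective_iff_bijective.1 hinj), h1, hs⟩

/-- A first return to a subset of the legs is a chain of first returns to the legs. -/
theorem trans {leg' : L' → L} {ψ : Perm L'} (hl : Function.Injective leg) (h : Induces φ leg σ)
    (h' : Induces σ leg' ψ) : Induces φ (leg ∘ leg') ψ := by
  have hsub : Set.range (leg ∘ leg') ⊆ Set.range leg := Set.range_comp_subset_range _ _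
  have hmem : ∀ i, leg i ∈ Set.range (leg ∘ leg') ↔ i ∈ Set.range leg' := fun i =>
    ⟨fun ⟨j, hj⟩ => ⟨j, hl hj⟩, fun ⟨j, hj⟩ => ⟨j, congrArg leg hj⟩⟩
  have key : ∀ i j, FirstHit σ (Set.range leg') i j →
      FirstHit φ (Set.range (leg ∘ leg')) (leg i) (leg j) := by
    intro i j hij
    induction hij with
    | @hit i hi => exact (h.2 i).mono hsub ((hmem _).2 hi)
    | @step i j hi _ ih => exact (h.2 i).trans hsub (fun h1 => hi ((hmem _).1 h1)) ih
  refine ⟨fun x => ?_, fun i => key _ _ (h'.2 i)⟩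
  obtain ⟨i, hi⟩ := h.1 x
  by_cases hi' : i ∈ Set.range leg'
  · obtain ⟨j, rfl⟩ := hi'
    exact ⟨j, hi.mono hsub ⟨j, rfl⟩⟩
  · obtain ⟨j, hj⟩ := h'.1 i
    exact ⟨j, hi.trans hsub (fun h1 => hi' ((hmem _).1 h1)) (key _ _ hj)⟩

theorem sameCycle_iff [Finite F] (hl : Function.Injective leg) (h : Induces φ leg σ) {i j : L} :
    σ.SameCycle i j ↔ φ.SameCycle (leg i) (leg j) := by
  have : Finite L := Finite.of_injective _ hl
  constructor
  · intro hij
    obtain ⟨n, rfl⟩ := hij.exists_nat_pow_eq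
    induction n with
    | zero => exact Perm.SameCycle.refl _ _
    | succ n ih =>
      rw [pow_succ', Perm.mul_apply]
      exact (ih ⟨n, by simp⟩).trans (h.2 _).sameCycle
  · intro hij
    obtain ⟨n, hn, -, e⟩ := hij.exists_pow_eq''
    obtain ⟨n, rfl⟩ : ∃ k, n = k + 1 := ⟨n - 1, by omega⟩
    -- Follow `φ` towards `leg j` while carrying along the next leg `l` ahead; each time a leg is
    -- passed, `l` advances by `σ`.
    have key : ∀ (n : ℕ) (x : F) (l : L), (φ ^ (n + 1)) x = leg j →
        FirstHit φ (Set.range leg) x (leg l) → σ.SameCycle l j := by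
      intro n
      induction n with
      | zero =>
        intro x l hx hl'
        simp only [zero_add, pow_one] at hx
        have : FirstHit φ (Set.range leg) x (φ x) := FirstHit.hit ⟨j, hx.symm⟩
        rw [← hl (hx.symm.trans (this.det hl'))]
      | succ n ih =>
        intro x l hx hl'
        rw [pow_succ, Perm.mul_apply] at hx
        generalize hz : leg l = z at hl'
        cases hl' with
        | hit h1 => exact Perm.sameCycle_apply_left.1 (ih _ _ hx (hz ▸ h.2 l))
        | step _ h2 => exact ih _ _ hx (hz ▸ h2)
    exact Perm.sameCycle_apply_left.1 (key n _ _ e (h.2 i))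

/-- The converse of `trans` needs no further path argument: cycles of `σ` and of `φ` correspond, so
some permutation is induced on the smaller set of legs, and induced permutations are unique. -/
theorem trans_iff [Finite F] {leg' : L' → L} {ψ : Perm L'} (hl : Function.Injective leg)
    (hl' : Function.Injective leg') (h : Induces φ leg σ) :
    Induces φ (leg ∘ leg') ψ ↔ Induces σ leg' ψ := by
  have : Finite L := Finite.of_injective _ hl
  have : Finite L' := Finite.of_injective _ hl'
  refine ⟨fun h1 => ?_, h.trans hl⟩
  obtain ⟨ψ', h2⟩ := exists_of_meets (φ := σ) hl' fun i => by
    obtain ⟨j, hj⟩ := h1.1 (leg i)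
    exact ⟨j, (h.sameCycle_iff hl).2 hj.sameCycle⟩
  rwa [h1.unique (hl.comp hl') (h.trans hl h2)]

theorem congr_iff (g : F ≃ F') (e : L ≃ L') : Induces (g.permCongr φ) (g ∘ leg ∘ e.symm)
    (e.permCongr σ) ↔ Induces φ leg σ := by
  have h1 : ∀ x, g (φ x) = g.permCongr φ (g x) := by simp
  have h2 : ∀ x, g x ∈ Set.range (g ∘ leg ∘ e.symm) ↔ x ∈ Set.range leg := fun x =>
    ⟨fun ⟨j, hj⟩ => ⟨e.symm j, g.injective hj⟩, fun ⟨j, hj⟩ => ⟨e j, by simp [hj]⟩⟩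
  have key : ∀ x y, FirstHit (g.permCongr φ) (Set.range (g ∘ leg ∘ e.symm)) (g x) (g y) ↔
      FirstHit φ (Set.range leg) x y := by
    intro x y
    refine ⟨fun h => ?_, fun h => h.map h1 h2⟩
    obtain ⟨z, hz, h⟩ := FirstHit.of_map h1 h2 h
    rwa [g.injective hz]
  unfold Induces
  rw [g.symm.forall_congr_left, e.symm.forall_congr_left]
  refine and_congr (forall_congr' fun x => ?_) (forall_congr' fun i => ?_)
  · rw [e.exists_congr_left (p := fun i => FirstHit φ (Set.range leg) x (leg i))]
    exact exists_congr fun i => key _ _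
  · simpa using key (leg i) (leg (σ i))

theorem sumCongr_iff {φ' : Perm F'} {leg' : L' → F'} {σ' : Perm L'} :
    Induces (sumCongr φ φ') (Sum.map leg leg') (sumCongr σ σ') ↔
      Induces φ leg σ ∧ Induces φ' leg' σ' := by
  have h1 : ∀ x y, FirstHit (sumCongr φ φ') (Set.range (Sum.map leg leg')) (Sum.inl x) y ↔
      ∃ z, y = Sum.inl z ∧ FirstHit φ (Set.range leg) x z := by
    intro x y
    have ha : ∀ x, (Sum.inl (φ x) : F ⊕ F') = sumCongr φ φ' (Sum.inl x) := by simp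
    have hb : ∀ x, (Sum.inl x : F ⊕ F') ∈ Set.range (Sum.map leg leg') ↔ x ∈ Set.range leg := by
      simp
    exact ⟨fun h => FirstHit.of_map ha hb h, by rintro ⟨z, rfl, h⟩; exact h.map ha hb⟩
  have h2 : ∀ x y, FirstHit (sumCongr φ φ') (Set.range (Sum.map leg leg')) (Sum.inr x) y ↔
      ∃ z, y = Sum.inr z ∧ FirstHit φ' (Set.range leg') x z := by
    intro x y
    have ha : ∀ x, (Sum.inr (φ' x) : F ⊕ F') = sumCongr φ φ' (Sum.inr x) := by simp
    have hb : ∀ x, (Sum.inr x : F ⊕ F') ∈ Set.range (Sum.map leg leg') ↔ x ∈ Set.range leg' := by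
      simp
    exact ⟨fun h => FirstHit.of_map ha hb h, by rintro ⟨z, rfl, h⟩; exact h.map ha hb⟩
  unfold Induces
  simp only [Sum.forall, Sum.exists, h1, h2, sumCongr_apply, Sum.map_inl, Sum.map_inr,
    Sum.inl.injEq, Sum.inr.injEq, exists_eq_left', reduceCtorEq, false_and, exists_false,
    or_false, false_or]
  tauto

end Induces

/-! ### Invariant sets, connectedness and the number of vertices -/

/-- The set `X` is a union of cycles of `φ`. -/
def Preserves {F : Type*} (φ : Perm F) (X : Set F) : Prop := ∀ x, φ x ∈ X ↔ x ∈ X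

theorem Preserves.sameCycle {F : Type*} {φ : Perm F} {X : Set F} (h : Preserves φ X) {x y : F}
    (hxy : φ.SameCycle x y) : x ∈ X ↔ y ∈ X := by
  obtain ⟨i, rfl⟩ := hxy
  have hz : ∀ i : ℤ, ∀ x, (φ ^ i) x ∈ X ↔ x ∈ X := by
    intro i
    induction i using Int.induction_on with
    | zero => simp
    | succ i ih => intro x; rw [zpow_add_one, Perm.mul_apply, ih, h]
    | pred i ih =>
      intro x
      rw [zpow_sub_one, Perm.mul_apply, ih, ← h]
      simp
  exact (hz i x).symm

theorem preserves_iff_sameCycle {F : Type*} {φ : Perm F} {X : Set F} :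
    Preserves φ X ↔ ∀ x y, φ.SameCycle x y → x ∈ X → y ∈ X :=
  ⟨fun h _ _ hxy => (h.sameCycle hxy).1, fun h _ =>
    ⟨h _ _ (Perm.sameCycle_apply_left.2 (Perm.SameCycle.refl _ _)),
      h _ _ (Perm.sameCycle_apply_right.2 (Perm.SameCycle.refl _ _))⟩⟩

theorem preserves_sameCycle {F : Type*} (φ : Perm F) (x : F) :
    Preserves φ {y | φ.SameCycle x y} := fun _ => Perm.sameCycle_apply_right

theorem Preserves.mul {F : Type*} {φ ψ : Perm F} {X : Set F} (h : Preserves φ X)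
    (h' : Preserves ψ X) : Preserves (φ * ψ) X := fun _ => by
  rw [Perm.mul_apply, h, h']

theorem preserves_swap {F : Type*} [DecidableEq F] {a b : F} {X : Set F} (h : a ∈ X ↔ b ∈ X) :
    Preserves (swap a b) X := fun x => by
  by_cases ha : x = a
  · simp [ha, h]
  by_cases hb : x = b
  · simp [hb, h]
  rw [swap_apply_of_ne_of_ne ha hb]

theorem Preserves.union {F : Type*} {φ : Perm F} {X Y : Set F} (h : Preserves φ X)
    (h' : Preserves φ Y) : Preserves φ (X ∪ Y) := fun x => by
  simp only [Set.mem_union, h x, h' x]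

theorem Preserves.compl {F : Type*} {φ : Perm F} {X : Set F} (h : Preserves φ X) :
    Preserves φ Xᶜ := fun x => by simp only [Set.mem_compl_iff, h x]

/-- Two permutations act transitively. -/
def Joined {F : Type*} (φ ψ : Perm F) : Prop :=
  Nonempty F ∧ ∀ X : Set F, Preserves φ X → Preserves ψ X → X.Nonempty → X = Set.univ

/-- An orbit is an invariant set, and a set invariant under the generators is invariant under the
group. Invariant sets are easier to transport through gluings than words in the generators. -/
theorem joined_iff {F : Type*} (φ ψ : Perm F) : Joined φ ψ ↔
    Nonempty F ∧ ∀ x y : F, ∃ π ∈ Subgroup.closure {φ, ψ}, π x = y := by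
  refine and_congr_right fun _ => ⟨fun h x y => ?_, fun h X h1 h2 ⟨x, hx⟩ => ?_⟩
  · have key : ∀ ρ ∈ ({φ, ψ} : Set (Perm F)),
        Preserves ρ {y | ∃ π ∈ Subgroup.closure {φ, ψ}, π x = y} := by
      intro ρ hρ z
      have hm := Subgroup.subset_closure hρ
      constructor
      · rintro ⟨π, h1, h2⟩
        exact ⟨ρ⁻¹ * π, mul_mem (inv_mem hm) h1, by simp [h2]⟩
      · rintro ⟨π, h1, h2⟩
        exact ⟨ρ * π, mul_mem hm h1, by simp [h2]⟩
    have := h _ (key φ (by simp)) (key ψ (by simp)) ⟨x, 1, one_mem _, rfl⟩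
    exact (Set.ext_iff.1 this y).2 trivial
  · refine Set.eq_univ_of_forall fun y => ?_
    obtain ⟨π, hπ, rfl⟩ := h x y
    have : Preserves π X := by
      induction hπ using Subgroup.closure_induction with
      | mem ρ hρ =>
        obtain rfl | rfl := hρ
        exacts [h1, h2]
      | one => exact fun _ => Iff.rfl
      | mul a b _ _ ha hb => exact ha.mul hb
      | inv a _ ha => exact fun z => by rw [← ha]; simp
    exact (this x).2 hx

theorem Preserves.congr_iff {F F' : Type*} (g : F ≃ F') {φ : Perm F} {X : Set F'} :
    Preserves (g.permCongr φ) X ↔ Preserves φ (g ⁻¹' X) := by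
  unfold Preserves
  rw [g.symm.forall_congr_left]
  simp

theorem joined_congr {F F' : Type*} (g : F ≃ F') {φ ψ : Perm F} :
    Joined (g.permCongr φ) (g.permCongr ψ) ↔ Joined φ ψ := by
  unfold Joined
  refine and_congr g.symm.nonempty_congr ⟨fun h X h1 h2 h3 => ?_, fun h X h1 h2 h3 => ?_⟩
  · have e : g ⁻¹' (g '' X) = X := Set.preimage_image_eq _ g.injective
    have := h (g '' X) (by rwa [Preserves.congr_iff, e]) (by rwa [Preserves.congr_iff, e])
      (h3.image _)
    rw [← e, this, Set.preimage_univ]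
  · rw [Preserves.congr_iff] at h1 h2
    have := h _ h1 h2 (h3.preimage g.surjective)
    rw [← Set.image_preimage_eq X g.surjective, this, Set.image_univ, g.range_eq_univ]

/-- The number of cycles of a permutation, fixed points included. -/
def numCycles {F : Type*} (φ : Perm F) : ℕ := Nat.card (Quotient (Perm.SameCycle.setoid φ))

theorem sameCycle_permCongr {F F' : Type*} (g : F ≃ F') {φ : Perm F} {x y : F} :
    (g.permCongr φ).SameCycle (g x) (g y) ↔ φ.SameCycle x y := by
  have hz : ∀ i : ℤ, (g.permCongr φ) ^ i = g.permCongr (φ ^ i) := fun i =>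
    (map_zpow g.permCongrHom φ i).symm
  unfold Perm.SameCycle
  refine exists_congr fun i => ?_
  rw [hz]
  simp

theorem numCycles_congr {F F' : Type*} (g : F ≃ F') (φ : Perm F) :
    numCycles (g.permCongr φ) = numCycles φ :=
  (Nat.card_congr (Quotient.congr g fun _ _ => (sameCycle_permCongr g).symm)).symm

theorem sameCycle_sumCongr_inl {F F' : Type*} {φ : Perm F} {ψ : Perm F'} {x y : F} :
    Perm.SameCycle (sumCongr φ ψ : Perm (F ⊕ F')) (Sum.inl x) (Sum.inl y) ↔ φ.SameCycle x y := by
  have hz : ∀ i : ℤ, (sumCongr φ ψ : Perm (F ⊕ F')) ^ i = sumCongr (φ ^ i) (ψ ^ i) := fun i =>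
    (map_zpow (Perm.sumCongrHom F F') (φ, ψ) i).symm
  exact exists_congr fun i => by rw [hz]; simp

theorem sameCycle_sumCongr_inr {F F' : Type*} {φ : Perm F} {ψ : Perm F'} {x y : F'} :
    Perm.SameCycle (sumCongr φ ψ : Perm (F ⊕ F')) (Sum.inr x) (Sum.inr y) ↔ ψ.SameCycle x y := by
  have hz : ∀ i : ℤ, (sumCongr φ ψ : Perm (F ⊕ F')) ^ i = sumCongr (φ ^ i) (ψ ^ i) := fun i =>
    (map_zpow (Perm.sumCongrHom F F') (φ, ψ) i).symm
  exact exists_congr fun i => by rw [hz]; simp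

theorem not_sameCycle_sumCongr {F F' : Type*} {φ : Perm F} {ψ : Perm F'} {x : F} {y : F'} :
    ¬ Perm.SameCycle (sumCongr φ ψ : Perm (F ⊕ F')) (Sum.inl x) (Sum.inr y) := by
  have hz : ∀ i : ℤ, (sumCongr φ ψ : Perm (F ⊕ F')) ^ i = sumCongr (φ ^ i) (ψ ^ i) := fun i =>
    (map_zpow (Perm.sumCongrHom F F') (φ, ψ) i).symm
  rintro ⟨i, hi⟩
  rw [hz] at hi
  simp at hi

theorem numCycles_sumCongr {F F' : Type*} [Finite F] [Finite F'] (φ : Perm F) (ψ : Perm F') :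
    numCycles (sumCongr φ ψ : Perm (F ⊕ F')) = numCycles φ + numCycles ψ := by
  unfold numCycles
  have : Finite (Quotient (Perm.SameCycle.setoid φ)) := Quotient.finite _
  have : Finite (Quotient (Perm.SameCycle.setoid ψ)) := Quotient.finite _
  rw [← Nat.card_sum]
  symm
  refine Nat.card_congr (Equiv.ofBijective (Sum.elim
    (Quotient.map (sb := Perm.SameCycle.setoid (sumCongr φ ψ : Perm (F ⊕ F'))) Sum.inl
      fun _ _ h => sameCycle_sumCongr_inl.2 h)
    (Quotient.map Sum.inr fun _ _ h => sameCycle_sumCongr_inr.2 h)) ⟨?_, ?_⟩)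
  · rintro (a | a) (b | b) h <;> induction a using Quotient.inductionOn with | _ a => ?_ <;>
      induction b using Quotient.inductionOn with | _ b => ?_
    · exact congrArg _ (Quotient.sound (sameCycle_sumCongr_inl.1 (Quotient.exact h)))
    · exact absurd (Quotient.exact h) not_sameCycle_sumCongr
    · exact absurd (Quotient.exact h).symm not_sameCycle_sumCongr
    · exact congrArg _ (Quotient.sound (sameCycle_sumCongr_inr.1 (Quotient.exact h)))
  · intro c
    induction c using Quotient.inductionOn with | _ c => ?_
    obtain c | c := c
    · exact ⟨Sum.inl (Quotient.mk _ c), rfl⟩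
    · exact ⟨Sum.inr (Quotient.mk _ c), rfl⟩

theorem Induces.numCycles_eq {F L : Type*} [Finite F] {φ : Perm F} {leg : L → F} {σ : Perm L}
    (hl : Function.Injective leg) (h : Induces φ leg σ) : numCycles σ = numCycles φ := by
  refine Nat.card_congr (Equiv.ofBijective (Quotient.map (sa := Perm.SameCycle.setoid σ)
    (sb := Perm.SameCycle.setoid φ) leg fun _ _ h' => (h.sameCycle_iff hl).1 h') ⟨?_, ?_⟩)
  · intro a b hab
    induction a using Quotient.inductionOn with | _ a => ?_
    induction b using Quotient.inductionOn with | _ b => ?_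
    exact Quotient.sound ((h.sameCycle_iff hl).2 (Quotient.exact hab))
  · intro c
    induction c using Quotient.inductionOn with | _ c => ?_
    obtain ⟨i, hi⟩ := h.1 c
    exact ⟨Quotient.mk _ i, Quotient.sound hi.sameCycle.symm⟩

/-! ### Fusing two cycles by a transposition. -/

section mulSwap

variable {F : Type*} [Finite F] [DecidableEq F] {τ : Perm F} {a b : F}

/-- The product sends `a` to `τ b` and then runs along the cycle of `b`, which avoids `a`, until it
returns to `b`. -/
theorem sameCycle_mul_swap (h : ¬ τ.SameCycle a b) : (τ * swap a b).SameCycle a b := by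
  have hpow : ∀ k : ℕ, (∀ j, 0 < j → j < k → (τ ^ j) b ≠ b) → 0 < k →
      ((τ * swap a b) ^ k) a = (τ ^ k) b := by
    intro k
    induction k with
    | zero => simp
    | succ k ih =>
      intro hk _
      rcases Nat.eq_zero_or_pos k with rfl | hk0
      · simp
      · rw [pow_succ', Perm.mul_apply, ih (fun j h1 h2 => hk j h1 (by omega)) hk0,
          Perm.mul_apply, swap_apply_of_ne_of_ne, pow_succ', Perm.mul_apply]
        · intro e
          exact h (Perm.SameCycle.symm ⟨k, by simpa using e⟩)
        · exact hk k hk0 (by omega)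
  have hper : ∃ k, 0 < k ∧ (τ ^ k) b = b := ⟨orderOf τ, orderOf_pos τ, by simp [pow_orderOf_eq_one]⟩
  classical
  have := hpow (Nat.find hper) (fun j h1 h2 h3 => Nat.find_min hper h2 ⟨h1, h3⟩)
    (Nat.find_spec hper).1
  exact ⟨Nat.find hper, by rw [zpow_natCast, this, (Nat.find_spec hper).2]⟩

/-- The union of the cycles of `a` and `b`, and every other cycle of `τ`, are invariant under the
product, which bounds its cycles from above. Conversely its cycles do not separate `a` from `b`, so
they are invariant under the transposition and hence under `τ`. -/
theorem sameCycle_mul_swap_iff (h : ¬ τ.SameCycle a b) {x y : F} :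
    (τ * swap a b).SameCycle x y ↔ τ.SameCycle x y ∨
      ((τ.SameCycle a x ∨ τ.SameCycle b x) ∧ (τ.SameCycle a y ∨ τ.SameCycle b y)) := by
  have hab := sameCycle_mul_swap h
  have hpre : Preserves (τ * swap a b) ({y | τ.SameCycle a y} ∪ {y | τ.SameCycle b y}) :=
    ((preserves_sameCycle τ a).union (preserves_sameCycle τ b)).mul
      (preserves_swap (by simp [Perm.SameCycle.refl]))
  -- the orbit of `a` under the product contains the cycles of `a` and `b`
  have hX : ∀ c, Preserves τ {y | (τ * swap a b).SameCycle c y} := by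
    intro c z
    have hs : Preserves (swap a b) {y | (τ * swap a b).SameCycle c y} :=
      preserves_swap ⟨fun h => Perm.SameCycle.trans h hab, fun h => Perm.SameCycle.trans h hab.symm⟩
    have := preserves_sameCycle (τ * swap a b) c (swap a b z)
    rw [Perm.mul_apply, swap_apply_self] at this
    rw [this, hs]
  have hτ : ∀ x y, τ.SameCycle x y → (τ * swap a b).SameCycle x y := fun x y hxy =>
    ((hX x).sameCycle hxy).1 (Perm.SameCycle.refl _ _)
  constructor
  · intro hxy
    by_cases hx : τ.SameCycle a x ∨ τ.SameCycle b x
    · exact Or.inr ⟨hx, (hpre.sameCycle hxy).1 hx⟩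
    · left
      have : Preserves (τ * swap a b) {y | τ.SameCycle x y} :=
        (preserves_sameCycle τ x).mul (preserves_swap
          ⟨fun h => absurd (Or.inl (Perm.SameCycle.symm h)) hx,
            fun h => absurd (Or.inr (Perm.SameCycle.symm h)) hx⟩)
      exact (this.sameCycle hxy).1 (Perm.SameCycle.refl _ _)
  · rintro (hxy | ⟨hx, hy⟩)
    · exact hτ _ _ hxy
    · have key : ∀ z, τ.SameCycle a z ∨ τ.SameCycle b z → (τ * swap a b).SameCycle a z := by
        rintro z (hz | hz)
        · exact hτ _ _ hz
        · exact hab.trans (hτ _ _ hz)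
      exact (key x hx).symm.trans (key y hy)

theorem numCycles_mul_swap (h : ¬ τ.SameCycle a b) :
    numCycles τ = numCycles (τ * swap a b) + 1 := by
  classical
  unfold numCycles
  have : Finite (Quotient (Perm.SameCycle.setoid (τ * swap a b))) := Quotient.finite _
  rw [← Finite.card_option]
  have hτ : ∀ x y, τ.SameCycle x y → (τ * swap a b).SameCycle x y := fun x y hxy =>
    (sameCycle_mul_swap_iff h).2 (Or.inl hxy)
  -- The class of `b` goes to the additional point; the class of `a` then represents the fused
  -- cycle.
  let f : Quotient (Perm.SameCycle.setoid τ) →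
      Option (Quotient (Perm.SameCycle.setoid (τ * swap a b))) := fun c =>
    if c = Quotient.mk _ b then none else
      some (Quotient.map (sa := Perm.SameCycle.setoid τ)
        (sb := Perm.SameCycle.setoid (τ * swap a b)) id hτ c)
  have hb : ∀ x, (Quotient.mk (Perm.SameCycle.setoid τ) x = Quotient.mk _ b) ↔
      τ.SameCycle b x := fun x =>
    ⟨fun h => (Quotient.exact h : τ.SameCycle x b).symm, fun h => Quotient.sound h.symm⟩
  refine Nat.card_congr (Equiv.ofBijective f ⟨?_, ?_⟩)
  · intro c d hcd
    induction c using Quotient.inductionOn with | _ x => ?_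
    induction d using Quotient.inductionOn with | _ y => ?_
    simp only [f, hb] at hcd
    by_cases hx : τ.SameCycle b x <;> by_cases hy : τ.SameCycle b y
    · exact Quotient.sound (hx.symm.trans hy)
    · simp [hx, hy] at hcd
    · simp [hx, hy] at hcd
    · simp only [hx, hy, if_false, Option.some.injEq] at hcd
      have := (sameCycle_mul_swap_iff h).1 (Quotient.exact hcd :
        (τ * swap a b).SameCycle x y)
      rcases this with h1 | ⟨h1 | h1, h2 | h2⟩
      · exact Quotient.sound h1
      · exact Quotient.sound (h1.symm.trans h2)
      · exact absurd h2 hy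
      · exact absurd h1 hx
      · exact absurd h1 hx
  · rintro (_ | d)
    · exact ⟨Quotient.mk _ b, by simp [f]⟩
    · induction d using Quotient.inductionOn with | _ y => ?_
      by_cases hy : τ.SameCycle b y
      · refine ⟨Quotient.mk _ a, ?_⟩
        have ha : ¬ τ.SameCycle b a := fun e => h e.symm
        simp only [f, hb, ha, if_false]
        refine congrArg some (Quotient.sound ?_)
        exact (sameCycle_mul_swap_iff h).2
          (Or.inr ⟨Or.inl (Perm.SameCycle.refl _ _), Or.inr hy⟩)
      · refine ⟨Quotient.mk _ y, ?_⟩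
        simp only [f, hb, hy, if_false]
        rfl

end mulSwap

end

section

/-! ### Koszul signs -/

variable {k : Type*} [Field k]

/-- The sign `(-1)^ε`. -/
def paritySign (k : Type*) [Field k] (ε : ZMod 2) : k := if ε = 1 then -1 else 1

theorem zmod_two_cases (ε : ZMod 2) : ε = 0 ∨ ε = 1 :=
  (by decide : ∀ ε : ZMod 2, ε = 0 ∨ ε = 1) ε

theorem zmod_two_add_self (ε : ZMod 2) : ε + ε = 0 := CharTwo.add_self_eq_zero ε

@[simp] theorem paritySign_zero : paritySign k 0 = 1 := by simp [paritySign]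

@[simp] theorem paritySign_one : paritySign k 1 = -1 := by simp [paritySign]

theorem paritySign_add (a b : ZMod 2) :
    paritySign k (a + b) = paritySign k a * paritySign k b := by
  obtain rfl | rfl := zmod_two_cases a <;> obtain rfl | rfl := zmod_two_cases b <;>
    simp [zmod_two_add_self]

@[simp] theorem paritySign_mul_self (a : ZMod 2) : paritySign k a * paritySign k a = 1 := by
  rw [← paritySign_add, zmod_two_add_self, paritySign_zero]

theorem paritySign_sum {α : Type*} (s : Finset α) (f : α → ZMod 2) :
    paritySign k (∑ i ∈ s, f i) = ∏ i ∈ s, paritySign k (f i) := by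
  classical
  induction s using Finset.induction_on with
  | empty => simp
  | insert a s ha ih => rw [sum_insert ha, prod_insert ha, paritySign_add, ih]

variable {F : Type*}

/-- The Koszul sign of passing from the order of letters given by the ranks `r` to the one given
by `r'`; the letters have parities `q`. -/
def reorderSign (k : Type*) [Field k] {F : Type*} [Fintype F] (q : F → ZMod 2) (r r' : F → ℕ) : k :=
  ∏ x, ∏ y, if r x < r y ∧ r' y < r' x then paritySign k (q x * q y) else 1

theorem mul_eq_one_iff_zmod_two (a b : ZMod 2) : a * b = 1 ↔ a = 1 ∧ b = 1 := by
  revert a b; decide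

theorem koszul_eq_reorderSign {N : ℕ} (q : Fin N → ZMod 2) (r : Fin N → ℕ) :
    (koszul q r : k) = reorderSign k q (fun i => (i : ℕ)) r := by
  unfold koszul reorderSign
  refine prod_congr rfl fun x _ => prod_congr rfl fun y _ => ?_
  simp only [paritySign, mul_eq_one_iff_zmod_two, Fin.lt_def]
  rw [← ite_and]
  simp only [and_assoc]

theorem reorderSign_symm [Fintype F] (q : F → ZMod 2) (r r' : F → ℕ) :
    reorderSign k q r r' = reorderSign k q r' r := by
  unfold reorderSign
  rw [prod_comm]
  refine prod_congr rfl fun x _ => prod_congr rfl fun y _ => ?_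
  simp only [mul_comm (q x), and_comm]

theorem reorderSign_eq_one [Fintype F] (q : F → ZMod 2) (r r' : F → ℕ)
    (h : ∀ x y, r x < r y → ¬ r' y < r' x) : reorderSign k q r r' = 1 := by
  refine prod_eq_one fun x _ => prod_eq_one fun y _ => ?_
  rw [if_neg fun h1 => h x y h1.1 h1.2]

theorem reorderSign_congr [Fintype F] (q : F → ZMod 2) {r r' s s' : F → ℕ}
    (h : ∀ x y, (r x < r y ∧ r' y < r' x) ↔ (s x < s y ∧ s' y < s' x)) :
    reorderSign k q r r' = reorderSign k q s s' := by
  unfold reorderSign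
  simp only [h]

theorem reorderSign_comp {F' : Type*} [Fintype F] [Fintype F'] (g : F' ≃ F) (q : F → ZMod 2)
    (r r' : F → ℕ) : reorderSign k (q ∘ g) (r ∘ g) (r' ∘ g) = reorderSign k q r r' := by
  unfold reorderSign
  rw [← g.prod_comp]
  refine prod_congr rfl fun x _ => ?_
  rw [← g.prod_comp]
  rfl

/-- Collects the factors of `(x, y)` and `(y, x)`, so that identities between signs can be checked
for one unordered pair of letters at a time. -/
theorem prod_prod_eq_of_injective [Fintype F] {r : F → ℕ} (hr : Function.Injective r)
    (A : F → F → k) (hA : ∀ x, A x x = 1) :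
    ∏ x, ∏ y, A x y = ∏ x, ∏ y, if r x < r y then A x y * A y x else 1 := by
  have h1 : ∀ x y, A x y = (if r x < r y then A x y else 1) * (if r y < r x then A x y else 1) := by
    intro x y
    obtain h | h | h := lt_trichotomy (r x) (r y)
    · simp [h, h.le]
    · rw [hr h, hA]; simp
    · simp [h, h.le]
  rw [prod_congr rfl fun x _ => prod_congr rfl fun y _ => h1 x y,
    prod_congr rfl fun x _ => prod_mul_distrib, prod_mul_distrib]
  conv_lhs => rw [mul_comm, prod_comm, mul_comm]
  rw [← prod_mul_distrib]
  refine prod_congr rfl fun x _ => ?_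
  rw [← prod_mul_distrib]
  refine prod_congr rfl fun y _ => ?_
  split_ifs <;> simp

/-- For a pair of letters, the outer orders disagree exactly when one of the two passages exchanges
the pair; when both do, the sign appears twice and disappears. -/
theorem reorderSign_trans [Fintype F] (q : F → ZMod 2) {r r' r'' : F → ℕ}
    (hr : Function.Injective r) (hr' : Function.Injective r') (hr'' : Function.Injective r'') :
    reorderSign k q r r'' = reorderSign k q r r' * reorderSign k q r' r'' := by
  unfold reorderSign
  rw [prod_prod_eq_of_injective hr _ (by simp),
    prod_prod_eq_of_injective hr (fun x y => if r x < r y ∧ r' y < r' x then _ else _) (by simp),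
    prod_prod_eq_of_injective hr (fun x y => if r' x < r' y ∧ r'' y < r'' x then _ else _)
      (by simp), ← prod_mul_distrib]
  refine prod_congr rfl fun x _ => ?_
  rw [← prod_mul_distrib]
  refine prod_congr rfl fun y _ => ?_
  by_cases h : r x < r y
  · have h1 : r' x ≠ r' y := fun e => h.ne (congrArg r (hr' e))
    have h2 : r'' x ≠ r'' y := fun e => h.ne (congrArg r (hr'' e))
    simp only [h, not_lt.2 h.le, if_true, true_and, false_and, if_false, mul_one,
      mul_comm (q y) (q x)]
    obtain h1 | h1 := lt_or_gt_of_ne h1 <;> obtain h2 | h2 := lt_or_gt_of_ne h2 <;>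
      simp [h1, h2, not_lt.2 h1.le, not_lt.2 h2.le]
  · simp [h]

/-! ### Signs of lists -/

/-- The product of the signs of exchanging each letter of `A` with each letter of `B` of lower
rank. -/
def crossSign (k : Type*) [Field k] (q : F → ZMod 2) (r : F → ℕ) (A B : List F) : k :=
  (A.map fun x => (B.map fun y => if r y < r x then paritySign k (q x * q y) else 1).prod).prod

/-- The sign of rearranging the letters of a list in order of increasing rank. -/
def listSign (k : Type*) [Field k] (q : F → ZMod 2) (r : F → ℕ) : List F → k
  | [] => 1
  | x :: l => crossSign k q r [x] l * listSign k q r l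

section lists

variable (q : F → ZMod 2) (r : F → ℕ)

theorem crossSign_append_left (A B C : List F) :
    crossSign k q r (A ++ B) C = crossSign k q r A C * crossSign k q r B C := by
  simp [crossSign]

theorem crossSign_append_right (A B C : List F) :
    crossSign k q r A (B ++ C) = crossSign k q r A B * crossSign k q r A C := by
  simp only [crossSign, List.map_append, List.prod_append]
  exact List.prod_map_mul

theorem crossSign_perm {A A' B B' : List F} (hA : A.Perm A') (hB : B.Perm B') :
    crossSign k q r A B = crossSign k q r A' B' := by
  unfold crossSign
  rw [(hA.map _).prod_eq]
  exact congrArg _ (List.map_congr_left fun x _ => (hB.map _).prod_eq)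

theorem listSign_append (A B : List F) :
    listSign k q r (A ++ B) = listSign k q r A * crossSign k q r A B * listSign k q r B := by
  induction A with
  | nil => simp [listSign, crossSign]
  | cons x A ih =>
    rw [List.cons_append, listSign, ih, listSign, crossSign_append_right,
      show x :: A = [x] ++ A from rfl, crossSign_append_left]
    ring

theorem crossSign_mul_self (A B : List F) :
    crossSign k q r A B * crossSign k q r A B = 1 := by
  unfold crossSign
  rw [← List.prod_map_mul]
  refine List.prod_eq_one fun c hc => ?_
  obtain ⟨x, -, rfl⟩ := List.mem_map.1 hc
  rw [← List.prod_map_mul]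
  refine List.prod_eq_one fun c hc => ?_
  obtain ⟨y, -, rfl⟩ := List.mem_map.1 hc
  split_ifs <;> simp

theorem crossSign_cons_left (x : F) (A B : List F) :
    crossSign k q r (x :: A) B = crossSign k q r [x] B * crossSign k q r A B :=
  crossSign_append_left q r [x] A B

theorem crossSign_cons_right (y : F) (A B : List F) :
    crossSign k q r A (y :: B) = crossSign k q r A [y] * crossSign k q r A B :=
  crossSign_append_right q r A [y] B

variable {q r}

/-- Ranks being distinct, each pair of letters carries its sign in exactly one of the two factors,
so the product counts all pairs. -/
theorem crossSign_mul_swap (hr : Function.Injective r) {A B : List F} (h : A.Disjoint B) :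
    crossSign k q r A B * crossSign k q r B A =
      paritySign k ((A.map q).sum * (B.map q).sum) := by
  induction A with
  | nil => simp [crossSign]
  | cons x A ih =>
    rw [List.disjoint_cons_left] at h
    have hx : crossSign k q r [x] B * crossSign k q r B [x] =
        paritySign k (q x * (B.map q).sum) := by
      have hB := h.1
      clear h ih
      induction B with
      | nil => simp [crossSign]
      | cons y B ih =>
        rw [List.mem_cons, not_or] at hB
        have hxy : crossSign k q r [x] [y] * crossSign k q r [y] [x] =
            paritySign k (q x * q y) := by
          obtain h1 | h1 := lt_or_gt_of_ne (fun e => hB.1 (hr e) : r x ≠ r y) <;>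
            simp [crossSign, h1, not_lt.2 h1.le, mul_comm]
        rw [crossSign_cons_right, crossSign_cons_left q r y B, List.map_cons, List.sum_cons, mul_add,
          paritySign_add, ← hxy, ← ih hB.2]
        ring
    rw [crossSign_cons_left, crossSign_cons_right _ _ x, List.map_cons, List.sum_cons, add_mul,
      paritySign_add, ← hx, ← ih h.2]
    ring

/-- Connects the recursive sign, convenient for concatenating and rotating words, with the sign
between two rankings, convenient for changing numberings. -/
theorem listSign_eq_reorderSign [Fintype F] [DecidableEq F] {l : List F} (hl : l.Nodup)
    (hmem : ∀ x, x ∈ l) : listSign k q r l = reorderSign k q r (fun x => l.idxOf x) := by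
  have key : ∀ l : List F, l.Nodup → listSign k q r l = (l.map fun x => (l.map fun y =>
      if r x < r y ∧ l.idxOf y < l.idxOf x then paritySign k (q x * q y) else 1).prod).prod := by
    intro l hl
    induction l with
    | nil => simp [listSign]
    | cons a l ih =>
      rw [List.nodup_cons] at hl
      have h1 : ∀ x ∈ l, (a :: l).idxOf x = l.idxOf x + 1 := fun x hx =>
        List.idxOf_cons_ne _ (fun e => hl.1 (e ▸ hx))
      have h0 : (a :: l).idxOf a = 0 := List.idxOf_cons_self
      rw [listSign, ih hl.2, List.map_cons, List.prod_cons]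
      have e1 : ((a :: l).map fun y => if r a < r y ∧ (a :: l).idxOf y < (a :: l).idxOf a then
          paritySign k (q a * q y) else 1).prod = 1 := by
        refine List.prod_eq_one fun c hc => ?_
        obtain ⟨y, -, rfl⟩ := List.mem_map.1 hc
        rw [h0, if_neg (by omega)]
      rw [e1, one_mul, show crossSign k q r [a] l = crossSign k q r [a] l from rfl]
      simp only [crossSign, List.map_cons, List.prod_cons, List.map_nil, List.prod_nil, mul_one]
      rw [← List.prod_map_mul]
      refine congrArg _ (List.map_congr_left fun x hx => ?_)
      rw [h1 x hx, h0]
      congr 1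
      · simp [mul_comm]
      · refine congrArg _ (List.map_congr_left fun y hy => ?_)
        rw [h1 y hy]
        simp
  have hprod : ∀ f : F → k, (l.map f).prod = ∏ x, f x := by
    intro f
    rw [← List.prod_toFinset f hl]
    exact prod_congr (by ext x; simp [hmem]) fun _ _ => rfl
  rw [key l hl, hprod]
  exact prod_congr rfl fun x _ => hprod _

/-- The value of the words `L`, with their letters rearranged in order of increasing rank. -/
def wordsValue (k : Type*) [Field k] (q : F → ZMod 2) (r : F → ℕ) (M : List F → k)
    (L : List (List F)) : k :=
  listSign k q r L.flatten * (L.map M).prod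

/-- A word with nonzero value is even and passes the other words without a sign; if some value is
zero, both sides vanish. -/
theorem wordsValue_perm (hr : Function.Injective r) {M : List F → k}
    (hM : ∀ w, M w ≠ 0 → (w.map q).sum = 0) {L L' : List (List F)} (h : L.Perm L')
    (hL : L.flatten.Nodup) : wordsValue k q r M L = wordsValue k q r M L' := by
  unfold wordsValue
  induction h with
  | nil => rfl
  | @cons w L L' h ih =>
    rw [List.flatten_cons, List.nodup_append] at hL
    simp only [List.flatten_cons, listSign_append, List.map_cons, List.prod_cons,
      crossSign_perm q r (List.Perm.refl w) h.flatten]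
    linear_combination (listSign k q r w * crossSign k q r w L'.flatten * M w) * ih hL.2.1
  | swap w w' L =>
    simp only [List.flatten_cons, listSign_append, List.map_cons, List.prod_cons,
      crossSign_append_right]
    by_cases hw : M w = 0
    · simp [hw]
    have hd : w'.Disjoint w := by
      rw [List.flatten_cons, List.flatten_cons, List.nodup_append'] at hL
      exact fun x h1 h2 => hL.2.2 h1 (List.mem_append_left _ h2)
    have := crossSign_mul_swap (k := k) (q := q) hr hd
    rw [hM w hw, mul_zero, paritySign_zero] at this
    have e : crossSign k q r w' w = crossSign k q r w w' := by
      have h2 := crossSign_mul_self (k := k) q r w w'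
      linear_combination crossSign k q r w w' * this - crossSign k q r w' w * h2
    rw [e]
    ring
  | trans h1 _ ih1 ih2 => rw [ih1 hL, ih2 (h1.flatten.nodup_iff.1 hL)]

/-- Moving the first letter to the end changes the sign of the list by exactly the factor in `hM`,
by `crossSign_mul_swap`. -/
theorem wordValue_isRotated (hr : Function.Injective r) {M : List F → k}
    (hM : ∀ x w, M (x :: w) = paritySign k (q x * (w.map q).sum) * M (w ++ [x]))
    {w w' : List F} (h : w ~r w') (hw : w.Nodup) :
    listSign k q r w * M w = listSign k q r w' * M w' := by
  obtain ⟨n, rfl⟩ := h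
  induction n generalizing w with
  | zero => simp
  | succ n ih =>
    cases w with
    | nil => simp
    | cons x w =>
      rw [List.rotate_cons_succ, ← ih]
      · rw [hM, listSign_append, show x :: w = [x] ++ w from rfl, listSign_append]
        have h1 : listSign k q r [x] = 1 := by simp [listSign, crossSign]
        have hd : [x].Disjoint w := by
          rw [List.nodup_cons] at hw
          simpa using hw.1
        have h2 := crossSign_mul_swap (k := k) (q := q) hr hd
        have h3 := crossSign_mul_self (k := k) q r [x] w
        simp only [List.map_cons, List.map_nil, List.sum_cons, List.sum_nil, add_zero] at h2
        rw [← h2, h1]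
        linear_combination (listSign k q r w * crossSign k q r w [x] * M (w ++ [x])) * h3
      · have : (w ++ [x]).Perm (x :: w) := List.perm_append_comm
        exact this.nodup_iff.2 hw

theorem wordsValue_isRotated (hr : Function.Injective r) {M : List F → k}
    (hM : ∀ x w, M (x :: w) = paritySign k (q x * (w.map q).sum) * M (w ++ [x]))
    {L L' : List (List F)} (h : List.Forall₂ (· ~r ·) L L') (hL : L.flatten.Nodup) :
    wordsValue k q r M L = wordsValue k q r M L' := by
  unfold wordsValue
  have hp : ∀ {L L' : List (List F)}, List.Forall₂ (· ~r ·) L L' → L.flatten.Perm L'.flatten := by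
    intro L L' h
    induction h with
    | nil => exact List.Perm.refl _
    | cons h _ ih => exact h.perm.append ih
  induction h with
  | nil => rfl
  | cons h h' ih =>
    rw [List.flatten_cons, List.nodup_append] at hL
    have h1 := wordValue_isRotated (k := k) hr hM h hL.1
    simp only [List.flatten_cons, listSign_append, List.map_cons, List.prod_cons,
      crossSign_perm q r h.perm (hp h')]
    rename_i w w' L L' 
    calc _ = (listSign k q r w * M w) * crossSign k q r w' L'.flatten *
          (listSign k q r L.flatten * (L.map M).prod) := by ring
      _ = _ := by rw [h1, ih hL.2.1]; ring

end lists

/-! ### Even pairs of letters -/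

/-- The two letters of every pair `e` are neighbours. -/
def PairRank {E L : Type*} (r : (E × Fin 2) ⊕ L → ℕ) : Prop :=
  ∀ e z, z ≠ Sum.inl (e, 0) → z ≠ Sum.inl (e, 1) →
    ((r (Sum.inl (e, 0)) < r z ↔ r (Sum.inl (e, 1)) < r z) ∧
      (r z < r (Sum.inl (e, 0)) ↔ r z < r (Sum.inl (e, 1))))

/-- Pairs of letters of the same parity may be moved without signs. -/
theorem reorderSign_pairs {E L : Type*} [Fintype E] [Fintype L]
    {q : (E × Fin 2) ⊕ L → ZMod 2} {r r' : (E × Fin 2) ⊕ L → ℕ}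
    (hq : ∀ e, q (Sum.inl (e, 0)) = q (Sum.inl (e, 1))) (hr : PairRank r) (hr' : PairRank r')
    (h01 : ∀ e, r (Sum.inl (e, 0)) < r (Sum.inl (e, 1))) :
    reorderSign k q r r' =
      (∏ e, if r' (Sum.inl (e, 1)) < r' (Sum.inl (e, 0)) then
        paritySign k (q (Sum.inl (e, 0))) else 1) *
      reorderSign k (q ∘ Sum.inr) (r ∘ Sum.inr) (r' ∘ Sum.inr) := by
  classical
  unfold reorderSign
  set A : (E × Fin 2) ⊕ L → (E × Fin 2) ⊕ L → k := fun x y =>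
    if r x < r y ∧ r' y < r' x then paritySign k (q x * q y) else 1 with hA
  have hsq : ∀ x y, A x y * A x y = 1 := by
    intro x y
    simp only [hA]
    split_ifs <;> simp
  -- The two letters of a pair compare with any other letter in the same way in both orders, and
  -- have equal parity, so their factors agree and cancel in products.
  have h1 : ∀ e z, z ≠ Sum.inl (e, 0) → z ≠ Sum.inl (e, 1) →
      A (Sum.inl (e, 1)) z = A (Sum.inl (e, 0)) z ∧ A z (Sum.inl (e, 1)) = A z (Sum.inl (e, 0)) := by
    intro e z h0 h1
    obtain ⟨a1, a2⟩ := hr e z h0 h1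
    obtain ⟨b1, b2⟩ := hr' e z h0 h1
    simp only [hA, a1, a2, b1, b2, hq, and_self]
  have hprod : ∀ f : E × Fin 2 → k, ∏ x, f x = ∏ e, f (e, 0) * f (e, 1) := by
    intro f
    rw [Fintype.prod_prod_type]
    simp
  have hne : ∀ (e : E) (s : Fin 2) (l : L), (Sum.inr l : (E × Fin 2) ⊕ L) ≠ Sum.inl (e, s) := by
    simp
  change (∏ x, ∏ y, A x y) = _
  rw [Fintype.prod_sum_type]
  congr 1
  · rw [hprod]
    refine prod_congr rfl fun e _ => ?_
    rw [Fintype.prod_sum_type, Fintype.prod_sum_type, hprod, hprod]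
    have hl : ∀ l, A (Sum.inl (e, 1)) (Sum.inr l) = A (Sum.inl (e, 0)) (Sum.inr l) := fun l =>
      (h1 e _ (hne _ _ _) (hne _ _ _)).1
    have hl' : (∏ l, A (Sum.inl (e, 0)) (Sum.inr l)) * ∏ l, A (Sum.inl (e, 0)) (Sum.inr l) = 1 := by
      rw [← prod_mul_distrib]
      exact prod_eq_one fun l _ => hsq _ _
    simp only [hl]
    have hsingle : ∀ s : Fin 2, ∏ e', A (Sum.inl (e, s)) (Sum.inl (e', 0)) *
        A (Sum.inl (e, s)) (Sum.inl (e', 1)) =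
        A (Sum.inl (e, s)) (Sum.inl (e, 0)) * A (Sum.inl (e, s)) (Sum.inl (e, 1)) := by
      intro s
      refine prod_eq_single_of_mem e (mem_univ _) fun e' _ he => ?_
      rw [(h1 e' (Sum.inl (e, s)) (by simp [he.symm]) (by simp [he.symm])).2, hsq]
    rw [hsingle, hsingle]
    have h00 : ∀ x, A x x = 1 := fun x => by simp [hA]
    have h10 : A (Sum.inl (e, 1)) (Sum.inl (e, 0)) = 1 := by
      simp only [hA]
      rw [if_neg fun h => absurd (h01 e) (not_lt.2 h.1.le)]
    -- Only the exchange within a pair survives; its exponent is the square of the parity, that is,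
    -- the parity itself.
    have hqq : ∀ a : ZMod 2, a * a = a := by decide
    have h01' : A (Sum.inl (e, 0)) (Sum.inl (e, 1)) =
        if r' (Sum.inl (e, 1)) < r' (Sum.inl (e, 0)) then
          paritySign k (q (Sum.inl (e, 0))) else 1 := by
      simp only [hA, h01, true_and, ← hq e, hqq]
    rw [h00, h00, h10, h01']
    linear_combination (if r' (Sum.inl (e, 1)) < r' (Sum.inl (e, 0)) then
          paritySign k (q (Sum.inl (e, 0))) else 1) * hl'
  · refine prod_congr rfl fun l _ => ?_
    rw [Fintype.prod_sum_type, hprod]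
    have : (∏ e, A (Sum.inr l) (Sum.inl (e, 0)) * A (Sum.inr l) (Sum.inl (e, 1))) = 1 := by
      refine prod_eq_one fun e _ => ?_
      rw [(h1 e _ (hne _ _ _) (hne _ _ _)).2, hsq]
    change (∏ e, A (Sum.inr l) (Sum.inl (e, 0)) * A (Sum.inr l) (Sum.inl (e, 1))) * _ = _
    rw [this, one_mul]
    rfl

end

section

/-! ### Listings of the cycles of a permutation -/

section listing

variable {F F' : Type*}

/-- Every cycle of `τ` (fixed points included) is written exactly once in `L`. -/
def IsListing (τ : Perm F) (L : List (List F)) : Prop :=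
  (L.map fun w : List F => (w : Cycle F)).Nodup ∧
    ∀ c : Cycle F, c ∈ L.map (fun w : List F => (w : Cycle F)) ↔ ∃ x, c = Function.periodicOrbit τ x

theorem mem_periodicPts_perm [Finite F] (τ : Perm F) (x : F) : x ∈ Function.periodicPts τ :=
  ⟨orderOf τ, orderOf_pos τ, by
    rw [Function.IsPeriodicPt, Function.IsFixedPt, Perm.iterate_eq_pow, pow_orderOf_eq_one]; rfl⟩

theorem mem_periodicOrbit_perm [Finite F] {τ : Perm F} {x y : F} :
    y ∈ Function.periodicOrbit τ x ↔ τ.SameCycle x y := by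
  rw [Function.mem_periodicOrbit_iff (mem_periodicPts_perm τ x)]
  simp only [Perm.iterate_eq_pow]
  exact ⟨fun ⟨n, hn⟩ => ⟨n, by simpa using hn⟩, fun h => h.exists_nat_pow_eq⟩

theorem periodicOrbit_eq_iff [Finite F] {τ : Perm F} {x y : F} :
    Function.periodicOrbit τ x = Function.periodicOrbit τ y ↔ τ.SameCycle x y := by
  constructor
  · intro h
    rw [← mem_periodicOrbit_perm, h, mem_periodicOrbit_perm]
  · intro h
    obtain ⟨n, rfl⟩ := h.exists_nat_pow_eq
    rw [← Perm.iterate_eq_pow, Function.periodicOrbit_apply_iterate_eq (mem_periodicPts_perm τ x)]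

theorem periodicOrbit_map {τ : Perm F} {τ' : Perm F'} {j : F → F'} (hj : Function.Injective j)
    (h : ∀ x, j (τ x) = τ' (j x)) (x : F) :
    Function.periodicOrbit τ' (j x) = (Function.periodicOrbit τ x).map j := by
  have hit : ∀ n, τ'^[n] (j x) = j (τ^[n] x) := by
    intro n
    induction n with
    | zero => rfl
    | succ n ih => rw [Function.iterate_succ_apply', Function.iterate_succ_apply', ih, h]
  have hp : Function.minimalPeriod τ' (j x) = Function.minimalPeriod τ x := by
    rw [Function.minimalPeriod_eq_minimalPeriod_iff]
    intro n
    rw [Function.IsPeriodicPt, Function.IsPeriodicPt, Function.IsFixedPt, Function.IsFixedPt, hit]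
    exact hj.eq_iff
  unfold Function.periodicOrbit
  rw [hp]
  refine congrArg _ ?_
  rw [List.map_map]
  exact List.map_congr_left fun n _ => hit n

namespace IsListing

variable {τ : Perm F} {τ' : Perm F'} {L L' : List (List F)}

theorem word [Finite F] (h : IsListing τ L) {w : List F} (hw : w ∈ L) :
    ∃ x, (w : Cycle F) = Function.periodicOrbit τ x ∧ w.Nodup ∧
      w.length = Function.minimalPeriod τ x ∧ ∀ y, y ∈ w ↔ τ.SameCycle x y := by
  obtain ⟨x, hx⟩ := (h.2 w).1 (List.mem_map.2 ⟨w, hw, rfl⟩)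
  refine ⟨x, hx, ?_, ?_, fun y => ?_⟩
  · rw [← Cycle.nodup_coe_iff, hx]
    exact Function.nodup_periodicOrbit
  · rw [← Cycle.length_coe, hx, Function.periodicOrbit_length]
  · rw [← mem_periodicOrbit_perm, ← hx, Cycle.mem_coe_iff]

theorem exists_word [Finite F] (h : IsListing τ L) (x : F) : ∃ w ∈ L,
    w.length = Function.minimalPeriod τ x ∧ x ∈ w := by
  obtain ⟨w, hw, e⟩ := List.mem_map.1 ((h.2 (Function.periodicOrbit τ x)).2 ⟨x, rfl⟩)
  refine ⟨w, hw, ?_, ?_⟩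
  · rw [← Cycle.length_coe, e, Function.periodicOrbit_length]
  · rw [← Cycle.mem_coe_iff, e, mem_periodicOrbit_perm]

theorem mem_flatten [Finite F] (h : IsListing τ L) (x : F) : x ∈ L.flatten := by
  obtain ⟨w, hw, -, hx⟩ := h.exists_word x
  exact List.mem_flatten.2 ⟨w, hw, hx⟩

theorem nodup_flatten [Finite F] (h : IsListing τ L) : L.flatten.Nodup := by
  rw [List.nodup_flatten]
  refine ⟨fun w hw => (h.word hw).choose_spec.2.1, ?_⟩
  have h1 : L.Pairwise fun a b : List F => (a : Cycle F) ≠ (b : Cycle F) := List.pairwise_map.1 h.1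
  refine h1.imp_of_mem fun {a b} ha hb hab x hxa hxb => hab ?_
  obtain ⟨y, hy, -, -, hy'⟩ := h.word ha
  obtain ⟨z, hz, -, -, hz'⟩ := h.word hb
  rw [hy, hz, periodicOrbit_eq_iff]
  exact ((hy' x).1 hxa).trans ((hz' x).1 hxb).symm

/-- Two listings contain the same cycles, so they differ by the order of the words followed by the
choice of a first letter in each. -/
theorem exists_perm (h : IsListing τ L) (h' : IsListing τ L') :
    ∃ L'', L.Perm L'' ∧ List.Forall₂ (· ~r ·) L'' L' := by
  have hp : (L.map fun w : List F => (w : Cycle F)).Perm (L'.map fun w : List F => (w : Cycle F)) :=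
    (List.perm_ext_iff_of_nodup h.1 h'.1).2 fun c => by rw [h.2, h'.2]
  let R : List F → Cycle F → Prop := fun w c => (w : Cycle F) = c
  have h1 : Relation.Comp (List.Forall₂ R) List.Perm L (L'.map fun w : List F => (w : Cycle F)) :=
    ⟨_, by rw [List.forall₂_map_right_iff]; exact List.forall₂_same.2 fun _ _ => rfl, hp⟩
  rw [List.forall₂_comp_perm_eq_perm_comp_forall₂] at h1
  obtain ⟨L'', h2, h3⟩ := h1
  rw [List.forall₂_map_right_iff] at h3
  exact ⟨L'', h2, h3.imp fun _ _ e => Cycle.coe_eq_coe.1 e⟩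

theorem map (h : IsListing τ L) (g : F ≃ F') : IsListing (g.permCongr τ) (L.map (List.map g)) := by
  have e : (L.map (List.map g)).map (fun w : List F' => (w : Cycle F')) =
      (L.map fun w : List F => (w : Cycle F)).map (Cycle.map g) := by
    simp [Function.comp_def]
  have ho : ∀ x, Function.periodicOrbit (g.permCongr τ) (g x) =
      (Function.periodicOrbit τ x).map g := periodicOrbit_map g.injective (by simp)
  have hinj : Function.Injective (Cycle.map g) := by
    intro c c' hc
    have : ∀ c : Cycle F, Cycle.map g.symm (Cycle.map g c) = c := by
      intro c
      induction c using Quotient.inductionOn with | _ l => ?_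
      exact congrArg _ (by simp : (l.map g).map g.symm = l)
    rw [← this c, hc, this]
  refine ⟨?_, fun c => ?_⟩
  · rw [e]
    exact h.1.map hinj
  · rw [e, List.mem_map]
    simp only [h.2]
    constructor
    · rintro ⟨_, ⟨x, rfl⟩, rfl⟩
      exact ⟨g x, (ho x).symm⟩
    · rintro ⟨x, rfl⟩
      exact ⟨_, ⟨g.symm x, rfl⟩, by rw [← ho]; simp⟩

theorem sumCongr [Finite F] [Finite F'] {M : List (List F')} (h : IsListing τ L)
    (h' : IsListing τ' M) : IsListing (Equiv.sumCongr τ τ' : Perm (F ⊕ F'))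
      (L.map (List.map Sum.inl) ++ M.map (List.map Sum.inr)) := by
  have e1 : (L.map (List.map (Sum.inl : F → F ⊕ F'))).map (fun w : List (F ⊕ F') => (w : Cycle (F ⊕ F'))) =
      (L.map fun w : List F => (w : Cycle F)).map (Cycle.map Sum.inl) := by
    simp [Function.comp_def]
  have e2 : (M.map (List.map (Sum.inr : F' → F ⊕ F'))).map (fun w : List (F ⊕ F') => (w : Cycle (F ⊕ F'))) =
      (M.map fun w : List F' => (w : Cycle F')).map (Cycle.map Sum.inr) := by
    simp [Function.comp_def]
  have ho1 : ∀ x, Function.periodicOrbit (Equiv.sumCongr τ τ' : Perm (F ⊕ F')) (Sum.inl x) =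
      (Function.periodicOrbit τ x).map Sum.inl := periodicOrbit_map Sum.inl_injective (by simp)
  have ho2 : ∀ x, Function.periodicOrbit (Equiv.sumCongr τ τ' : Perm (F ⊕ F')) (Sum.inr x) =
      (Function.periodicOrbit τ' x).map Sum.inr := periodicOrbit_map Sum.inr_injective (by simp)
  have hm1 : ∀ c, c ∈ (L.map fun w : List F => (w : Cycle F)).map (Cycle.map (Sum.inl : F → F ⊕ F')) ↔
      ∃ x, c = Function.periodicOrbit (Equiv.sumCongr τ τ' : Perm (F ⊕ F')) (Sum.inl x) := by
    intro c
    rw [List.mem_map]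
    simp only [h.2, ho1]
    exact ⟨by rintro ⟨_, ⟨x, rfl⟩, rfl⟩; exact ⟨x, rfl⟩, by rintro ⟨x, rfl⟩; exact ⟨_, ⟨x, rfl⟩, rfl⟩⟩
  have hm2 : ∀ c, c ∈ (M.map fun w : List F' => (w : Cycle F')).map (Cycle.map (Sum.inr : F' → F ⊕ F')) ↔
      ∃ x, c = Function.periodicOrbit (Equiv.sumCongr τ τ' : Perm (F ⊕ F')) (Sum.inr x) := by
    intro c
    rw [List.mem_map]
    simp only [h'.2, ho2]
    exact ⟨by rintro ⟨_, ⟨x, rfl⟩, rfl⟩; exact ⟨x, rfl⟩, by rintro ⟨x, rfl⟩; exact ⟨_, ⟨x, rfl⟩, rfl⟩⟩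
  refine ⟨?_, fun c => ?_⟩
  · rw [List.map_append, e1, e2, List.nodup_append']
    refine ⟨h.1.map_on ?_, h'.1.map_on ?_, fun c h1 h2 => ?_⟩
    · intro c hc d hd hcd
      obtain ⟨x, rfl⟩ := (h.2 _).1 hc
      obtain ⟨y, rfl⟩ := (h.2 _).1 hd
      rw [← ho1, ← ho1, periodicOrbit_eq_iff, sameCycle_sumCongr_inl] at hcd
      exact periodicOrbit_eq_iff.2 hcd
    · intro c hc d hd hcd
      obtain ⟨x, rfl⟩ := (h'.2 _).1 hc
      obtain ⟨y, rfl⟩ := (h'.2 _).1 hd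
      rw [← ho2, ← ho2, periodicOrbit_eq_iff, sameCycle_sumCongr_inr] at hcd
      exact periodicOrbit_eq_iff.2 hcd
    · obtain ⟨x, hx⟩ := (hm1 _).1 h1
      obtain ⟨y, hy⟩ := (hm2 _).1 h2
      exact not_sameCycle_sumCongr (periodicOrbit_eq_iff.1 (hx.symm.trans hy))
  · rw [List.map_append, e1, e2, List.mem_append, hm1, hm2, Sum.exists]

end IsListing

theorem isListing_cycleLists {N : ℕ} (τ : Perm (Fin N)) : IsListing τ (cycleLists τ) := by
  classical
  have e : (cycleLists τ).map (fun w : List (Fin N) => (w : Cycle (Fin N))) =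
      ((List.finRange N).filter (fun x => ∀ y, τ.SameCycle x y → x ≤ y)).map
        (Function.periodicOrbit τ) := by
    unfold cycleLists Function.periodicOrbit
    simp only [Perm.iterate_eq_pow, List.map_map]
    rfl
  refine ⟨?_, fun c => ?_⟩
  · rw [e]
    refine ((List.nodup_finRange N).filter _).map_on fun x hx y hy hxy => ?_
    rw [periodicOrbit_eq_iff] at hxy
    simp only [List.mem_filter, decide_eq_true_eq] at hx hy
    exact le_antisymm (hx.2 _ hxy) (hy.2 _ hxy.symm)
  · rw [e, List.mem_map]
    constructor
    · rintro ⟨x, -, rfl⟩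
      exact ⟨x, rfl⟩
    · rintro ⟨x, rfl⟩
      let S : Finset (Fin N) := univ.filter fun y => τ.SameCycle x y
      have hS : S.Nonempty := ⟨x, by simp [S, Perm.SameCycle.refl]⟩
      have h1 : τ.SameCycle x (S.min' hS) := by
        have := S.min'_mem hS
        simpa [S] using this
      refine ⟨S.min' hS, ?_, periodicOrbit_eq_iff.2 h1.symm⟩
      simp only [List.mem_filter, List.mem_finRange, true_and, decide_eq_true_eq]
      intro y hy
      exact S.min'_le _ (by simpa [S] using h1.trans hy)

theorem exists_isListing [Finite F] (τ : Perm F) : ∃ L, IsListing τ L := by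
  obtain ⟨N, ⟨e⟩⟩ := Finite.exists_equiv_fin F
  have := (isListing_cycleLists (e.permCongr τ)).map e.symm
  refine ⟨_, (?_ : IsListing τ ((cycleLists (e.permCongr τ)).map (List.map e.symm)))⟩
  convert this
  ext; simp

variable {k : Type*} [Field k]

/-- Consequently a product of even, cyclically invariant words may be evaluated with any order of
the words and any starting letters. -/
theorem IsListing.wordsValue_eq [Finite F] {τ : Perm F} {L L' : List (List F)}
    (h : IsListing τ L) (h' : IsListing τ L') {q : F → ZMod 2} {r : F → ℕ}
    (hr : Function.Injective r) {M : List F → k} (hM : ∀ w, M w ≠ 0 → (w.map q).sum = 0)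
    (hM' : ∀ x w, M (x :: w) = paritySign k (q x * (w.map q).sum) * M (w ++ [x])) :
    wordsValue k q r M L = wordsValue k q r M L' := by
  obtain ⟨L'', h1, h2⟩ := h.exists_perm h'
  rw [wordsValue_perm hr hM h1 h.nodup_flatten,
    wordsValue_isRotated hr hM' h2 (h1.flatten.nodup_iff.1 h.nodup_flatten)]

theorem crossSign_map (g : F → F') (q : F' → ZMod 2) (r : F' → ℕ) (A B : List F) :
    crossSign k q r (A.map g) (B.map g) = crossSign k (q ∘ g) (r ∘ g) A B := by
  simp [crossSign, Function.comp_def]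

theorem listSign_map (g : F → F') (q : F' → ZMod 2) (r : F' → ℕ) (A : List F) :
    listSign k q r (A.map g) = listSign k (q ∘ g) (r ∘ g) A := by
  induction A with
  | nil => rfl
  | cons x A ih =>
    rw [List.map_cons, listSign, listSign, ih, ← crossSign_map g]
    rfl

theorem wordsValue_map (g : F → F') (q : F' → ZMod 2) (r : F' → ℕ) (M : List F' → k)
    (L : List (List F)) : wordsValue k q r M (L.map (List.map g)) =
      wordsValue k (q ∘ g) (r ∘ g) (fun w => M (w.map g)) L := by
  unfold wordsValue
  rw [← List.map_flatten, listSign_map, List.map_map]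
  rfl

end listing

/-! ### Multilinear functions and homogeneous vectors -/

variable {k : Type*} [Field k] {V : Type*} [AddCommGroup V] [Module k V] {F F' : Type*}

/-- `φ` is multilinear. -/
def IsMultilinear (φ : (F → V) → k) : Prop :=
  ∃ g : MultilinearMap k (fun _ : F => V) k, ∀ a, φ a = g a

namespace IsMultilinear

variable {φ ψ : (F → V) → k}

theorem of_update [DecidableEq F]
    (h1 : ∀ a i x y, φ (Function.update a i (x + y)) =
      φ (Function.update a i x) + φ (Function.update a i y))
    (h2 : ∀ a i (c : k) x, φ (Function.update a i (c • x)) = c * φ (Function.update a i x)) :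
    IsMultilinear φ :=
  ⟨{ toFun := φ
     map_update_add' := fun {inst} a i x y => by
      convert h1 a i x y
     map_update_smul' := fun {inst} a i c x => by
      rw [smul_eq_mul]
      convert h2 a i c x }, fun _ => rfl⟩

theorem update_add [DecidableEq F] (h : IsMultilinear φ) (a : F → V) (i : F) (x y : V) :
    φ (Function.update a i (x + y)) =
      φ (Function.update a i x) + φ (Function.update a i y) := by
  obtain ⟨g, hg⟩ := h
  simp only [hg, g.map_update_add]

theorem update_smul [DecidableEq F] (h : IsMultilinear φ) (a : F → V) (i : F) (c : k) (x : V) :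
    φ (Function.update a i (c • x)) = c * φ (Function.update a i x) := by
  obtain ⟨g, hg⟩ := h
  simp only [hg, g.map_update_smul, smul_eq_mul]

theorem eq_zero (h : IsMultilinear φ) {a : F → V} (i : F) (hi : a i = 0) : φ a = 0 := by
  obtain ⟨g, hg⟩ := h
  rw [hg, g.map_coord_zero i hi]

theorem zero : IsMultilinear (fun _ : F → V => (0 : k)) := ⟨0, fun _ => rfl⟩

theorem add (h : IsMultilinear φ) (h' : IsMultilinear ψ) :
    IsMultilinear fun a => φ a + ψ a := by
  obtain ⟨g, hg⟩ := h
  obtain ⟨g', hg'⟩ := h'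
  exact ⟨g + g', fun a => by simp [hg, hg']⟩

theorem const_mul (h : IsMultilinear φ) (c : k) : IsMultilinear fun a => c * φ a := by
  obtain ⟨g, hg⟩ := h
  exact ⟨c • g, fun a => by simp [hg]⟩

theorem neg (h : IsMultilinear φ) : IsMultilinear fun a => -φ a := by
  simpa using h.const_mul (-1)

theorem sum {ι : Type*} (s : Finset ι) {φ : ι → (F → V) → k}
    (h : ∀ i ∈ s, IsMultilinear (φ i)) : IsMultilinear fun a => ∑ i ∈ s, φ i a := by
  classical
  induction s using Finset.induction_on with
  | empty => simpa using zero
  | insert i s hi ih =>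
    simp only [sum_insert hi]
    exact (h i (mem_insert_self _ _)).add (ih fun j hj => h j (mem_insert_of_mem hj))

theorem ite_zero (c : Prop) [Decidable c] (h : c → IsMultilinear φ) :
    IsMultilinear fun a => if c then φ a else 0 := by
  split_ifs with hc
  exacts [h hc, zero]

theorem comp_linear {W : Type*} [AddCommGroup W] [Module k W] (h : IsMultilinear φ)
    (f : F → W →ₗ[k] V) : IsMultilinear fun a : F → W => φ fun i => f i (a i) := by
  obtain ⟨g, hg⟩ := h
  exact ⟨g.compLinearMap f, fun a => by simp [hg]⟩

theorem reindex (h : IsMultilinear φ) (e : F ≃ F') :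
    IsMultilinear fun a : F' → V => φ (a ∘ e) := by
  obtain ⟨g, hg⟩ := h
  exact ⟨g.domDomCongr e, fun a => by simp [hg, Function.comp_def]⟩

theorem elim {φ : (F ⊕ F' → V) → k} (h : IsMultilinear φ) (x : F → V) :
    IsMultilinear fun a : F' → V => φ (Sum.elim x a) := by
  classical
  refine of_update (fun a i y z => ?_) fun a i c y => ?_
  · simp only [← Sum.update_elim_inr, h.update_add]
  · simp only [← Sum.update_elim_inr, h.update_smul]

theorem mul {ψ : (F' → V) → k} (h : IsMultilinear φ) (h' : IsMultilinear ψ) :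
    IsMultilinear fun a : F ⊕ F' → V => φ (a ∘ Sum.inl) * ψ (a ∘ Sum.inr) := by
  classical
  refine of_update (fun a i y z => ?_) fun a i c y => ?_
  · obtain i | i := i
    · simp only [Sum.update_inl_comp_inl, Sum.update_inl_comp_inr, h.update_add]
      ring
    · simp only [Sum.update_inr_comp_inl, Sum.update_inr_comp_inr, h'.update_add]
      ring
  · obtain i | i := i
    · simp only [Sum.update_inl_comp_inl, Sum.update_inl_comp_inr, h.update_smul]
      ring
    · simp only [Sum.update_inr_comp_inl, Sum.update_inr_comp_inr, h'.update_smul]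
      ring

theorem cons {n : ℕ} {φ : (Fin (n + 1) → V) → k} (h : IsMultilinear φ) (v : V) :
    IsMultilinear fun a : Fin n → V => φ (Fin.cons v a) := by
  refine of_update (fun a i y z => ?_) fun a i c y => ?_
  · have : ∀ y, (Fin.cons v (Function.update a i y) : Fin (n + 1) → V) =
      Function.update (Fin.cons v a) i.succ y := fun y => Fin.cons_update _ _ _ _
    simp only [this, h.update_add]
  · have : ∀ y, (Fin.cons v (Function.update a i y) : Fin (n + 1) → V) =
      Function.update (Fin.cons v a) i.succ y := fun y => Fin.cons_update _ _ _ _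
    simp only [this, h.update_smul]

end IsMultilinear

section components

variable (𝒱 : ZMod 2 → Submodule k V) [DirectSum.Decomposition 𝒱]

/-- The projection to the homogeneous component of parity `ε`. -/
def componentMap (ε : ZMod 2) : V →ₗ[k] V where
  toFun := component 𝒱 ε
  map_add' x y := by simp [component, DirectSum.decompose_add]
  map_smul' c x := by
    simp only [component, DirectSum.decompose_smul]
    rfl

theorem component_mem' (ε : ZMod 2) (v : V) : component 𝒱 ε v ∈ 𝒱 ε :=
  (DirectSum.decompose 𝒱 v ε).2

theorem component_of_mem {ε : ZMod 2} {v : V} (h : v ∈ 𝒱 ε) : component 𝒱 ε v = v :=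
  DirectSum.decompose_of_mem_same 𝒱 h

theorem component_of_mem_ne {ε ε' : ZMod 2} {v : V} (h : v ∈ 𝒱 ε) (hε : ε ≠ ε') :
    component 𝒱 ε' v = 0 :=
  DirectSum.decompose_of_mem_ne 𝒱 h hε

theorem sum_component (v : V) : ∑ ε, component 𝒱 ε v = v := by
  conv_rhs => rw [← (DirectSum.decompose 𝒱).symm_apply_apply v]
  conv_rhs => rw [← DirectSum.sum_univ_of (DirectSum.decompose 𝒱 v)]
  rw [DirectSum.decompose_symm_sum]
  exact Finset.sum_congr rfl fun ε _ => (DirectSum.decompose_symm_of 𝒱 _).symm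

theorem piSign_of_mem {ε : ZMod 2} {v : V} (h : v ∈ 𝒱 ε) :
    piSign 𝒱 v = paritySign k (ε + 1) • v := by
  unfold piSign
  obtain rfl | rfl := zmod_two_cases ε
  · rw [component_of_mem 𝒱 h, component_of_mem_ne 𝒱 h (by decide)]
    simp
  · rw [component_of_mem 𝒱 h, component_of_mem_ne 𝒱 h (by decide)]
    simp [zmod_two_add_self]

/-- `piSign` as a linear map. -/
def piSignMap : V →ₗ[k] V := componentMap 𝒱 1 - componentMap 𝒱 0

variable {𝒱}

theorem IsMultilinear.sum_components [Fintype F] [DecidableEq F] {φ : (F → V) → k}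
    (h : IsMultilinear φ) (a : F → V) :
    φ a = ∑ p : F → ZMod 2, φ fun i => component 𝒱 (p i) (a i) := by
  obtain ⟨g, hg⟩ := h
  simp only [hg]
  have := g.map_sum (fun i ε => component 𝒱 ε (a i))
  simp only [sum_component] at this
  exact this

/-- Multilinear functions that agree on homogeneous vectors are equal. -/
theorem IsMultilinear.ext_homogeneous [Finite F] {φ ψ : (F → V) → k} (h : IsMultilinear φ)
    (h' : IsMultilinear ψ)
    (H : ∀ (p : F → ZMod 2) (a : F → V), (∀ i, a i ∈ 𝒱 (p i)) → φ a = ψ a) (a : F → V) :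
    φ a = ψ a := by
  classical
  have := Fintype.ofFinite F
  rw [h.sum_components (𝒱 := 𝒱), h'.sum_components (𝒱 := 𝒱)]
  exact sum_congr rfl fun p _ => H p _ fun i => component_mem' 𝒱 _ _

/-- On homogeneous letters every decomposition other than the true parities has a zero component, so
the sums over `p` in the definitions collapse to one term. -/
theorem IsMultilinear.sum_components_of_mem [Fintype F] [DecidableEq F] {p : F → ZMod 2}
    {a : F → V} (ha : ∀ i, a i ∈ 𝒱 (p i)) (f : (F → ZMod 2) → (F → V) → k)
    (hf : ∀ p, IsMultilinear (f p)) :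
    ∑ p' : F → ZMod 2, f p' (fun i => component 𝒱 (p' i) (a i)) = f p a := by
  rw [sum_eq_single p]
  · simp only [component_of_mem 𝒱 (ha _)]
  · intro p' _ hp
    obtain ⟨i, hi⟩ := Function.ne_iff.1 hp
    exact (hf p').eq_zero i (component_of_mem_ne 𝒱 (ha i) hi.symm)
  · simp

end components

/-! ### Functionals on letters indexed by a finite type -/

/-- The value of a functional on letters numbered by `e`. -/
def evalOn (f : Functional k V) {N : ℕ} (e : F ≃ Fin N) (τ : Perm F) (x : F → V) : k :=
  f N (e.permCongr τ) (x ∘ e.symm)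

theorem evalOn_permCongr {k V F F' : Type*} (f : Functional k V) {N : ℕ} (e : F' ≃ Fin N) (g : F ≃ F') (τ : Perm F)
    (x : F' → V) : evalOn f e (g.permCongr τ) x = evalOn f (g.trans e) τ (x ∘ g) := by
  unfold evalOn
  congr 1
  ext i
  simp

/-- The values of `f` in two orders of the letters differ by the Koszul sign. -/
theorem IsEvenFunctional.evalOn_reorder {𝒱 : ZMod 2 → Submodule k V} {f : Functional k V}
    (hf : IsEvenFunctional 𝒱 f) [Fintype F] {N N' : ℕ} (e : F ≃ Fin N) (e' : F ≃ Fin N')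
    (τ : Perm F) {p : F → ZMod 2} {x : F → V} (hx : ∀ i, x i ∈ 𝒱 (p i)) :
    evalOn f e τ x =
      reorderSign k (fun i => p i + 1) (fun i => e i) (fun i => e' i) * evalOn f e' τ x := by
  obtain rfl : N = N' := by simpa using Fintype.card_congr (e.symm.trans e')
  have h := hf.equivariant N (e'.permCongr τ) (e'.symm.trans e) (p ∘ e.symm) (x ∘ e.symm)
    fun i => hx _
  unfold evalOn
  have h1 : (e'.symm.trans e) * (e'.permCongr τ) * (e'.symm.trans e)⁻¹ = e.permCongr τ := by
    ext i
    simp [Perm.inv_def]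
  rw [h1, koszul_eq_reorderSign] at h
  rw [h]
  congr 1
  · rw [← reorderSign_comp e]
    have e1 : (fun i => (p ∘ e.symm) i + 1) ∘ e = fun i => p i + 1 := by ext i; simp
    have e2 : (fun i => (((e'.symm.trans e)⁻¹ i : Fin N) : ℕ)) ∘ e = fun i => (e' i : ℕ) := by
      ext i; simp [Perm.inv_def]
    rw [e1, e2]
    rfl
  · congr 1
    ext i
    simp

end

section

/-! ### Products of cyclic tensors -/

variable {k : Type*} [Field k] {V : Type*} [AddCommGroup V] [Module k V]
  {𝒱 : ZMod 2 → Submodule k V} {F F₁ F₂ : Type*}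

namespace CyclicTensors

/-- The tensors in fewer than three letters, which are not used, are zero. -/
def IsReduced (m : CyclicTensors 𝒱) : Prop := ∀ n < 3, m.tensor n = 0

open Classical in
/-- Replace the unused tensors by zero. -/
def truncate (m : CyclicTensors 𝒱) : CyclicTensors 𝒱 where
  tensor n := if 3 ≤ n then m.tensor n else 0
  even n hn := by simpa only [hn, if_true] using m.even n hn
  cyclic n hn := by simpa only [hn, if_true] using m.cyclic n hn

theorem isReduced_truncate (m : CyclicTensors 𝒱) : m.truncate.IsReduced := fun n hn => by
  simp [truncate, not_le.2 hn]

theorem truncate_tensor (m : CyclicTensors 𝒱) {n : ℕ} (hn : 3 ≤ n) :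
    m.truncate.tensor n = m.tensor n := by
  simp [truncate, hn]

/-- The tensor evaluated on the letters of the word `w`. -/
def wordValue (m : CyclicTensors 𝒱) (x : F → V) (w : List F) : k :=
  m.tensor w.length (fun i => x (w.get i))

theorem wordValue_eq (m : CyclicTensors 𝒱) (x : F → V) (w : List F) {n : ℕ} (h : n = w.length) :
    m.wordValue x w = m.tensor n (fun i => x (w.get (i.cast h))) := by
  subst h
  rfl

theorem wordValue_map {F' : Type*} (m : CyclicTensors 𝒱) (g : F → F') (x : F' → V) (w : List F) :
    m.wordValue x (w.map g) = m.wordValue (x ∘ g) w := by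
  rw [m.wordValue_eq x (w.map g) (List.length_map (as := w) g).symm, wordValue]
  congr 1
  ext i
  simp

theorem wordValue_update_of_notMem [DecidableEq F] (m : CyclicTensors 𝒱) (x : F → V) {w : List F}
    {i : F} (h : i ∉ w) (v : V) : m.wordValue (Function.update x i v) w = m.wordValue x w := by
  unfold wordValue
  congr 1
  ext j
  rw [Function.update_of_ne]
  rintro rfl
  exact h (List.get_mem _ _)

theorem wordValue_update [DecidableEq F] (m : CyclicTensors 𝒱) (x : F → V) {w : List F}
    (hw : w.Nodup) {i : F} (h : i ∈ w) : ∃ j : Fin w.length, ∀ v,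
      m.wordValue (Function.update x i v) w =
        m.tensor w.length (Function.update (fun j => x (w.get j)) j v) := by
  obtain ⟨j, rfl⟩ := List.get_of_mem h
  refine ⟨j, fun v => ?_⟩
  unfold wordValue
  congr 1
  exact Function.update_comp_eq_of_injective x (List.nodup_iff_injective_get.1 hw) j v

/-- A letter occurs in at most one word, because no letter is repeated; the other words enter as a
constant. This is the source of multilinearity. -/
theorem prod_wordValue_update [DecidableEq F] (m : CyclicTensors 𝒱) (x : F → V) (i : F) :
    ∀ L : List (List F), L.flatten.Nodup →
      (i ∉ L.flatten → ∀ v, (L.map (m.wordValue (Function.update x i v))).prod =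
        (L.map (m.wordValue x)).prod) ∧
      (i ∈ L.flatten → ∃ w ∈ L, w.Nodup ∧ i ∈ w ∧ ∃ c, ∀ v,
        (L.map (m.wordValue (Function.update x i v))).prod =
          c * m.wordValue (Function.update x i v) w) := by
  intro L hL
  induction L with
  | nil => simp
  | cons w L ih =>
    rw [List.flatten_cons, List.nodup_append'] at hL
    obtain ⟨ih1, ih2⟩ := ih hL.2.1
    simp only [List.flatten_cons, List.mem_append, List.map_cons, List.prod_cons, not_or]
    refine ⟨fun ⟨h1, h2⟩ v => by rw [m.wordValue_update_of_notMem x h1, ih1 h2], fun h => ?_⟩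
    by_cases hi : i ∈ w
    · refine ⟨w, by simp, hL.1, hi, (L.map (m.wordValue x)).prod, fun v => ?_⟩
      rw [ih1 (fun h' => hL.2.2 hi h'), mul_comm]
    · obtain ⟨w', h1, h2, h3, c, hc⟩ := ih2 (h.resolve_left hi)
      refine ⟨w', by simp [h1], h2, h3, m.wordValue x w * c, fun v => ?_⟩
      rw [m.wordValue_update_of_notMem x hi, hc]
      ring

theorem isMultilinear_prod_wordValue (m : CyclicTensors 𝒱) {L : List (List F)}
    (hL : L.flatten.Nodup) (hmem : ∀ x, x ∈ L.flatten) :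
    IsMultilinear fun x : F → V => (L.map (m.wordValue x)).prod := by
  classical
  refine .of_update (fun a i x y => ?_) fun a i c x => ?_ <;>
    obtain ⟨w, -, hw, hi, d, hd⟩ := (m.prod_wordValue_update a i L hL).2 (hmem i) <;>
    obtain ⟨j, hj⟩ := m.wordValue_update a hw hi
  · simp only [hd, hj, MultilinearMap.map_update_add]
    ring
  · simp only [hd, hj, MultilinearMap.map_update_smul, smul_eq_mul]
    ring

variable {m : CyclicTensors 𝒱}

theorem sum_eq_zero_of_wordValue_ne_zero (hm : m.IsReduced) {p : F → ZMod 2} {x : F → V}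
    (hx : ∀ i, x i ∈ 𝒱 (p i)) {w : List F} (h : m.wordValue x w ≠ 0) :
    (w.map fun i => p i + 1).sum = 0 := by
  by_contra hs
  refine h ?_
  unfold wordValue
  by_cases hn : 3 ≤ w.length
  · refine m.even _ hn (fun i => p (w.get i)) _ (fun i => hx _) ?_
    rwa [← List.sum_ofFn, show (List.ofFn fun i => p (w.get i) + 1) = w.map fun i => p i + 1 from ?_]
    conv_rhs => rw [← List.ofFn_get w]
    rw [List.map_ofFn]
    rfl
  · rw [hm _ (by omega)]
    rfl

theorem three_le_of_wordValue_ne_zero (hm : m.IsReduced) {x : F → V} {w : List F}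
    (h : m.wordValue x w ≠ 0) : 3 ≤ w.length := by
  by_contra hn
  refine h ?_
  rw [wordValue, hm _ (by omega)]
  rfl

/-- The rotation moves the first letter past all the others and exchanges no other pair. -/
theorem koszul_finRotate {n : ℕ} (q : Fin (n + 1) → ZMod 2) :
    (koszul q (fun i => (((finRotate (n + 1))⁻¹ i : Fin (n + 1)) : ℕ)) : k) =
      paritySign k (q 0 * ∑ i : Fin n, q i.succ) := by
  have h0 : (finRotate (n + 1))⁻¹ 0 = Fin.last n := by
    rw [Perm.inv_eq_iff_eq, finRotate_last]
  have h1 : ∀ i : Fin n, (finRotate (n + 1))⁻¹ i.succ = i.castSucc := by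
    intro i
    rw [Perm.inv_eq_iff_eq, finRotate_apply, Fin.coeSucc_eq_succ]
  rw [koszul_eq_reorderSign, reorderSign, Fin.prod_univ_succ, mul_sum, paritySign_sum]
  simp only [Fin.prod_univ_succ (n := n), h0, h1]
  simp only [lt_self_iff_false, false_and, if_false, one_mul, Fin.val_zero, Fin.val_succ,
    Nat.succ_pos, true_and, Fin.val_castSucc, Fin.val_last, Fin.is_lt, if_true, not_lt_zero,
    Nat.add_lt_add_iff_right]
  rw [show (∏ x : Fin n, ∏ y : Fin n, if (x : ℕ) < y ∧ (y : ℕ) < x then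
      paritySign k (q x.succ * q y.succ) else 1) = 1 from
    prod_eq_one fun x _ => prod_eq_one fun y _ => if_neg fun h => by omega, mul_one]

/-- Cyclic invariance in the shape required by `wordValue_isRotated`. For words with fewer than
three letters it holds because reduced tensors vanish there. -/
theorem wordValue_cons (hm : m.IsReduced) {p : F → ZMod 2} {x : F → V}
    (hx : ∀ i, x i ∈ 𝒱 (p i)) (z : F) (w : List F) :
    m.wordValue x (z :: w) = paritySign k ((p z + 1) * (w.map fun i => p i + 1).sum) *
      m.wordValue x (w ++ [z]) := by
  rw [m.wordValue_eq x (w ++ [z]) (n := w.length + 1) (by simp)]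
  change m.tensor (w.length + 1) _ = _
  by_cases hn : 3 ≤ w.length + 1
  · refine (m.cyclic (w.length + 1) hn (fun i => p ((z :: w).get i)) _ fun i => hx _).trans ?_
    rw [koszul_finRotate]
    congr 2
    · rw [← List.sum_ofFn]
      congr 2
      conv_rhs => rw [← List.ofFn_get w]
      rw [List.map_ofFn]
      rfl
    · ext i
      congr 1
      obtain ⟨i, rfl⟩ | rfl := i.eq_castSucc_or_eq_last
      · rw [finRotate_apply, Fin.coeSucc_eq_succ]
        simp
      · rw [finRotate_last]
        simp
  · rw [hm _ (by omega)]
    simp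

variable [DirectSum.Decomposition 𝒱]

/-- The functional `exp(m)`, whose value on a product of cyclic words is the product of the values
of the tensors on the words. -/
def expFunctional (m : CyclicTensors 𝒱) : Functional k V := fun _ σ a => vertexProduct m σ a

theorem vertexProduct_isMultilinear (m : CyclicTensors 𝒱) {N : ℕ} (τ : Perm (Fin N)) :
    IsMultilinear (vertexProduct m τ) := by
  have hL := isListing_cycleLists τ
  refine IsMultilinear.sum _ fun p _ => ?_
  exact ((m.isMultilinear_prod_wordValue hL.nodup_flatten hL.mem_flatten).comp_linear
    fun i => componentMap 𝒱 (p i)).const_mul _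

theorem vertexProduct_eq (m : CyclicTensors 𝒱) {N : ℕ} (τ : Perm (Fin N)) {p : Fin N → ZMod 2}
    {x : Fin N → V} (hx : ∀ i, x i ∈ 𝒱 (p i)) : vertexProduct m τ x =
      wordsValue k (fun i => p i + 1) (fun i => (i : ℕ)) (m.wordValue x) (cycleLists τ) := by
  have hL := isListing_cycleLists τ
  have := IsMultilinear.sum_components_of_mem hx (fun p y =>
      koszul (fun y => p y + 1) (fun y => (cycleLists τ).flatten.idxOf y) *
        ((cycleLists τ).map (m.wordValue y)).prod) fun p =>
    (m.isMultilinear_prod_wordValue hL.nodup_flatten hL.mem_flatten).const_mul _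
  rw [koszul_eq_reorderSign, ← listSign_eq_reorderSign hL.nodup_flatten hL.mem_flatten] at this
  exact this

theorem evalOn_isMultilinear (m : CyclicTensors 𝒱) {N : ℕ} (e : F ≃ Fin N) (τ : Perm F) :
    IsMultilinear (evalOn m.expFunctional e τ) :=
  (m.vertexProduct_isMultilinear (e.permCongr τ)).reindex e.symm

/-- Frees `exp(m)` from the particular listing `cycleLists` and from numberings of the letters by an
initial segment. -/
theorem evalOn_eq_wordsValue (hm : m.IsReduced) [Finite F] {N : ℕ} (e : F ≃ Fin N) {τ : Perm F}
    {p : F → ZMod 2} {x : F → V} (hx : ∀ i, x i ∈ 𝒱 (p i)) {L : List (List F)}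
    (hL : IsListing τ L) : evalOn m.expFunctional e τ x =
      wordsValue k (fun i => p i + 1) (fun i => (e i : ℕ)) (m.wordValue x) L := by
  unfold evalOn expFunctional
  rw [m.vertexProduct_eq (p := p ∘ e.symm) (x := x ∘ e.symm) _ fun i => hx _,
    (isListing_cycleLists _).wordsValue_eq (hL.map e) Fin.val_injective
      (fun w => sum_eq_zero_of_wordValue_ne_zero hm (p := p ∘ e.symm) (x := x ∘ e.symm) fun i => hx _)
      (wordValue_cons hm (p := p ∘ e.symm) (x := x ∘ e.symm) fun i => hx _), wordsValue_map]
  congr 1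
  · ext i; simp
  · ext w; rw [wordValue_map]; congr 1; ext i; simp

/-- A cycle of length less than three contributes a reduced tensor, which is zero. The valence
condition on graphs is therefore automatic wherever the value is nonzero. -/
theorem three_le_minimalPeriod (hm : m.IsReduced) [Finite F] {N : ℕ} (e : F ≃ Fin N) {τ : Perm F}
    {x : F → V} (h : evalOn m.expFunctional e τ x ≠ 0) (z : F) :
    3 ≤ Function.minimalPeriod τ z := by
  by_contra hz
  refine h (IsMultilinear.ext_homogeneous (𝒱 := 𝒱) (m.evalOn_isMultilinear e τ) .zero
    (fun p a ha => ?_) x)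
  obtain ⟨L, hL⟩ := exists_isListing τ
  obtain ⟨w, hw, h1, -⟩ := hL.exists_word z
  rw [evalOn_eq_wordsValue hm e ha hL, wordsValue, List.prod_eq_zero, mul_zero]
  refine List.mem_map.2 ⟨w, hw, ?_⟩
  by_contra h2
  exact hz (h1 ▸ three_le_of_wordValue_ne_zero hm h2)

theorem isEvenFunctional_exp (hm : m.IsReduced) : IsEvenFunctional 𝒱 m.expFunctional where
  multilinear n σ := m.vertexProduct_isMultilinear σ
  even n σ p a ha hp := by
    by_contra h
    refine hp ?_
    have hL := isListing_cycleLists σ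
    rw [expFunctional, m.vertexProduct_eq σ ha, wordsValue] at h
    have h1 : ∀ w ∈ cycleLists σ, (w.map fun i => p i + 1).sum = 0 := by
      intro w hw
      refine sum_eq_zero_of_wordValue_ne_zero hm ha fun h2 => h ?_
      rw [List.prod_eq_zero (List.mem_map.2 ⟨w, hw, h2⟩), mul_zero]
    have h2 : ((cycleLists σ).flatten.map fun i => p i + 1).sum = 0 := by
      rw [List.map_flatten, List.sum_flatten, List.map_map]
      exact List.sum_eq_zero fun c hc => by
        obtain ⟨w, hw, rfl⟩ := List.mem_map.1 hc
        exact h1 w hw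
    rw [← h2, ← List.sum_toFinset _ hL.nodup_flatten]
    exact sum_congr (by ext i; simpa using List.mem_flatten.1 (hL.mem_flatten i)) fun _ _ => rfl
  equivariant n σ ρ p a ha := by
    obtain ⟨L, hL⟩ := exists_isListing σ
    have h1 := evalOn_eq_wordsValue hm (Equiv.refl (Fin n)) ha (hL.map ρ)
    have h2 := evalOn_eq_wordsValue hm (Equiv.refl (Fin n)) (p := p ∘ ρ) (x := fun i => a (ρ i))
      (fun i => ha _) hL
    have e1 : ρ * σ * ρ⁻¹ = (Equiv.refl (Fin n)).permCongr (ρ.permCongr σ) := by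
      ext i; simp [Perm.inv_def]
    have e2 : σ = (Equiv.refl (Fin n)).permCongr σ := by ext i; simp
    rw [e1]
    conv_rhs => rw [e2]
    refine h1.trans (Eq.trans ?_ (congrArg _ h2.symm))
    rw [wordsValue_map, wordsValue, wordsValue, ← mul_assoc]
    congr 1
    · have hfl := hL.nodup_flatten
      have hmem := hL.mem_flatten
      rw [listSign_eq_reorderSign hfl hmem, listSign_eq_reorderSign hfl hmem,
        koszul_eq_reorderSign,
        ← reorderSign_comp ρ _ _ (fun i => (((ρ⁻¹ : Perm (Fin n)) i : Fin n) : ℕ))]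
      have e3 : (fun i => (((ρ⁻¹ : Perm (Fin n)) i : Fin n) : ℕ)) ∘ ρ = fun i : Fin n => (i : ℕ) := by
        ext i; simp
      -- The listing order of the relabelled letters is compared with the numbering in two stages,
      -- and the first stage is the Koszul sign of `ρ`.
      rw [e3]
      exact reorderSign_trans _ (Fin.val_injective.comp ρ.injective) Fin.val_injective
        fun x y hxy => (List.idxOf_inj (hmem x)).1 hxy
    · congr 1
      exact List.map_congr_left fun w _ => m.wordValue_map _ _ _

/-- The numbering of a disjoint union. -/
def _root_.NCBV.sumNumbering {N₁ N₂ : ℕ} (e₁ : F₁ ≃ Fin N₁) (e₂ : F₂ ≃ Fin N₂) :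
    F₁ ⊕ F₂ ≃ Fin (N₁ + N₂) := (Equiv.sumCongr e₁ e₂).trans finSumFinEquiv

/-- `exp(m)` is multiplicative. -/
theorem evalOn_sumCongr (hm : m.IsReduced) [Fintype F₁] [Fintype F₂] {N N₁ N₂ : ℕ}
    (e : F₁ ⊕ F₂ ≃ Fin N) (e₁ : F₁ ≃ Fin N₁) (e₂ : F₂ ≃ Fin N₂) (τ₁ : Perm F₁) (τ₂ : Perm F₂)
    {p : F₁ ⊕ F₂ → ZMod 2} {x : F₁ ⊕ F₂ → V} (hx : ∀ i, x i ∈ 𝒱 (p i)) :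
    evalOn m.expFunctional e (Equiv.sumCongr τ₁ τ₂) x =
      reorderSign k (fun i => p i + 1) (fun i => e i) (fun i => sumNumbering e₁ e₂ i) *
        (evalOn m.expFunctional e₁ τ₁ (x ∘ Sum.inl) *
          evalOn m.expFunctional e₂ τ₂ (x ∘ Sum.inr)) := by
  rw [(isEvenFunctional_exp hm).evalOn_reorder e (sumNumbering e₁ e₂) _ hx]
  congr 1
  obtain ⟨L₁, h₁⟩ := exists_isListing τ₁
  obtain ⟨L₂, h₂⟩ := exists_isListing τ₂
  rw [evalOn_eq_wordsValue hm _ hx (h₁.sumCongr h₂),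
    evalOn_eq_wordsValue hm e₁ (p := p ∘ Sum.inl) (x := x ∘ Sum.inl) (fun i => hx _) h₁,
    evalOn_eq_wordsValue hm e₂ (p := p ∘ Sum.inr) (x := x ∘ Sum.inr) (fun i => hx _) h₂]
  unfold wordsValue
  rw [List.flatten_append, listSign_append, ← List.map_flatten, ← List.map_flatten, listSign_map,
    listSign_map, List.map_append, List.prod_append, List.map_map, List.map_map]
  -- In `sumNumbering` the letters of the first part precede those of the second, so nothing
  -- crosses.
  have hc : crossSign k (fun i => p i + 1) (fun i => (sumNumbering e₁ e₂ i : ℕ))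
      (L₁.flatten.map Sum.inl) (L₂.flatten.map Sum.inr) = 1 := by
    unfold crossSign
    refine List.prod_eq_one fun c hc => ?_
    obtain ⟨a, ha, rfl⟩ := List.mem_map.1 hc
    refine List.prod_eq_one fun c hc => ?_
    obtain ⟨b, hb, rfl⟩ := List.mem_map.1 hc
    obtain ⟨a, -, rfl⟩ := List.mem_map.1 ha
    obtain ⟨b, -, rfl⟩ := List.mem_map.1 hb
    rw [if_neg]
    simp only [sumNumbering, Equiv.trans_apply, sumCongr_apply, Sum.map_inl, Sum.map_inr,
      finSumFinEquiv_apply_left, finSumFinEquiv_apply_right, Fin.val_castAdd, Fin.val_natAdd]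
    omega
  classical
  have hs1 : listSign k ((fun i => p i + 1) ∘ Sum.inl)
      ((fun i => (sumNumbering e₁ e₂ i : ℕ)) ∘ Sum.inl) L₁.flatten =
      listSign k (fun i => (p ∘ Sum.inl) i + 1) (fun i => (e₁ i : ℕ)) L₁.flatten := rfl
  have hs2 : listSign k ((fun i => p i + 1) ∘ Sum.inr)
      ((fun i => (sumNumbering e₁ e₂ i : ℕ)) ∘ Sum.inr) L₂.flatten =
      listSign k (fun i => (p ∘ Sum.inr) i + 1) (fun i => (e₂ i : ℕ)) L₂.flatten := by
    rw [listSign_eq_reorderSign h₂.nodup_flatten h₂.mem_flatten,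
      listSign_eq_reorderSign h₂.nodup_flatten h₂.mem_flatten]
    refine reorderSign_congr _ fun a b => ?_
    simp [sumNumbering]
  have hw1 : m.wordValue x ∘ List.map Sum.inl = m.wordValue (x ∘ Sum.inl) :=
    funext fun w => m.wordValue_map Sum.inl x w
  have hw2 : m.wordValue x ∘ List.map Sum.inr = m.wordValue (x ∘ Sum.inr) :=
    funext fun w => m.wordValue_map Sum.inr x w
  rw [hc, hs1, hs2, mul_one, hw1, hw2]
  ring

end CyclicTensors

end

section

variable {k : Type*} [Field k] {V : Type*} [AddCommGroup V] [Module k V]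
  {𝒱 : ZMod 2 → Submodule k V}

/-! ### Bilinear functions and homogeneous dual bases -/

/-- `Φ` is bilinear. -/
def IsBilinear (Φ : V → V → k) : Prop := ∃ B : LinearMap.BilinForm k V, ∀ v w, Φ v w = B v w

theorem IsMultilinear.isBilinear_update {F : Type*} [DecidableEq F] {φ : (F → V) → k}
    (h : IsMultilinear φ) (a : F → V) {i j : F} (hij : i ≠ j) :
    IsBilinear fun v w => φ (Function.update (Function.update a i v) j w) := by
  refine ⟨LinearMap.mk₂ k (fun v w => φ (Function.update (Function.update a i v) j w))
    (fun v v' w => ?_) (fun c v w => ?_) (fun v w w' => ?_) (fun c v w => ?_), fun _ _ => rfl⟩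
  · simp only [Function.update_comm hij, h.update_add]
  · simp only [Function.update_comm hij, h.update_smul, smul_eq_mul]
  · simp only [h.update_add]
  · simp only [h.update_smul, smul_eq_mul]

theorem IsMultilinear.isBilinear_cons {n : ℕ} {φ : (Fin (n + 2) → V) → k}
    (h : IsMultilinear φ) (a : Fin n → V) :
    IsBilinear fun v w => φ (Fin.cons v (Fin.cons w a)) := by
  have := h.isBilinear_update (Fin.cons 0 (Fin.cons 0 a)) (i := 0) (j := 1) (by simp)
  convert this using 5 with v w
  rw [Fin.update_cons_zero]
  have h1 : (1 : Fin (n + 2)) = Fin.succ 0 := rfl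
  rw [h1, ← Fin.cons_update, Fin.update_cons_zero]

theorem OddScalarProduct.sum_dual_form (β : OddScalarProduct 𝒱) {ι : Type*} [Fintype ι] [DecidableEq ι]
    (u : Module.Basis ι k V) (v w : V) :
    ∑ i, β.form (β.form.dualBasis β.nondegenerate u i) v * β.form (u i) w = β.form v w := by
  conv_rhs => rw [← u.sum_repr v]
  rw [map_sum, LinearMap.sum_apply]
  refine sum_congr rfl fun i _ => ?_
  rw [map_smul, LinearMap.smul_apply, smul_eq_mul]
  congr 1
  conv_lhs => rw [← u.sum_repr v]
  rw [map_sum]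
  simp [LinearMap.BilinForm.apply_dualBasis_left]

/-- Expanding both arguments in the dual basis leaves coefficients that depend only on the tensor,
tested against the scalar product. -/
theorem IsBilinear.sum_expand [FiniteDimensional k V] (β : OddScalarProduct 𝒱) {Φ : V → V → k}
    (h : IsBilinear Φ) {ι : Type*} [Fintype ι] (c : ι → k) (y z : ι → V) :
    ∑ i, c i * Φ (y i) (z i) =
      ∑ a, ∑ b, (∑ i, c i * (β.form (y i) (Module.finBasis k V a) *
        β.form (z i) (Module.finBasis k V b))) * Φ (β.dual a) (β.dual b) := by
  obtain ⟨B, hB⟩ := h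
  have hv : ∀ v, v = ∑ a, β.form v (Module.finBasis k V a) • β.dual a := by
    intro v
    have h1 := (β.dual).sum_repr v
    conv_lhs => rw [← h1]
    refine sum_congr rfl fun a _ => ?_
    congr 1
    rw [OddScalarProduct.dual, LinearMap.BilinForm.dualBasis_repr_apply]
  have hΦ : ∀ v w, Φ v w = ∑ a, ∑ b, β.form v (Module.finBasis k V a) *
      β.form w (Module.finBasis k V b) * Φ (β.dual a) (β.dual b) := by
    intro v w
    simp only [hB]
    conv_lhs => rw [hv v, hv w]
    simp only [map_sum, LinearMap.sum_apply, map_smul, LinearMap.smul_apply, smul_eq_mul, mul_sum]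
    rw [sum_comm]
    refine sum_congr rfl fun a _ => sum_congr rfl fun b _ => ?_
    ring
  simp only [hΦ (y _), mul_sum, sum_mul]
  rw [sum_comm]
  refine sum_congr rfl fun a _ => ?_
  rw [sum_comm]
  refine sum_congr rfl fun b _ => sum_congr rfl fun i _ => ?_
  ring

/-- Sums of values of a bilinear function are determined by the corresponding tensors. -/
theorem IsBilinear.sum_eq [FiniteDimensional k V] (β : OddScalarProduct 𝒱) {Φ : V → V → k}
    (h : IsBilinear Φ) {ι κ : Type*} [Fintype ι] [Fintype κ]
    {c : ι → k} {y z : ι → V} {c' : κ → k} {y' z' : κ → V}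
    (H : ∀ v w, ∑ i, c i * (β.form (y i) v * β.form (z i) w) =
      ∑ j, c' j * (β.form (y' j) v * β.form (z' j) w)) :
    ∑ i, c i * Φ (y i) (z i) = ∑ j, c' j * Φ (y' j) (z' j) := by
  rw [h.sum_expand β, h.sum_expand β]
  simp only [H]

/-- A pair of dual bases of homogeneous vectors. -/
structure HomogeneousBasis (β : OddScalarProduct 𝒱) (ι : Type*) [Fintype ι] where
  vec : ι → V
  dual : ι → V
  parity : ι → ZMod 2
  vec_mem : ∀ i, vec i ∈ 𝒱 (parity i)
  dual_mem : ∀ i, dual i ∈ 𝒱 (parity i + 1)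
  sum_form : ∀ v w, ∑ i, β.form (dual i) v * β.form (vec i) w = β.form v w

/-- A basis adapted to the grading has homogeneous dual vectors of the opposite parity, because `β`
pairs only vectors of opposite parities. With such bases all signs become explicit. -/
theorem exists_homogeneousBasis [FiniteDimensional k V] [DirectSum.Decomposition 𝒱]
    (β : OddScalarProduct 𝒱) : Nonempty (HomogeneousBasis β
      (Σ ε : ZMod 2, Fin (Module.finrank k (𝒱 ε)))) := by
  classical
  let u := (DirectSum.Decomposition.isInternal 𝒱).collectedBasis
    fun ε => Module.finBasis k (𝒱 ε)
  have hu : ∀ i, u i ∈ 𝒱 i.1 := fun i =>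
    (DirectSum.Decomposition.isInternal 𝒱).collectedBasis_mem _ i
  refine ⟨⟨u, β.form.dualBasis β.nondegenerate u, fun i => i.1, hu, fun i => ?_,
    β.sum_dual_form u⟩⟩
  set d := β.form.dualBasis β.nondegenerate u i with hd
  have hsum := sum_component 𝒱 d
  have h2 : ∀ f : ZMod 2 → V, ∑ ε, f ε = f i.1 + f (i.1 + 1) := by
    intro f
    obtain h | h := zmod_two_cases i.1
    · rw [h]; exact Fin.sum_univ_two f
    · rw [h, show (1 : ZMod 2) + 1 = 0 from rfl, add_comm]; exact Fin.sum_univ_two f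
  rw [h2] at hsum
  -- Nondegeneracy reduces this to basis vectors. Those of the same parity are handled by oddness of
  -- `β`; on the others both the whole dual vector and its complementary component vanish.
  have h0 : component 𝒱 i.1 d = 0 := by
    refine β.nondegenerate.1 _ fun v => ?_
    rw [← u.sum_repr v, map_sum]
    refine sum_eq_zero fun j _ => ?_
    rw [map_smul, smul_eq_mul]
    refine mul_eq_zero_of_right _ ?_
    by_cases hj : j.1 = i.1
    · exact β.odd _ _ (component_mem' 𝒱 _ _) _ (hj ▸ hu j)
    · have hj' : j.1 = i.1 + 1 := by
        obtain h | h := zmod_two_cases i.1 <;> obtain h' | h' := zmod_two_cases j.1 <;>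
          simp_all [zmod_two_add_self]
      have h3 : β.form (component 𝒱 (i.1 + 1) d) (u j) = 0 :=
        β.odd _ _ (component_mem' 𝒱 _ _) _ (hj' ▸ hu j)
      have h4 : β.form d (u j) = 0 := by
        rw [hd, LinearMap.BilinForm.apply_dualBasis_left, if_neg]
        rintro rfl
        exact hj rfl
      rw [← hsum, map_add, LinearMap.add_apply, h3, add_zero] at h4
      exact h4
  rw [h0, zero_add] at hsum
  rw [← hsum]
  exact component_mem' 𝒱 _ _

section

variable [FiniteDimensional k V] {β : OddScalarProduct 𝒱} {ι : Type*} [Fintype ι]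
  (u : HomogeneousBasis β ι)

/-- The tensor of the scalar product does not depend on the basis, so the non-homogeneous basis of
the definitions can be replaced by a homogeneous one. -/
theorem HomogeneousBasis.sum_eq {Φ : V → V → k} (h : IsBilinear Φ) :
    ∑ j, Φ (β.dual j) (Module.finBasis k V j) = ∑ i, Φ (u.dual i) (u.vec i) := by
  have := h.sum_eq β (c := fun _ => 1) (c' := fun _ => 1) (y := β.dual)
    (z := Module.finBasis k V) (y' := u.dual) (z' := u.vec) fun v w => by
      simp only [one_mul]
      rw [u.sum_form, ← β.sum_dual_form (Module.finBasis k V)]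
      refine sum_congr rfl fun i _ => ?_
      rfl
  simpa using this

end

/-! ### Products of functionals -/

/-- The letters in `T`, followed by those in the complement of `T`. -/
def splitEquiv {n : ℕ} (T : Finset (Fin n)) : Fin T.card ⊕ Fin Tᶜ.card ≃ Fin n :=
  finSumEquivOfFinset rfl rfl

theorem splitEquiv_inl {n : ℕ} (T : Finset (Fin n)) (i : Fin T.card) :
    splitEquiv T (Sum.inl i) = T.orderEmbOfFin rfl i := rfl

theorem splitEquiv_inr {n : ℕ} (T : Finset (Fin n)) (i : Fin Tᶜ.card) :
    splitEquiv T (Sum.inr i) = Tᶜ.orderEmbOfFin rfl i := rfl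

theorem splitEquiv_inl_mem {n : ℕ} (T : Finset (Fin n)) (i : Fin T.card) :
    splitEquiv T (Sum.inl i) ∈ T := Finset.orderEmbOfFin_mem T rfl i

theorem splitEquiv_inr_notMem {n : ℕ} (T : Finset (Fin n)) (i : Fin Tᶜ.card) :
    splitEquiv T (Sum.inr i) ∉ T := Finset.mem_compl.1 (Finset.orderEmbOfFin_mem Tᶜ rfl i)

theorem IsUnionOfWords.compl {N : ℕ} {τ : Perm (Fin N)} {T : Finset (Fin N)}
    (h : IsUnionOfWords τ T) : IsUnionOfWords τ Tᶜ := fun x => by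
  rw [Finset.mem_compl, Finset.mem_compl, h x]

theorem splitEquiv_restrictWords {N : ℕ} {τ : Perm (Fin N)} {T : Finset (Fin N)}
    (h : IsUnionOfWords τ T) :
    (splitEquiv T).permCongr (sumCongr (restrictWords τ T) (restrictWords τ Tᶜ)) = τ := by
  have key : ∀ {T : Finset (Fin N)}, IsUnionOfWords τ T → ∀ i,
      T.orderEmbOfFin rfl (restrictWords τ T i) = τ (T.orderEmbOfFin rfl i) := by
    intro T h i
    rw [restrictWords, dif_pos h]
    simp only [Equiv.permCongr_apply, ← Finset.coe_orderIsoOfFin_apply]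
    simp
    rfl
  ext x
  obtain ⟨i | i, rfl⟩ := (splitEquiv T).surjective x
  · rw [permCongr_apply, symm_apply_apply, sumCongr_apply, Sum.map_inl, splitEquiv_inl,
      splitEquiv_inl, key h]
  · rw [permCongr_apply, symm_apply_apply, sumCongr_apply, Sum.map_inr, splitEquiv_inr,
      splitEquiv_inr, key h.compl]

theorem isUnionOfWords_split {N : ℕ} (T : Finset (Fin N)) (τ₁ : Perm (Fin T.card))
    (τ₂ : Perm (Fin Tᶜ.card)) :
    IsUnionOfWords ((splitEquiv T).permCongr (sumCongr τ₁ τ₂)) T := by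
  intro x
  obtain ⟨i | i, rfl⟩ := (splitEquiv T).surjective x
  · rw [permCongr_apply, symm_apply_apply, sumCongr_apply, Sum.map_inl]
    simp [splitEquiv_inl_mem]
  · rw [permCongr_apply, symm_apply_apply, sumCongr_apply, Sum.map_inr]
    simp [splitEquiv_inr_notMem]

theorem sumCongr_injective {A B : Type*} {τ₁ σ₁ : Perm A} {τ₂ σ₂ : Perm B}
    (h : (sumCongr τ₁ τ₂ : Perm (A ⊕ B)) = sumCongr σ₁ σ₂) : τ₁ = σ₁ ∧ τ₂ = σ₂ := by
  have := Perm.sumCongrHom_injective (show Perm.sumCongrHom A B (τ₁, τ₂) =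
    Perm.sumCongrHom A B (σ₁, σ₂) from h)
  simpa using this

theorem restrictWords_split {N : ℕ} (T : Finset (Fin N)) (τ₁ : Perm (Fin T.card))
    (τ₂ : Perm (Fin Tᶜ.card)) :
    restrictWords ((splitEquiv T).permCongr (sumCongr τ₁ τ₂)) T = τ₁ ∧
      restrictWords ((splitEquiv T).permCongr (sumCongr τ₁ τ₂)) Tᶜ = τ₂ :=
  sumCongr_injective ((splitEquiv T).permCongr.injective
    (splitEquiv_restrictWords (isUnionOfWords_split T τ₁ τ₂)))

/-- The Koszul sign of moving the letters in `T` to the front. -/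
theorem reorderSign_splitEquiv {N : ℕ} (T : Finset (Fin N)) (q : Fin N → ZMod 2) :
    reorderSign k (q ∘ splitEquiv T) (fun i => (splitEquiv T i : ℕ))
      (fun i => (sumNumbering (Equiv.refl (Fin T.card)) (Equiv.refl (Fin Tᶜ.card)) i : ℕ)) =
    koszul q (fun x => if x ∈ T then 0 else 1) := by
  rw [koszul_eq_reorderSign, ← reorderSign_comp (splitEquiv T)]
  refine reorderSign_congr _ fun x y => ?_
  obtain x | x := x <;> obtain y | y := y <;>
    simp only [Function.comp_apply, splitEquiv_inl_mem, splitEquiv_inr_notMem, if_true, if_false,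
      sumNumbering, Equiv.trans_apply, sumCongr_apply, Sum.map_inl, Sum.map_inr, refl_apply,
      finSumFinEquiv_apply_left, finSumFinEquiv_apply_right, Fin.val_castAdd, Fin.val_natAdd,
      lt_self_iff_false, and_false, iff_false, not_and, not_lt, Nat.lt_one_iff, Nat.not_lt_zero]
  · intro h
    have h' : T.orderEmbOfFin rfl x < T.orderEmbOfFin rfl y := h
    exact ((T.orderEmbOfFin rfl).lt_iff_lt.1 h').le
  · intro _
    omega
  · refine and_congr_right fun _ => ⟨fun _ => by norm_num, fun _ => by omega⟩
  · intro h
    have h' : Tᶜ.orderEmbOfFin rfl x < Tᶜ.orderEmbOfFin rfl y := h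
    have : (x : ℕ) < y := (Tᶜ.orderEmbOfFin rfl).lt_iff_lt.1 h'
    omega

theorem splitProduct_eq [DirectSum.Decomposition 𝒱] {f g : Functional k V} {N : ℕ}
    (τ : Perm (Fin N)) (T : Finset (Fin N))
    (hf : IsMultilinear (f T.card (restrictWords τ T)))
    (hg : IsMultilinear (g Tᶜ.card (restrictWords τ Tᶜ))) {p : Fin N → ZMod 2} {a : Fin N → V}
    (ha : ∀ i, a i ∈ 𝒱 (p i)) :
    splitProduct 𝒱 f g τ T a = koszul (fun x => p x + 1) (fun x => if x ∈ T then 0 else 1) *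
      (f T.card (restrictWords τ T) (a ∘ splitEquiv T ∘ Sum.inl) *
        g Tᶜ.card (restrictWords τ Tᶜ) (a ∘ splitEquiv T ∘ Sum.inr)) := by
  have h1 : ∀ p : Fin N → ZMod 2, IsMultilinear fun a : Fin N → V =>
      (koszul (fun x => p x + 1) (fun x => if x ∈ T then 0 else 1) : k) *
      (f T.card (restrictWords τ T) (a ∘ splitEquiv T ∘ Sum.inl) *
        g Tᶜ.card (restrictWords τ Tᶜ) (a ∘ splitEquiv T ∘ Sum.inr)) := fun p =>
    ((hf.mul hg).reindex (splitEquiv T)).const_mul _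
  rw [← IsMultilinear.sum_components_of_mem ha _ h1]
  refine sum_congr rfl fun p _ => ?_
  rw [mul_assoc]
  rfl

theorem IsMultilinear.splitProduct [DirectSum.Decomposition 𝒱] {f g : Functional k V} {N : ℕ}
    (τ : Perm (Fin N)) (T : Finset (Fin N))
    (hf : IsMultilinear (f T.card (restrictWords τ T)))
    (hg : IsMultilinear (g Tᶜ.card (restrictWords τ Tᶜ))) :
    IsMultilinear (NCBV.splitProduct 𝒱 f g τ T) := by
  refine IsMultilinear.sum _ fun p _ => ?_
  have := ((((hf.mul hg).reindex (splitEquiv T)).comp_linear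
    fun i => componentMap 𝒱 (p i)).const_mul
      (koszul (fun x => p x + 1) (fun x => if x ∈ T then 0 else 1)))
  simp only [mul_assoc]
  exact this

/-- Multiplicativity of `exp(m)`: separating any union of words and multiplying back, with the
Koszul sign, changes nothing. -/
theorem CyclicTensors.splitProduct_exp [DirectSum.Decomposition 𝒱] {m : CyclicTensors 𝒱}
    (hm : m.IsReduced) {N : ℕ} {τ : Perm (Fin N)} {T : Finset (Fin N)} (h : IsUnionOfWords τ T)
    {p : Fin N → ZMod 2} {a : Fin N → V} (ha : ∀ i, a i ∈ 𝒱 (p i)) :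
    koszul (fun x => p x + 1) (fun x => if x ∈ T then 0 else 1) *
      (m.expFunctional T.card (restrictWords τ T) (a ∘ splitEquiv T ∘ Sum.inl) *
        m.expFunctional Tᶜ.card (restrictWords τ Tᶜ) (a ∘ splitEquiv T ∘ Sum.inr)) =
      m.expFunctional N τ a := by
  have h1 := m.evalOn_sumCongr hm (splitEquiv T) (Equiv.refl _) (Equiv.refl _)
    (restrictWords τ T) (restrictWords τ Tᶜ) (p := p ∘ splitEquiv T) (x := a ∘ splitEquiv T)
    fun i => ha _
  have h2 : ∀ {N : ℕ} (τ : Perm (Fin N)) (x : Fin N → V),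
      evalOn m.expFunctional (Equiv.refl _) τ x = m.expFunctional N τ x := by
    intro N τ x
    unfold evalOn
    congr 1
  have h3 : evalOn m.expFunctional (splitEquiv T)
      (sumCongr (restrictWords τ T) (restrictWords τ Tᶜ)) (a ∘ splitEquiv T) =
      m.expFunctional N τ a := by
    unfold evalOn
    rw [splitEquiv_restrictWords h]
    congr 1
    ext i
    simp
  rw [h3, h2, h2] at h1
  rw [h1, ← reorderSign_splitEquiv T]
  rfl

end

section

variable {k : Type*} [Field k] {V : Type*} [AddCommGroup V] [Module k V]
  {𝒱 : ZMod 2 → Submodule k V}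

/-! ### The action of an odd operator -/

/-- The action of an odd operator on homogeneous letters. -/
theorem dualAction_eq [DirectSum.Decomposition 𝒱] (I : Module.End k V) (f : Functional k V) {n : ℕ}
    (σ : Perm (Fin n)) (hf : IsMultilinear (f n σ)) {p : Fin n → ZMod 2} {a : Fin n → V}
    (ha : ∀ i, a i ∈ 𝒱 (p i)) : dualAction 𝒱 I f n σ a =
      -∑ i, (∏ j, if j < i then paritySign k (p j + 1) else 1) *
        f n σ (Function.update a i (I (a i))) := by
  obtain ⟨g, hg⟩ := hf
  unfold dualAction
  congr 1
  refine sum_congr rfl fun i _ => ?_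
  rw [hg, hg, ← smul_eq_mul, ← g.map_smul_univ]
  congr 1
  ext j
  by_cases h1 : j < i
  · simp [h1, h1.ne, piSign_of_mem 𝒱 (ha j)]
  · by_cases h2 : j = i
    · subst h2; simp
    · simp [h1, h2]

theorem koszul_split {N : ℕ} (T : Finset (Fin N)) (q : Fin N → ZMod 2) :
    (koszul q (fun x => if x ∈ T then 0 else 1) : k) = ∏ b : Fin Tᶜ.card, ∏ a : Fin T.card,
      if splitEquiv T (Sum.inr b) < splitEquiv T (Sum.inl a) then
        paritySign k (q (splitEquiv T (Sum.inr b)) * q (splitEquiv T (Sum.inl a))) else 1 := by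
  rw [koszul_eq_reorderSign, reorderSign, ← (splitEquiv T).prod_comp, Fintype.prod_sum_type]
  have h : ∀ x : Fin N, ∏ y : Fin N, (if (x : ℕ) < (y : ℕ) ∧
      (if y ∈ T then 0 else 1) < (if x ∈ T then 0 else 1) then paritySign k (q x * q y) else 1) =
      if x ∈ T then 1 else ∏ a : Fin T.card, if x < splitEquiv T (Sum.inl a) then
        paritySign k (q x * q (splitEquiv T (Sum.inl a))) else 1 := by
    intro x
    rw [← (splitEquiv T).prod_comp, Fintype.prod_sum_type]
    split_ifs with hx <;>
      simp [splitEquiv_inl_mem, splitEquiv_inr_notMem]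
  rw [prod_congr rfl fun a _ => h (splitEquiv T (Sum.inl a)),
    prod_congr rfl fun b _ => h (splitEquiv T (Sum.inr b))]
  simp only [splitEquiv_inl_mem, splitEquiv_inr_notMem, if_true, if_false, prod_const_one,
    one_mul]

/-- The letters before the `i`-th letter of `T` are those in `T` and those outside. Changing the
parity of this letter changes the splitting sign by exactly the outside ones, which leaves the sign
of the action inside `T`. -/
theorem koszul_split_update {N : ℕ} (T : Finset (Fin N)) (p : Fin N → ZMod 2) (i : Fin T.card) :
    (∏ j, if j < splitEquiv T (Sum.inl i) then paritySign k (p j + 1) else 1) *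
      (koszul (fun x => Function.update p (splitEquiv T (Sum.inl i))
        (p (splitEquiv T (Sum.inl i)) + 1) x + 1) (fun x => if x ∈ T then 0 else 1) : k) =
    (koszul (fun x => p x + 1) (fun x => if x ∈ T then 0 else 1) : k) *
      ∏ j, if j < i then paritySign k (p (splitEquiv T (Sum.inl j)) + 1) else 1 := by
  have h1 : (koszul (fun x => Function.update p (splitEquiv T (Sum.inl i))
        (p (splitEquiv T (Sum.inl i)) + 1) x + 1) (fun x => if x ∈ T then 0 else 1) : k) =
      (koszul (fun x => p x + 1) (fun x => if x ∈ T then 0 else 1) : k) *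
        ∏ b : Fin Tᶜ.card, if splitEquiv T (Sum.inr b) < splitEquiv T (Sum.inl i) then
          paritySign k (p (splitEquiv T (Sum.inr b)) + 1) else 1 := by
    rw [koszul_split, koszul_split, ← prod_mul_distrib]
    refine prod_congr rfl fun b _ => ?_
    have h2 : (if splitEquiv T (Sum.inr b) < splitEquiv T (Sum.inl i) then
          paritySign k (p (splitEquiv T (Sum.inr b)) + 1) else 1) =
        ∏ a, if a = i then (if splitEquiv T (Sum.inr b) < splitEquiv T (Sum.inl i) then
          paritySign k (p (splitEquiv T (Sum.inr b)) + 1) else 1) else 1 := by simp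
    rw [h2, ← prod_mul_distrib]
    refine prod_congr rfl fun a _ => ?_
    rw [Function.update_of_ne (by simp)]
    by_cases hai : a = i
    · subst hai
      rw [Function.update_self, if_pos rfl]
      split_ifs
      · rw [← paritySign_add]
        congr 1
        ring
      · simp
    · rw [Function.update_of_ne (by simp [hai]), if_neg hai, mul_one]
  rw [h1, ← (splitEquiv T).prod_comp, Fintype.prod_sum_type]
  have h3 : ∀ j : Fin T.card, splitEquiv T (Sum.inl j) < splitEquiv T (Sum.inl i) ↔ j < i :=
    fun j => (T.orderEmbOfFin rfl).lt_iff_lt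
  simp only [h3]
  have h4 : ((∏ b : Fin Tᶜ.card, if splitEquiv T (Sum.inr b) < splitEquiv T (Sum.inl i) then
          paritySign k (p (splitEquiv T (Sum.inr b)) + 1) else 1) *
      ∏ b : Fin Tᶜ.card, if splitEquiv T (Sum.inr b) < splitEquiv T (Sum.inl i) then
          paritySign k (p (splitEquiv T (Sum.inr b)) + 1) else 1) = 1 := by
    rw [← prod_mul_distrib]
    refine prod_eq_one fun b _ => ?_
    split_ifs <;> simp
  linear_combination ((∏ j, if j < i then paritySign k (p (splitEquiv T (Sum.inl j)) + 1) else 1) *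
    koszul (fun x => p x + 1) (fun x => if x ∈ T then 0 else 1)) * h4

theorem update_comp_splitEquiv_inl {V : Type*} {N : ℕ} (T : Finset (Fin N)) (x : Fin N → V) (i : Fin T.card)
    (v : V) : Function.update x (splitEquiv T (Sum.inl i)) v ∘ splitEquiv T ∘ Sum.inl =
      Function.update (x ∘ splitEquiv T ∘ Sum.inl) i v :=
  Function.update_comp_eq_of_injective x ((splitEquiv T).injective.comp Sum.inl_injective) i v

theorem update_comp_splitEquiv_inr {V : Type*} {N : ℕ} (T : Finset (Fin N)) (x : Fin N → V) (i : Fin T.card)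
    (v : V) : Function.update x (splitEquiv T (Sum.inl i)) v ∘ splitEquiv T ∘ Sum.inr =
      x ∘ splitEquiv T ∘ Sum.inr := by
  ext j
  simp

theorem update_mem {ι : Type*} [DecidableEq ι] {p : ι → ZMod 2} {a : ι → V}
    (ha : ∀ i, a i ∈ 𝒱 (p i)) (i : ι) {ε : ZMod 2} {v : V} (hv : v ∈ 𝒱 ε) (j : ι) :
    Function.update a i v j ∈ 𝒱 (Function.update p i ε j) := by
  by_cases h : j = i
  · subst h; simpa using hv
  · simpa [h] using ha j

theorem cons_mem {n : ℕ} {p : Fin n → ZMod 2} {a : Fin n → V} (ha : ∀ i, a i ∈ 𝒱 (p i))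
    {ε : ZMod 2} {v : V} (hv : v ∈ 𝒱 ε) (j : Fin (n + 1)) :
    (Fin.cons v a : Fin (n + 1) → V) j ∈ 𝒱 ((Fin.cons ε p : Fin (n + 1) → ZMod 2) j) := by
  cases j using Fin.cases with
  | zero => simpa using hv
  | succ j => simpa using ha j

theorem sameCycle_restrictWords {N : ℕ} {τ : Perm (Fin N)} {T : Finset (Fin N)}
    (h : IsUnionOfWords τ T) {i j : Fin T.card} : (restrictWords τ T).SameCycle i j ↔
      τ.SameCycle (splitEquiv T (Sum.inl i)) (splitEquiv T (Sum.inl j)) := by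
  conv_rhs => rw [← splitEquiv_restrictWords h]
  rw [sameCycle_permCongr, sameCycle_sumCongr_inl]

theorem sameCycle_restrictWords_compl {N : ℕ} {τ : Perm (Fin N)} {T : Finset (Fin N)}
    (h : IsUnionOfWords τ T) {i j : Fin Tᶜ.card} : (restrictWords τ Tᶜ).SameCycle i j ↔
      τ.SameCycle (splitEquiv T (Sum.inr i)) (splitEquiv T (Sum.inr j)) := by
  conv_rhs => rw [← splitEquiv_restrictWords h]
  rw [sameCycle_permCongr, sameCycle_sumCongr_inr]

theorem IsUnionOfWords.preserves {N : ℕ} {τ : Perm (Fin N)} {T : Finset (Fin N)}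
    (h : IsUnionOfWords τ T) : Preserves τ (T : Set (Fin N)) := fun x => by
  simpa using h x

theorem exists_splitEquiv_inl {N : ℕ} {T : Finset (Fin N)} {x : Fin N} (h : x ∈ T) :
    ∃ i, splitEquiv T (Sum.inl i) = x := by
  obtain ⟨i | i, rfl⟩ := (splitEquiv T).surjective x
  · exact ⟨i, rfl⟩
  · exact absurd h (splitEquiv_inr_notMem T i)

theorem exists_splitEquiv_inr {N : ℕ} {T : Finset (Fin N)} {x : Fin N} (h : x ∉ T) :
    ∃ i, splitEquiv T (Sum.inr i) = x := by
  obtain ⟨i | i, rfl⟩ := (splitEquiv T).surjective x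
  · exact absurd (splitEquiv_inl_mem T i) h
  · exact ⟨i, rfl⟩

namespace CyclicTensors

variable [DirectSum.Decomposition 𝒱] {m : CyclicTensors 𝒱}

open Classical in
-- `m` is the part of `exp(m)` on a single word. The case `n = 0` is excluded: the single-word
-- condition then holds vacuously while `exp(m)` has the value one.
theorem functional_eq (hm : m.IsReduced) {n : ℕ} (hn : n ≠ 0) (σ : Perm (Fin n)) (a : Fin n → V) :
    m.functional n σ a =
      if ∀ i j, σ.SameCycle i j then m.expFunctional n σ a else 0 := by
  unfold functional
  by_cases h : ∀ i j, σ.SameCycle i j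
  · by_cases h3 : 3 ≤ n
    · rw [if_pos ⟨h3, h⟩, if_pos h]
      rfl
    · rw [if_neg (fun h' => h3 h'.1), if_pos h]
      by_contra h0
      have h1 : evalOn m.expFunctional (Equiv.refl _) σ a ≠ 0 := by
        rw [show evalOn m.expFunctional (Equiv.refl _) σ a = m.expFunctional n σ a by
          unfold evalOn; congr 1]
        exact fun e => h0 e.symm
      have h2 := three_le_minimalPeriod hm _ h1 ⟨0, by omega⟩
      have h4 : (Function.periodicOrbit σ ⟨0, by omega⟩).length ≤ n := by
        have := (Function.nodup_periodicOrbit (f := σ) (x := ⟨0, by omega⟩))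
        generalize Function.periodicOrbit σ ⟨0, by omega⟩ = c at this
        induction c using Quotient.inductionOn with | _ l => ?_
        have h5 : l.Nodup := this
        simpa using h5.length_le_card
      rw [Function.periodicOrbit_length] at h4
      omega
  · rw [if_neg (fun h' => h h'.2), if_neg h]

theorem functional_isMultilinear (m : CyclicTensors 𝒱) {n : ℕ} (σ : Perm (Fin n)) :
    IsMultilinear (m.functional n σ) := by
  classical
  exact IsMultilinear.ite_zero _ fun _ => m.vertexProduct_isMultilinear σ

open Classical in
/-- The operator acts on `exp(m)` as a derivation. -/
theorem dualAction_exp (hm : m.IsReduced) {I : Module.End k V}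
    (hI : ∀ ε, ∀ a ∈ 𝒱 ε, I a ∈ 𝒱 (ε + 1)) {n : ℕ} (ρ : Perm (Fin n)) {p : Fin n → ZMod 2}
    {x : Fin n → V} (hx : ∀ i, x i ∈ 𝒱 (p i)) : dualAction 𝒱 I m.expFunctional n ρ x =
      ∑ T : Finset (Fin n), if IsUnionOfWords ρ T then
        koszul (fun x => p x + 1) (fun x => if x ∈ T then 0 else 1) *
        (dualAction 𝒱 I m.functional T.card (restrictWords ρ T) (x ∘ splitEquiv T ∘ Sum.inl) *
          m.expFunctional Tᶜ.card (restrictWords ρ Tᶜ) (x ∘ splitEquiv T ∘ Sum.inr)) else 0 := by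
  rw [dualAction_eq I m.expFunctional ρ (m.vertexProduct_isMultilinear ρ) hx]
  have h1 : ∀ T : Finset (Fin n), dualAction 𝒱 I m.functional T.card (restrictWords ρ T)
      (x ∘ splitEquiv T ∘ Sum.inl) = -∑ i : Fin T.card,
        (∏ j, if j < i then paritySign k (p (splitEquiv T (Sum.inl j)) + 1) else 1) *
        if ∀ i j, (restrictWords ρ T).SameCycle i j then
          m.expFunctional T.card (restrictWords ρ T) (Function.update
            (x ∘ splitEquiv T ∘ Sum.inl) i (I (x (splitEquiv T (Sum.inl i))))) else 0 := by
    intro T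
    rw [dualAction_eq I _ _ (m.functional_isMultilinear _) (p := p ∘ splitEquiv T ∘ Sum.inl)
      (a := x ∘ splitEquiv T ∘ Sum.inl) (fun i => hx _)]
    congr 1
    refine sum_congr rfl fun i _ => ?_
    rw [functional_eq hm (by have := i.2; omega)]
    rfl
  simp only [h1]
  -- the summand of a letter of `T`
  let S : Finset (Fin n) → Fin n → k := fun T i =>
    if IsUnionOfWords ρ T ∧ i ∈ T ∧ ∀ y ∈ T, ρ.SameCycle i y then
      (∏ j, if j < i then paritySign k (p j + 1) else 1) *
        m.expFunctional n ρ (Function.update x i (I (x i))) else 0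
  have h2 : ∀ i, (∏ j, if j < i then paritySign k (p j + 1) else 1) *
      m.expFunctional n ρ (Function.update x i (I (x i))) = ∑ T, S T i := by
    intro i
    -- A letter is acted upon inside its own word, so exactly one `T` contributes: the cycle of `i`.
    have hC : IsUnionOfWords ρ (univ.filter fun y => ρ.SameCycle i y) := fun y => by
      simp [Perm.sameCycle_apply_right]
    rw [sum_eq_single (univ.filter fun y => ρ.SameCycle i y)]
    · simp only [S]
      rw [if_pos ⟨hC, by simp [Perm.SameCycle.refl], by simp⟩]
    · intro T _ hT
      simp only [S]
      rw [if_neg]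
      rintro ⟨h3, h4, h5⟩
      refine hT (Finset.ext fun y => ?_)
      simp only [mem_filter, mem_univ, true_and]
      exact ⟨h5 y, fun h => by simpa using (h3.preserves.sameCycle h).1 (by simpa using h4)⟩
    · simp
  simp only [h2]
  rw [sum_comm, ← sum_neg_distrib]
  refine sum_congr rfl fun T _ => ?_
  by_cases hT : IsUnionOfWords ρ T
  · rw [if_pos hT, ← (splitEquiv T).sum_comp, Fintype.sum_sum_type]
    have h3 : ∀ i, S T (splitEquiv T (Sum.inr i)) = 0 := fun i =>
      if_neg fun h => splitEquiv_inr_notMem T i h.2.1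
    simp only [h3, sum_const_zero, add_zero]
    rw [neg_mul, mul_neg, sum_mul, mul_sum]
    congr 1
    refine sum_congr rfl fun i _ => ?_
    simp only [S]
    have h4 : (IsUnionOfWords ρ T ∧ splitEquiv T (Sum.inl i) ∈ T ∧
        ∀ y ∈ T, ρ.SameCycle (splitEquiv T (Sum.inl i)) y) ↔
        ∀ i j, (restrictWords ρ T).SameCycle i j := by
      simp only [hT, splitEquiv_inl_mem, true_and]
      constructor
      · intro h a b
        rw [sameCycle_restrictWords hT]
        exact (h _ (splitEquiv_inl_mem T a)).symm.trans (h _ (splitEquiv_inl_mem T b))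
      · intro h y hy
        obtain ⟨j, rfl⟩ := exists_splitEquiv_inl hy
        exact (sameCycle_restrictWords hT).1 (h i j)
    by_cases h5 : ∀ i j, (restrictWords ρ T).SameCycle i j
    · rw [if_pos (h4.2 h5), if_pos h5,
        ← splitProduct_exp hm hT (update_mem hx (splitEquiv T (Sum.inl i)) (hI _ _ (hx _))),
        update_comp_splitEquiv_inl, update_comp_splitEquiv_inr, ← mul_assoc, koszul_split_update]
      ring
    · rw [if_neg (fun h => h5 (h4.1 h)), if_neg h5]
      ring
  · rw [if_neg hT, neg_eq_zero]
    exact sum_eq_zero fun i _ => if_neg fun h => hT h.1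

end CyclicTensors

/-! ### Gluing words inside a union of words -/

/-- Two letters, followed by the others. -/
def consTwo (n : ℕ) : Fin 2 ⊕ Fin n ≃ Fin (n + 2) :=
  finSumFinEquiv.trans (finCongr (Nat.add_comm 2 n))

@[simp] theorem consTwo_zero (n : ℕ) : consTwo n (Sum.inl 0) = 0 := rfl
@[simp] theorem consTwo_one (n : ℕ) : consTwo n (Sum.inl 1) = 1 := rfl
@[simp] theorem consTwo_inr (n : ℕ) (i : Fin n) : consTwo n (Sum.inr i) = i.succ.succ :=
  Fin.ext (by simp [consTwo])
@[simp] theorem consTwo_symm_zero (n : ℕ) : (consTwo n).symm 0 = Sum.inl 0 :=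
  (consTwo n).symm_apply_eq.2 rfl
@[simp] theorem consTwo_symm_one (n : ℕ) : (consTwo n).symm 1 = Sum.inl 1 :=
  (consTwo n).symm_apply_eq.2 rfl
@[simp] theorem consTwo_symm_succ (n : ℕ) (i : Fin n) :
    (consTwo n).symm i.succ.succ = Sum.inr i :=
  (consTwo n).symm_apply_eq.2 (consTwo_inr n i).symm

theorem forall_fin_add_two {n : ℕ} {P : Fin (n + 2) → Prop} :
    (∀ x, P x) ↔ P 0 ∧ P 1 ∧ ∀ i : Fin n, P i.succ.succ := by
  rw [Fin.forall_fin_succ, Fin.forall_fin_succ]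
  rfl

/-- The two letters to be glued and those in `T`, followed by those in the complement of `T`. -/
def glueEquiv {n : ℕ} (T : Finset (Fin n)) : Fin (T.card + 2) ⊕ Fin Tᶜ.card ≃ Fin (n + 2) :=
  ((sumCongr (consTwo _).symm (Equiv.refl _)).trans (sumAssoc _ _ _)).trans
    ((sumCongr (Equiv.refl _) (splitEquiv T)).trans (consTwo n))

section

variable {n : ℕ} (T : Finset (Fin n))

@[simp] theorem glueEquiv_zero : glueEquiv T (Sum.inl 0) = 0 := by simp [glueEquiv]
@[simp] theorem glueEquiv_one : glueEquiv T (Sum.inl 1) = 1 := by simp [glueEquiv]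
@[simp] theorem glueEquiv_succ (i : Fin T.card) :
    glueEquiv T (Sum.inl i.succ.succ) = (splitEquiv T (Sum.inl i)).succ.succ := by
  simp [glueEquiv]
@[simp] theorem glueEquiv_inr (i : Fin Tᶜ.card) :
    glueEquiv T (Sum.inr i) = (splitEquiv T (Sum.inr i)).succ.succ := by
  simp [glueEquiv]

/-- The arrangement `τ₁` of the letters to be glued and those in `T`, with the words of `ρ` outside
`T`. -/
def extendWords (ρ : Perm (Fin n)) (τ₁ : Perm (Fin (T.card + 2))) : Perm (Fin (n + 2)) :=
  (glueEquiv T).permCongr (sumCongr τ₁ (restrictWords ρ Tᶜ))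

variable {T}

theorem extendWords_injective (ρ : Perm (Fin n)) : Function.Injective (extendWords T ρ) :=
  fun _ _ h => (sumCongr_injective ((glueEquiv T).permCongr.injective h)).1

theorem induces_id {F : Type*} (φ : Perm F) : Induces φ id φ := by
  have h : ∀ x, FirstHit φ (Set.range (id : F → F)) x (φ x) := fun x => FirstHit.hit (by simp)
  exact ⟨fun x => ⟨_, h x⟩, h⟩

theorem glues_iff {τ : Perm (Fin (n + 2))} {σ : Perm (Fin n)} :
    Glues τ σ ↔ Induces (τ * swap 0 1) (fun i : Fin n => i.succ.succ) σ := isBoundary_iff _ _ _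

theorem succ_succ_injective : Function.Injective (fun i : Fin n => i.succ.succ) :=
  fun _ _ h => Fin.succ_injective _ (Fin.succ_injective _ h)

/-- The transposition of the glued letters lives on the first summand, so gluing is gluing there and
equality of words on the second. -/
theorem glues_glueEquiv (τ₁ : Perm (Fin (T.card + 2))) (τ₂ σ₂ : Perm (Fin Tᶜ.card))
    (σ₁ : Perm (Fin T.card)) :
    Glues ((glueEquiv T).permCongr (sumCongr τ₁ τ₂))
      ((splitEquiv T).permCongr (sumCongr σ₁ σ₂)) ↔ Glues τ₁ σ₁ ∧ τ₂ = σ₂ := by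
  rw [glues_iff, glues_iff]
  have e1 : (glueEquiv T).permCongr (sumCongr τ₁ τ₂) * swap 0 1 =
      (glueEquiv T).permCongr (sumCongr (τ₁ * swap 0 1) τ₂) := by
    have h : (swap 0 1 : Perm (Fin (n + 2))) =
        (glueEquiv T).permCongr (swap (Sum.inl 0) (Sum.inl 1)) := by
      rw [permCongr_def, Equiv.symm_trans_swap_trans]
      simp
    have h' : (swap (Sum.inl 0) (Sum.inl 1) : Perm (Fin (T.card + 2) ⊕ Fin Tᶜ.card)) =
        sumCongr (swap 0 1) 1 := (Perm.sumCongr_swap_one 0 1).symm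
    rw [h, h', ← permCongr_mul]
    exact congrArg _ (Perm.sumCongr_mul _ _ _ _)
  have e2 : (fun i : Fin n => i.succ.succ) =
      glueEquiv T ∘ Sum.map (fun i : Fin T.card => i.succ.succ) id ∘ (splitEquiv T).symm := by
    ext i
    obtain ⟨i | i, rfl⟩ := (splitEquiv T).surjective i <;> simp
  rw [e1, e2, Induces.congr_iff, Induces.sumCongr_iff]
  refine and_congr_right fun _ => ⟨fun h => (induces_id τ₂).unique Function.injective_id h, ?_⟩
  rintro rfl
  exact induces_id τ₂

open Classical in
/-- The letters on the words of the first two letters. -/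
def gluedLetters (τ : Perm (Fin (n + 2))) : Finset (Fin n) :=
  univ.filter fun i => τ.SameCycle 0 i.succ.succ ∨ τ.SameCycle 1 i.succ.succ

theorem mem_gluedLetters {τ : Perm (Fin (n + 2))} {i : Fin n} :
    i ∈ gluedLetters τ ↔ τ.SameCycle 0 i.succ.succ ∨ τ.SameCycle 1 i.succ.succ := by
  simp [gluedLetters]

/-- The union of the words of the two glued letters is invariant under `τ` and under the exchange of
these letters, hence under taking first returns. -/
theorem isUnionOfWords_of_glues {τ : Perm (Fin (n + 2))} {ρ : Perm (Fin n)} (h : Glues τ ρ) :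
    IsUnionOfWords ρ (gluedLetters τ) := by
  intro i
  have h1 : Preserves (τ * swap 0 1) ({y | τ.SameCycle 0 y} ∪ {y | τ.SameCycle 1 y}) :=
    ((preserves_sameCycle τ 0).union (preserves_sameCycle τ 1)).mul
      (preserves_swap (by simp [Perm.SameCycle.refl]))
  have h2 := h1.sameCycle ((glues_iff.1 h).2 i).sameCycle
  rw [mem_gluedLetters, mem_gluedLetters]
  exact h2.symm

/-- The words without a glued letter pass unchanged into `ρ`. So a gluing with result `ρ` is
recovered from the set `gluedLetters τ` and a gluing of the letters in it. -/
theorem exists_extendWords {τ : Perm (Fin (n + 2))} {ρ : Perm (Fin n)} (h : Glues τ ρ) :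
    ∃ τ₁, extendWords (gluedLetters τ) ρ τ₁ = τ := by
  set T := gluedLetters τ with hT
  have hρ : IsUnionOfWords ρ T := isUnionOfWords_of_glues h
  have hX : ∀ x, glueEquiv T x ∈ ({y | τ.SameCycle 0 y} ∪ {y | τ.SameCycle 1 y} : Set _) ↔
      x ∈ Set.range Sum.inl := by
    intro x
    obtain x | x := x
    · simp only [Set.mem_range_self, iff_true]
      revert x
      rw [forall_fin_add_two]
      refine ⟨by simp [Perm.SameCycle.refl], by simp [Perm.SameCycle.refl], fun i => ?_⟩
      rw [glueEquiv_succ]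
      exact mem_gluedLetters.1 (splitEquiv_inl_mem T i)
    · simp only [Set.mem_range, reduceCtorEq, exists_false, iff_false, glueEquiv_inr]
      intro h
      exact splitEquiv_inr_notMem T x (mem_gluedLetters.2 h)
  have hmaps : Set.MapsTo ((glueEquiv T).symm.permCongr τ) (Set.range Sum.inl)
      (Set.range Sum.inl) := by
    intro x hx
    rw [← hX] at hx ⊢
    rw [permCongr_apply, symm_symm, apply_symm_apply]
    exact (((preserves_sameCycle τ 0).union (preserves_sameCycle τ 1)) _).2 hx
  obtain ⟨⟨τ₁, τ₂⟩, hτ⟩ := Perm.mem_sumCongrHom_range_of_perm_mapsTo_inl hmaps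
  have hτ' : (glueEquiv T).permCongr (sumCongr τ₁ τ₂) = τ := by
    have : sumCongr τ₁ τ₂ = (glueEquiv T).symm.permCongr τ := hτ
    rw [this]
    ext x
    simp
  refine ⟨τ₁, ?_⟩
  rw [← hτ', ← splitEquiv_restrictWords hρ, glues_glueEquiv] at h
  rw [extendWords, ← h.2, hτ']

theorem glues_extendWords {ρ : Perm (Fin n)} (hρ : IsUnionOfWords ρ T)
    (τ₁ : Perm (Fin (T.card + 2))) : Glues (extendWords T ρ τ₁) ρ ↔
      Glues τ₁ (restrictWords ρ T) := by
  conv_lhs => rw [extendWords, ← splitEquiv_restrictWords hρ]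
  rw [glues_glueEquiv]
  simp [restrictWords_split]

theorem sameCycle_extendWords (ρ : Perm (Fin n)) (τ₁ : Perm (Fin (T.card + 2)))
    (x y : Fin (T.card + 2)) : (extendWords T ρ τ₁).SameCycle (glueEquiv T (Sum.inl x))
      (glueEquiv T (Sum.inl y)) ↔ τ₁.SameCycle x y := by
  rw [extendWords, sameCycle_permCongr, sameCycle_sumCongr_inl]

theorem gluedLetters_extendWords (ρ : Perm (Fin n)) (τ₁ : Perm (Fin (T.card + 2))) :
    gluedLetters (extendWords T ρ τ₁) = T ↔ ∀ x, τ₁.SameCycle 0 x ∨ τ₁.SameCycle 1 x := by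
  have h0 := fun x => sameCycle_extendWords (T := T) ρ τ₁ 0 x
  have h1 := fun x => sameCycle_extendWords (T := T) ρ τ₁ 1 x
  simp only [glueEquiv_zero, glueEquiv_one] at h0 h1
  rw [forall_fin_add_two]
  simp only [Perm.SameCycle.refl, true_or, or_true, true_and]
  have h2 : ∀ i, ¬ (splitEquiv T (Sum.inr i)) ∈ gluedLetters (extendWords T ρ τ₁) := by
    intro i h
    rw [mem_gluedLetters, ← glueEquiv_inr] at h
    obtain h | h := h
    · rw [← glueEquiv_zero T, extendWords, sameCycle_permCongr] at h
      exact not_sameCycle_sumCongr h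
    · rw [← glueEquiv_one T, extendWords, sameCycle_permCongr] at h
      exact not_sameCycle_sumCongr h
  constructor
  · intro h i
    have := (Finset.ext_iff.1 h _).2 (splitEquiv_inl_mem T i)
    rw [← h0, ← h1, glueEquiv_succ]
    exact mem_gluedLetters.1 this
  · intro h
    ext x
    obtain ⟨i | i, rfl⟩ := (splitEquiv T).surjective x
    · simp only [splitEquiv_inl_mem, iff_true]
      rw [mem_gluedLetters, ← glueEquiv_succ, h0, h1]
      exact h i
    · simp only [splitEquiv_inr_notMem, iff_false]
      exact h2 i

end

end

section

variable {k : Type*} [Field k] {V : Type*} [AddCommGroup V] [Module k V]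
  {𝒱 : ZMod 2 → Submodule k V}

/-! ### Contraction of two letters of `exp(m)` -/

theorem reorderSign_sumNumbering {a b : ℕ} (q : Fin a ⊕ Fin b → ZMod 2) {e : Fin a ⊕ Fin b → ℕ}
    (h₁ : StrictMono (e ∘ Sum.inl)) (h₂ : StrictMono (e ∘ Sum.inr)) :
    reorderSign k q e
      (fun i => (sumNumbering (Equiv.refl (Fin a)) (Equiv.refl (Fin b)) i : ℕ)) =
      ∏ y : Fin b, ∏ x : Fin a, if e (Sum.inr y) < e (Sum.inl x) then
        paritySign k (q (Sum.inr y) * q (Sum.inl x)) else 1 := by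
  have h1 : ∀ x y, e (Sum.inl x) < e (Sum.inl y) ↔ x < y := fun x y => h₁.lt_iff_lt
  have h2 : ∀ x y, e (Sum.inr x) < e (Sum.inr y) ↔ x < y := fun x y => h₂.lt_iff_lt
  unfold reorderSign
  have h3 : ∀ x y : Fin a, ¬ (x < y ∧ y < x) := fun x y h => lt_asymm h.1 h.2
  have h4 : ∀ x y : Fin b, ¬ (x < y ∧ y < x) := fun x y h => lt_asymm h.1 h.2
  have h5 : ∀ (x : Fin a) (y : Fin b), ¬ (a + (y : ℕ) < x) := fun x y => by omega
  have h6 : ∀ (x : Fin a) (y : Fin b), (x : ℕ) < a + (y : ℕ) := fun x y => by omega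
  rw [Fintype.prod_sum_type]
  simp only [Fintype.prod_sum_type, h1, h2, sumNumbering, Equiv.trans_apply, sumCongr_apply,
    Sum.map_inl, Sum.map_inr, refl_apply, finSumFinEquiv_apply_left, finSumFinEquiv_apply_right,
    Fin.val_castAdd, Fin.val_natAdd, Fin.val_fin_lt, add_lt_add_iff_left, h3, h4, h5, h6, and_true,
    and_false, if_false, prod_const_one, one_mul, mul_one]

/-- The two letters to be glued stand at the very front and belong to the first part; no letter has
to pass them, whatever their parities. -/
theorem reorderSign_glueEquiv {n : ℕ} (T : Finset (Fin n)) (q : Fin (n + 2) → ZMod 2) :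
    reorderSign k (q ∘ glueEquiv T) (fun i => (glueEquiv T i : ℕ))
      (fun i => (sumNumbering (Equiv.refl (Fin (T.card + 2))) (Equiv.refl (Fin Tᶜ.card)) i : ℕ)) =
    koszul (fun i => q i.succ.succ) (fun x => if x ∈ T then 0 else 1) := by
  rw [reorderSign_sumNumbering, koszul_split]
  · refine prod_congr rfl fun y _ => ?_
    simp [Fin.prod_univ_succ]
  · have h : ∀ x y : Fin (T.card + 2), x < y →
        glueEquiv T (Sum.inl x) < glueEquiv T (Sum.inl y) := by
      have h' : ∀ x y : Fin T.card,
          splitEquiv T (Sum.inl x) < splitEquiv T (Sum.inl y) ↔ x < y :=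
        fun x y => (T.orderEmbOfFin rfl).lt_iff_lt
      simp only [forall_fin_add_two, glueEquiv_zero, glueEquiv_one, glueEquiv_succ,
        Fin.succ_lt_succ_iff, h', imp_self, implies_true, and_true]
      refine ⟨⟨id, id, fun i _ => Fin.succ_pos _⟩, ⟨id, id, fun i _ =>
        Fin.succ_lt_succ_iff.2 (Fin.succ_pos _)⟩, fun i => ⟨fun h => absurd h (Fin.not_lt_zero _),
        fun h => absurd (Fin.succ_lt_succ_iff.1 h) (Fin.not_lt_zero _)⟩⟩
    exact fun x y hxy => h x y hxy
  · intro x y hxy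
    have : splitEquiv T (Sum.inr x) < splitEquiv T (Sum.inr y) :=
      (Tᶜ.orderEmbOfFin rfl).lt_iff_lt.2 hxy
    simpa using this

theorem cons_cons_comp_glueEquiv_inl {V : Type*} {n : ℕ} (T : Finset (Fin n)) (v w : V)
    (x : Fin n → V) : (Fin.cons v (Fin.cons w x : Fin (n + 1) → V) : Fin (n + 2) → V) ∘
      glueEquiv T ∘ Sum.inl = Fin.cons v (Fin.cons w (x ∘ splitEquiv T ∘ Sum.inl)) := by
  funext i
  revert i
  rw [forall_fin_add_two]
  refine ⟨by simp, (congrArg _ (glueEquiv_one T)).trans rfl, fun i => by simp⟩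

theorem cons_cons_comp_glueEquiv_inr {V : Type*} {n : ℕ} (T : Finset (Fin n)) (v w : V)
    (x : Fin n → V) : (Fin.cons v (Fin.cons w x : Fin (n + 1) → V) : Fin (n + 2) → V) ∘
      glueEquiv T ∘ Sum.inr = x ∘ splitEquiv T ∘ Sum.inr := by
  funext i
  simp

namespace CyclicTensors

variable [DirectSum.Decomposition 𝒱] {m : CyclicTensors 𝒱}

theorem exp_extendWords (hm : m.IsReduced) {n : ℕ} {T : Finset (Fin n)} (ρ : Perm (Fin n))
    (τ₁ : Perm (Fin (T.card + 2))) {p : Fin n → ZMod 2} {x : Fin n → V} (hx : ∀ i, x i ∈ 𝒱 (p i))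
    {ε ε' : ZMod 2} {v w : V} (hv : v ∈ 𝒱 ε) (hw : w ∈ 𝒱 ε') :
    m.expFunctional (n + 2) (extendWords T ρ τ₁) (Fin.cons v (Fin.cons w x)) =
      koszul (fun i => p i + 1) (fun x => if x ∈ T then 0 else 1) *
        (m.expFunctional (T.card + 2) τ₁
          (Fin.cons v (Fin.cons w (x ∘ splitEquiv T ∘ Sum.inl))) *
        m.expFunctional Tᶜ.card (restrictWords ρ Tᶜ) (x ∘ splitEquiv T ∘ Sum.inr)) := by
  have h0 := evalOn_sumCongr hm (glueEquiv T) (Equiv.refl _) (Equiv.refl _) τ₁ (restrictWords ρ Tᶜ)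
    (p := (Fin.cons ε (Fin.cons ε' p : Fin (n + 1) → ZMod 2) : Fin (n + 2) → ZMod 2) ∘ glueEquiv T)
    (x := (Fin.cons v (Fin.cons w x : Fin (n + 1) → V) : Fin (n + 2) → V) ∘ glueEquiv T)
    (fun i => cons_mem (cons_mem hx hw) hv _)
  have h1 := reorderSign_glueEquiv (k := k) T
    (fun i => (Fin.cons ε (Fin.cons ε' p : Fin (n + 1) → ZMod 2) : Fin (n + 2) → ZMod 2) i + 1)
  simp only [Fin.cons_succ] at h1
  rw [← h1]
  rw [Function.comp_assoc, Function.comp_assoc, cons_cons_comp_glueEquiv_inl,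
    cons_cons_comp_glueEquiv_inr] at h0
  rw [evalOn, Function.comp_assoc, self_comp_symm, Function.comp_id] at h0
  exact h0

variable {β : OddScalarProduct 𝒱} {ι : Type*} [Fintype ι]

/-- The contraction of the first two letters of `exp(m)` with the tensor of the scalar product. -/
def contract (m : CyclicTensors 𝒱) (u : HomogeneousBasis β ι) {n : ℕ} (τ : Perm (Fin (n + 2)))
    (x : Fin n → V) : k :=
  ∑ i, m.expFunctional (n + 2) τ (Fin.cons (u.dual i) (Fin.cons (u.vec i) x))

open Classical in
-- Sorts the gluings by the set `T` of letters on the glued words; the untouched words split off as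
-- a factor of `exp(m)`. The proposition `Q` selects gluings within one word or of two words. The
-- weight `c` stays arbitrary because a surface condition depending only on `T` will be inserted for
-- it.
theorem sum_glues (hm : m.IsReduced) (u : HomogeneousBasis β ι) {n : ℕ} (ρ : Perm (Fin n))
    {p : Fin n → ZMod 2} {x : Fin n → V} (hx : ∀ i, x i ∈ 𝒱 (p i)) (Q : Prop)
    (c : Finset (Fin n) → k) :
    (∑ τ : Perm (Fin (n + 2)), if Glues τ ρ ∧ (τ.SameCycle 0 1 ↔ Q) then
      c (gluedLetters τ) * m.contract u τ x else 0) =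
    ∑ T : Finset (Fin n), if IsUnionOfWords ρ T then
      c T * (koszul (fun i => p i + 1) (fun x => if x ∈ T then 0 else 1) *
        ((∑ τ₁ : Perm (Fin (T.card + 2)), if Glues τ₁ (restrictWords ρ T) ∧
          (τ₁.SameCycle 0 1 ↔ Q) ∧ ∀ y, τ₁.SameCycle 0 y ∨ τ₁.SameCycle 1 y then
            m.contract u τ₁ (x ∘ splitEquiv T ∘ Sum.inl) else 0) *
          m.expFunctional Tᶜ.card (restrictWords ρ Tᶜ) (x ∘ splitEquiv T ∘ Sum.inr))) else 0 := by
  have h1 : ∀ τ : Perm (Fin (n + 2)), (if Glues τ ρ ∧ (τ.SameCycle 0 1 ↔ Q) then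
      c (gluedLetters τ) * m.contract u τ x else 0) = ∑ T, if gluedLetters τ = T then
        (if Glues τ ρ ∧ (τ.SameCycle 0 1 ↔ Q) then c T * m.contract u τ x else 0) else 0 := by
    intro τ
    simp
  simp only [h1]
  rw [sum_comm]
  refine sum_congr rfl fun T _ => ?_
  by_cases hT : IsUnionOfWords ρ T
  · rw [if_pos hT, sum_mul, mul_sum, mul_sum]
    symm
    refine sum_of_injOn (extendWords T ρ) (extendWords_injective ρ).injOn (fun _ _ => by simp) ?_ ?_
    · intro τ _ hτ
      rw [← ite_and, if_neg]
      rintro ⟨h2, h3, -⟩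
      obtain ⟨τ₁, h4⟩ := exists_extendWords h3
      subst h2
      exact hτ ⟨τ₁, by simp, h4⟩
    · intro τ₁ _
      have h2 := sameCycle_extendWords (T := T) ρ τ₁ 0 1
      rw [glueEquiv_zero, glueEquiv_one] at h2
      simp only [← ite_and, gluedLetters_extendWords, glues_extendWords hT, h2]
      by_cases h3 : Glues τ₁ (restrictWords ρ T) ∧
          (τ₁.SameCycle 0 1 ↔ Q) ∧ ∀ y, τ₁.SameCycle 0 y ∨ τ₁.SameCycle 1 y
      · rw [if_pos h3, if_pos ⟨h3.2.2, h3.1, h3.2.1⟩]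
        congr 1
        unfold contract
        rw [sum_mul, mul_sum]
        exact sum_congr rfl fun i _ =>
          (exp_extendWords hm ρ τ₁ hx (u.dual_mem i) (u.vec_mem i)).symm
      · rw [if_neg h3, if_neg (fun h => h3 ⟨h.2.1, h.2.2, h.1⟩)]
        ring
  · rw [if_neg hT]
    refine sum_eq_zero fun τ _ => ?_
    rw [← ite_and, if_neg]
    rintro ⟨rfl, h2, -⟩
    exact hT (isUnionOfWords_of_glues h2)

open Classical in
-- Since `m` lives on single words, only arrangements with all letters on the common word of the two
-- glued ones survive.
theorem laplacian_functional [FiniteDimensional k V] (hm : m.IsReduced) (u : HomogeneousBasis β ι) {n : ℕ}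
    (σ : Perm (Fin n)) (x : Fin n → V) : laplacian β m.functional n σ x =
      (2 : k)⁻¹ * ∑ τ : Perm (Fin (n + 2)), if Glues τ σ ∧
        (τ.SameCycle 0 1 ↔ True) ∧ ∀ y, τ.SameCycle 0 y ∨ τ.SameCycle 1 y then
          m.contract u τ x else 0 := by
  unfold laplacian
  congr 1
  refine sum_congr rfl fun τ _ => ?_
  rw [ite_and]
  refine if_congr Iff.rfl ?_ rfl
  rw [u.sum_eq ((m.functional_isMultilinear τ).isBilinear_cons x)]
  simp only [functional_eq hm (Nat.succ_ne_zero (n + 1))]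
  have h : (∀ i j, τ.SameCycle i j) ↔
      (τ.SameCycle 0 1 ↔ True) ∧ ∀ y, τ.SameCycle 0 y ∨ τ.SameCycle 1 y := by
    constructor
    · intro h
      exact ⟨by simp [h], fun y => Or.inl (h 0 y)⟩
    · rintro ⟨h1, h2⟩ i j
      have h3 : ∀ y, τ.SameCycle 0 y := fun y =>
        (h2 y).elim id fun h => (h1.2 trivial).trans h
      exact (h3 i).symm.trans (h3 j)
  unfold contract
  by_cases h' : ∀ i j, τ.SameCycle i j
  · rw [if_pos (h.1 h')]
    exact sum_congr rfl fun i _ => if_pos h'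
  · rw [if_neg (fun h1 => h' (h.2 h1))]
    exact sum_eq_zero fun i _ => if_neg h'

open Classical in
-- Each factor is a single word, so the arrangement consists of the two words of the glued letters,
-- and the set fed to the first factor is forced to be the word of the first letter.
theorem bracket_functional [FiniteDimensional k V] (hm : m.IsReduced) (u : HomogeneousBasis β ι) {n : ℕ}
    (σ : Perm (Fin n)) {p : Fin n → ZMod 2} {x : Fin n → V} (hx : ∀ i, x i ∈ 𝒱 (p i)) :
    bracket β m.functional m.functional n σ x = ∑ τ : Perm (Fin (n + 2)), if Glues τ σ ∧
        (τ.SameCycle 0 1 ↔ False) ∧ ∀ y, τ.SameCycle 0 y ∨ τ.SameCycle 1 y then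
          m.contract u τ x else 0 := by
  unfold bracket
  refine sum_congr rfl fun τ _ => ?_
  rw [ite_and]
  refine if_congr Iff.rfl ?_ rfl
  have h1 : ∀ T : Finset (Fin (n + 2)), (if IsUnionOfWords τ T ∧ 0 ∈ T ∧ 1 ∉ T then
      ∑ j, splitProduct 𝒱 m.functional m.functional τ T
        (Fin.cons (β.dual j) (Fin.cons (Module.finBasis k V j) x)) else 0) =
      if IsUnionOfWords τ T ∧ (∀ y, y ∈ T ↔ τ.SameCycle 0 y) ∧ (∀ y, y ∉ T ↔ τ.SameCycle 1 y) then
        m.contract u τ x else 0 := by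
    intro T
    by_cases hT : IsUnionOfWords τ T ∧ 0 ∈ T ∧ 1 ∉ T
    · rw [if_pos hT, u.sum_eq ((IsMultilinear.splitProduct τ T (m.functional_isMultilinear _)
        (m.functional_isMultilinear _)).isBilinear_cons x)]
      obtain ⟨hT, h0, h1⟩ := hT
      have hs : ∀ i, splitProduct 𝒱 m.functional m.functional τ T
          (Fin.cons (u.dual i) (Fin.cons (u.vec i) x)) =
          if (∀ i j, (restrictWords τ T).SameCycle i j) ∧
            (∀ i j, (restrictWords τ Tᶜ).SameCycle i j) then
          m.expFunctional (n + 2) τ (Fin.cons (u.dual i) (Fin.cons (u.vec i) x)) else 0 := by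
        intro i
        have hy := cons_mem (cons_mem hx (u.vec_mem i)) (u.dual_mem i)
        rw [splitProduct_eq τ T (m.functional_isMultilinear _) (m.functional_isMultilinear _) hy,
          functional_eq hm (card_ne_zero_of_mem h0),
          functional_eq hm (card_ne_zero_of_mem (mem_compl.2 h1)), ite_zero_mul_ite_zero,
          mul_ite, mul_zero, splitProduct_exp hm hT hy]
      simp only [hs]
      have h2 : ((∀ i j, (restrictWords τ T).SameCycle i j) ∧
            (∀ i j, (restrictWords τ Tᶜ).SameCycle i j)) ↔ IsUnionOfWords τ T ∧
            (∀ y, y ∈ T ↔ τ.SameCycle 0 y) ∧ (∀ y, y ∉ T ↔ τ.SameCycle 1 y) := by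
        simp only [hT, true_and, sameCycle_restrictWords hT, sameCycle_restrictWords_compl hT]
        refine and_congr ⟨fun h y => ⟨fun hy => ?_, fun hy => ?_⟩, fun h i j => ?_⟩
          ⟨fun h y => ⟨fun hy => ?_, fun hy => ?_⟩, fun h i j => ?_⟩
        · obtain ⟨i, hi⟩ := exists_splitEquiv_inl h0
          obtain ⟨j, hj⟩ := exists_splitEquiv_inl hy
          rw [← hi, ← hj]
          exact h i j
        · simpa using (hT.preserves.sameCycle hy).1 (by simpa using h0)
        · exact ((h _).1 (splitEquiv_inl_mem T i)).symm.trans ((h _).1 (splitEquiv_inl_mem T j))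
        · obtain ⟨i, hi⟩ := exists_splitEquiv_inr h1
          obtain ⟨j, hj⟩ := exists_splitEquiv_inr hy
          rw [← hi, ← hj]
          exact h i j
        · intro h'
          exact h1 (by simpa using (hT.preserves.sameCycle hy).2 (by simpa using h'))
        · exact ((h _).1 (splitEquiv_inr_notMem T i)).symm.trans
            ((h _).1 (splitEquiv_inr_notMem T j))
      unfold contract
      by_cases h3 : (∀ i j, (restrictWords τ T).SameCycle i j) ∧
            (∀ i j, (restrictWords τ Tᶜ).SameCycle i j)
      · simp only [if_pos h3, if_pos (h2.1 h3)]
      · simp only [if_neg h3, if_neg (fun h => h3 (h2.2 h)), sum_const_zero]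
    · rw [if_neg hT, if_neg]
      rintro ⟨h1, h2, h3⟩
      exact hT ⟨h1, (h2 0).2 (Perm.SameCycle.refl _ _), (h3 1).2 (Perm.SameCycle.refl _ _)⟩
  simp only [h1]
  by_cases h2 : (τ.SameCycle 0 1 ↔ False) ∧ ∀ y, τ.SameCycle 0 y ∨ τ.SameCycle 1 y
  · rw [if_pos h2, sum_eq_single (univ.filter fun y => τ.SameCycle 0 y)]
    · rw [if_pos]
      refine ⟨fun y => by simp [Perm.sameCycle_apply_right], fun y => by simp, fun y => ?_⟩
      simp only [mem_filter, mem_univ, true_and]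
      exact ⟨fun h => (h2.2 y).resolve_left h, fun h h' => h2.1.1 (h'.trans h.symm)⟩
    · intro T _ hT
      rw [if_neg]
      rintro ⟨-, h3, -⟩
      exact hT (Finset.ext fun y => by simp [h3])
    · simp
  · rw [if_neg h2]
    refine sum_eq_zero fun T _ => if_neg ?_
    rintro ⟨h3, h4, h5⟩
    refine h2 ⟨iff_false_intro fun h => (h5 1).2 (Perm.SameCycle.refl _ _) ((h4 1).2 h), fun y => ?_⟩
    by_cases hy : y ∈ T
    · exact Or.inl ((h4 y).1 hy)
    · exact Or.inr ((h5 y).1 hy)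

open Classical in
/-- The form of the equation for `m` at two different words of `exp(m)`. -/
theorem sum_glues_of_not_sameCycle [FiniteDimensional k V] [CharZero k] (hm : m.IsReduced) (u : HomogeneousBasis β ι)
    (I : OddSymmetry β)
    (h : dualAction 𝒱 I.I m.functional + (2 : k)⁻¹ • bracket β m.functional m.functional = 0)
    {n : ℕ} (ρ : Perm (Fin n)) {p : Fin n → ZMod 2} {x : Fin n → V} (hx : ∀ i, x i ∈ 𝒱 (p i)) :
    (∑ τ : Perm (Fin (n + 2)), if Glues τ ρ ∧ ¬ τ.SameCycle 0 1 then
      m.contract u τ x else 0) = -2 * dualAction 𝒱 I.I m.expFunctional n ρ x := by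
  have h0 := sum_glues hm u ρ hx False 1
  simp only [iff_false, Pi.one_apply, one_mul] at h0
  rw [h0, dualAction_exp hm I.odd ρ hx, mul_sum]
  refine sum_congr rfl fun T _ => ?_
  split_ifs with hT
  · have h1 := bracket_functional hm u (restrictWords ρ T) (p := p ∘ splitEquiv T ∘ Sum.inl)
      (x := x ∘ splitEquiv T ∘ Sum.inl) (fun i => hx _)
    simp only [iff_false] at h1
    rw [← h1]
    have h2 := congrFun (congrFun (congrFun h T.card) (restrictWords ρ T))
      (x ∘ splitEquiv T ∘ Sum.inl)
    simp only [Pi.add_apply, Pi.smul_apply, smul_eq_mul, Pi.zero_apply] at h2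
    have h3 : bracket β m.functional m.functional T.card (restrictWords ρ T)
        (x ∘ splitEquiv T ∘ Sum.inl) = -2 * dualAction 𝒱 I.I m.functional T.card
          (restrictWords ρ T) (x ∘ splitEquiv T ∘ Sum.inl) := by
      field_simp at h2
      linear_combination h2
    rw [h3]
    ring
  · ring

open Classical in
/-- The form of the equation for `m` at a single word of `exp(m)`. -/
theorem sum_glues_of_sameCycle [FiniteDimensional k V] [CharZero k] (hm : m.IsReduced) (u : HomogeneousBasis β ι)
    (h : laplacian β m.functional = 0) {n : ℕ} (ρ : Perm (Fin n)) {p : Fin n → ZMod 2}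
    {x : Fin n → V} (hx : ∀ i, x i ∈ 𝒱 (p i)) (c : Finset (Fin n) → k) :
    (∑ τ : Perm (Fin (n + 2)), if Glues τ ρ ∧ τ.SameCycle 0 1 then
      c (gluedLetters τ) * m.contract u τ x else 0) = 0 := by
  have h0 := sum_glues hm u ρ hx True c
  simp only [iff_true] at h0
  rw [h0]
  refine sum_eq_zero fun T _ => ?_
  split_ifs with hT
  · have h1 := laplacian_functional hm u (restrictWords ρ T) (x ∘ splitEquiv T ∘ Sum.inl)
    simp only [iff_true] at h1
    rw [h, Pi.zero_apply, Pi.zero_apply, Pi.zero_apply] at h1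
    have h2 := (mul_eq_zero.1 h1.symm).resolve_left (by simp)
    rw [h2]
    ring
  · rfl

end CyclicTensors

end

section

variable {k : Type*} [Field k] {V : Type*} [AddCommGroup V] [Module k V]
  {𝒱 : ZMod 2 → Submodule k V}

/-! ### Contraction along edges -/

/-- All edge letters are expanded in the dual basis at once. The coefficients factor over the edges,
so each edge enters only through its own tensor. -/
theorem IsMultilinear.sum_pairs_expand [FiniteDimensional k V] (β : OddScalarProduct 𝒱)
    {E L : Type*} [Fintype E] [DecidableEq E] {Φ : ((E × Fin 2) ⊕ L → V) → k}
    (h : IsMultilinear Φ) (a : L → V) {κ : Type*} [Fintype κ] (c : E → κ → k) (y z : E → κ → V) :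
    ∑ j : E → κ, (∏ e, c e (j e)) *
        Φ (Sum.elim (fun x => if x.2 = 0 then y x.1 (j x.1) else z x.1 (j x.1)) a) =
      ∑ r : E × Fin 2 → Fin (Module.finrank k V), (∏ e, ∑ i, c e i *
        (β.form (y e i) (Module.finBasis k V (r (e, 0))) *
          β.form (z e i) (Module.finBasis k V (r (e, 1))))) *
        Φ (Sum.elim (fun x => β.dual (r x)) a) := by
  classical
  let b := Module.finBasis k V
  have hv : ∀ v, v = ∑ s, β.form v (b s) • β.dual s := by
    intro v
    conv_lhs => rw [← (β.dual).sum_repr v]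
    refine sum_congr rfl fun s _ => ?_
    congr 1
    rw [OddScalarProduct.dual, LinearMap.BilinForm.dualBasis_repr_apply]
  have hΨ : IsMultilinear fun x : E × Fin 2 → V => Φ (Sum.elim x a) := by
    refine of_update (fun x i v w => ?_) fun x i r v => ?_
    · simp only [← Sum.update_elim_inl, h.update_add]
    · simp only [← Sum.update_elim_inl, h.update_smul]
  obtain ⟨g, hg⟩ := hΨ
  have h1 : ∀ j : E → κ, g (fun x => if x.2 = 0 then y x.1 (j x.1) else z x.1 (j x.1)) =
      ∑ r : E × Fin 2 → Fin (Module.finrank k V), (∏ e, β.form (y e (j e)) (b (r (e, 0))) *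
        β.form (z e (j e)) (b (r (e, 1)))) * g fun x => β.dual (r x) := by
    intro j
    have h2 : (fun x : E × Fin 2 => if x.2 = 0 then y x.1 (j x.1) else z x.1 (j x.1)) =
        fun x => ∑ s, β.form (if x.2 = 0 then y x.1 (j x.1) else z x.1 (j x.1)) (b s) •
          β.dual s := funext fun x => hv _
    rw [h2, g.map_sum]
    refine sum_congr rfl fun r _ => ?_
    rw [g.map_smul_univ, smul_eq_mul, Fintype.prod_prod_type]
    simp [Fin.prod_univ_two]
  simp only [hg, h1, mul_sum]
  rw [sum_comm]
  refine sum_congr rfl fun r _ => ?_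
  -- A product over edges of sums over indices becomes a sum over the assignments `j`.
  rw [prod_univ_sum, Fintype.piFinset_univ, sum_mul]
  refine sum_congr rfl fun j _ => ?_
  rw [prod_mul_distrib (f := fun e => c e (j e)), mul_assoc]

/-- Contractions of a multilinear function along pairs of letters depend only on the tensors. -/
theorem IsMultilinear.sum_pairs_eq [FiniteDimensional k V] (β : OddScalarProduct 𝒱)
    {E L : Type*} [Fintype E] [DecidableEq E] {Φ : ((E × Fin 2) ⊕ L → V) → k}
    (h : IsMultilinear Φ) (a : L → V) {κ κ' : Type*} [Fintype κ] [Fintype κ']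
    {c : E → κ → k} {y z : E → κ → V} {c' : E → κ' → k} {y' z' : E → κ' → V}
    (H : ∀ e v w, ∑ i, c e i * (β.form (y e i) v * β.form (z e i) w) =
      ∑ i, c' e i * (β.form (y' e i) v * β.form (z' e i) w)) :
    ∑ j : E → κ, (∏ e, c e (j e)) *
        Φ (Sum.elim (fun x => if x.2 = 0 then y x.1 (j x.1) else z x.1 (j x.1)) a) =
      ∑ j : E → κ', (∏ e, c' e (j e)) *
        Φ (Sum.elim (fun x => if x.2 = 0 then y' x.1 (j x.1) else z' x.1 (j x.1)) a) := by
  rw [h.sum_pairs_expand β, h.sum_pairs_expand β]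
  simp only [H]

theorem HomogeneousBasis.sum_form_comp {β : OddScalarProduct 𝒱} {ι : Type*} [Fintype ι]
    (u : HomogeneousBasis β ι) (H : Module.End k V) [FiniteDimensional k V] (v w : V) :
    ∑ i, β.form (H (u.dual i)) v * β.form (u.vec i) w =
      ∑ i, β.form (H (β.dual i)) v * β.form (Module.finBasis k V i) w :=
  (u.sum_eq (Φ := fun x y => β.form (H x) v * β.form y w)
    ⟨(LinearMap.BilinForm.linMulLin ((β.form.flip v).comp H) (β.form.flip w)), fun _ _ => rfl⟩).symm

/-! ### Graph contractions with a fixed propagator. -/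

section EdgeLetters

variable {β : OddScalarProduct 𝒱} {ι : Type*} [Fintype ι] {E L : Type*}

/-- The letters at the flags of a graph: those of the tensor `(H ⊗ 1) β^∨` at the halves of the
edges, and `a` at the legs. -/
def edgeLetters (u : HomogeneousBasis β ι) (H : Module.End k V) (j : E → ι) (a : L → V) :
    (E × Fin 2) ⊕ L → V :=
  Sum.elim (fun x => if x.2 = 0 then H (u.dual (j x.1)) else u.vec (j x.1)) a

def edgeParity (u : HomogeneousBasis β ι) (j : E → ι) (p : L → ZMod 2) : (E × Fin 2) ⊕ L → ZMod 2 :=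
  Sum.elim (fun x => u.parity (j x.1)) p

theorem HomogeneousBasis.apply_dual_mem (u : HomogeneousBasis β ι) {H : Module.End k V}
    (hH : ∀ ε, ∀ a ∈ 𝒱 ε, H a ∈ 𝒱 (ε + 1)) (i : ι) : H (u.dual i) ∈ 𝒱 (u.parity i) := by
  have := hH _ _ (u.dual_mem i)
  rwa [add_assoc, zmod_two_add_self, add_zero] at this

theorem edgeLetters_mem (u : HomogeneousBasis β ι) {H : Module.End k V}
    (hH : ∀ ε, ∀ a ∈ 𝒱 ε, H a ∈ 𝒱 (ε + 1)) (j : E → ι) {p : L → ZMod 2} {a : L → V}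
    (ha : ∀ i, a i ∈ 𝒱 (p i)) (x : (E × Fin 2) ⊕ L) :
    edgeLetters u H j a x ∈ 𝒱 (edgeParity u j p x) := by
  obtain ⟨e, s⟩ | i := x
  · simp only [edgeLetters, edgeParity, Sum.elim_inl]
    split_ifs
    · exact u.apply_dual_mem hH _
    · exact u.vec_mem _
  · exact ha i

/-- The flags of every edge are neighbours, in their order. -/
structure IsStandard {N : ℕ} (e : (E × Fin 2) ⊕ L ≃ Fin N) : Prop where
  pairRank : PairRank fun x => (e x : ℕ)
  lt : ∀ x, (e (Sum.inl (x, 0)) : ℕ) < e (Sum.inl (x, 1))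

variable [Fintype E] [DecidableEq E] [DirectSum.Decomposition 𝒱]

/-- The contraction of `exp(m)` along the edges of a graph. -/
def contractEdges (m : CyclicTensors 𝒱) (u : HomogeneousBasis β ι) (H : Module.End k V) {N : ℕ}
    (e : (E × Fin 2) ⊕ L ≃ Fin N) (τ : Perm ((E × Fin 2) ⊕ L)) (a : L → V) : k :=
  ∑ j : E → ι, evalOn m.expFunctional e τ (edgeLetters u H j a)

variable {m : CyclicTensors 𝒱} {u : HomogeneousBasis β ι} {H : Module.End k V} {N : ℕ}

theorem contractEdges_isMultilinear (m : CyclicTensors 𝒱) (u : HomogeneousBasis β ι)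
    (H : Module.End k V) (e : (E × Fin 2) ⊕ L ≃ Fin N) (τ : Perm ((E × Fin 2) ⊕ L)) :
    IsMultilinear (contractEdges m u H e τ) :=
  IsMultilinear.sum _ fun _ _ => (m.evalOn_isMultilinear e τ).elim _

theorem contractEdges_permCongr {E' L' : Type*} [Fintype E'] [DecidableEq E'] (g : E ≃ E')
    (l : L ≃ L') (e : (E' × Fin 2) ⊕ L' ≃ Fin N) (τ : Perm ((E × Fin 2) ⊕ L)) (a : L' → V) :
    contractEdges m u H e ((sumCongr (prodCongr g (Equiv.refl (Fin 2))) l).permCongr τ) a =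
      contractEdges m u H ((sumCongr (prodCongr g (Equiv.refl (Fin 2))) l).trans e) τ (a ∘ l) := by
  unfold contractEdges
  rw [← (Equiv.arrowCongr g (Equiv.refl ι)).sum_comp]
  refine sum_congr rfl fun j _ => ?_
  rw [evalOn_permCongr]
  congr 1
  ext x
  obtain ⟨e, s⟩ | i := x <;> simp [edgeLetters]

theorem three_le_of_contractEdges (hm : m.IsReduced) [Finite L]
    {e : (E × Fin 2) ⊕ L ≃ Fin N} {τ : Perm ((E × Fin 2) ⊕ L)} {a : L → V}
    (h : contractEdges m u H e τ a ≠ 0) (z) : 3 ≤ Function.minimalPeriod τ z := by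
  obtain ⟨j, -, hj⟩ := exists_ne_zero_of_sum_ne_zero h
  exact CyclicTensors.three_le_minimalPeriod hm e hj z

/-- Both halves of an edge carry letters of parity `u.parity`, so an edge is an even pair and
travels freely; only the relative order of the legs produces a sign. -/
theorem contractEdges_reorder (hm : m.IsReduced) (hH : ∀ ε, ∀ a ∈ 𝒱 ε, H a ∈ 𝒱 (ε + 1))
    [Fintype L] {N' : ℕ} {e : (E × Fin 2) ⊕ L ≃ Fin N} {e' : (E × Fin 2) ⊕ L ≃ Fin N'}
    (he : IsStandard e) (he' : IsStandard e') (τ : Perm ((E × Fin 2) ⊕ L)) {p : L → ZMod 2}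
    {a : L → V} (ha : ∀ i, a i ∈ 𝒱 (p i)) : contractEdges m u H e τ a =
      reorderSign k (fun i => p i + 1) (fun i => (e (Sum.inr i) : ℕ))
        (fun i => (e' (Sum.inr i) : ℕ)) * contractEdges m u H e' τ a := by
  unfold contractEdges
  rw [mul_sum]
  refine sum_congr rfl fun j _ => ?_
  rw [(CyclicTensors.isEvenFunctional_exp hm).evalOn_reorder e e' τ (edgeLetters_mem u hH j ha),
    reorderSign_pairs (fun e => rfl) he.pairRank he'.pairRank he.lt, prod_eq_one, one_mul]
  · rfl
  · intro x _
    rw [if_neg (he'.lt x).le.not_gt]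

theorem contractEdges_eq_zero (hm : m.IsReduced) (hH : ∀ ε, ∀ a ∈ 𝒱 ε, H a ∈ 𝒱 (ε + 1))
    [Fintype L] (e : (E × Fin 2) ⊕ L ≃ Fin N) (τ : Perm ((E × Fin 2) ⊕ L)) {p : L → ZMod 2}
    {a : L → V} (ha : ∀ i, a i ∈ 𝒱 (p i)) (hp : ∑ i, (p i + 1) ≠ 0) :
    contractEdges m u H e τ a = 0 := by
  refine sum_eq_zero fun j _ => ?_
  have hx := edgeLetters_mem u hH j ha
  refine (CyclicTensors.isEvenFunctional_exp hm).even N _ (edgeParity u j p ∘ e.symm) _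
    (fun i => hx _) fun h => hp ?_
  rw [← e.sum_comp] at h
  simpa only [Function.comp_apply, symm_apply_apply, Fintype.sum_sum_type, Fintype.sum_prod_type,
    edgeParity, Sum.elim_inl, Sum.elim_inr, Fin.sum_univ_two, zmod_two_add_self, sum_const_zero,
    zero_add] using h

/-- The relabelling of the flags that permutes the edges by `g` and turns them by `t`. -/
def relabel (L : Type*) (g : Perm E) (t : E → Perm (Fin 2)) : Perm ((E × Fin 2) ⊕ L) :=
  sumCongr (Equiv.prodShear g t) (Equiv.refl L)

/-- Symmetry of the propagator. Selfadjointness of `H` identifies both tensors, tested on `v` and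
`w`, with `β.form (H w) v`; the sign is the Koszul sign of exchanging the two letters of the edge.
-/
theorem HomogeneousBasis.sum_form_turn (u : HomogeneousBasis β ι)
    (hs : ∀ ε, ∀ a ∈ 𝒱 ε, ∀ b, β.form (H a) b = (-1) ^ ε.val * β.form a (H b)) (v w : V) :
    ∑ i, paritySign k (u.parity i + 1) * (β.form (u.vec i) v * β.form (H (u.dual i)) w) =
      ∑ i, 1 * (β.form (H (u.dual i)) v * β.form (u.vec i) w) := by
  have hsgn : ∀ ε : ZMod 2, ((-1) ^ ε.val : k) = paritySign k ε := by
    intro ε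
    obtain rfl | rfl := zmod_two_cases ε
    · simp
    · rw [show (1 : ZMod 2).val = 1 from rfl]; simp
  have h1 : ∀ i v, β.form (H (u.dual i)) v =
      paritySign k (u.parity i + 1) * β.form (u.dual i) (H v) := fun i v => by
    rw [hs _ _ (u.dual_mem i), hsgn]
  have h2 : ∑ i, paritySign k (u.parity i + 1) * (β.form (u.vec i) v * β.form (H (u.dual i)) w) =
      β.form (H w) v := by
    rw [← u.sum_form]
    refine sum_congr rfl fun i _ => ?_
    rw [h1]
    linear_combination (β.form (u.vec i) v * β.form (u.dual i) (H w)) *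
      paritySign_mul_self (k := k) (u.parity i + 1)
  rw [h2]
  clear h2
  have key : ∀ ε, ∀ w ∈ 𝒱 ε, β.form (H w) v =
      ∑ i, 1 * (β.form (H (u.dual i)) v * β.form (u.vec i) w) := by
    intro ε w hw
    rw [hs ε w hw, β.symm, ← u.sum_form, hsgn, mul_sum]
    refine sum_congr rfl fun i _ => ?_
    by_cases hi : u.parity i = ε
    · rw [β.odd ε _ (hi ▸ u.vec_mem i) w hw]
      ring
    · have : u.parity i + 1 = ε := by
        obtain h3 | h3 := zmod_two_cases (u.parity i) <;> obtain h4 | h4 := zmod_two_cases ε <;>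
          simp_all
        rfl
      rw [h1, this]
      ring
  induction w using DirectSum.Decomposition.inductionOn 𝒱 with
  | zero => simp
  | homogeneous w => exact key _ _ w.2
  | add w w' hw hw' =>
    simp only [map_add, LinearMap.add_apply, mul_add, sum_add_distrib, hw, hw']

/-- Permuting edges is free because they are even pairs, and turning an edge is compensated by the
symmetry of the propagator. Hence graph values are isomorphism invariants. -/
theorem contractEdges_relabel [FiniteDimensional k V] (hm : m.IsReduced)
    (hH : ∀ ε, ∀ a ∈ 𝒱 ε, H a ∈ 𝒱 (ε + 1))
    (hs : ∀ ε, ∀ a ∈ 𝒱 ε, ∀ b, β.form (H a) b = (-1) ^ ε.val * β.form a (H b)) [Fintype L]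
    {e : (E × Fin 2) ⊕ L ≃ Fin N} (he : IsStandard e) (g : Perm E) (t : E → Perm (Fin 2))
    (τ : Perm ((E × Fin 2) ⊕ L)) (a : L → V) :
    contractEdges m u H e ((relabel L g t).permCongr τ) a = contractEdges m u H e τ a := by
  refine IsMultilinear.ext_homogeneous (𝒱 := 𝒱) (contractEdges_isMultilinear m u H e _)
    (contractEdges_isMultilinear m u H e _) (fun p a ha => ?_) a
  have ht : ∀ x s, t x s = if t x = 1 then s else swap 0 1 s := by
    intro x s
    have : ∀ π : Perm (Fin 2), π s = if π = 1 then s else swap 0 1 s := by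
      revert s; decide
    exact this _
  -- The propagators of the edges that `t` turns are replaced by their mirror images; the signs that
  -- appear are those of reordering the flags below.
  have h1 := IsMultilinear.sum_pairs_eq β (m.evalOn_isMultilinear e τ) a (κ := ι) (κ' := ι)
    (c := fun x i => if t x = 1 then 1 else paritySign k (u.parity i + 1))
    (y := fun x i => if t x = 1 then H (u.dual i) else u.vec i)
    (z := fun x i => if t x = 1 then u.vec i else H (u.dual i)) (c' := fun _ _ => 1)
    (y' := fun _ i => H (u.dual i)) (z' := fun _ i => u.vec i) (fun x v w => by
      by_cases hx : t x = 1
      · simp only [if_pos hx]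
      · simp only [if_neg hx]
        exact u.sum_form_turn hs v w)
  simp only [prod_const_one, one_mul] at h1
  rw [show contractEdges m u H e τ a = _ from h1.symm]
  unfold contractEdges
  rw [← (Equiv.arrowCongr g (Equiv.refl ι)).sum_comp]
  refine sum_congr rfl fun j _ => ?_
  rw [evalOn_permCongr]
  have hx := edgeLetters_mem u hH ((Equiv.arrowCongr g (Equiv.refl ι)) j) ha
  have h0 : ∀ x, t x = 1 → relabel L g t (Sum.inl (x, 0)) = Sum.inl (g x, 0) ∧
      relabel L g t (Sum.inl (x, 1)) = Sum.inl (g x, 1) := fun x hx => by simp [relabel, hx]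
  have h1 : ∀ x, t x ≠ 1 → relabel L g t (Sum.inl (x, 0)) = Sum.inl (g x, 1) ∧
      relabel L g t (Sum.inl (x, 1)) = Sum.inl (g x, 0) := fun x hx => by
    simp [relabel, ht x, hx]
  have hpr : PairRank fun x => ((relabel L g t).trans e x : ℕ) := by
    intro x z hz0 hz1
    have h2 := he.pairRank (g x) (relabel L g t z)
    by_cases hx : t x = 1
    · simp only [trans_apply, h0 x hx]
      exact h2 (by rwa [← (h0 x hx).1, (relabel L g t).injective.ne_iff])
        (by rwa [← (h0 x hx).2, (relabel L g t).injective.ne_iff])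
    · simp only [trans_apply, h1 x hx]
      have := h2 (by rwa [← (h1 x hx).2, (relabel L g t).injective.ne_iff])
        (by rwa [← (h1 x hx).1, (relabel L g t).injective.ne_iff])
      exact ⟨this.1.symm, this.2.symm⟩
  rw [(CyclicTensors.isEvenFunctional_exp hm).evalOn_reorder _ e τ
      (p := fun i => edgeParity u ((Equiv.arrowCongr g (Equiv.refl ι)) j) p (relabel L g t i))
      (x := edgeLetters u H ((Equiv.arrowCongr g (Equiv.refl ι)) j) a ∘ relabel L g t)
      (fun i => hx (relabel L g t i)),
    reorderSign_symm, reorderSign_pairs (fun e => by simp [relabel, edgeParity]) he.pairRank hpr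
      he.lt, reorderSign_eq_one (r := _ ∘ Sum.inr), mul_one]
  · congr 1
    · refine prod_congr rfl fun x _ => ?_
      by_cases hx : t x = 1
      · rw [if_pos hx, if_neg]
        simp only [trans_apply, h0 x hx]
        exact (he.lt (g x)).le.not_gt
      · simp [h1 x hx, hx, he.lt (g x), edgeParity]
    · congr 1
      ext y
      obtain ⟨x, s⟩ | i := y
      · by_cases hx : t x = 1
        · simp [relabel, edgeLetters, hx]
        · obtain rfl | rfl : s = 0 ∨ s = 1 := by omega
          · simp [relabel, edgeLetters, hx, ht x]
          · simp [relabel, edgeLetters, hx, ht x]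
      · rfl
  · intro x y h2 h3
    exact lt_asymm h2 h3

end EdgeLetters

end

section

variable {k : Type*} [Field k] {V : Type*} [AddCommGroup V] [Module k V]
  {𝒱 : ZMod 2 → Submodule k V}

/-! ### Labelled ribbon graphs -/

/-- The surface glued from the vertices, the cycles of `τ`, by the involution `ψ` is connected, has
Euler characteristic `1 - b` if there are `c` edges, and has the boundary words `σ`. -/
structure SurfaceCond {F L : Type*} (τ ψ : Perm F) (leg : L → F) (c b : ℕ) (σ : Perm L) : Prop where
  joined : Joined τ ψ
  euler : 1 + c = b + numCycles τ
  boundary : Induces (τ * ψ) leg σ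

theorem SurfaceCond.congr_iff {F F' L L' : Type*} (g : F ≃ F') (l : L ≃ L') {τ ψ : Perm F}
    {leg : L → F} {c b : ℕ} {σ : Perm L} :
    SurfaceCond (g.permCongr τ) (g.permCongr ψ) (g ∘ leg ∘ l.symm) c b (l.permCongr σ) ↔
      SurfaceCond τ ψ leg c b σ := by
  have h : g.permCongr τ * g.permCongr ψ = g.permCongr (τ * ψ) := (g.permCongr_mul τ ψ).symm
  constructor
  · rintro ⟨h1, h2, h3⟩
    rw [joined_congr] at h1
    rw [numCycles_congr] at h2
    rw [h, Induces.congr_iff] at h3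
    exact ⟨h1, h2, h3⟩
  · rintro ⟨h1, h2, h3⟩
    exact ⟨(joined_congr g).2 h1, by rwa [numCycles_congr],
      by rwa [h, Induces.congr_iff]⟩

/-- The involution that exchanges the two halves of every edge and fixes the legs. -/
def edgeFlip (E L : Type*) : Perm ((E × Fin 2) ⊕ L) :=
  sumCongr (prodCongr (Equiv.refl E) (swap 0 1)) (Equiv.refl L)

/-- The flags of the graphs with `E` edges and `n` legs. -/
abbrev Flag (E n : ℕ) := (Fin E × Fin 2) ⊕ Fin n

def flagNumbering (E n : ℕ) : Flag E n ≃ Fin (E * 2 + n) :=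
  (sumCongr finProdFinEquiv (Equiv.refl _)).trans finSumFinEquiv

theorem flagNumbering_inl {E n : ℕ} (x : Fin E) (s : Fin 2) :
    (flagNumbering E n (Sum.inl (x, s)) : ℕ) = s + 2 * x := by
  simp [flagNumbering]

theorem flagNumbering_inr {E n : ℕ} (i : Fin n) :
    (flagNumbering E n (Sum.inr i) : ℕ) = E * 2 + i := by
  simp [flagNumbering]

theorem isStandard_flagNumbering (E n : ℕ) : IsStandard (flagNumbering E n) where
  lt x := by simp [flagNumbering_inl]
  pairRank x z hz0 hz1 := by
    obtain ⟨y, s⟩ | i := z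
    · simp only [flagNumbering_inl]
      have h : (y : ℕ) ≠ x := by
        intro h
        obtain rfl := Fin.ext h
        obtain rfl | rfl : s = 0 ∨ s = 1 := by omega
        · exact hz0 rfl
        · exact hz1 rfl
      have := s.2
      simp only [Fin.val_zero, Fin.val_one]
      omega
    · simp only [flagNumbering_inl, flagNumbering_inr, Fin.val_zero, Fin.val_one]
      have := x.2
      omega

/-! ### Isomorphisms of graphs on a fixed set of flags. -/

section Relabel

variable {E L : Type*}

theorem relabel_edgeFlip (g : Perm E) (t : E → Perm (Fin 2)) (x : (E × Fin 2) ⊕ L) :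
    relabel L g t (edgeFlip E L x) = edgeFlip E L (relabel L g t x) := by
  obtain ⟨x, s⟩ | i := x
  · have h : ∀ (π : Perm (Fin 2)) s, π (swap 0 1 s) = swap 0 1 (π s) := by decide
    simp [relabel, edgeFlip, h]
  · rfl

theorem relabel_permCongr_edgeFlip (g : Perm E) (t : E → Perm (Fin 2)) :
    (relabel L g t).permCongr (edgeFlip E L) = edgeFlip E L := by
  refine Equiv.ext fun x => ?_
  rw [permCongr_apply, relabel_edgeFlip, apply_symm_apply]

theorem relabel_injective : Function.Injective fun x : Perm E × (E → Perm (Fin 2)) =>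
    relabel L x.1 x.2 := by
  rintro ⟨g, t⟩ ⟨g', t'⟩ h
  have h1 : ∀ x s, g x = g' x ∧ t x s = t' x s := fun x s => by
    simpa [relabel] using Equiv.ext_iff.1 h (Sum.inl (x, s))
  exact Prod.ext (Equiv.ext fun x => (h1 x 0).1) (funext fun x => Equiv.ext fun s => (h1 x s).2)

/-- Compatibility with the flip means that the image of the first half of an edge determines the
image edge and whether the edge is turned. -/
theorem exists_relabel [Finite E] {φ : Perm ((E × Fin 2) ⊕ L)}
    (h1 : ∀ x, φ (edgeFlip E L x) = edgeFlip E L (φ x)) (h2 : ∀ i, φ (Sum.inr i) = Sum.inr i) :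
    ∃ g t, φ = relabel L g t := by
  have h3 : ∀ x, ∃ y : E × Fin 2, φ (Sum.inl (x, 0)) = Sum.inl y := by
    intro x
    rcases hx : φ (Sum.inl (x, 0)) with y | i
    · exact ⟨y, rfl⟩
    · rw [← h2] at hx
      exact absurd (φ.injective hx) (by simp)
  choose y hy using h3
  have hy1 : ∀ x, φ (Sum.inl (x, 1)) = Sum.inl ((y x).1, swap 0 1 (y x).2) := by
    intro x
    have := h1 (Sum.inl (x, 0))
    rw [hy] at this
    exact this
  have hinj : Function.Injective fun x => (y x).1 := by
    intro x x' h
    have h4 : (y x').2 = (y x).2 ∨ (y x').2 = swap 0 1 (y x).2 := by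
      generalize (y x').2 = a
      generalize (y x).2 = b
      revert a b
      decide
    obtain h4 | h4 := h4
    · have : φ (Sum.inl (x', 0)) = φ (Sum.inl (x, 0)) := by
        rw [hy, hy, Prod.ext h.symm h4]
      simpa using (φ.injective this).symm
    · have : φ (Sum.inl (x', 0)) = φ (Sum.inl (x, 1)) := by
        rw [hy, hy1, show y x' = ((y x).1, swap 0 1 (y x).2) from Prod.ext h.symm h4]
      simpa using (φ.injective this).symm
  refine ⟨Equiv.ofBijective _ (Finite.injective_iff_bijective.1 hinj),
    fun x => if (y x).2 = 0 then 1 else swap 0 1, Equiv.ext ?_⟩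
  rintro (⟨x, s⟩ | i)
  · obtain h0 | h0 : (y x).2 = 0 ∨ (y x).2 = 1 := by omega
    · obtain rfl | rfl : s = 0 ∨ s = 1 := by omega
      · rw [hy]
        simp [relabel, h0, Prod.ext_iff]
      · rw [hy1]
        simp [relabel, h0]
    · obtain rfl | rfl : s = 0 ∨ s = 1 := by omega
      · rw [hy]
        simp [relabel, h0, Prod.ext_iff]
      · rw [hy1]
        simp [relabel, h0]
  · exact h2 i

/-- A connected graph with a leg has no automorphisms. -/
theorem relabel_permCongr_injective {τ : Perm ((E × Fin 2) ⊕ L)} (h : Joined τ (edgeFlip E L))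
    [Nonempty L] : Function.Injective fun x : Perm E × (E → Perm (Fin 2)) =>
      (relabel L x.1 x.2).permCongr τ := by
  intro a b hab
  refine relabel_injective (L := L) (Equiv.ext fun x => ?_)
  have hA : ∀ x, relabel L a.1 a.2 (τ x) = (relabel L a.1 a.2).permCongr τ (relabel L a.1 a.2 x) :=
    fun x => by simp
  have hB : ∀ x, relabel L b.1 b.2 (τ x) = (relabel L a.1 a.2).permCongr τ (relabel L b.1 b.2 x) :=
    fun x => by
      have := Equiv.ext_iff.1 hab (relabel L b.1 b.2 x)
      simp only at this
      rw [this]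
      simp
  -- The flags on which the two relabellings agree form an invariant set that contains the legs;
  -- connectedness makes it everything.
  have := h.2 {x | relabel L a.1 a.2 x = relabel L b.1 b.2 x}
    (fun x => by
      simp only [Set.mem_ofPred_eq]
      rw [hA, hB, EmbeddingLike.apply_eq_iff_eq])
    (fun x => by simp only [Set.mem_ofPred_eq, relabel_edgeFlip, EmbeddingLike.apply_eq_iff_eq])
    ⟨Sum.inr (Classical.arbitrary L), rfl⟩
  exact this.symm.subset (Set.mem_univ x)

end Relabel

namespace RibbonGraph

variable {n : ℕ}

/-- Counting flags shows that isomorphic graphs have equally many edges, so an isomorphism is a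
relabelling of one set of flags. -/
theorem exists_relabel_of_iso {Γ Γ' : RibbonGraph n} (h : (isoSetoid n).r Γ Γ') :
    ∃ g t, Γ' = ⟨Γ.edges, (relabel (Fin n) g t).permCongr Γ.next⟩ := by
  obtain ⟨φ, h1, h2, h3⟩ := h
  obtain ⟨E, τ⟩ := Γ
  obtain ⟨E', τ'⟩ := Γ'
  obtain rfl : E = E' := by
    have := Fintype.card_congr φ
    simp only [Flag, Fintype.card_sum, Fintype.card_prod, Fintype.card_fin] at this
    omega
  obtain ⟨g, t, hgt⟩ := exists_relabel (L := Fin n) (φ := φ) h2 h3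
  refine ⟨g, t, ?_⟩
  congr 1
  refine Equiv.ext fun x => ?_
  rw [← hgt, permCongr_apply]
  have := h1 (φ.symm x)
  rw [apply_symm_apply] at this
  exact this.symm

theorem iso_relabel (E : ℕ) (τ : Perm (NCBV.Flag E n)) (g : Perm (Fin E))
    (t : Fin E → Perm (Fin 2)) :
    (isoSetoid n).r ⟨E, τ⟩ ⟨E, (relabel (Fin n) g t).permCongr τ⟩ :=
  ⟨relabel (Fin n) g t, fun x => (congrArg _ (by simp)).trans (permCongr_apply _ _ _).symm,
    fun x => relabel_edgeFlip g t x, fun _ => rfl⟩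

/-- The isomorphism class of a graph. -/
def isoClass (Γ : RibbonGraph n) : IsoClass n := Quotient.mk (isoSetoid n) Γ

theorem isoClass_eq_iff {Γ : RibbonGraph n} {c : IsoClass n} :
    isoClass Γ = c ↔ (isoSetoid n).r (Quotient.out c) Γ :=
  Quotient.mk_eq_iff_out.trans ⟨fun h => (isoSetoid n).symm h, fun h => (isoSetoid n).symm h⟩

theorem contributes_iff {Γ : RibbonGraph n} {b : ℕ} {σ : Perm (Fin n)} : Γ.Contributes b σ ↔
    SurfaceCond Γ.next Γ.flip Sum.inr Γ.edges b σ ∧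
      ∀ x : Γ.Flag, 3 ≤ Function.minimalPeriod Γ.next x := by
  constructor
  · rintro ⟨h1, h2, h3, h4⟩
    exact ⟨⟨(joined_iff _ _).2 h1, h3, (isBoundary_iff _ _ _).1 h4⟩, h2⟩
  · rintro ⟨⟨h1, h3, h4⟩, h2⟩
    exact ⟨(joined_iff _ _).1 h1, h2, h3, (isBoundary_iff _ _ _).2 h4⟩

theorem surfaceCond_relabel {E : ℕ} {τ : Perm (NCBV.Flag E n)} (g : Perm (Fin E))
    (t : Fin E → Perm (Fin 2)) {c b : ℕ} {σ : Perm (Fin n)} :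
    SurfaceCond ((relabel (Fin n) g t).permCongr τ) (edgeFlip _ _) Sum.inr c b σ ↔
      SurfaceCond τ (edgeFlip _ _) Sum.inr c b σ := by
  have := SurfaceCond.congr_iff (relabel (Fin n) g t) (Equiv.refl (Fin n)) (τ := τ)
    (ψ := edgeFlip _ _) (leg := Sum.inr) (c := c) (b := b) (σ := σ)
  rw [relabel_permCongr_edgeFlip] at this
  exact this

/-- The sum over the graphs with labelled edges in an isomorphism class. -/
theorem sum_isoClass {M : Type*} [AddCommMonoid M] {Γ : RibbonGraph n}
    (h : Joined Γ.next Γ.flip) (hn : n ≠ 0) [DecidablePred fun τ : Perm Γ.Flag =>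
      (isoSetoid n).r Γ ⟨Γ.edges, τ⟩] (f : Perm Γ.Flag → M) :
    (∑ τ : Perm Γ.Flag, if (isoSetoid n).r Γ ⟨Γ.edges, τ⟩ then f τ else 0) =
      ∑ x : Perm (Fin Γ.edges) × (Fin Γ.edges → Perm (Fin 2)),
        f ((relabel (Fin n) x.1 x.2).permCongr Γ.next) := by
  have : Nonempty (Fin n) := ⟨⟨0, by omega⟩⟩
  symm
  refine sum_of_injOn (fun x => (relabel (Fin n) x.1 x.2).permCongr Γ.next)
    (relabel_permCongr_injective h).injOn (fun _ _ => by simp) (fun τ _ hτ => ?_) fun x _ => ?_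
  · rw [if_neg]
    intro hr
    obtain ⟨g, t, hgt⟩ := exists_relabel_of_iso hr
    refine hτ ⟨(g, t), by simp, ?_⟩
    simpa using hgt.symm
  · rw [if_pos (iso_relabel Γ.edges Γ.next x.1 x.2)]

end RibbonGraph

theorem Induces.ne_zero {F : Type*} {n : ℕ} [Nonempty F] {φ : Perm F} {leg : Fin n → F}
    {σ : Perm (Fin n)} (h : Induces φ leg σ) : n ≠ 0 := by
  rintro rfl
  obtain ⟨i, -⟩ := h.1 (Classical.arbitrary F)
  exact i.elim0

section

variable [DirectSum.Decomposition 𝒱]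

theorem CyclicTensors.vertexProduct_truncate (m : CyclicTensors 𝒱) {N : ℕ} {τ : Perm (Fin N)}
    (h : ∀ z, 3 ≤ Function.minimalPeriod τ z) (x : Fin N → V) :
    vertexProduct m.truncate τ x = vertexProduct m τ x := by
  have h1 : ∀ w ∈ cycleLists τ, 3 ≤ w.length := by
    intro w hw
    simp only [cycleLists, List.mem_map] at hw
    obtain ⟨z, -, rfl⟩ := hw
    simpa using h z
  unfold vertexProduct
  refine sum_congr rfl fun p _ => ?_
  congr 2
  refine List.map_congr_left fun w hw => ?_
  rw [m.truncate_tensor (h1 w hw)]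

theorem minimalPeriod_permCongr {F F' : Type*} (g : F ≃ F') (τ : Perm F) (x : F') :
    Function.minimalPeriod (g.permCongr τ) x = Function.minimalPeriod τ (g.symm x) := by
  refine Function.minimalPeriod_eq_minimalPeriod_iff.2 fun j => ?_
  have h : ∀ j, (g.permCongr τ)^[j] x = g (τ^[j] (g.symm x)) := by
    intro j
    induction j with
    | zero => simp
    | succ j ih => rw [Function.iterate_succ_apply', ih, Function.iterate_succ_apply']; simp
  unfold Function.IsPeriodicPt Function.IsFixedPt
  rw [h, ← g.eq_symm_apply]

/-- The functional only involves words with at least three letters. The equations assumed for `m`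
thus pass to its truncation, for which the valence condition takes care of itself. -/
theorem CyclicTensors.truncate_functional (m : CyclicTensors 𝒱) :
    m.truncate.functional = m.functional := by
  funext n σ a
  unfold functional
  split_ifs with h
  · refine m.vertexProduct_truncate (fun z => ?_) a
    obtain ⟨L, hL⟩ := exists_isListing σ
    obtain ⟨w, hw, h1, hz⟩ := hL.exists_word z
    obtain ⟨x, -, -, -, h2⟩ := hL.word hw
    have h3 : (univ : Finset (Fin n)) ⊆ w.toFinset := fun y _ => by
      simpa using (h2 y).2 (h.2 x y)
    have h4 := (card_le_card h3).trans w.toFinset_card_le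
    rw [card_univ, Fintype.card_fin] at h4
    omega
  · rfl

variable [FiniteDimensional k V] {β : OddScalarProduct 𝒱} {I : OddSymmetry β} {ι : Type*}
  [Fintype ι]

/-- Basis independence applied at every edge: the weight may be computed in a homogeneous basis. -/
theorem RibbonGraph.weight_eq (h : OddHomotopy I) (m : CyclicTensors 𝒱) (u : HomogeneousBasis β ι)
    {n : ℕ} (Γ : RibbonGraph n) (a : Fin n → V) :
    Γ.weight h m a = contractEdges m u h.H Γ.numbering Γ.next a := by
  have h1 := IsMultilinear.sum_pairs_eq β (m.evalOn_isMultilinear Γ.numbering Γ.next) a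
    (c := fun _ _ => 1) (y := fun _ i => h.H (β.dual i)) (z := fun _ i => Module.finBasis k V i)
    (c' := fun _ _ => 1) (y' := fun _ i => h.H (u.dual i)) (z' := fun _ i => u.vec i)
    (fun _ v w => by simpa using (u.sum_form_comp h.H v w).symm)
  simp only [prod_const_one, one_mul] at h1
  refine Eq.trans ?_ h1
  refine sum_congr rfl fun j _ => ?_
  unfold evalOn CyclicTensors.expFunctional
  congr 1
  funext x
  simp only [Function.comp_apply]
  rcases Γ.numbering.symm x with ⟨x, s⟩ | i <;> rfl

theorem RibbonGraph.weight_truncate (h : OddHomotopy I) (m : CyclicTensors 𝒱) {n : ℕ}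
    {Γ : RibbonGraph n} (hΓ : ∀ x : Γ.Flag, 3 ≤ Function.minimalPeriod Γ.next x) (a : Fin n → V) :
    Γ.weight h m.truncate a = Γ.weight h m a :=
  sum_congr rfl fun _ _ => m.vertexProduct_truncate
    (fun z => by rw [minimalPeriod_permCongr]; exact hΓ _) _

/-- The number of relabellings of the flags at `E` edges. -/
def relabelCount (E : ℕ) : ℕ := E.factorial * 2 ^ E

open Classical in
/-- The sum over the graphs with `E` labelled edges. -/
def labelledSum (m : CyclicTensors 𝒱) (u : HomogeneousBasis β ι) (H : Module.End k V) (E b : ℕ) :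
    Functional k V := fun n σ a =>
  ∑ τ : Perm (Flag E n), if SurfaceCond τ (edgeFlip _ _) Sum.inr E b σ then
    contractEdges m u H (flagNumbering E n) τ a else 0

theorem numCycles_mul_three_le {F : Type*} [Fintype F] {τ : Perm F}
    (h : ∀ x, 3 ≤ Function.minimalPeriod τ x) : numCycles τ * 3 ≤ Fintype.card F := by
  classical
  have : Fintype (Quotient (Perm.SameCycle.setoid τ)) := Fintype.ofFinite _
  unfold numCycles
  rw [Nat.card_eq_fintype_card, ← card_univ, ← card_univ, mul_comm]
  refine mul_card_image_le_card_of_maps_to (f := Quotient.mk (Perm.SameCycle.setoid τ))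
    (fun _ _ => mem_univ _) 3 fun v _ => ?_
  obtain ⟨x, rfl⟩ := Quotient.exists_rep v
  have hx := h x
  have hin : Function.Injective (fun i : Fin 3 => τ^[(i : ℕ)] x) := by
    intro i j hij
    exact Fin.ext (Function.iterate_injOn_Iio_minimalPeriod
      (Set.mem_Iio.2 (by omega)) (Set.mem_Iio.2 (by omega)) hij)
  rw [show 3 = (univ.image (fun i : Fin 3 => τ^[(i : ℕ)] x)).card by
    rw [card_image_of_injective _ hin]; simp]
  refine card_le_card fun y hy => ?_
  obtain ⟨i, -, rfl⟩ := mem_image.1 hy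
  refine mem_filter.2 ⟨mem_univ _, Quotient.sound ?_⟩
  change τ.SameCycle _ x
  exact Perm.SameCycle.symm ⟨(i : ℕ), by simp [Perm.iterate_eq_pow]⟩

/-- A bound for the number of edges of the graphs that contribute. -/
theorem le_of_valence {E n b : ℕ} {τ : Perm (Flag E n)} {σ : Perm (Fin n)}
    (h : SurfaceCond τ (edgeFlip _ _) Sum.inr E b σ)
    (hτ : ∀ x, 3 ≤ Function.minimalPeriod τ x) : E ≤ 3 * b + n := by
  have h1 := numCycles_mul_three_le hτ
  have h2 := h.euler
  simp only [Fintype.card_sum, Fintype.card_prod, Fintype.card_fin] at h1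
  omega

theorem RibbonGraph.weight_relabel [CharZero k] (h : OddHomotopy I) {m : CyclicTensors 𝒱}
    (hm : m.IsReduced) (u : HomogeneousBasis β ι) {n : ℕ} {Γ Γ' : RibbonGraph n}
    (hΓ : (isoSetoid n).r Γ Γ') (a : Fin n → V) : Γ'.weight h m a = Γ.weight h m a := by
  obtain ⟨g, t, rfl⟩ := exists_relabel_of_iso hΓ
  rw [weight_eq h m u, weight_eq h m u]
  exact contractEdges_relabel hm h.odd h.selfadjoint (isStandard_flagNumbering Γ.edges n) g t
    Γ.next a

theorem RibbonGraph.valence_of_weight (h : OddHomotopy I) {m : CyclicTensors 𝒱}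
    (hm : m.IsReduced) (u : HomogeneousBasis β ι) {n : ℕ} {Γ : RibbonGraph n} {a : Fin n → V}
    (hΓ : Γ.weight h m a ≠ 0) (x : Γ.Flag) : 3 ≤ Function.minimalPeriod Γ.next x := by
  rw [weight_eq h m u] at hΓ
  exact three_le_of_contractEdges hm hΓ x

theorem relabelCount_ne_zero [CharZero k] (E : ℕ) : (relabelCount E : k) ≠ 0 := by
  simp [relabelCount, Nat.factorial_ne_zero]

open Classical in
-- Orbit counting. A class of connected graphs with `E` edges and at least one leg has exactly
-- $E!\,2^E$ representatives on the standard flags, as there are no automorphisms, and all have the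
-- same weight. The valence condition is dropped by truncating `m`, and `M` exceeds the resulting
-- bound on the number of edges.
theorem sum_contributes [CharZero k] (h : OddHomotopy I) (m : CyclicTensors 𝒱)
    (u : HomogeneousBasis β ι) {n b M : ℕ} (hM : 3 * b + n < M) (σ : Perm (Fin n)) (a : Fin n → V) :
    ∑ᶠ c ∈ {c : RibbonGraph.IsoClass n | (Quotient.out c).Contributes b σ},
      (Quotient.out c).weight h m a =
    ∑ E ∈ range M, (relabelCount E : k)⁻¹ * labelledSum m.truncate u h.H E b n σ a := by
  have hm := m.isReduced_truncate
  let S := (RibbonGraph.finite_contributes b σ).toFinset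
  have hS : ∀ c, c ∈ S ↔ (Quotient.out c).Contributes b σ := fun c => by simp [S]
  rw [finsum_mem_eq_finite_toFinset_sum _ (RibbonGraph.finite_contributes b σ)]
  have h1 : ∀ c ∈ S, (Quotient.out c).weight h m a = ∑ E ∈ range M, (relabelCount E : k)⁻¹ *
      ∑ τ : Perm (Flag E n), if RibbonGraph.isoClass ⟨E, τ⟩ = c then
        RibbonGraph.weight h m.truncate ⟨E, τ⟩ a else 0 := by
    intro c hc
    have hc := RibbonGraph.contributes_iff.1 ((hS c).1 hc)
    have hE : (Quotient.out c).edges < M :=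
      (le_of_valence (τ := (Quotient.out c).next) hc.1 hc.2).trans_lt hM
    rw [sum_eq_single_of_mem _ (mem_range.2 hE)]
    · have hne : Nonempty (Quotient.out c).Flag := hc.1.joined.1
      have h2 := RibbonGraph.sum_isoClass (Γ := Quotient.out c) hc.1.joined hc.1.boundary.ne_zero
        (fun τ => RibbonGraph.weight h m.truncate ⟨_, τ⟩ a)
      have h3 : ∀ x : Perm (Fin (Quotient.out c).edges) ×
          (Fin (Quotient.out c).edges → Perm (Fin 2)), RibbonGraph.weight h m.truncate
          ⟨_, (relabel (Fin n) x.1 x.2).permCongr (Quotient.out c).next⟩ a =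
          (Quotient.out c).weight h m a := fun x => by
        rw [RibbonGraph.weight_relabel h hm u (RibbonGraph.iso_relabel _ _ x.1 x.2),
          ← RibbonGraph.weight_truncate h m hc.2]
      simp only [h3] at h2
      simp only [RibbonGraph.isoClass_eq_iff]
      rw [eq_inv_mul_iff_mul_eq₀ (relabelCount_ne_zero _)]
      refine Eq.trans ?_ h2.symm
      rw [sum_const, card_univ, nsmul_eq_mul]
      congr 2
      simp [relabelCount, Fintype.card_prod, Fintype.card_perm]
    · intro E _ hne
      rw [sum_eq_zero, mul_zero]
      intro τ _
      rw [if_neg]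
      rw [RibbonGraph.isoClass_eq_iff]
      intro hr
      obtain ⟨g, t, hgt⟩ := RibbonGraph.exists_relabel_of_iso hr
      exact hne (congrArg RibbonGraph.edges hgt)
  rw [sum_congr rfl h1, sum_comm]
  refine sum_congr rfl fun E _ => ?_
  rw [← mul_sum, sum_comm]
  congr 1
  refine sum_congr rfl fun τ _ => ?_
  rw [sum_ite_eq]
  have h2 := RibbonGraph.weight_eq h m.truncate u ⟨E, τ⟩ a
  -- A graph of weight zero is irrelevant on both sides; a nonzero weight forces the valence
  -- condition, so that only the surface condition remains to be compared.
  by_cases h0 : RibbonGraph.weight h m.truncate ⟨E, τ⟩ a = 0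
  · rw [h0] at h2 ⊢
    rw [ite_self]
    split_ifs
    · exact h2
    · rfl
  · refine if_congr ?_ h2 rfl
    have h3 := (RibbonGraph.isoClass_eq_iff (Γ := ⟨E, τ⟩)).1 rfl
    have h4 : (Quotient.out (RibbonGraph.isoClass ⟨E, τ⟩)).weight h m.truncate a
        ≠ 0 := by
      rwa [← RibbonGraph.weight_relabel h hm u h3]
    rw [hS, RibbonGraph.contributes_iff, and_iff_left (RibbonGraph.valence_of_weight h hm u h4)]
    obtain ⟨g, t, hgt⟩ := RibbonGraph.exists_relabel_of_iso ((RibbonGraph.isoSetoid n).symm h3)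
    rw [hgt]
    exact RibbonGraph.surfaceCond_relabel g t

end

end

section

variable {k : Type*} [Field k] {V : Type*} [AddCommGroup V] [Module k V]
  {𝒱 : ZMod 2 → Submodule k V}

/-! ### The action of the operator on the value of a graph -/

theorem neg_one_pow_val (ε : ZMod 2) : ((-1) ^ ε.val : k) = paritySign k ε := by
  obtain rfl | rfl := zmod_two_cases ε
  · simp
  · rw [show (1 : ZMod 2).val = 1 from rfl]; simp

section

variable [DirectSum.Decomposition 𝒱] {β : OddScalarProduct 𝒱} {ι : Type*} [Fintype ι]

theorem evalOn_dualAction (I : Module.End k V) {f : Functional k V}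
    (hf : ∀ n σ, IsMultilinear (f n σ)) {F : Type*} [Fintype F] [DecidableEq F] {N : ℕ}
    (e : F ≃ Fin N) (τ : Perm F) {p : F → ZMod 2} {x : F → V} (hx : ∀ i, x i ∈ 𝒱 (p i)) :
    evalOn (dualAction 𝒱 I f) e τ x =
      -∑ y, (∏ z, if (e z : ℕ) < e y then paritySign k (p z + 1) else 1) *
        evalOn f e τ (Function.update x y (I (x y))) := by
  unfold evalOn
  rw [dualAction_eq I f _ (hf _ _) (p := p ∘ e.symm) (a := x ∘ e.symm) (fun i => hx _),
    ← e.sum_comp]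
  congr 1
  refine sum_congr rfl fun y _ => ?_
  rw [← e.prod_comp]
  congr 1
  · refine prod_congr rfl fun z _ => ?_
    simp
  · congr 1
    rw [Function.comp_apply, symm_apply_apply, Function.update_comp_equiv, symm_symm]

/-- Invariance of `β` moves `I` from the second half of an edge to the first, where it acts before
`H`. Together with the action on the first half this produces `IH + HI`. -/
theorem HomogeneousBasis.sum_form_commute (u : HomogeneousBasis β ι) (I : OddSymmetry β)
    (h : OddHomotopy I) (v w : V) :
    ∑ i, paritySign k (u.parity i + 1) *
      (β.form (h.H (u.dual i)) v * β.form (I.I (u.vec i)) w) =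
      ∑ i, 1 * (β.form (h.H (I.I (u.dual i))) v * β.form (u.vec i) w) := by
  have hI : ∀ ε, ∀ a ∈ 𝒱 ε, ∀ b, β.form (I.I a) b = -(paritySign k ε * β.form a (I.I b)) :=
    fun ε a ha b => by
      rw [← neg_one_pow_val, eq_neg_iff_add_eq_zero]
      exact I.invariant ε a ha b
  have hH : ∀ ε, ∀ a ∈ 𝒱 ε, ∀ b, β.form (h.H a) b = paritySign k ε * β.form a (h.H b) :=
    fun ε a ha b => by rw [h.selfadjoint ε a ha, neg_one_pow_val]
  have hsq := fun ε => paritySign_mul_self (k := k) ε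
  have h1 : ∀ i, β.form (h.H (I.I (u.dual i))) v = β.form (u.dual i) (I.I (h.H v)) := by
    intro i
    have h2 := I.odd _ _ (u.dual_mem i)
    rw [hH _ _ h2, hI _ _ (u.dual_mem i), paritySign_add, paritySign_one]
    linear_combination β.form (u.dual i) (I.I (h.H v)) * hsq (u.parity i + 1)
  have h3 : ∀ i, paritySign k (u.parity i + 1) * β.form (I.I (u.vec i)) w =
      β.form (u.vec i) (I.I w) := by
    intro i
    rw [hI _ _ (u.vec_mem i), paritySign_add, paritySign_one]
    linear_combination β.form (u.vec i) (I.I w) * hsq (u.parity i)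
  simp only [h1, one_mul, u.sum_form]
  have h4 : ∀ v, ∑ i, paritySign k (u.parity i + 1) *
      (β.form (h.H (u.dual i)) v * β.form (I.I (u.vec i)) w) =
      ∑ i, β.form (h.H (u.dual i)) v * β.form (u.vec i) (I.I w) := by
    intro v
    refine sum_congr rfl fun i _ => ?_
    rw [← h3 i]
    ring
  rw [h4]
  clear h1 h4
  -- Homogeneous `v` are tested first: indices `i` with the parity of `v` contribute zero on both
  -- sides, and the others have a sign fixed by the parity of `v`.
  have key : ∀ ε, ∀ v ∈ 𝒱 ε, ∑ i, β.form (h.H (u.dual i)) v * β.form (u.vec i) (I.I w) =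
      β.form (I.I (h.H v)) w := by
    intro ε v hv
    rw [hI _ _ (h.odd _ _ hv), ← u.sum_form, mul_sum, ← sum_neg_distrib]
    refine sum_congr rfl fun i _ => ?_
    by_cases hi : u.parity i = ε
    · rw [β.odd _ _ (u.apply_dual_mem h.odd i) v (hi ▸ hv),
        β.odd (ε + 1) _ (hi ▸ u.dual_mem i) _ (h.odd _ _ hv)]
      ring
    · have : u.parity i + 1 = ε := by
        obtain h3 | h3 := zmod_two_cases (u.parity i) <;> obtain h4 | h4 := zmod_two_cases ε <;>
          simp_all
        rfl
      rw [hH _ _ (u.dual_mem i), this, paritySign_add, paritySign_one]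
      ring
  induction v using DirectSum.Decomposition.inductionOn 𝒱 with
  | zero => simp
  | homogeneous v => exact key _ _ v.2
  | add v v' hv hv' =>
    simp only [map_add, LinearMap.add_apply, add_mul, sum_add_distrib, hv, hv']

/-- The value of a graph with the operator `T` instead of `H` at the edge `e`. -/
def edgeTerm (m : CyclicTensors 𝒱) (u : HomogeneousBasis β ι) (H T : Module.End k V) {E n : ℕ}
    (e : Fin E) (τ : Perm (Flag E n)) (a : Fin n → V) : k :=
  ∑ j : Fin E → ι, evalOn m.expFunctional (flagNumbering E n) τ
    (Function.update (edgeLetters u H j a) (Sum.inl (e, 0)) (T (u.dual (j e))))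

/-- The operator acts at the vertices of a graph. -/
def vertexTerm (m : CyclicTensors 𝒱) (u : HomogeneousBasis β ι) (H I : Module.End k V) {E n : ℕ}
    (τ : Perm (Flag E n)) (a : Fin n → V) : k :=
  ∑ j : Fin E → ι, evalOn (dualAction 𝒱 I m.expFunctional) (flagNumbering E n) τ
    (edgeLetters u H j a)

theorem edgeTerm_add (m : CyclicTensors 𝒱) (u : HomogeneousBasis β ι) (H T T' : Module.End k V)
    {E n : ℕ} (e : Fin E) (τ : Perm (Flag E n)) (a : Fin n → V) :
    edgeTerm m u H (T + T') e τ a = edgeTerm m u H T e τ a + edgeTerm m u H T' e τ a := by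
  unfold edgeTerm
  rw [← sum_add_distrib]
  refine sum_congr rfl fun j _ => ?_
  rw [LinearMap.add_apply, (m.evalOn_isMultilinear _ τ).update_add]

/-- The Leibniz rule over all flags gives the vertex term. Its legs form the left side, and its edge
halves combine to `IH + HI = 1 - P` at one edge at a time. -/
theorem dualAction_contractEdges [FiniteDimensional k V] (m : CyclicTensors 𝒱)
    (u : HomogeneousBasis β ι) {I : OddSymmetry β} (h : OddHomotopy I) {E n : ℕ}
    (τ : Perm (Flag E n)) {p : Fin n → ZMod 2} {a : Fin n → V} (ha : ∀ i, a i ∈ 𝒱 (p i)) :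
    -∑ i, (∏ j, if j < i then paritySign k (p j + 1) else 1) *
        contractEdges m u h.H (flagNumbering E n) τ (Function.update a i (I.I (a i))) =
      vertexTerm m u h.H I.I τ a + ∑ e, (edgeTerm m u h.H 1 e τ a -
        edgeTerm m u h.H h.proj e τ a) := by
  classical
  let x := fun j : Fin E → ι => edgeLetters u h.H j a
  let Φ := evalOn m.expFunctional (flagNumbering E n) τ
  have hΦ : IsMultilinear Φ := m.evalOn_isMultilinear _ τ
  -- the signs
  have s0 : ∀ (j : Fin E → ι) (e : Fin E), (∏ z, if (flagNumbering E n z : ℕ) <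
      flagNumbering E n (Sum.inl (e, 0)) then paritySign k (edgeParity u j p z + 1) else 1) =
      1 := by
    intro j e
    rw [Fintype.prod_sum_type, Fintype.prod_prod_type, prod_eq_one, prod_eq_one, one_mul]
    · intro i _
      rw [if_neg]
      rw [flagNumbering_inl, flagNumbering_inr, Fin.val_zero]
      omega
    · intro y _
      rw [Fin.prod_univ_two]
      simp only [flagNumbering_inl, Fin.val_zero, Fin.val_one, edgeParity, Sum.elim_inl]
      by_cases hy : (y : ℕ) < e
      · rw [if_pos (by omega), if_pos (by omega), paritySign_mul_self]
      · rw [if_neg (by omega), if_neg (by omega), one_mul]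
  have s1 : ∀ (j : Fin E → ι) (e : Fin E), (∏ z, if (flagNumbering E n z : ℕ) <
      flagNumbering E n (Sum.inl (e, 1)) then paritySign k (edgeParity u j p z + 1) else 1) =
      paritySign k (u.parity (j e) + 1) := by
    intro j e
    rw [Fintype.prod_sum_type, Fintype.prod_prod_type, prod_eq_single e,
      prod_eq_one (s := (univ : Finset (Fin n))), mul_one]
    · rw [Fin.prod_univ_two]
      simp only [flagNumbering_inl, Fin.val_zero, Fin.val_one, edgeParity, Sum.elim_inl]
      rw [if_pos (by omega), if_neg (by omega), mul_one]
    · intro i _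
      rw [if_neg]
      rw [flagNumbering_inl, flagNumbering_inr, Fin.val_one]
      omega
    · intro y _ hy
      have hy : (y : ℕ) ≠ e := fun h => hy (Fin.ext h)
      rw [Fin.prod_univ_two]
      simp only [flagNumbering_inl, Fin.val_zero, Fin.val_one, edgeParity, Sum.elim_inl]
      by_cases hy : (y : ℕ) < e
      · rw [if_pos (by omega), if_pos (by omega), paritySign_mul_self]
      · rw [if_neg (by omega), if_neg (by omega), one_mul]
    · simp
  have s2 : ∀ (j : Fin E → ι) (i : Fin n), (∏ z, if (flagNumbering E n z : ℕ) <
      flagNumbering E n (Sum.inr i) then paritySign k (edgeParity u j p z + 1) else 1) =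
      ∏ j, if j < i then paritySign k (p j + 1) else 1 := by
    intro j i
    rw [Fintype.prod_sum_type, Fintype.prod_prod_type, prod_eq_one, one_mul]
    · refine prod_congr rfl fun l _ => ?_
      simp only [flagNumbering_inr, edgeParity, Sum.elim_inr, add_lt_add_iff_left, Fin.val_fin_lt]
    · intro y _
      rw [Fin.prod_univ_two]
      simp only [flagNumbering_inl, flagNumbering_inr, Fin.val_zero, Fin.val_one, edgeParity,
        Sum.elim_inl]
      rw [if_pos (by omega), if_pos (by omega), paritySign_mul_self]
  -- Preceding edges are even pairs and give no sign. The second half of an edge sees only the sign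
  -- of its own first half, and a leg sees only earlier legs.
  have h1 : vertexTerm m u h.H I.I τ a =
      -(∑ e, (∑ j, (Φ (Function.update (x j) (Sum.inl (e, 0)) (I.I (h.H (u.dual (j e))))) +
        paritySign k (u.parity (j e) + 1) *
          Φ (Function.update (x j) (Sum.inl (e, 1)) (I.I (u.vec (j e))))))) -
      ∑ i, (∏ j, if j < i then paritySign k (p j + 1) else 1) *
        contractEdges m u h.H (flagNumbering E n) τ (Function.update a i (I.I (a i))) := by
    unfold vertexTerm contractEdges
    simp only [mul_sum]
    rw [sum_comm (s := univ (α := Fin n)), sum_comm (s := univ (α := Fin E)), ← sum_neg_distrib,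
      ← sum_sub_distrib]
    refine sum_congr rfl fun j _ => ?_
    rw [evalOn_dualAction I.I (f := m.expFunctional) (fun n σ => m.vertexProduct_isMultilinear σ) _ _
      (edgeLetters_mem u h.odd j ha), Fintype.sum_sum_type, Fintype.sum_prod_type]
    simp only [Fin.sum_univ_two, s0, s1, s2, one_mul]
    have h6 : ∀ i v, Function.update (edgeLetters u h.H j a) (Sum.inr i) v =
        edgeLetters u h.H j (Function.update a i v) := fun i v => Sum.update_elim_inr
    simp only [h6]
    rw [neg_add']
    rfl
  have h2 : ∀ e, ∑ j, (Φ (Function.update (x j) (Sum.inl (e, 0)) (I.I (h.H (u.dual (j e))))) +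
        paritySign k (u.parity (j e) + 1) *
          Φ (Function.update (x j) (Sum.inl (e, 1)) (I.I (u.vec (j e))))) =
      edgeTerm m u h.H (I.I * h.H + h.H * I.I) e τ a := by
    intro e
    rw [edgeTerm_add, sum_add_distrib]
    congr 1
    -- Only the tensor at the edge `e` is changed; at all other edges the two sides coincide.
    have h3 := hΦ.sum_pairs_eq β a (κ := ι) (κ' := ι)
      (c := fun e' i => if e' = e then paritySign k (u.parity i + 1) else 1)
      (y := fun _ i => h.H (u.dual i))
      (z := fun e' i => if e' = e then I.I (u.vec i) else u.vec i)
      (c' := fun _ _ => 1)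
      (y' := fun e' i => if e' = e then h.H (I.I (u.dual i)) else h.H (u.dual i))
      (z' := fun _ i => u.vec i) (fun e' v w => by
        by_cases he : e' = e
        · simp only [if_pos he]
          exact u.sum_form_commute I h v w
        · simp only [if_neg he])
    simp only [prod_const_one, one_mul, prod_ite_eq', mem_univ, if_true] at h3
    have h4 : ∀ j : Fin E → ι, Function.update (x j) (Sum.inl (e, 1)) (I.I (u.vec (j e))) =
        Sum.elim (fun y => if y.2 = 0 then h.H (u.dual (j y.1)) else
          if y.1 = e then I.I (u.vec (j y.1)) else u.vec (j y.1)) a := by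
      intro j
      ext z
      obtain ⟨y, s⟩ | i := z
      · by_cases hy : y = e
        · subst hy
          obtain rfl | rfl : s = 0 ∨ s = 1 := by omega
          · simp [x, edgeLetters]
          · simp
        · simp [x, edgeLetters, hy]
      · simp [x, edgeLetters]
    have h5 : ∀ j : Fin E → ι, Function.update (x j) (Sum.inl (e, 0)) (h.H (I.I (u.dual (j e)))) =
        Sum.elim (fun y => if y.2 = 0 then
          if y.1 = e then h.H (I.I (u.dual (j y.1))) else h.H (u.dual (j y.1))
          else u.vec (j y.1)) a := by
      intro j
      ext z
      obtain ⟨y, s⟩ | i := z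
      · by_cases hy : y = e
        · subst hy
          obtain rfl | rfl : s = 0 ∨ s = 1 := by omega
          · simp
          · simp [x, edgeLetters]
        · simp [x, edgeLetters, hy]
      · simp [x, edgeLetters]
    simp only [h4]
    rw [h3]
    exact sum_congr rfl fun j _ => congrArg Φ (h5 j).symm
  have h3 : ∀ e, edgeTerm m u h.H (I.I * h.H + h.H * I.I) e τ a =
      edgeTerm m u h.H 1 e τ a - edgeTerm m u h.H h.proj e τ a := by
    intro e
    rw [eq_sub_iff_add_eq, ← edgeTerm_add]
    congr 1
    unfold OddHomotopy.proj
    abel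
  rw [h1]
  simp only [h2, h3]
  ring

end

/-! ### Marked edges -/

/-- The flags of a graph with a marked edge `e`, whose halves are numbered as two further legs. -/
def unmark {E : ℕ} (n : ℕ) (e : Fin (E + 1)) : Flag E (n + 2) ≃ Flag (E + 1) n :=
  Equiv.ofBijective (Sum.elim (fun x => Sum.inl (e.succAbove x.1, x.2))
    (Fin.cons (Sum.inl (e, 0)) (Fin.cons (Sum.inl (e, 1)) Sum.inr))) <| by
    rw [Fintype.bijective_iff_injective_and_card]
    constructor
    · refine Function.Injective.sumElim ?_ ?_ ?_
      · intro x y hxy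
        simp only [Sum.inl.injEq, Prod.mk.injEq, Fin.succAbove_right_inj] at hxy
        exact Prod.ext hxy.1 hxy.2
      · rw [Fin.cons_injective_iff, Fin.cons_injective_iff]
        refine ⟨?_, by simp, Sum.inr_injective⟩
        rintro ⟨i, hi⟩
        cases i using Fin.cases <;> simp at hi
      · intro x i
        cases i using Fin.cases with
        | zero => simp
        | succ i => cases i using Fin.cases <;> simp
    · simp only [Fintype.card_sum, Fintype.card_prod, Fintype.card_fin]
      ring

section

variable {E n : ℕ} (e : Fin (E + 1))

@[simp] theorem unmark_inl (x : Fin E) (s : Fin 2) :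
    unmark n e (Sum.inl (x, s)) = Sum.inl (e.succAbove x, s) := rfl
@[simp] theorem unmark_zero : unmark n e (Sum.inr 0) = Sum.inl (e, 0) := rfl
@[simp] theorem unmark_one : unmark n e (Sum.inr 1) = Sum.inl (e, 1) := rfl
@[simp] theorem unmark_succ (i : Fin n) : unmark n e (Sum.inr i.succ.succ) = Sum.inr i := rfl

/-- The involution of the flags of a graph with a marked edge. -/
def markedFlip (E n : ℕ) : Perm (Flag E (n + 2)) :=
  edgeFlip (Fin E) (Fin (n + 2)) * swap (Sum.inr 0) (Sum.inr 1)

/-- The conditions on a graph, with the marked edge included. -/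
abbrev MarkedCond (E b : ℕ) {n : ℕ} (τ : Perm (Flag E (n + 2))) (σ : Perm (Fin n)) : Prop :=
  SurfaceCond τ (markedFlip E n) (fun i => Sum.inr i.succ.succ) (E + 1) b σ

/-- Exchanging the first two legs makes them the halves of an edge again. -/
theorem unmark_permCongr_markedFlip :
    (unmark n e).permCongr (markedFlip E n) = edgeFlip (Fin (E + 1)) (Fin n) := by
  refine Equiv.ext fun x => ?_
  obtain ⟨x, rfl⟩ := (unmark n e).surjective x
  rw [permCongr_apply, symm_apply_apply, markedFlip, Perm.mul_apply]
  obtain ⟨x, s⟩ | i := x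
  · rw [swap_apply_of_ne_of_ne (by simp) (by simp)]
    rfl
  · revert i
    rw [forall_fin_add_two]
    refine ⟨?_, ?_, fun i => ?_⟩
    · rw [swap_apply_left]
      rfl
    · rw [swap_apply_right]
      rfl
    · rw [swap_apply_of_ne_of_ne (by simp) (by simp [Fin.ext_iff])]
      rfl

theorem markedCond_iff {b : ℕ} {σ : Perm (Fin n)} {τ : Perm (Flag E (n + 2))} :
    SurfaceCond ((unmark n e).permCongr τ) (edgeFlip _ _) Sum.inr (E + 1) b σ ↔
      MarkedCond E b τ σ := by
  have := SurfaceCond.congr_iff (unmark n e) (Equiv.refl (Fin n)) (τ := τ) (ψ := markedFlip E n)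
    (leg := fun i => Sum.inr i.succ.succ) (c := E + 1) (b := b) (σ := σ)
  rw [unmark_permCongr_markedFlip] at this
  exact this

variable [DirectSum.Decomposition 𝒱] {β : OddScalarProduct 𝒱} {ι : Type*} [Fintype ι]

/-- The value of a graph with the operator `T` at a marked edge. -/
def markedTerm (m : CyclicTensors 𝒱) (u : HomogeneousBasis β ι) (H T : Module.End k V)
    (τ : Perm (Flag E (n + 2))) (a : Fin n → V) : k :=
  ∑ i, contractEdges m u H (flagNumbering E (n + 2)) τ
    (Fin.cons (T (u.dual i)) (Fin.cons (u.vec i) a))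

/-- The marked edge moves behind the other edges, which are even pairs, and its halves remain in
front of the legs; so separating it costs no sign. -/
theorem edgeTerm_unmark {m : CyclicTensors 𝒱} (hm : m.IsReduced) (u : HomogeneousBasis β ι)
    {H T : Module.End k V} (hH : ∀ ε, ∀ a ∈ 𝒱 ε, H a ∈ 𝒱 (ε + 1)) (hT : ∀ ε, ∀ a ∈ 𝒱 ε, T a ∈ 𝒱 ε)
    (τ : Perm (Flag E (n + 2))) {p : Fin n → ZMod 2} {a : Fin n → V} (ha : ∀ i, a i ∈ 𝒱 (p i)) :
    edgeTerm m u H T e ((unmark n e).permCongr τ) a = markedTerm m u H T τ a := by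
  unfold edgeTerm markedTerm contractEdges
  rw [← (Fin.insertNthEquiv (fun _ => ι) e).sum_comp, Fintype.sum_prod_type]
  refine sum_congr rfl fun i _ => sum_congr rfl fun j _ => ?_
  have hletters : Function.update (edgeLetters u H (Fin.insertNthEquiv (fun _ => ι) e (i, j)) a)
      (Sum.inl (e, 0)) (T (u.dual (Fin.insertNthEquiv (fun _ => ι) e (i, j) e))) ∘ unmark n e =
      edgeLetters u H j (Fin.cons (T (u.dual i)) (Fin.cons (u.vec i) a)) := by
    funext x
    have hj : ∀ x, Fin.insertNthEquiv (fun _ => ι) e (i, j) (e.succAbove x) = j x := fun x => by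
      rw [Fin.insertNthEquiv_apply, Fin.insertNth_apply_succAbove]
    have he : Fin.insertNthEquiv (fun _ => ι) e (i, j) e = i := by
      rw [Fin.insertNthEquiv_apply, Fin.insertNth_apply_same]
    rw [he, Function.comp_apply]
    obtain ⟨x, s⟩ | l := x
    · rw [unmark_inl, Function.update_of_ne (by simp)]
      simp only [edgeLetters, Sum.elim_inl, hj]
    · revert l
      rw [forall_fin_add_two]
      refine ⟨?_, ?_, fun l => ?_⟩
      · rw [unmark_zero, Function.update_self]
        rfl
      · rw [unmark_one, Function.update_of_ne (by simp)]
        simp only [edgeLetters, Sum.elim_inl, he]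
        rfl
      · rw [unmark_succ, Function.update_of_ne (by simp)]
        rfl
  rw [evalOn_permCongr, hletters, (CyclicTensors.isEvenFunctional_exp hm).evalOn_reorder _
    (flagNumbering E (n + 2)) τ
    (edgeLetters_mem u hH j (cons_mem (cons_mem ha (u.vec_mem i)) (hT _ _ (u.dual_mem i)))),
    reorderSign_symm, reorderSign_pairs (fun _ => rfl) (isStandard_flagNumbering _ _).pairRank _
      (isStandard_flagNumbering _ _).lt, prod_eq_one, reorderSign_eq_one, one_mul, one_mul]
  · have hmono : ∀ x y : Fin (n + 2), x < y →
        (flagNumbering (E + 1) n (unmark n e (Sum.inr x)) : ℕ) <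
          flagNumbering (E + 1) n (unmark n e (Sum.inr y)) := by
      have := e.2
      simp only [forall_fin_add_two, unmark_zero, unmark_one, unmark_succ, flagNumbering_inl,
        flagNumbering_inr, Fin.lt_def, Fin.val_succ, Fin.val_zero, Fin.val_one]
      refine ⟨⟨?_, ?_, ?_⟩, ⟨?_, ?_, ?_⟩, fun i => ⟨?_, ?_, ?_⟩⟩ <;> intros <;> omega
    intro x y hxy h
    refine lt_asymm h (hmono x y ?_)
    simpa [flagNumbering_inr] using hxy
  · intro x _
    rw [if_neg]
    exact ((isStandard_flagNumbering (E + 1) n).lt (e.succAbove x)).le.not_gt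
  · intro x z hz0 hz1
    exact (isStandard_flagNumbering (E + 1) n).pairRank (e.succAbove x) (unmark n e z)
      (by rwa [← unmark_inl, (unmark n e).injective.ne_iff])
      (by rwa [← unmark_inl, (unmark n e).injective.ne_iff])

open Classical in
-- Reindexing by `unmark n e` turns the sum for every choice of the edge `e` into the same sum over
-- graphs with a marked edge, whence the factor `E + 1`.
theorem sum_markedCond {M : Type*} [CommRing M] (b : ℕ) (σ : Perm (Fin n))
    (f : Perm (Flag E (n + 2)) → M) :
    (∑ τ : Perm (Flag (E + 1) n), if SurfaceCond τ (edgeFlip _ _) Sum.inr (E + 1) b σ then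
      ∑ e, f ((unmark n e).symm.permCongr τ) else 0) =
      (E + 1 : M) * ∑ τ : Perm (Flag E (n + 2)), if MarkedCond E b τ σ then f τ else 0 := by
  have h : ∀ τ : Perm (Flag (E + 1) n), (if SurfaceCond τ (edgeFlip _ _) Sum.inr (E + 1) b σ then
      ∑ e, f ((unmark n e).symm.permCongr τ) else 0) =
      ∑ e, if SurfaceCond τ (edgeFlip _ _) Sum.inr (E + 1) b σ then
        f ((unmark n e).symm.permCongr τ) else 0 := by
    intro τ
    split_ifs <;> simp
  simp only [h]
  rw [sum_comm]
  have h2 : ∀ e : Fin (E + 1), (∑ τ : Perm (Flag (E + 1) n),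
      if SurfaceCond τ (edgeFlip _ _) Sum.inr (E + 1) b σ then
        f ((unmark n e).symm.permCongr τ) else 0) =
      ∑ τ : Perm (Flag E (n + 2)), if MarkedCond E b τ σ then f τ else 0 := by
    intro e
    rw [← ((unmark n e).permCongr).sum_comp]
    refine sum_congr rfl fun τ _ => ?_
    refine if_congr (markedCond_iff e) ?_ rfl
    congr 1
    ext x
    simp
  simp only [h2, sum_const, card_univ, Fintype.card_fin, nsmul_eq_mul]
  push_cast
  rfl

end

end

section

variable {k : Type*} [Field k] {V : Type*} [AddCommGroup V] [Module k V]
  {𝒱 : ZMod 2 → Submodule k V}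

/-! ### Permutations that only move the distinguished points -/

section

variable {F L L' : Type*} {φ ψ : Perm F} {leg : L → F} {f σ : Perm L}

/-- Since `ψ` only moves points of `P`, it can affect only the first step of a path: the interior of
a path to the first hit lies outside `P`. -/
theorem FirstHit.mul {P : Set F} (hψ : ∀ x, x ∉ P → ψ x = x) {x y : F} (h : FirstHit φ P x y)
    {w : F} (hw : ψ w = x) : FirstHit (φ * ψ) P w y := by
  have e : (φ * ψ) w = φ x := by rw [Perm.mul_apply, hw]
  induction h generalizing w with
  | hit h => exact e ▸ FirstHit.hit (e ▸ h)
  | step h _ ih =>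
    refine FirstHit.step (e ▸ h) (e ▸ ih (hψ _ h) ?_)
    rw [Perm.mul_apply, hψ _ h]

theorem Induces.mul (hf : ∀ l, ψ (leg l) = leg (f l)) (hψ : ∀ x, x ∉ Set.range leg → ψ x = x)
    (h : Induces φ leg σ) : Induces (φ * ψ) leg (σ * f) := by
  refine ⟨fun x => ?_, fun i => ?_⟩
  · obtain ⟨i, hi⟩ := h.1 (ψ x)
    exact ⟨i, hi.mul hψ rfl⟩
  · exact (h.2 (f i)).mul hψ (hf i)

/-- Regluing at the legs may be carried out on the induced permutation `σ` instead of on `φ`. Both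
the contraction and the cutting of an edge are instances. -/
theorem Induces.mul_iff [Finite F] {leg' : L' → L} {σ' : Perm L'} (hl : Function.Injective leg)
    (hl' : Function.Injective leg') (hf : ∀ l, ψ (leg l) = leg (f l))
    (hψ : ∀ x, x ∉ Set.range leg → ψ x = x) (h : Induces φ leg σ) :
    Induces (φ * ψ) (leg ∘ leg') σ' ↔ Induces (σ * f) leg' σ' :=
  (h.mul hf hψ).trans_iff hl hl'

/-- A cycle of `φ` without legs would be untouched by `ψ` and would survive in the product as a
boundary component without legs. -/
theorem Induces.exists_of_mul [Finite F] {leg' : L' → L} {σ' : Perm L'}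
    (hl : Function.Injective leg) (hf : ∀ l, ψ (leg l) = leg (f l))
    (hψ : ∀ x, x ∉ Set.range leg → ψ x = x) (h : Induces (φ * ψ) (leg ∘ leg') σ') :
    ∃ σ, Induces φ leg σ := by
  have : Finite L := Finite.of_injective _ hl
  refine Induces.exists_of_meets hl fun x => ?_
  by_contra hx
  have h1 : Preserves φ {x | ∃ i, φ.SameCycle x (leg i)} := fun x => by
    simp only [Set.mem_ofPred_eq, Perm.sameCycle_apply_left]
  have h2 : Preserves ψ {x | ∃ i, φ.SameCycle x (leg i)} := fun x => by
    by_cases hx : x ∈ Set.range leg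
    · obtain ⟨l, rfl⟩ := hx
      rw [hf]
      exact iff_of_true ⟨_, .refl _ _⟩ ⟨_, .refl _ _⟩
    · rw [hψ x hx]
  obtain ⟨i, hi⟩ := h.1 x
  exact hx (((h1.mul h2).sameCycle hi.sameCycle).2 ⟨leg' i, .refl _ _⟩)

end

theorem numCycles_eq_of_sameCycle {F : Type*} {τ τ' : Perm F}
    (h : ∀ x y, τ.SameCycle x y ↔ τ'.SameCycle x y) : numCycles τ = numCycles τ' :=
  Nat.card_congr (Quotient.congr (Equiv.refl F) h)

theorem joined_iff_of_sameCycle {F : Type*} {τ τ' ψ : Perm F}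
    (h : ∀ x y, τ.SameCycle x y ↔ τ'.SameCycle x y) : Joined τ ψ ↔ Joined τ' ψ := by
  unfold Joined
  simp only [preserves_iff_sameCycle (φ := τ), preserves_iff_sameCycle (φ := τ'), h]

/-! ### Gluing at the vertices -/

/-- The extension of a permutation by the identity on two further letters. -/
def extendTwo {N : ℕ} (f : Perm (Fin N)) : Perm (Fin (N + 2)) :=
  (consTwo N).permCongr (sumCongr (Equiv.refl _) f)

section

variable {N n : ℕ} (f : Perm (Fin N))

@[simp] theorem extendTwo_zero : extendTwo f 0 = 0 := by simp [extendTwo]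
@[simp] theorem extendTwo_one : extendTwo f 1 = 1 := by simp [extendTwo]
@[simp] theorem extendTwo_succ (i : Fin N) : extendTwo f i.succ.succ = (f i).succ.succ := by
  simp [extendTwo]

theorem extendTwo_of_notMem {x : Fin (N + 2)} (hx : x ∉ Set.range fun i : Fin N => i.succ.succ) :
    extendTwo f x = x := by
  revert x
  rw [forall_fin_add_two]
  exact ⟨fun _ => extendTwo_zero f, fun _ => extendTwo_one f, fun i h => absurd ⟨i, rfl⟩ h⟩

theorem extendTwo_mul_swap : extendTwo f * swap 0 1 = swap 0 1 * extendTwo f := by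
  refine Equiv.ext ?_
  rw [forall_fin_add_two]
  have h : ∀ i : Fin N, swap 0 1 i.succ.succ = (i.succ.succ : Fin (N + 2)) := fun i =>
    swap_apply_of_ne_of_ne (by simp) (by simp [Fin.ext_iff])
  simp [h]

variable {f} {t t' : Perm (Fin (N + 2))} {r : Perm (Fin N)} {leg : Fin n → Fin N}
  {σ : Perm (Fin n)} {c b : ℕ}

theorem Glues.unique {r' : Perm (Fin N)} (h : Glues t r) (h' : Glues t r') : r = r' :=
  (glues_iff.1 h).unique succ_succ_injective (glues_iff.1 h')

/-- The transposition at the two letters to be glued commutes with the other edges. Gluing at the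
vertices first gives `r`, and the remaining edges `f` then act on the contracted graph. -/
theorem induces_extendTwo_iff (hleg : Function.Injective leg) (h : Glues t r) :
    Induces (t * (extendTwo f * swap 0 1)) (fun i => (leg i).succ.succ) σ ↔
      Induces (r * f) leg σ := by
  rw [extendTwo_mul_swap, ← mul_assoc]
  exact (glues_iff.1 h).mul_iff succ_succ_injective hleg (extendTwo_succ f)
    fun x hx => extendTwo_of_notMem f hx

theorem exists_glues (h : Induces (t * (extendTwo f * swap 0 1)) (fun i => (leg i).succ.succ) σ) :
    ∃ r, Glues t r := by
  rw [extendTwo_mul_swap, ← mul_assoc] at h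
  obtain ⟨r, hr⟩ := Induces.exists_of_mul (leg := fun i : Fin N => i.succ.succ)
    succ_succ_injective (extendTwo_succ f) (fun x hx => extendTwo_of_notMem f hx) h
  exact ⟨r, glues_iff.2 hr⟩

/-- Contracting an edge between two vertices does not affect connectedness: invariant sets of the
contracted graph are the traces of those of the original one. -/
theorem joined_extendTwo_iff (h : Glues t r) (h01 : ¬ t.SameCycle 0 1) :
    Joined t (extendTwo f * swap 0 1) ↔ Joined r f := by
  rw [glues_iff] at h
  have hmeet : ∀ x, ∃ i : Fin N, (t * swap 0 1).SameCycle x i.succ.succ := fun x => by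
    obtain ⟨i, hi⟩ := h.1 x
    exact ⟨i, hi.sameCycle⟩
  have hr : ∀ i j : Fin N, r.SameCycle i j ↔ (t * swap 0 1).SameCycle i.succ.succ j.succ.succ :=
    fun i j => h.sameCycle_iff succ_succ_injective
  have hs : swap (0 : Fin (N + 2)) 1 * swap 0 1 = 1 := swap_mul_self 0 1
  constructor
  · intro hJ
    refine ⟨(hmeet 0).nonempty, fun X h1 h2 h3 => ?_⟩
    -- The saturation of `X`: the cycles of the glued permutation that meet `X`. The two glued
    -- letters lie on one such cycle, because they came from different words.
    let Y : Set (Fin (N + 2)) := {x | ∃ i ∈ X, (t * swap 0 1).SameCycle x i.succ.succ}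
    have hY : ∀ i, i.succ.succ ∈ Y ↔ i ∈ X := fun i => by
      constructor
      · rintro ⟨j, hj, hij⟩
        exact (h1.sameCycle ((hr i j).2 hij)).2 hj
      · exact fun hi => ⟨i, hi, .refl _ _⟩
    have p1 : Preserves (t * swap 0 1) Y := fun x => by
      simp only [Y, Set.mem_ofPred_eq, Perm.sameCycle_apply_left]
    have p2 : Preserves (swap 0 1) Y := by
      refine preserves_swap ?_
      have h4 := sameCycle_mul_swap h01
      exact ⟨fun ⟨i, hi, h5⟩ => ⟨i, hi, h4.symm.trans h5⟩, fun ⟨i, hi, h5⟩ => ⟨i, hi, h4.trans h5⟩⟩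
    have p3 : Preserves (extendTwo f) Y := by
      unfold Preserves
      rw [forall_fin_add_two]
      simp only [extendTwo_zero, extendTwo_one, extendTwo_succ, hY, true_and]
      exact h2
    have p4 : Preserves t Y := by
      have := p1.mul p2
      rwa [mul_assoc, hs, mul_one] at this
    have := hJ.2 Y p4 (p3.mul p2) (by
      obtain ⟨x, hx⟩ := h3
      exact ⟨_, (hY x).2 hx⟩)
    exact Set.eq_univ_of_forall fun i => (hY i).1 (this ▸ Set.mem_univ _)
  · intro hJ
    refine ⟨⟨0⟩, fun Y h1 h2 h3 => ?_⟩
    have p2 : Preserves (swap 0 1) Y := by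
      refine preserves_swap ?_
      have := h2 0
      rw [Perm.mul_apply, swap_apply_left, extendTwo_one] at this
      exact this.symm
    have p1 := h1.mul p2
    have p3 : Preserves (extendTwo f) Y := by
      have := h2.mul p2
      rwa [mul_assoc, hs, mul_one] at this
    have := hJ.2 ((fun i : Fin N => i.succ.succ) ⁻¹' Y)
      (fun i => (p1.sameCycle (h.2 i).sameCycle).symm)
      (fun i => by
        have := p3 i.succ.succ
        rwa [extendTwo_succ] at this)
      (by
        obtain ⟨x, hx⟩ := h3
        obtain ⟨i, hi⟩ := hmeet x
        exact ⟨i, (p1.sameCycle hi).1 hx⟩)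
    refine Set.eq_univ_of_forall fun x => ?_
    obtain ⟨i, hi⟩ := hmeet x
    exact (p1.sameCycle hi).2 (show i ∈ (fun i : Fin N => i.succ.succ) ⁻¹' Y by
      rw [this]; exact Set.mem_univ i)

/-- The contraction removes one edge and one vertex, so the Euler characteristic is unchanged. -/
theorem surfaceCond_extendTwo_iff (hleg : Function.Injective leg) (h : Glues t r)
    (h01 : ¬ t.SameCycle 0 1) :
    SurfaceCond t (extendTwo f * swap 0 1) (fun i => (leg i).succ.succ) (c + 1) b σ ↔
      SurfaceCond r f leg c b σ := by
  have h1 := numCycles_mul_swap h01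
  have h2 := (glues_iff.1 h).numCycles_eq succ_succ_injective
  constructor
  · rintro ⟨h3, h4, h5⟩
    exact ⟨(joined_extendTwo_iff h h01).1 h3, by omega, (induces_extendTwo_iff hleg h).1 h5⟩
  · rintro ⟨h3, h4, h5⟩
    exact ⟨(joined_extendTwo_iff h h01).2 h3, by omega, (induces_extendTwo_iff hleg h).2 h5⟩

/-- When both glued letters are on one word, the partition into words is known from `r` and the set
of glued letters: that set together with the two letters is one word, the rest are words of `r`. -/
theorem sameCycle_iff_of_gluedLetters (h : Glues t r) (h01 : t.SameCycle 0 1) (h' : Glues t' r)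
    (h01' : t'.SameCycle 0 1) (hg : gluedLetters t = gluedLetters t') (x y : Fin (N + 2)) :
    t.SameCycle x y ↔ t'.SameCycle x y := by
  obtain ⟨τ, hτ⟩ := exists_extendWords h
  have h2 : ∃ τ', extendWords (gluedLetters t) r τ' = t' := by
    rw [hg]
    exact exists_extendWords h'
  obtain ⟨τ', hτ'⟩ := h2
  set T := gluedLetters t
  have key : ∀ {t : Perm (Fin (N + 2))} {τ : Perm (Fin (T.card + 2))}, extendWords T r τ = t →
      gluedLetters t = T → t.SameCycle 0 1 → ∀ i j, τ.SameCycle i j := by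
    intro t τ h1 h2 h3 i j
    rw [← h1] at h2 h3
    have h4 := (gluedLetters_extendWords r τ).1 h2
    have h5 := sameCycle_extendWords (T := T) r τ 0 1
    rw [glueEquiv_zero, glueEquiv_one] at h5
    have h6 : ∀ i, τ.SameCycle 0 i := fun i => (h4 i).elim id fun h => (h5.1 h3).trans h
    exact (h6 i).symm.trans (h6 j)
  have k1 := key hτ rfl h01
  have k2 := key hτ' hg.symm h01'
  rw [← hτ, ← hτ', extendWords, extendWords]
  obtain ⟨x, rfl⟩ := (glueEquiv T).surjective x
  obtain ⟨y, rfl⟩ := (glueEquiv T).surjective y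
  rw [sameCycle_permCongr, sameCycle_permCongr]
  obtain x | x := x <;> obtain y | y := y
  · rw [sameCycle_sumCongr_inl, sameCycle_sumCongr_inl]
    exact iff_of_true (k1 _ _) (k2 _ _)
  · exact iff_of_false not_sameCycle_sumCongr not_sameCycle_sumCongr
  · exact iff_of_false (fun h => not_sameCycle_sumCongr h.symm)
      fun h => not_sameCycle_sumCongr h.symm
  · rw [sameCycle_sumCongr_inr, sameCycle_sumCongr_inr]

/-- Loops with the same contracted arrangement and the same set of glued letters therefore yield the
same surface, so the surface condition can serve as the weight in `sum_glues_of_sameCycle`. -/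
theorem surfaceCond_iff_of_gluedLetters (hleg : Function.Injective leg) (h : Glues t r)
    (h01 : t.SameCycle 0 1) (h' : Glues t' r) (h01' : t'.SameCycle 0 1)
    (hg : gluedLetters t = gluedLetters t') :
    SurfaceCond t (extendTwo f * swap 0 1) (fun i => (leg i).succ.succ) c b σ ↔
      SurfaceCond t' (extendTwo f * swap 0 1) (fun i => (leg i).succ.succ) c b σ := by
  have h1 := sameCycle_iff_of_gluedLetters h h01 h' h01' hg
  have h2 := numCycles_eq_of_sameCycle h1
  have h3 := joined_iff_of_sameCycle (ψ := extendTwo f * swap 0 1) h1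
  have h4 := (induces_extendTwo_iff (f := f) (σ := σ) hleg h).trans
    (induces_extendTwo_iff hleg h').symm
  exact ⟨fun ⟨a, b, c⟩ => ⟨h3.1 a, h2 ▸ b, h4.1 c⟩, fun ⟨a, b, c⟩ => ⟨h3.2 a, h2 ▸ b, h4.2 c⟩⟩

end

section

variable [DirectSum.Decomposition 𝒱] [FiniteDimensional k V] [CharZero k] {β : OddScalarProduct 𝒱}
  {ι : Type*} [Fintype ι] {m : CyclicTensors 𝒱}

open Classical in
/-- The equation for `m` in the sum over the ways to contract two letters of `exp(m)`. -/
theorem sum_contract (hm : m.IsReduced) (u : HomogeneousBasis β ι) (I : OddSymmetry β)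
    (h : dualAction 𝒱 I.I m.functional + (2 : k)⁻¹ • bracket β m.functional m.functional = 0)
    (hΔ : laplacian β m.functional = 0) {N n : ℕ} (f : Perm (Fin N)) {leg : Fin n → Fin N}
    (hleg : Function.Injective leg) (c b : ℕ) (σ : Perm (Fin n)) {p : Fin N → ZMod 2}
    {x : Fin N → V} (hx : ∀ i, x i ∈ 𝒱 (p i)) :
    (∑ t : Perm (Fin (N + 2)), if SurfaceCond t (extendTwo f * swap 0 1)
      (fun i => (leg i).succ.succ) (c + 1) b σ then m.contract u t x else 0) =
    -2 * ∑ r : Perm (Fin N), if SurfaceCond r f leg c b σ then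
      dualAction 𝒱 I.I m.expFunctional N r x else 0 := by
  let C : Perm (Fin (N + 2)) → Prop := fun t => SurfaceCond t (extendTwo f * swap 0 1)
    (fun i => (leg i).succ.succ) (c + 1) b σ
  -- A gluing satisfying the surface condition has a unique result `r`; the sum is sorted by it.
  have h1 : ∀ t, (if C t then m.contract u t x else 0) =
      ∑ r, if Glues t r then if C t then m.contract u t x else 0 else 0 := by
    intro t
    by_cases hC : C t
    · obtain ⟨r, hr⟩ := exists_glues hC.boundary
      rw [sum_eq_single r, if_pos hr]
      · intro r' _ hne
        exact if_neg fun h' => hne (h'.unique hr)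
      · simp
    · simp only [if_neg hC, ite_self, sum_const_zero]
  rw [sum_congr rfl fun t _ => h1 t, sum_comm, mul_sum]
  refine sum_congr rfl fun r _ => ?_
  -- For ends on different words the condition passes to `r`. For a loop it is written with an
  -- existential, so that the coefficient visibly depends only on `gluedLetters t`.
  have h2 : ∀ t, (if Glues t r then if C t then m.contract u t x else 0 else 0) =
      (if SurfaceCond r f leg c b σ then
        (if Glues t r ∧ ¬ t.SameCycle 0 1 then m.contract u t x else 0) else 0) +
      if Glues t r ∧ t.SameCycle 0 1 then
        (if ∃ t', Glues t' r ∧ t'.SameCycle 0 1 ∧ gluedLetters t' = gluedLetters t ∧ C t' then 1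
          else 0) * m.contract u t x else 0 := by
    intro t
    by_cases hG : Glues t r
    · by_cases h01 : t.SameCycle 0 1
      · rw [if_pos hG, if_neg (show ¬(Glues t r ∧ ¬t.SameCycle 0 1) from fun h' => h'.2 h01),
          ite_self, zero_add, if_pos (show Glues t r ∧ t.SameCycle 0 1 from ⟨hG, h01⟩)]
        have h3 : (∃ t', Glues t' r ∧ t'.SameCycle 0 1 ∧ gluedLetters t' = gluedLetters t ∧ C t') ↔
            C t := by
          constructor
          · rintro ⟨t', h4, h5, h6, h7⟩
            exact (surfaceCond_iff_of_gluedLetters hleg h4 h5 hG h01 h6).1 h7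
          · exact fun hC => ⟨t, hG, h01, rfl, hC⟩
        simp only [h3, ite_mul, one_mul, zero_mul]
      · rw [if_pos hG, if_pos (show Glues t r ∧ ¬t.SameCycle 0 1 from ⟨hG, h01⟩),
          if_neg (show ¬(Glues t r ∧ t.SameCycle 0 1) from fun h' => h01 h'.2), add_zero]
        exact if_congr (surfaceCond_extendTwo_iff hleg hG h01) rfl rfl
    · rw [if_neg hG, if_neg (show ¬(Glues t r ∧ ¬t.SameCycle 0 1) from fun h' => hG h'.1),
        if_neg (show ¬(Glues t r ∧ t.SameCycle 0 1) from fun h' => hG h'.1), ite_self, add_zero]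
  rw [sum_congr rfl fun t _ => h2 t, sum_add_distrib,
    CyclicTensors.sum_glues_of_sameCycle hm u hΔ r hx fun T =>
      if ∃ t', Glues t' r ∧ t'.SameCycle 0 1 ∧ gluedLetters t' = T ∧ C t' then 1 else 0, add_zero]
  by_cases hr : SurfaceCond r f leg c b σ
  · simp only [if_pos hr]
    exact CyclicTensors.sum_glues_of_not_sameCycle hm u I h r hx
  · simp only [if_neg hr, sum_const_zero, mul_zero]

end

/-! ### Numbering of the flags that starts with the first two legs -/

def legsFirst (E n : ℕ) : Flag E (n + 2) ≃ Fin (E * 2 + n + 2) :=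
  ((sumCongr (Equiv.refl _) (consTwo n).symm).trans (sumAssoc _ _ _).symm).trans
    (((sumCongr (sumComm _ _) (Equiv.refl _)).trans (sumAssoc _ _ _)).trans
      ((sumCongr (Equiv.refl _) (flagNumbering E n)).trans (consTwo _)))

section

variable {E n : ℕ}

@[simp] theorem legsFirst_inl (x : Fin E × Fin 2) :
    legsFirst E n (Sum.inl x) = (flagNumbering E n (Sum.inl x)).succ.succ := by
  simp [legsFirst]
@[simp] theorem legsFirst_zero : legsFirst E n (Sum.inr 0) = 0 := by simp [legsFirst]
@[simp] theorem legsFirst_one : legsFirst E n (Sum.inr 1) = 1 := by simp [legsFirst]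
@[simp] theorem legsFirst_succ (i : Fin n) :
    legsFirst E n (Sum.inr i.succ.succ) = (flagNumbering E n (Sum.inr i)).succ.succ := by
  simp [legsFirst]

theorem isStandard_legsFirst (E n : ℕ) : IsStandard (legsFirst E n) where
  lt x := by simp [flagNumbering_inl]
  pairRank x z hz0 hz1 := by
    have h := (isStandard_flagNumbering E n).pairRank x
    obtain z | i := z
    · have := h (Sum.inl z) (by simpa using hz0) (by simpa using hz1)
      simpa using this
    · revert i
      rw [forall_fin_add_two]
      refine ⟨by simp, by simp, fun i _ _ => ?_⟩
      have := h (Sum.inr i) (by simp) (by simp)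
      simpa using this

theorem legsFirst_permCongr_markedFlip : (legsFirst E n).permCongr (markedFlip E n) =
    extendTwo ((flagNumbering E n).permCongr (edgeFlip _ _)) * swap 0 1 := by
  refine Equiv.ext fun x => ?_
  obtain ⟨x, rfl⟩ := (legsFirst E n).surjective x
  have h : ∀ i : Fin (E * 2 + n), swap 0 1 i.succ.succ = (i.succ.succ : Fin (E * 2 + n + 2)) :=
    fun i => swap_apply_of_ne_of_ne (by simp) (by simp [Fin.ext_iff])
  rw [permCongr_apply, symm_apply_apply, markedFlip, Perm.mul_apply, Perm.mul_apply]
  obtain ⟨x, s⟩ | i := x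
  · rw [swap_apply_of_ne_of_ne (by simp) (by simp), legsFirst_inl, h, extendTwo_succ,
      permCongr_apply, symm_apply_apply]
    exact legsFirst_inl _
  · revert i
    rw [forall_fin_add_two]
    refine ⟨?_, ?_, fun i => ?_⟩
    · rw [swap_apply_left, legsFirst_zero, swap_apply_left, extendTwo_one]
      exact legsFirst_one
    · rw [swap_apply_right, legsFirst_one, swap_apply_right, extendTwo_zero]
      exact legsFirst_zero
    · rw [swap_apply_of_ne_of_ne (by simp) (by simp [Fin.ext_iff]), legsFirst_succ, h,
        extendTwo_succ, permCongr_apply, symm_apply_apply]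
      exact legsFirst_succ i

theorem markedCond_iff_legsFirst {b : ℕ} {σ : Perm (Fin n)} {τ : Perm (Flag E (n + 2))} :
    SurfaceCond ((legsFirst E n).permCongr τ)
      (extendTwo ((flagNumbering E n).permCongr (edgeFlip _ _)) * swap 0 1)
      (fun i => (flagNumbering E n (Sum.inr i)).succ.succ) (E + 1) b σ ↔ MarkedCond E b τ σ := by
  have := SurfaceCond.congr_iff (legsFirst E n) (Equiv.refl (Fin n)) (τ := τ)
    (ψ := markedFlip E n) (leg := fun i => Sum.inr i.succ.succ) (c := E + 1) (b := b) (σ := σ)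
  rw [legsFirst_permCongr_markedFlip] at this
  have e : legsFirst E n ∘ (fun i : Fin n => Sum.inr i.succ.succ) ∘ (Equiv.refl (Fin n)).symm =
      fun i => (flagNumbering E n (Sum.inr i)).succ.succ := funext fun i => legsFirst_succ i
  rw [e] at this
  exact this

theorem surfaceCond_flagNumbering {b c : ℕ} {σ : Perm (Fin n)} {τ : Perm (Flag E n)} :
    SurfaceCond ((flagNumbering E n).permCongr τ) ((flagNumbering E n).permCongr (edgeFlip _ _))
      (fun i => flagNumbering E n (Sum.inr i)) c b σ ↔
      SurfaceCond τ (edgeFlip _ _) Sum.inr c b σ :=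
  SurfaceCond.congr_iff (flagNumbering E n) (Equiv.refl (Fin n))

variable [DirectSum.Decomposition 𝒱] {β : OddScalarProduct 𝒱}
  {ι : Type*} [Fintype ι] {m : CyclicTensors 𝒱}

/-- With the identity at the marked edge its two letters form the tensor of `β` and can be placed
first. The legs keep their relative order, so no sign arises, and what remains is a contraction of
`exp(m)`. -/
theorem markedTerm_one_eq (hm : m.IsReduced) (u : HomogeneousBasis β ι) {H : Module.End k V}
    (hH : ∀ ε, ∀ a ∈ 𝒱 ε, H a ∈ 𝒱 (ε + 1)) (τ : Perm (Flag E (n + 2))) {p : Fin n → ZMod 2}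
    {a : Fin n → V} (ha : ∀ i, a i ∈ 𝒱 (p i)) : markedTerm m u H 1 τ a =
      ∑ j : Fin E → ι, m.contract u ((legsFirst E n).permCongr τ)
        (edgeLetters u H j a ∘ (flagNumbering E n).symm) := by
  unfold markedTerm CyclicTensors.contract
  rw [sum_comm]
  refine sum_congr rfl fun i _ => ?_
  rw [Module.End.one_apply, contractEdges_reorder hm hH (isStandard_flagNumbering E (n + 2))
    (isStandard_legsFirst E n) τ (cons_mem (cons_mem ha (u.vec_mem i)) (u.dual_mem i)),
    reorderSign_eq_one, one_mul]
  · refine sum_congr rfl fun j _ => ?_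
    unfold evalOn
    congr 1
    funext x
    obtain ⟨x, rfl⟩ := (legsFirst E n).surjective x
    rw [Function.comp_apply, symm_apply_apply]
    obtain x | i := x
    · rw [legsFirst_inl]
      simp [edgeLetters]
    · revert i
      rw [forall_fin_add_two]
      refine ⟨?_, ?_, fun i => ?_⟩
      · rw [legsFirst_zero]; rfl
      · rw [legsFirst_one]; rfl
      · rw [legsFirst_succ]
        simp [edgeLetters]
  · have hmono : ∀ x y : Fin (n + 2), x < y →
        (legsFirst E n (Sum.inr x) : ℕ) < legsFirst E n (Sum.inr y) := by
      simp only [forall_fin_add_two, legsFirst_zero, legsFirst_one, legsFirst_succ,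
        flagNumbering_inr, Fin.lt_def, Fin.val_succ, Fin.val_zero, Fin.val_one]
      refine ⟨⟨?_, ?_, ?_⟩, ⟨?_, ?_, ?_⟩, fun i => ⟨?_, ?_, ?_⟩⟩ <;> intros <;> omega
    intro x y hxy h
    refine lt_asymm h (hmono x y ?_)
    simpa [flagNumbering_inr] using hxy

open Classical in
/-- The contributions of the identity on a marked edge cancel those of the vertices. -/
theorem sum_markedTerm_one [FiniteDimensional k V] [CharZero k] (hm : m.IsReduced)
    (u : HomogeneousBasis β ι) (I : OddSymmetry β)
    (h : dualAction 𝒱 I.I m.functional + (2 : k)⁻¹ • bracket β m.functional m.functional = 0)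
    (hΔ : laplacian β m.functional = 0) {H : Module.End k V}
    (hH : ∀ ε, ∀ a ∈ 𝒱 ε, H a ∈ 𝒱 (ε + 1)) (E b : ℕ) (σ : Perm (Fin n)) {p : Fin n → ZMod 2}
    {a : Fin n → V} (ha : ∀ i, a i ∈ 𝒱 (p i)) :
    (∑ τ : Perm (Flag E (n + 2)), if MarkedCond E b τ σ then markedTerm m u H 1 τ a else 0) =
      -2 * ∑ τ : Perm (Flag E n), if SurfaceCond τ (edgeFlip _ _) Sum.inr E b σ then
        vertexTerm m u H I.I τ a else 0 := by
  have h1 : ∀ τ : Perm (Flag E (n + 2)),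
      (if MarkedCond E b τ σ then markedTerm m u H 1 τ a else 0) = ∑ j : Fin E → ι,
        if SurfaceCond ((legsFirst E n).permCongr τ)
          (extendTwo ((flagNumbering E n).permCongr (edgeFlip _ _)) * swap 0 1)
          (fun i => (flagNumbering E n (Sum.inr i)).succ.succ) (E + 1) b σ then
        m.contract u ((legsFirst E n).permCongr τ)
          (edgeLetters u H j a ∘ (flagNumbering E n).symm) else 0 := by
    intro τ
    simp only [markedCond_iff_legsFirst, markedTerm_one_eq hm u hH τ ha]
    split_ifs <;> simp
  have h2 : ∀ τ : Perm (Flag E n), (if SurfaceCond τ (edgeFlip _ _) Sum.inr E b σ then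
        vertexTerm m u H I.I τ a else 0) = ∑ j : Fin E → ι,
        if SurfaceCond ((flagNumbering E n).permCongr τ)
          ((flagNumbering E n).permCongr (edgeFlip _ _))
          (fun i => flagNumbering E n (Sum.inr i)) E b σ then
        dualAction 𝒱 I.I m.expFunctional (E * 2 + n) ((flagNumbering E n).permCongr τ)
          (edgeLetters u H j a ∘ (flagNumbering E n).symm) else 0 := by
    intro τ
    simp only [surfaceCond_flagNumbering]
    split_ifs
    · rfl
    · simp
  rw [sum_congr rfl fun τ _ => h1 τ, sum_congr rfl fun τ _ => h2 τ, sum_comm,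
    sum_comm (s := (univ : Finset (Perm (Flag E n)))), mul_sum]
  refine sum_congr rfl fun j _ => ?_
  have h3 := sum_contract hm u I h hΔ ((flagNumbering E n).permCongr (edgeFlip _ _))
    (leg := fun i => flagNumbering E n (Sum.inr i))
    ((flagNumbering E n).injective.comp Sum.inr_injective) E b σ
    (p := edgeParity u j p ∘ (flagNumbering E n).symm)
    (x := edgeLetters u H j a ∘ (flagNumbering E n).symm) fun i => edgeLetters_mem u hH j ha _
  rw [← (legsFirst E n).permCongr.sum_comp, ← (flagNumbering E n).permCongr.sum_comp] at h3
  exact h3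

end

end

section

/-! ### Connectedness after a swap of two fixed points -/

/-- A connected graph with `E` edges has at most `E + 1` vertices. -/
theorem Joined.numCycles_le {E L : Type*} [Fintype E] [Finite L] {τ : Perm ((E × Fin 2) ⊕ L)}
    (h : Joined τ (edgeFlip E L)) : numCycles τ ≤ Fintype.card E + 1 := by
  classical
  let Q := Quotient (Perm.SameCycle.setoid τ)
  have : Fintype Q := Fintype.ofFinite _
  let q : (E × Fin 2) ⊕ L → Q := Quotient.mk _
  -- The coboundary from functions on vertices to functions on edges. Connectedness makes its kernel
  -- at most the constants, and rank-nullity bounds the number of vertices.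
  let D : (Q → ℚ) →ₗ[ℚ] (E → ℚ) := LinearMap.pi fun e =>
    (LinearMap.proj (q (Sum.inl (e, 0))) : (Q → ℚ) →ₗ[ℚ] ℚ) - LinearMap.proj (q (Sum.inl (e, 1)))
  obtain ⟨x₀⟩ := h.1
  have hker : LinearMap.ker D ≤ Submodule.span ℚ {fun _ => 1} := by
    intro f hf
    have hf' : ∀ e, f (q (Sum.inl (e, 0))) = f (q (Sum.inl (e, 1))) := fun e => by
      have := congrFun (LinearMap.mem_ker.1 hf) e
      simpa [D, sub_eq_zero] using this
    have hX := h.2 {x | f (q x) = f (q x₀)} (fun x => by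
      have : q (τ x) = q x :=
        Quotient.sound (show τ.SameCycle (τ x) x from Perm.sameCycle_apply_left.2 (.refl _ _))
      simp only [Set.mem_ofPred_eq, this]) (fun x => by
      obtain ⟨e, s⟩ | i := x
      · have : f (q (edgeFlip E L (Sum.inl (e, s)))) = f (q (Sum.inl (e, s))) := by
          fin_cases s
          · exact (hf' e).symm
          · exact hf' e
        simp only [Set.mem_ofPred_eq, this]
      · rfl) ⟨x₀, rfl⟩
    refine Submodule.mem_span_singleton.2 ⟨f (q x₀), funext fun y => ?_⟩
    obtain ⟨x, rfl⟩ := Quotient.exists_rep y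
    have : x ∈ {x | f (q x) = f (q x₀)} := hX ▸ Set.mem_univ x
    simpa using this.symm
  have h1 := D.finrank_range_add_finrank_ker
  have h2 := (Submodule.finrank_mono hker).trans (finrank_span_le_card (R := ℚ) _)
  have h3 := Submodule.finrank_le (LinearMap.range D)
  simp only [Module.finrank_fintype_fun_eq_card, Set.toFinset_singleton, card_singleton] at h1 h2 h3
  have h4 : numCycles τ = Fintype.card Q := Nat.card_eq_fintype_card
  omega

section

variable {F : Type*} [DecidableEq F] {τ f : Perm F} {a b : F}

/-- As `f` fixes `b`, the product sends `a` to `b`, so an invariant set cannot separate them. -/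
theorem preserves_mul_swap_iff (hb : f b = b) {X : Set F} :
    Preserves (f * swap a b) X ↔ Preserves f X ∧ (a ∈ X ↔ b ∈ X) := by
  constructor
  · intro h
    have h1 : a ∈ X ↔ b ∈ X := by
      have := h a
      rw [Perm.mul_apply, swap_apply_left, hb] at this
      exact this.symm
    have h2 := h.mul (preserves_swap h1)
    rw [mul_assoc, swap_mul_self, mul_one] at h2
    exact ⟨h2, h1⟩
  · exact fun h => h.1.mul (preserves_swap h.2)

theorem Joined.mul_swap (hb : f b = b) (h : Joined τ f) :
    Joined τ (f * swap a b) :=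
  ⟨h.1, fun X h1 h2 h3 => h.2 X h1 ((preserves_mul_swap_iff hb).1 h2).1 h3⟩

/-- If the graph is disconnected without the edge, a proper nonempty invariant set exists; it must
separate the ends of the edge, or it would be invariant with the edge too. A complement is taken if
needed. -/
theorem Joined.exists_preserves (hb : f b = b) (h : Joined τ (f * swap a b))
    (h' : ¬ Joined τ f) : ∃ X : Set F, Preserves τ X ∧ Preserves f X ∧ a ∈ X ∧ b ∉ X := by
  have h1 : ∃ X : Set F, Preserves τ X ∧ Preserves f X ∧ X.Nonempty ∧ X ≠ Set.univ := by
    by_contra hc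
    exact h' ⟨h.1, fun X h1 h2 h3 => by_contra fun h4 => hc ⟨X, h1, h2, h3, h4⟩⟩
  obtain ⟨X, h1, h2, h3, h4⟩ := h1
  have h5 : ¬ (a ∈ X ↔ b ∈ X) := fun hc =>
    h4 (h.2 X h1 ((preserves_mul_swap_iff hb).2 ⟨h2, hc⟩) h3)
  by_cases haX : a ∈ X
  · exact ⟨X, h1, h2, haX, fun hbX => h5 (iff_of_true haX hbX)⟩
  · exact ⟨Xᶜ, h1.compl, h2.compl, haX, fun hbX => h5 (iff_of_false haX hbX)⟩

end

section

variable {F₁ F₂ : Type*} {τ₁ f₁ : Perm F₁} {τ₂ f₂ : Perm F₂}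

theorem preserves_sumCongr {X : Set (F₁ ⊕ F₂)} : Preserves (sumCongr τ₁ τ₂) X ↔
    Preserves τ₁ (Sum.inl ⁻¹' X) ∧ Preserves τ₂ (Sum.inr ⁻¹' X) := Sum.forall

theorem not_joined_sumCongr [Nonempty F₁] [Nonempty F₂] :
    ¬ Joined (sumCongr τ₁ τ₂ : Perm (F₁ ⊕ F₂)) (sumCongr f₁ f₂) := by
  intro h
  obtain ⟨x⟩ := ‹Nonempty F₁›
  obtain ⟨y⟩ := ‹Nonempty F₂›
  have h1 : ∀ (σ₁ : Perm F₁) (σ₂ : Perm F₂), Preserves (sumCongr σ₁ σ₂) (Set.range Sum.inl) :=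
    fun σ₁ σ₂ => preserves_sumCongr.2 ⟨fun z => by simp, fun z => by simp⟩
  have h2 : Sum.inr y ∈ Set.range (Sum.inl : F₁ → F₁ ⊕ F₂) :=
    h.2 _ (h1 _ _) (h1 _ _) ⟨_, x, rfl⟩ ▸ Set.mem_univ _
  simp at h2

/-- An invariant set of one part is extended by all or none of the other part, according to whether
it contains the end of the joining edge. -/
theorem joined_sumCongr_mul_swap [DecidableEq F₁] [DecidableEq F₂] {a : F₁} {b : F₂}
    (hb : f₂ b = b) :
    Joined (sumCongr τ₁ τ₂ : Perm (F₁ ⊕ F₂)) (sumCongr f₁ f₂ * swap (Sum.inl a) (Sum.inr b)) ↔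
      Joined τ₁ f₁ ∧ Joined τ₂ f₂ := by
  have hiff : ∀ X : Set (F₁ ⊕ F₂), Preserves (sumCongr f₁ f₂ * swap (Sum.inl a) (Sum.inr b)) X ↔
      Preserves (sumCongr f₁ f₂) X ∧ (Sum.inl a ∈ X ↔ Sum.inr b ∈ X) := fun X =>
    preserves_mul_swap_iff (congrArg Sum.inr hb)
  constructor
  · intro h
    constructor
    · refine ⟨⟨a⟩, fun Z h1 h2 ⟨z, hz⟩ => ?_⟩
      let Y : Set (F₁ ⊕ F₂) := {x | Sum.elim (· ∈ Z) (fun _ => a ∈ Z) x}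
      have hY := h.2 Y (preserves_sumCongr.2 ⟨h1, fun _ => Iff.rfl⟩)
        ((hiff Y).2 ⟨preserves_sumCongr.2 ⟨h2, fun _ => Iff.rfl⟩, Iff.rfl⟩) ⟨Sum.inl z, hz⟩
      exact Set.eq_univ_of_forall fun x => show Sum.inl x ∈ Y from hY ▸ Set.mem_univ _
    · refine ⟨⟨b⟩, fun Z h1 h2 ⟨z, hz⟩ => ?_⟩
      let Y : Set (F₁ ⊕ F₂) := {x | Sum.elim (fun _ => b ∈ Z) (· ∈ Z) x}
      have hY := h.2 Y (preserves_sumCongr.2 ⟨fun _ => Iff.rfl, h1⟩)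
        ((hiff Y).2 ⟨preserves_sumCongr.2 ⟨fun _ => Iff.rfl, h2⟩, Iff.rfl⟩) ⟨Sum.inr z, hz⟩
      exact Set.eq_univ_of_forall fun x => show Sum.inr x ∈ Y from hY ▸ Set.mem_univ _
  · rintro ⟨h1, h2⟩
    refine ⟨⟨Sum.inl a⟩, fun X h3 h4 hX => ?_⟩
    rw [hiff] at h4
    obtain ⟨h4, h5⟩ := h4
    rw [preserves_sumCongr] at h3 h4
    have k1 := h1.2 _ h3.1 h4.1
    have k2 := h2.2 _ h3.2 h4.2
    have k3 : Sum.inl a ∈ X := by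
      obtain ⟨x | y, hx⟩ := hX
      · exact show a ∈ Sum.inl ⁻¹' X from k1 ⟨x, hx⟩ ▸ Set.mem_univ _
      · exact h5.2 (show b ∈ Sum.inr ⁻¹' X from k2 ⟨y, hx⟩ ▸ Set.mem_univ _)
    refine Set.eq_univ_of_forall (Sum.forall.2 ⟨fun x => ?_, fun y => ?_⟩)
    · exact show x ∈ Sum.inl ⁻¹' X from k1 ⟨a, k3⟩ ▸ Set.mem_univ _
    · exact show y ∈ Sum.inr ⁻¹' X from k2 ⟨b, h5.1 k3⟩ ▸ Set.mem_univ _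

end

/-! ### Graphs with two parts -/

section

variable {E N : ℕ} (S : Finset (Fin E)) (T : Finset (Fin N))

/-- The flags of the edges in `S` and of the legs in `T`, and the other flags. -/
def splitFlags : Flag S.card T.card ⊕ Flag Sᶜ.card Tᶜ.card ≃ Flag E N :=
  (sumSumSumComm _ _ _ _).trans (sumCongr ((sumProdDistrib _ _ _).symm.trans
    (prodCongr (splitEquiv S) (Equiv.refl _))) (splitEquiv T))

@[simp] theorem splitFlags_inl_inl (x : Fin S.card) (s : Fin 2) :
    splitFlags S T (Sum.inl (Sum.inl (x, s))) = Sum.inl (splitEquiv S (Sum.inl x), s) := rfl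
@[simp] theorem splitFlags_inl_inr (i : Fin T.card) :
    splitFlags S T (Sum.inl (Sum.inr i)) = Sum.inr (splitEquiv T (Sum.inl i)) := rfl
@[simp] theorem splitFlags_inr_inl (x : Fin Sᶜ.card) (s : Fin 2) :
    splitFlags S T (Sum.inr (Sum.inl (x, s))) = Sum.inl (splitEquiv S (Sum.inr x), s) := rfl
@[simp] theorem splitFlags_inr_inr (i : Fin Tᶜ.card) :
    splitFlags S T (Sum.inr (Sum.inr i)) = Sum.inr (splitEquiv T (Sum.inr i)) := rfl

/-- The set of the flags of the edges in `S` and of the legs in `T`. -/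
def flagSet : Set (Flag E N) := {x | Sum.elim (fun y => y.1 ∈ S) (· ∈ T) x}

theorem splitFlags_inl_mem (x : Flag S.card T.card) :
    splitFlags S T (Sum.inl x) ∈ flagSet S T := by
  obtain ⟨x, s⟩ | i := x
  · exact splitEquiv_inl_mem S x
  · exact splitEquiv_inl_mem T i

theorem splitFlags_inr_notMem (x : Flag Sᶜ.card Tᶜ.card) :
    splitFlags S T (Sum.inr x) ∉ flagSet S T := by
  obtain ⟨x, s⟩ | i := x
  · exact splitEquiv_inr_notMem S x
  · exact splitEquiv_inr_notMem T i

variable {S T}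

theorem flagSet_injective {S' : Finset (Fin E)} {T' : Finset (Fin N)}
    (h : flagSet S T = flagSet S' T') : S = S' ∧ T = T' :=
  ⟨Finset.ext fun x => (Set.ext_iff.1 h) (Sum.inl (x, 0)),
    Finset.ext fun i => (Set.ext_iff.1 h) (Sum.inr i)⟩

theorem splitFlags_permCongr_edgeFlip :
    (splitFlags S T).permCongr (sumCongr (edgeFlip _ _) (edgeFlip _ _)) =
      edgeFlip (Fin E) (Fin N) := by
  refine Equiv.ext fun x => ?_
  obtain ⟨x, rfl⟩ := (splitFlags S T).surjective x
  rw [permCongr_apply, symm_apply_apply]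
  obtain (x | i) | (x | i) := x <;> rfl

/-- The ribbon graph with the given parts. -/
def joinGraphs (S : Finset (Fin E)) (T : Finset (Fin N)) (τ₁ : Perm (Flag S.card T.card))
    (τ₂ : Perm (Flag Sᶜ.card Tᶜ.card)) : Perm (Flag E N) :=
  (splitFlags S T).permCongr (sumCongr τ₁ τ₂)

/-- A set invariant under the flip contains both halves of an edge or neither, so it is given by a
set of edges and a set of legs. -/
theorem exists_joinGraphs {τ : Perm (Flag E N)} {X : Set (Flag E N)} (h : Preserves τ X)
    (h' : Preserves (edgeFlip _ _) X) :
    ∃ S T, X = flagSet S T ∧ ∃ τ₁ τ₂, joinGraphs S T τ₁ τ₂ = τ := by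
  classical
  let S : Finset (Fin E) := univ.filter fun x => Sum.inl (x, 0) ∈ X
  let T : Finset (Fin N) := univ.filter fun i => Sum.inr i ∈ X
  have hX : X = flagSet S T := by
    ext (⟨x, s⟩ | i)
    · have h1 : x ∈ S ↔ Sum.inl (x, 0) ∈ X := by simp [S]
      change _ ↔ x ∈ S
      rw [h1]
      fin_cases s
      · rfl
      · exact h' (Sum.inl (x, 0))
    · change _ ↔ i ∈ T
      simp [T]
  refine ⟨S, T, hX, ?_⟩
  have h1 : (splitFlags S T).symm.permCongr τ ∈ (Perm.sumCongrHom _ _).range := by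
    refine Perm.mem_sumCongrHom_range_of_perm_mapsTo_inl ?_
    rintro _ ⟨x, rfl⟩
    obtain ⟨y | y, hy⟩ : ∃ y, y = (splitFlags S T).symm.permCongr τ (Sum.inl x) := ⟨_, rfl⟩
    · exact ⟨y, hy⟩
    · rw [permCongr_apply, symm_symm, eq_symm_apply] at hy
      refine absurd ?_ (splitFlags_inr_notMem S T y)
      rw [hy, ← hX, h, hX]
      exact splitFlags_inl_mem S T x
  obtain ⟨⟨τ₁, τ₂⟩, h2⟩ := h1
  refine ⟨τ₁, τ₂, ?_⟩
  change sumCongr τ₁ τ₂ = _ at h2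
  rw [joinGraphs, h2]
  ext x
  simp [permCongr_apply]

theorem preserves_joinGraphs (τ₁ : Perm (Flag S.card T.card)) (τ₂ : Perm (Flag Sᶜ.card Tᶜ.card)) :
    Preserves (joinGraphs S T τ₁ τ₂) (flagSet S T) := by
  refine (Preserves.congr_iff _).2 (preserves_sumCongr.2 ⟨fun x => ?_, fun x => ?_⟩)
  · exact iff_of_true (splitFlags_inl_mem S T _) (splitFlags_inl_mem S T _)
  · exact iff_of_false (splitFlags_inr_notMem S T _) (splitFlags_inr_notMem S T _)

theorem preserves_edgeFlip_flagSet : Preserves (edgeFlip _ _) (flagSet S T) := by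
  rw [← splitFlags_permCongr_edgeFlip (S := S) (T := T)]
  exact preserves_joinGraphs _ _

theorem flagSet_subset {τ₁ : Perm (Flag S.card T.card)} {τ₂ : Perm (Flag Sᶜ.card Tᶜ.card)}
    (h : Joined τ₁ (edgeFlip _ _)) {X : Set (Flag E N)} (h1 : Preserves (joinGraphs S T τ₁ τ₂) X)
    (h2 : Preserves (edgeFlip _ _) X) {i : Fin N} (hi : i ∈ T) (hX : Sum.inr i ∈ X) :
    flagSet S T ⊆ X := by
  rw [joinGraphs, Preserves.congr_iff, preserves_sumCongr] at h1
  rw [← splitFlags_permCongr_edgeFlip (S := S) (T := T), Preserves.congr_iff,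
    preserves_sumCongr] at h2
  obtain ⟨j, rfl⟩ := exists_splitEquiv_inl hi
  have h3 := h.2 _ h1.1 h2.1 ⟨Sum.inr j, hX⟩
  intro x hx
  obtain ⟨x | x, rfl⟩ := (splitFlags S T).surjective x
  · exact show x ∈ Sum.inl ⁻¹' (splitFlags S T ⁻¹' X) from h3 ▸ Set.mem_univ _
  · exact absurd hx (splitFlags_inr_notMem S T x)

/-- The connected part containing the leg `i` is the smallest invariant set containing it, so the
graph determines the decomposition. -/
theorem joinGraphs_injective {S' : Finset (Fin E)} {T' : Finset (Fin N)}
    {τ₁ : Perm (Flag S.card T.card)} {τ₂ : Perm (Flag Sᶜ.card Tᶜ.card)}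
    {τ₁' : Perm (Flag S'.card T'.card)} {τ₂' : Perm (Flag S'ᶜ.card T'ᶜ.card)}
    (h : Joined τ₁ (edgeFlip _ _)) (h' : Joined τ₁' (edgeFlip _ _)) {i : Fin N} (hi : i ∈ T)
    (hi' : i ∈ T') (heq : joinGraphs S T τ₁ τ₂ = joinGraphs S' T' τ₁' τ₂') : S = S' ∧ T = T' := by
  refine flagSet_injective (Set.Subset.antisymm ?_ ?_)
  · exact flagSet_subset h (by rw [heq]; exact preserves_joinGraphs _ _)
      preserves_edgeFlip_flagSet hi hi'
  · exact flagSet_subset h' (by rw [← heq]; exact preserves_joinGraphs _ _)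
      preserves_edgeFlip_flagSet hi' hi

theorem numCycles_joinGraphs (τ₁ : Perm (Flag S.card T.card)) (τ₂ : Perm (Flag Sᶜ.card Tᶜ.card)) :
    numCycles (joinGraphs S T τ₁ τ₂) = numCycles τ₁ + numCycles τ₂ := by
  rw [joinGraphs, numCycles_congr, numCycles_sumCongr]

theorem joinGraphs_mul_edgeFlip (τ₁ : Perm (Flag S.card T.card))
    (τ₂ : Perm (Flag Sᶜ.card Tᶜ.card)) : joinGraphs S T τ₁ τ₂ * edgeFlip _ _ =
      joinGraphs S T (τ₁ * edgeFlip _ _) (τ₂ * edgeFlip _ _) := by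
  rw [joinGraphs, ← splitFlags_permCongr_edgeFlip (S := S) (T := T), ← permCongr_mul,
    Perm.sumCongr_mul, joinGraphs]

theorem induces_joinGraphs {τ₁ : Perm (Flag S.card T.card)} {τ₂ : Perm (Flag Sᶜ.card Tᶜ.card)}
    {τ : Perm (Fin N)} : Induces (joinGraphs S T τ₁ τ₂ * edgeFlip _ _) Sum.inr τ ↔
      IsUnionOfWords τ T ∧ Induces (τ₁ * edgeFlip _ _) Sum.inr (restrictWords τ T) ∧
        Induces (τ₂ * edgeFlip _ _) Sum.inr (restrictWords τ Tᶜ) := by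
  have key : ∀ (σ₁ : Perm (Fin T.card)) (σ₂ : Perm (Fin Tᶜ.card)),
      Induces (joinGraphs S T τ₁ τ₂ * edgeFlip _ _) Sum.inr
        ((splitEquiv T).permCongr (sumCongr σ₁ σ₂)) ↔
      Induces (τ₁ * edgeFlip _ _) Sum.inr σ₁ ∧ Induces (τ₂ * edgeFlip _ _) Sum.inr σ₂ := by
    intro σ₁ σ₂
    have h1 := Induces.congr_iff (splitFlags S T) (splitEquiv T)
      (φ := sumCongr (τ₁ * edgeFlip _ _) (τ₂ * edgeFlip _ _)) (leg := Sum.map Sum.inr Sum.inr)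
      (σ := sumCongr σ₁ σ₂)
    rw [Induces.sumCongr_iff] at h1
    rw [joinGraphs_mul_edgeFlip, ← h1]
    have h2 : splitFlags S T ∘ Sum.map Sum.inr Sum.inr ∘ (splitEquiv T).symm = Sum.inr := by
      funext i
      obtain ⟨i | i, rfl⟩ := (splitEquiv T).surjective i <;> simp
    rw [h2, joinGraphs]
  constructor
  · intro h
    have h1 : IsUnionOfWords τ T := fun i => by
      have h2 := ((preserves_joinGraphs (S := S) (T := T) τ₁ τ₂).mul
        preserves_edgeFlip_flagSet).sameCycle (h.2 i).sameCycle
      exact h2.symm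
    rw [← splitEquiv_restrictWords h1] at h
    exact ⟨h1, (key _ _).1 h⟩
  · rintro ⟨h1, h2⟩
    rw [← splitEquiv_restrictWords h1]
    exact (key _ _).2 h2

end

section

variable {E n : ℕ} {S : Finset (Fin E)} {T : Finset (Fin (n + 2))}

/-- Here the marked edge is the only connection between the parts, since its ends `0` and `1` lie on
opposite sides. -/
theorem joined_joinGraphs {τ₁ : Perm (Flag S.card T.card)} {τ₂ : Perm (Flag Sᶜ.card Tᶜ.card)}
    (h0 : 0 ∈ T) (h1 : 1 ∉ T) : Joined (joinGraphs S T τ₁ τ₂) (markedFlip E n) ↔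
      Joined τ₁ (edgeFlip _ _) ∧ Joined τ₂ (edgeFlip _ _) := by
  obtain ⟨i, hi⟩ := exists_splitEquiv_inl h0
  obtain ⟨j, hj⟩ := exists_splitEquiv_inr h1
  have e : markedFlip E n = (splitFlags S T).permCongr (sumCongr (edgeFlip _ _) (edgeFlip _ _) *
      swap (Sum.inl (Sum.inr i)) (Sum.inr (Sum.inr j))) := by
    rw [permCongr_mul, splitFlags_permCongr_edgeFlip, markedFlip]
    congr 1
    rw [permCongr_def, symm_trans_swap_trans]
    simp [hi, hj]
  rw [e, joinGraphs, joined_congr]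
  exact joined_sumCongr_mul_swap rfl

theorem not_joined_joinGraphs {τ₁ : Perm (Flag S.card T.card)}
    {τ₂ : Perm (Flag Sᶜ.card Tᶜ.card)} (h0 : 0 ∈ T) (h1 : 1 ∉ T) :
    ¬ Joined (joinGraphs S T τ₁ τ₂) (edgeFlip _ _) := by
  obtain ⟨i, -⟩ := exists_splitEquiv_inl h0
  obtain ⟨j, -⟩ := exists_splitEquiv_inr h1
  have : Nonempty (Flag S.card T.card) := ⟨Sum.inr i⟩
  have : Nonempty (Flag Sᶜ.card Tᶜ.card) := ⟨Sum.inr j⟩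
  rw [← splitFlags_permCongr_edgeFlip (S := S) (T := T), joinGraphs, joined_congr]
  exact not_joined_sumCongr

end

end

section

variable {k : Type*} [Field k] {V : Type*} [AddCommGroup V] [Module k V]
  {𝒱 : ZMod 2 → Submodule k V}

/-! ### The weight of a graph with two parts -/

section

variable {E₁ E₂ L₁ L₂ : Type*}

/-- Collecting the edges and the legs of two parts. -/
def mergeFlags (E₁ E₂ L₁ L₂ : Type*) :
    ((E₁ × Fin 2) ⊕ L₁) ⊕ ((E₂ × Fin 2) ⊕ L₂) ≃ ((E₁ ⊕ E₂) × Fin 2) ⊕ (L₁ ⊕ L₂) :=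
  (sumSumSumComm _ _ _ _).trans (sumCongr (sumProdDistrib _ _ _).symm (Equiv.refl _))

theorem sumNumbering_inl {N₁ N₂ : ℕ} {F₁ F₂ : Type*} (e₁ : F₁ ≃ Fin N₁) (e₂ : F₂ ≃ Fin N₂)
    (x : F₁) : (sumNumbering e₁ e₂ (Sum.inl x) : ℕ) = e₁ x := by simp [sumNumbering]

theorem sumNumbering_inr {N₁ N₂ : ℕ} {F₁ F₂ : Type*} (e₁ : F₁ ≃ Fin N₁) (e₂ : F₂ ≃ Fin N₂)
    (x : F₂) : (sumNumbering e₁ e₂ (Sum.inr x) : ℕ) = N₁ + e₂ x := by simp [sumNumbering]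

theorem IsStandard.merge {N₁ N₂ : ℕ} {e₁ : (E₁ × Fin 2) ⊕ L₁ ≃ Fin N₁}
    {e₂ : (E₂ × Fin 2) ⊕ L₂ ≃ Fin N₂} (h₁ : IsStandard e₁) (h₂ : IsStandard e₂) :
    IsStandard ((mergeFlags E₁ E₂ L₁ L₂).symm.trans (sumNumbering e₁ e₂)) where
  lt x := by
    obtain x | x := x
    · have := h₁.lt x
      simpa [mergeFlags, sumNumbering_inl] using this
    · have := h₂.lt x
      simpa [mergeFlags, sumNumbering_inr] using this
  pairRank x z hz0 hz1 := by
    obtain ⟨z, rfl⟩ := (mergeFlags E₁ E₂ L₁ L₂).surjective z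
    simp only [trans_apply, symm_apply_apply]
    obtain x | x := x
    · have e : ∀ s, (mergeFlags E₁ E₂ L₁ L₂).symm (Sum.inl (Sum.inl x, s)) =
        Sum.inl (Sum.inl (x, s)) := fun s => rfl
      rw [e, e, sumNumbering_inl, sumNumbering_inl]
      obtain z | z := z
      · rw [sumNumbering_inl]
        exact h₁.pairRank x z (by rintro rfl; exact hz0 rfl) (by rintro rfl; exact hz1 rfl)
      · rw [sumNumbering_inr]
        have := (e₁ (Sum.inl (x, 0))).2
        have := (e₁ (Sum.inl (x, 1))).2
        omega
    · have e : ∀ s, (mergeFlags E₁ E₂ L₁ L₂).symm (Sum.inl (Sum.inr x, s)) =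
        Sum.inr (Sum.inl (x, s)) := fun s => rfl
      rw [e, e, sumNumbering_inr, sumNumbering_inr]
      obtain z | z := z
      · rw [sumNumbering_inl]
        have := (e₁ z).2
        omega
      · rw [sumNumbering_inr]
        have := h₂.pairRank x z (by rintro rfl; exact hz0 rfl) (by rintro rfl; exact hz1 rfl)
        simpa only [add_lt_add_iff_left] using this

variable [Fintype E₁] [DecidableEq E₁] [Fintype E₂] [DecidableEq E₂] [Fintype L₁] [Fintype L₂]
  [DirectSum.Decomposition 𝒱] {β : OddScalarProduct 𝒱} {ι : Type*} [Fintype ι]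
  {m : CyclicTensors 𝒱}

theorem contractEdges_merge (hm : m.IsReduced) (u : HomogeneousBasis β ι) {H : Module.End k V}
    (hH : ∀ ε, ∀ a ∈ 𝒱 ε, H a ∈ 𝒱 (ε + 1)) {N₁ N₂ : ℕ} (e₁ : (E₁ × Fin 2) ⊕ L₁ ≃ Fin N₁)
    (e₂ : (E₂ × Fin 2) ⊕ L₂ ≃ Fin N₂) (τ₁ : Perm ((E₁ × Fin 2) ⊕ L₁))
    (τ₂ : Perm ((E₂ × Fin 2) ⊕ L₂)) {p : L₁ ⊕ L₂ → ZMod 2} {a : L₁ ⊕ L₂ → V}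
    (ha : ∀ i, a i ∈ 𝒱 (p i)) :
    contractEdges m u H ((mergeFlags E₁ E₂ L₁ L₂).symm.trans (sumNumbering e₁ e₂))
      ((mergeFlags E₁ E₂ L₁ L₂).permCongr (sumCongr τ₁ τ₂)) a =
    contractEdges m u H e₁ τ₁ (a ∘ Sum.inl) * contractEdges m u H e₂ τ₂ (a ∘ Sum.inr) := by
  unfold contractEdges
  rw [sum_mul_sum, ← Fintype.sum_prod_type', ← (sumArrowEquivProdArrow E₁ E₂ ι).sum_comp]
  refine sum_congr rfl fun j _ => ?_
  have e : (mergeFlags E₁ E₂ L₁ L₂).trans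
      ((mergeFlags E₁ E₂ L₁ L₂).symm.trans (sumNumbering e₁ e₂)) = sumNumbering e₁ e₂ := by
    rw [← trans_assoc, self_trans_symm, refl_trans]
  rw [evalOn_permCongr, e, m.evalOn_sumCongr hm (sumNumbering e₁ e₂) e₁ e₂
    (p := edgeParity u j p ∘ mergeFlags E₁ E₂ L₁ L₂) τ₁ τ₂
    (x := edgeLetters u H j a ∘ mergeFlags E₁ E₂ L₁ L₂) (fun i => edgeLetters_mem u hH j ha _), reorderSign_eq_one _ _ _ (fun x y => not_lt_of_gt),
    one_mul]
  congr 2 <;> · funext x; obtain ⟨x, s⟩ | i := x <;> rfl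

end

section

variable [DirectSum.Decomposition 𝒱] {β : OddScalarProduct 𝒱} {ι : Type*} [Fintype ι]
  {m : CyclicTensors 𝒱}

/-- `exp(m)` is multiplicative and the edges of both parts are even pairs, so the value factors with
just the Koszul sign of separating the legs. -/
theorem contractEdges_joinGraphs (hm : m.IsReduced) (u : HomogeneousBasis β ι)
    {H : Module.End k V} (hH : ∀ ε, ∀ a ∈ 𝒱 ε, H a ∈ 𝒱 (ε + 1)) {E N : ℕ} {S : Finset (Fin E)}
    {T : Finset (Fin N)} (τ₁ : Perm (Flag S.card T.card)) (τ₂ : Perm (Flag Sᶜ.card Tᶜ.card))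
    {p : Fin N → ZMod 2} {a : Fin N → V} (ha : ∀ i, a i ∈ 𝒱 (p i)) :
    contractEdges m u H (flagNumbering E N) (joinGraphs S T τ₁ τ₂) a =
      koszul (fun x => p x + 1) (fun x => if x ∈ T then 0 else 1) *
        (contractEdges m u H (flagNumbering _ _) τ₁ (a ∘ splitEquiv T ∘ Sum.inl) *
          contractEdges m u H (flagNumbering _ _) τ₂ (a ∘ splitEquiv T ∘ Sum.inr)) := by
  let g := sumCongr (prodCongr (splitEquiv S) (Equiv.refl (Fin 2))) (splitEquiv T)
  have e : joinGraphs S T τ₁ τ₂ = g.permCongr ((mergeFlags _ _ _ _).permCongr (sumCongr τ₁ τ₂)) := by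
    have h : splitFlags S T = (mergeFlags _ _ _ _).trans g := by
      refine Equiv.ext fun x => ?_
      obtain (x | i) | (x | i) := x <;> rfl
    rw [joinGraphs, h]
    rfl
  have hstd : IsStandard (g.trans (flagNumbering E N)) :=
    { lt := fun x => by simp [g, flagNumbering_inl]
      pairRank := fun x z hz0 hz1 => by
        have h := (isStandard_flagNumbering E N).pairRank (splitEquiv S x) (g z)
          (fun h' => hz0 (g.injective h')) (fun h' => hz1 (g.injective h'))
        exact h }
  rw [e, contractEdges_permCongr, contractEdges_reorder hm hH hstd
    ((isStandard_flagNumbering _ _).merge (isStandard_flagNumbering _ _)) _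
    (p := p ∘ splitEquiv T) (a := a ∘ splitEquiv T) (fun i => ha _),
    contractEdges_merge hm u hH _ _ _ _ (p := p ∘ splitEquiv T) (a := a ∘ splitEquiv T)
      (fun i => ha _)]
  congr 1
  rw [← reorderSign_splitEquiv T fun x => p x + 1]
  refine reorderSign_congr _ fun x y => and_congr ?_ ?_
  · simp [g, flagNumbering_inr]
  · obtain x | x := x <;> obtain y | y := y <;>
      simp [mergeFlags, sumNumbering, flagNumbering_inr] <;> omega

end

/-! ### Cutting the marked edge -/

section

variable {E n b : ℕ} {σ : Perm (Fin n)}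

/-- The boundary words of the whole graph arise by gluing the first two letters in the boundary
words `τ'` of the cut graph. -/
theorem markedCond_iff_of_induces {τ : Perm (Flag E (n + 2))} {τ' : Perm (Fin (n + 2))}
    (h : Induces (τ * edgeFlip _ _) Sum.inr τ') : MarkedCond E b τ σ ↔
      Glues τ' σ ∧ Joined τ (markedFlip E n) ∧ 1 + (E + 1) = b + numCycles τ := by
  have h1 : Induces (τ * markedFlip E n) (fun i : Fin n => Sum.inr i.succ.succ) σ ↔ Glues τ' σ := by
    rw [glues_iff, markedFlip, ← mul_assoc]
    refine h.mul_iff Sum.inr_injective succ_succ_injective (fun l => ?_) fun x hx => ?_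
    · exact (Sum.inr_injective.swap_apply 0 1 l)
    · exact swap_apply_of_ne_of_ne (fun h' => hx ⟨0, h'.symm⟩) (fun h' => hx ⟨1, h'.symm⟩)
  exact ⟨fun ⟨a, b, c⟩ => ⟨h1.1 c, a, b⟩, fun ⟨c, a, b⟩ => ⟨a, b, h1.2 c⟩⟩

theorem exists_induces_of_markedCond {τ : Perm (Flag E (n + 2))} (h : MarkedCond E b τ σ) :
    ∃ τ', Induces (τ * edgeFlip _ _) Sum.inr τ' := by
  have h1 := h.boundary
  rw [markedFlip, ← mul_assoc] at h1
  exact Induces.exists_of_mul (leg' := fun i : Fin n => i.succ.succ) (f := swap 0 1)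
    Sum.inr_injective (fun l => Sum.inr_injective.swap_apply 0 1 l)
    (fun x hx => swap_apply_of_ne_of_ne (fun h' => hx ⟨0, h'.symm⟩) fun h' => hx ⟨1, h'.symm⟩) h1

variable {M : Type*} [AddCommMonoid M] (f : Perm (Flag E (n + 2)) → M)

open Classical in
theorem sum_markedCond_eq_sum_glues (b : ℕ) (σ : Perm (Fin n)) :
    (∑ τ : Perm (Flag E (n + 2)), if MarkedCond E b τ σ then f τ else 0) =
      ∑ τ' : Perm (Fin (n + 2)), if Glues τ' σ then ∑ τ : Perm (Flag E (n + 2)),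
        if Induces (τ * edgeFlip _ _) Sum.inr τ' ∧ Joined τ (markedFlip E n) ∧
          1 + (E + 1) = b + numCycles τ then f τ else 0 else 0 := by
  have h1 : ∀ τ : Perm (Flag E (n + 2)), (if MarkedCond E b τ σ then f τ else 0) =
      ∑ τ' : Perm (Fin (n + 2)), if Glues τ' σ then
        if Induces (τ * edgeFlip _ _) Sum.inr τ' ∧ Joined τ (markedFlip E n) ∧
          1 + (E + 1) = b + numCycles τ then f τ else 0 else 0 := by
    intro τ
    by_cases h : ∃ τ', Induces (τ * edgeFlip _ _) Sum.inr τ'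
    · obtain ⟨τ₀, h⟩ := h
      rw [sum_eq_single τ₀ (fun τ' _ hne => ?_) (fun h' => absurd (mem_univ _) h'), ← ite_and]
      · refine if_congr ?_ rfl rfl
        rw [markedCond_iff_of_induces h, and_iff_right h]
      · rw [ite_eq_right_iff]
        exact fun _ => if_neg fun h' => hne (h'.1.unique Sum.inr_injective h)
    · rw [if_neg fun h' => h (exists_induces_of_markedCond h')]
      refine (sum_eq_zero fun τ' _ => ?_).symm
      rw [ite_eq_right_iff]
      exact fun _ => if_neg fun h' => h ⟨τ', h'.1⟩
  rw [sum_congr rfl fun τ _ => h1 τ, sum_comm]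
  refine sum_congr rfl fun τ' _ => ?_
  split_ifs
  · rfl
  · exact sum_const_zero

open Classical in
-- The Euler characteristics of the parts determine the two powers of `ħ`, so at most one term is
-- nonzero. The bound `Joined.numCycles_le` guarantees that these powers are genuinely natural
-- numbers and no subtraction is truncated.
theorem sum_surfaceCond_antidiagonal {E₁ E₂ n₁ n₂ : ℕ} (b : ℕ) (τ₁ : Perm (Flag E₁ n₁))
    (τ₂ : Perm (Flag E₂ n₂)) (σ₁ : Perm (Fin n₁)) (σ₂ : Perm (Fin n₂)) (x : M) :
    (∑ c ∈ antidiagonal b, if SurfaceCond τ₁ (edgeFlip _ _) Sum.inr E₁ c.1 σ₁ ∧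
      SurfaceCond τ₂ (edgeFlip _ _) Sum.inr E₂ c.2 σ₂ then x else 0) =
    if (Induces (τ₁ * edgeFlip _ _) Sum.inr σ₁ ∧ Induces (τ₂ * edgeFlip _ _) Sum.inr σ₂) ∧
      (Joined τ₁ (edgeFlip _ _) ∧ Joined τ₂ (edgeFlip _ _)) ∧
      1 + (E₁ + E₂ + 1) = b + (numCycles τ₁ + numCycles τ₂) then x else 0 := by
  split_ifs with h
  · obtain ⟨⟨h1, h2⟩, ⟨h3, h4⟩, h5⟩ := h
    have h6 := h3.numCycles_le
    have h7 := h4.numCycles_le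
    rw [Fintype.card_fin] at h6 h7
    rw [sum_eq_single (1 + E₁ - numCycles τ₁, 1 + E₂ - numCycles τ₂), if_pos]
    · exact ⟨⟨h3, by dsimp only; omega, h1⟩, ⟨h4, by dsimp only; omega, h2⟩⟩
    · rintro ⟨c₁, c₂⟩ - hne
      refine if_neg fun ⟨h8, h9⟩ => hne ?_
      have := h8.euler
      have := h9.euler
      ext <;> dsimp only at * <;> omega
    · intro h8
      rw [HasAntidiagonal.mem_antidiagonal] at h8
      dsimp only at h8
      omega
  · refine sum_eq_zero fun c hc => if_neg fun ⟨h1, h2⟩ => h ?_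
    have := h1.euler
    have := h2.euler
    rw [HasAntidiagonal.mem_antidiagonal] at hc
    exact ⟨⟨h1.boundary, h2.boundary⟩, ⟨h1.joined, h2.joined⟩, by omega⟩

open Classical in
-- If the cut disconnects the graph, its ends `0` and `1` lie in different parts. Taking the part of
-- `0` first makes the decomposition unique, which matches the convention of the bracket.
theorem sum_induces_not_joined (b : ℕ) (τ' : Perm (Fin (n + 2))) :
    (∑ τ : Perm (Flag E (n + 2)), if (Induces (τ * edgeFlip _ _) Sum.inr τ' ∧
      Joined τ (markedFlip E n) ∧ 1 + (E + 1) = b + numCycles τ) ∧ ¬ Joined τ (edgeFlip _ _) then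
      f τ else 0) =
    ∑ T : Finset (Fin (n + 2)), if IsUnionOfWords τ' T ∧ 0 ∈ T ∧ 1 ∉ T then
      ∑ S : Finset (Fin E), ∑ τ₁ : Perm (Flag S.card T.card), ∑ τ₂ : Perm (Flag Sᶜ.card Tᶜ.card),
        ∑ c ∈ antidiagonal b,
        if SurfaceCond τ₁ (edgeFlip _ _) Sum.inr S.card c.1 (restrictWords τ' T) ∧
          SurfaceCond τ₂ (edgeFlip _ _) Sum.inr Sᶜ.card c.2 (restrictWords τ' Tᶜ) then
          f (joinGraphs S T τ₁ τ₂) else 0 else 0 := by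
  let X := Σ x : Finset (Fin (n + 2)) × Finset (Fin E),
    Perm (Flag x.2.card x.1.card) × Perm (Flag x.2ᶜ.card x.1ᶜ.card)
  let P : X → Prop := fun x => (IsUnionOfWords τ' x.1.1 ∧ 0 ∈ x.1.1 ∧ 1 ∉ x.1.1) ∧
    (Induces (x.2.1 * edgeFlip _ _) Sum.inr (restrictWords τ' x.1.1) ∧
      Induces (x.2.2 * edgeFlip _ _) Sum.inr (restrictWords τ' x.1.1ᶜ)) ∧
    (Joined x.2.1 (edgeFlip _ _) ∧ Joined x.2.2 (edgeFlip _ _)) ∧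
    1 + (x.1.2.card + x.1.2ᶜ.card + 1) = b + (numCycles x.2.1 + numCycles x.2.2)
  have h1 : ∀ x : X, 0 ∈ x.1.1 → 1 ∉ x.1.1 →
      (((Induces (joinGraphs x.1.2 x.1.1 x.2.1 x.2.2 * edgeFlip _ _) Sum.inr τ' ∧
        Joined (joinGraphs x.1.2 x.1.1 x.2.1 x.2.2) (markedFlip E n) ∧
        1 + (E + 1) = b + numCycles (joinGraphs x.1.2 x.1.1 x.2.1 x.2.2)) ∧
        ¬ Joined (joinGraphs x.1.2 x.1.1 x.2.1 x.2.2) (edgeFlip _ _)) ↔ P x) := by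
    intro x h0 h1
    rw [induces_joinGraphs, joined_joinGraphs h0 h1, numCycles_joinGraphs,
      and_iff_left (not_joined_joinGraphs h0 h1)]
    have : x.1.2.card + x.1.2ᶜ.card = E := by simp [card_add_card_compl]
    simp only [P, this, h0, h1, not_false_eq_true, true_and, and_assoc]
  have h2 : (∑ x : X, if P x then f (joinGraphs x.1.2 x.1.1 x.2.1 x.2.2) else 0) =
      ∑ τ : Perm (Flag E (n + 2)), if (Induces (τ * edgeFlip _ _) Sum.inr τ' ∧
        Joined τ (markedFlip E n) ∧ 1 + (E + 1) = b + numCycles τ) ∧ ¬ Joined τ (edgeFlip _ _) then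
        f τ else 0 := by
    rw [← sum_filter, ← sum_filter]
    refine sum_bij (fun x _ => joinGraphs x.1.2 x.1.1 x.2.1 x.2.2) (fun x hx => ?_) ?_ ?_
      (fun _ _ => rfl)
    · have hx := (mem_filter.1 hx).2
      exact mem_filter.2 ⟨mem_univ _, (h1 x hx.1.2.1 hx.1.2.2).2 hx⟩
    · rintro ⟨⟨T, S⟩, τ₁, τ₂⟩ hx ⟨⟨T', S'⟩, τ₁', τ₂'⟩ hx' h
      have hx := (mem_filter.1 hx).2
      have hx' := (mem_filter.1 hx').2
      obtain ⟨rfl, rfl⟩ := joinGraphs_injective hx.2.2.1.1 hx'.2.2.1.1 hx.1.2.1 hx'.1.2.1 h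
      obtain ⟨rfl, rfl⟩ := sumCongr_injective ((splitFlags S T).permCongr.injective h)
      rfl
    · intro τ hτ
      have hτ := (mem_filter.1 hτ).2
      obtain ⟨Y, hY, hY', h0, h1'⟩ := Joined.exists_preserves (τ := τ) (f := edgeFlip _ _)
        (a := Sum.inr 0) (b := Sum.inr 1) rfl hτ.1.2.1 hτ.2
      obtain ⟨S, T, rfl, τ₁, τ₂, rfl⟩ := exists_joinGraphs hY hY'
      exact ⟨⟨(T, S), (τ₁, τ₂)⟩, mem_filter.2 ⟨mem_univ _, (h1 ⟨(T, S), (τ₁, τ₂)⟩ h0 h1').1 hτ⟩, rfl⟩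
  rw [← h2, Fintype.sum_sigma, Fintype.sum_prod_type]
  refine sum_congr rfl fun T _ => ?_
  simp only [sum_surfaceCond_antidiagonal, Fintype.sum_prod_type, P]
  by_cases hT : IsUnionOfWords τ' T ∧ 0 ∈ T ∧ 1 ∉ T
  · simp only [if_pos hT, and_iff_right hT]
  · simp only [if_neg hT, if_neg fun h : (IsUnionOfWords τ' T ∧ 0 ∈ T ∧ 1 ∉ T) ∧ _ => hT h.1,
      sum_const_zero]

end

end

section

variable {k : Type*} [Field k] {V : Type*} [AddCommGroup V] [Module k V]
  {𝒱 : ZMod 2 → Submodule k V}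

/-! ### The operators in a homogeneous basis -/

theorem coe_cons_cons {W : Submodule k V} {n : ℕ} (x y : W) (a : Fin n → W) :
    (fun i => (((Fin.cons x (Fin.cons y a : Fin (n + 1) → W) : Fin (n + 2) → W) i : W) : V)) =
      Fin.cons (x : V) (Fin.cons (y : V) fun i => (a i : V)) := by
  funext i
  revert i
  rw [forall_fin_add_two]
  exact ⟨rfl, rfl, fun _ => rfl⟩

section

variable [FiniteDimensional k V] {β : OddScalarProduct 𝒱} {ι : Type*} [Fintype ι]

open Classical in
theorem laplacian_eq (u : HomogeneousBasis β ι) {f : Functional k V}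
    (hf : ∀ n σ, IsMultilinear (f n σ)) {n : ℕ} (σ : Perm (Fin n)) (a : Fin n → V) :
    laplacian β f n σ a = (2 : k)⁻¹ * ∑ τ : Perm (Fin (n + 2)), if Glues τ σ then
      ∑ i, f (n + 2) τ (Fin.cons (u.dual i) (Fin.cons (u.vec i) a)) else 0 := by
  unfold laplacian
  congr 1
  refine sum_congr rfl fun τ _ => if_congr Iff.rfl ?_ rfl
  exact u.sum_eq ((hf _ _).isBilinear_cons a)

open Classical in
theorem bracket_eq [DirectSum.Decomposition 𝒱] (u : HomogeneousBasis β ι) {f g : Functional k V}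
    (hf : ∀ n σ, IsMultilinear (f n σ)) (hg : ∀ n σ, IsMultilinear (g n σ)) {n : ℕ}
    (σ : Perm (Fin n)) {p : Fin n → ZMod 2} {a : Fin n → V} (ha : ∀ i, a i ∈ 𝒱 (p i)) :
    bracket β f g n σ a = ∑ τ : Perm (Fin (n + 2)), if Glues τ σ then
      ∑ T : Finset (Fin (n + 2)), if IsUnionOfWords τ T ∧ 0 ∈ T ∧ 1 ∉ T then ∑ i,
        koszul (fun x => (Fin.cons (u.parity i + 1) (Fin.cons (u.parity i) p : Fin (n + 1) → ZMod 2) :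
          Fin (n + 2) → ZMod 2) x + 1) (fun x => if x ∈ T then 0 else 1) *
        (f T.card (restrictWords τ T) ((Fin.cons (u.dual i) (Fin.cons (u.vec i) a :
            Fin (n + 1) → V) : Fin (n + 2) → V) ∘ splitEquiv T ∘ Sum.inl) *
          g Tᶜ.card (restrictWords τ Tᶜ) ((Fin.cons (u.dual i) (Fin.cons (u.vec i) a :
            Fin (n + 1) → V) : Fin (n + 2) → V) ∘ splitEquiv T ∘ Sum.inr))
        else 0 else 0 := by
  unfold bracket
  refine sum_congr rfl fun τ _ => if_congr Iff.rfl ?_ rfl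
  refine sum_congr rfl fun T _ => if_congr Iff.rfl ?_ rfl
  rw [u.sum_eq ((IsMultilinear.splitProduct τ T (hf _ _) (hg _ _)).isBilinear_cons a)]
  exact sum_congr rfl fun i _ => splitProduct_eq τ T (hf _ _) (hg _ _)
    (cons_mem (cons_mem ha (u.vec_mem i)) (u.dual_mem i))

end

section

variable [DirectSum.Decomposition 𝒱] {β : OddScalarProduct 𝒱} {I : OddSymmetry β} {ι : Type*}
  [Fintype ι]

/-- The sum over the graphs with `E` edges, as a functional on `B`. -/
def edgeSum (h : OddHomotopy I) (m : CyclicTensors 𝒱) (u : HomogeneousBasis β ι) (E : ℕ) :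
    Series k h.image := fun b n σ a =>
  (relabelCount E : k)⁻¹ * labelledSum m u h.H E b n σ (fun i => (a i : V))

variable {h : OddHomotopy I} {m : CyclicTensors 𝒱} {u : HomogeneousBasis β ι}

theorem edgeSum_isMultilinear {E b n : ℕ} (σ : Perm (Fin n)) :
    IsMultilinear (edgeSum h m u E b n σ) := by
  classical
  refine IsMultilinear.const_mul (IsMultilinear.sum _ fun τ _ => ?_) _
  exact IsMultilinear.ite_zero _ fun _ =>
    (contractEdges_isMultilinear m u h.H (flagNumbering E n) τ).comp_linear
      fun _ => h.image.subtype

open Classical in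
-- The factor `ħ` accounts for the missing edge in the Euler characteristic. At `b = 0` the right
-- side is empty, since a connected graph with `E` edges cannot have `E + 2` vertices.
theorem hbar_edgeSum {E b n : ℕ} (σ : Perm (Fin n)) (a : Fin n → h.image) :
    hbar (edgeSum h m u E) b n σ a = (relabelCount E : k)⁻¹ * ∑ τ : Perm (Flag E n),
      if SurfaceCond τ (edgeFlip _ _) Sum.inr (E + 1) b σ then
        contractEdges m u h.H (flagNumbering E n) τ (fun i => (a i : V)) else 0 := by
  cases b with
  | zero =>
    rw [sum_eq_zero, mul_zero]
    · rfl
    · intro τ _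
      refine if_neg fun h' => ?_
      have h1 := h'.joined.numCycles_le
      have h2 := h'.euler
      rw [Fintype.card_fin] at h1
      omega
  | succ b =>
    refine congrArg _ (sum_congr rfl fun τ _ => if_congr ⟨?_, ?_⟩ rfl rfl)
    · rintro ⟨h1, h2, h3⟩
      exact ⟨h1, by omega, h3⟩
    · rintro ⟨h1, h2, h3⟩
      exact ⟨h1, by omega, h3⟩

/-- The binomial coefficient counting subsets `S` of given size is absorbed by $E!\,2^E=\binom
Er\,r!\,2^r\,(E-r)!\,2^{E-r}$. -/
theorem sum_relabelCount [CharZero k] (E : ℕ) (X : ℕ → ℕ → k) :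
    (relabelCount E : k)⁻¹ * ∑ S : Finset (Fin E), X S.card Sᶜ.card =
      ∑ d ∈ antidiagonal E, (relabelCount d.1 : k)⁻¹ * (relabelCount d.2 : k)⁻¹ * X d.1 d.2 := by
  have h1 := sum_powerset_apply_card (fun r => X r (E - r)) (x := (univ : Finset (Fin E)))
  rw [powerset_univ, card_univ, Fintype.card_fin] at h1
  simp only [card_compl, Fintype.card_fin]
  rw [h1, Nat.sum_antidiagonal_eq_sum_range_succ_mk, mul_sum]
  refine sum_congr rfl fun r hr => ?_
  have hr : r ≤ E := Nat.lt_succ_iff.1 (mem_range.1 hr)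
  have h2 : relabelCount E = E.choose r * (relabelCount r * relabelCount (E - r)) := by
    have h3 : 2 ^ E = 2 ^ r * 2 ^ (E - r) := by rw [← pow_add, Nat.add_sub_cancel' hr]
    rw [relabelCount, relabelCount, relabelCount, h3, ← Nat.choose_mul_factorial_mul_factorial hr]
    ring
  have h3 : ((E.choose r : ℕ) : k) ≠ 0 := Nat.cast_ne_zero.2 (Nat.choose_pos hr).ne'
  have h4 := relabelCount_ne_zero (k := k) r
  have h5 := relabelCount_ne_zero (k := k) (E - r)
  rw [h2, nsmul_eq_mul, Nat.cast_mul, Nat.cast_mul]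
  field_simp

open Classical in
-- Graph values factor over the parts and depend on `S` only through its cardinality, so the
-- weighted sum becomes a convolution over the numbers of edges.
theorem sum_joinGraphs [CharZero k] (hm : m.IsReduced) (E b : ℕ) {N : ℕ} (τ : Perm (Fin N))
    (T : Finset (Fin N)) {p : Fin N → ZMod 2} {a : Fin N → h.image}
    (ha : ∀ i, a i ∈ h.grading (p i)) :
    (relabelCount E : k)⁻¹ * ∑ S : Finset (Fin E), ∑ τ₁ : Perm (Flag S.card T.card),
      ∑ τ₂ : Perm (Flag Sᶜ.card Tᶜ.card), ∑ c ∈ antidiagonal b,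
        (if SurfaceCond τ₁ (edgeFlip _ _) Sum.inr S.card c.1 (restrictWords τ T) ∧
          SurfaceCond τ₂ (edgeFlip _ _) Sum.inr Sᶜ.card c.2 (restrictWords τ Tᶜ) then
          contractEdges m u h.H (flagNumbering E N) (joinGraphs S T τ₁ τ₂) (fun i => (a i : V))
          else 0) =
    ∑ c ∈ antidiagonal b, ∑ d ∈ antidiagonal E,
      koszul (fun x => p x + 1) (fun x => if x ∈ T then 0 else 1) *
        (edgeSum h m u d.1 c.1 _ (restrictWords τ T) (a ∘ splitEquiv T ∘ Sum.inl) *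
          edgeSum h m u d.2 c.2 _ (restrictWords τ Tᶜ) (a ∘ splitEquiv T ∘ Sum.inr)) := by
  let K : k := koszul (fun x => p x + 1) (fun x => if x ∈ T then 0 else 1)
  let Y : ℕ → ℕ → k := fun E₁ E₂ => ∑ c ∈ antidiagonal b, K *
    (labelledSum m u h.H E₁ c.1 _ (restrictWords τ T)
      (fun i => ((a ∘ splitEquiv T ∘ Sum.inl) i : V)) *
    labelledSum m u h.H E₂ c.2 _ (restrictWords τ Tᶜ)
      (fun i => ((a ∘ splitEquiv T ∘ Sum.inr) i : V)))
  have h1 : ∀ S : Finset (Fin E), (∑ τ₁ : Perm (Flag S.card T.card),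
      ∑ τ₂ : Perm (Flag Sᶜ.card Tᶜ.card), ∑ c ∈ antidiagonal b,
        (if SurfaceCond τ₁ (edgeFlip _ _) Sum.inr S.card c.1 (restrictWords τ T) ∧
          SurfaceCond τ₂ (edgeFlip _ _) Sum.inr Sᶜ.card c.2 (restrictWords τ Tᶜ) then
          contractEdges m u h.H (flagNumbering E N) (joinGraphs S T τ₁ τ₂) (fun i => (a i : V))
          else 0)) = Y S.card Sᶜ.card := by
    intro S
    rw [sum_congr rfl fun τ₁ _ => sum_comm, sum_comm]
    refine sum_congr rfl fun c _ => ?_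
    unfold labelledSum
    rw [sum_mul_sum, mul_sum]
    refine sum_congr rfl fun τ₁ _ => ?_
    rw [mul_sum]
    refine sum_congr rfl fun τ₂ _ => ?_
    rw [contractEdges_joinGraphs hm u h.odd τ₁ τ₂ (p := p) (a := fun i => (a i : V)) ha]
    simp only [and_comm (a := SurfaceCond τ₁ (edgeFlip _ _) Sum.inr S.card c.1 (restrictWords τ T)),
      ite_and, ite_mul, mul_ite, zero_mul, mul_zero]
    rfl
  rw [sum_congr rfl fun S _ => h1 S, sum_relabelCount, sum_comm]
  refine sum_congr rfl fun d _ => ?_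
  rw [mul_sum]
  refine sum_congr rfl fun c _ => ?_
  unfold edgeSum
  ring

variable [FiniteDimensional k V]

/-- The projection to `B` of the tensor of the scalar product is the tensor of its restriction. -/
theorem HomogeneousBasis.sum_proj {κ : Type*} [Fintype κ] (u : HomogeneousBasis β ι)
    (w : HomogeneousBasis h.form κ) {Φ : V → V → k} (hΦ : IsBilinear Φ) :
    ∑ i, Φ (h.proj (u.dual i)) (u.vec i) = ∑ j, Φ (w.dual j : V) (w.vec j : V) := by
  have key := hΦ.sum_eq β (c := fun _ : ι => 1) (y := fun i => h.proj (u.dual i)) (z := u.vec)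
    (c' := fun _ : κ => 1) (y' := fun j => (w.dual j : V)) (z' := fun j => (w.vec j : V)) ?_
  · simpa only [one_mul] using key
  intro x y
  -- By selfadjointness of `P`, a vector of `B` pairs with `x` as it does with `P x`, so both
  -- tensors may be tested on `B`.
  have hp : ∀ (b : h.image) (x : V), β.form (b : V) x = h.form.form b ⟨h.proj x, x, rfl⟩ :=
    fun b x => by
      change _ = β.form (b : V) (h.proj x)
      rw [← h.proj_selfadjoint, h.proj_of_mem b.2]
  simp only [one_mul, hp, h.proj_selfadjoint (u.dual _)]
  rw [u.sum_form, w.sum_form]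
  change _ = β.form (h.proj x) (h.proj y)
  rw [← h.proj_selfadjoint, h.proj_proj]

open Classical in
/-- The contributions of the projection on a marked edge. -/
theorem sum_markedTerm_proj [CharZero k] (hm : m.IsReduced) (E b : ℕ) {n : ℕ} (σ : Perm (Fin n))
    {p : Fin n → ZMod 2} {a : Fin n → h.image} (ha : ∀ i, a i ∈ h.grading (p i)) :
    (relabelCount E : k)⁻¹ * (∑ τ : Perm (Flag E (n + 2)), if MarkedCond E b τ σ then
      markedTerm m u h.H h.proj τ (fun i => (a i : V)) else 0) =
    2 * laplacian h.form (hbar (edgeSum h m u E) b) n σ a +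
      ∑ c ∈ antidiagonal b, ∑ d ∈ antidiagonal E,
        bracket h.form (edgeSum h m u d.1 c.1) (edgeSum h m u d.2 c.2) n σ a := by
  obtain ⟨w⟩ := exists_homogeneousBasis h.form
  let a' := fun j => (Fin.cons (w.dual j) (Fin.cons (w.vec j) a : Fin (n + 1) → h.image) :
    Fin (n + 2) → h.image)
  have hmul : ∀ n σ, IsMultilinear (hbar (edgeSum h m u E) b n σ) := by
    cases b with
    | zero => exact fun _ _ => IsMultilinear.zero
    | succ b => exact fun _ σ => edgeSum_isMultilinear σ
  have h1 : ∀ τ : Perm (Flag E (n + 2)), (if MarkedCond E b τ σ then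
      markedTerm m u h.H h.proj τ (fun i => (a i : V)) else 0) = ∑ j, if MarkedCond E b τ σ then
        contractEdges m u h.H (flagNumbering E (n + 2)) τ (fun i => (a' j i : V)) else 0 := by
    intro τ
    split_ifs
    · unfold markedTerm
      rw [u.sum_proj w ((contractEdges_isMultilinear m u h.H _ τ).isBilinear_cons _)]
      exact sum_congr rfl fun j _ => congrArg _ (coe_cons_cons _ _ _).symm
    · exact sum_const_zero.symm
  rw [sum_congr rfl fun τ _ => h1 τ, sum_comm, mul_sum]
  have h2 : ∀ j, (relabelCount E : k)⁻¹ * (∑ τ : Perm (Flag E (n + 2)),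
      if MarkedCond E b τ σ then
        contractEdges m u h.H (flagNumbering E (n + 2)) τ (fun i => (a' j i : V)) else 0) =
      ∑ τ : Perm (Fin (n + 2)), if Glues τ σ then hbar (edgeSum h m u E) b (n + 2) τ (a' j) +
        ∑ T : Finset (Fin (n + 2)), if IsUnionOfWords τ T ∧ 0 ∈ T ∧ 1 ∉ T then
          ∑ c ∈ antidiagonal b, ∑ d ∈ antidiagonal E,
          koszul (fun x => (Fin.cons (w.parity j + 1) (Fin.cons (w.parity j) p :
            Fin (n + 1) → ZMod 2) : Fin (n + 2) → ZMod 2) x + 1)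
              (fun x => if x ∈ T then 0 else 1) *
            (edgeSum h m u d.1 c.1 _ (restrictWords τ T) (a' j ∘ splitEquiv T ∘ Sum.inl) *
              edgeSum h m u d.2 c.2 _ (restrictWords τ Tᶜ) (a' j ∘ splitEquiv T ∘ Sum.inr))
          else 0 else 0 := by
    intro j
    rw [sum_markedCond_eq_sum_glues, mul_sum]
    refine sum_congr rfl fun τ _ => ?_
    rw [mul_ite, mul_zero]
    refine if_congr Iff.rfl ?_ rfl
    -- Separates cuts that leave the graph connected from those that do not. In the first case,
    -- connectedness with the marked edge restored is automatic.
    have h3 : ∀ τ₀ : Perm (Flag E (n + 2)),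
        (if Induces (τ₀ * edgeFlip _ _) Sum.inr τ ∧ Joined τ₀ (markedFlip E n) ∧
          1 + (E + 1) = b + numCycles τ₀ then
          contractEdges m u h.H (flagNumbering E (n + 2)) τ₀ (fun i => (a' j i : V)) else 0) =
        (if SurfaceCond τ₀ (edgeFlip _ _) Sum.inr (E + 1) b τ then
          contractEdges m u h.H (flagNumbering E (n + 2)) τ₀ (fun i => (a' j i : V)) else 0) +
        if (Induces (τ₀ * edgeFlip _ _) Sum.inr τ ∧ Joined τ₀ (markedFlip E n) ∧
          1 + (E + 1) = b + numCycles τ₀) ∧ ¬ Joined τ₀ (edgeFlip _ _) then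
          contractEdges m u h.H (flagNumbering E (n + 2)) τ₀ (fun i => (a' j i : V)) else 0 := by
      intro τ₀
      by_cases hJ : Joined τ₀ (edgeFlip (Fin E) (Fin (n + 2)))
      · rw [if_neg (fun h' : _ ∧ ¬ Joined τ₀ (edgeFlip _ _) => h'.2 hJ), add_zero]
        exact if_congr ⟨fun ⟨h1, _, h2⟩ => ⟨hJ, h2, h1⟩,
          fun ⟨_, h2, h1⟩ => ⟨h1, hJ.mul_swap rfl, h2⟩⟩ rfl rfl
      · rw [if_neg (fun h' : SurfaceCond τ₀ (edgeFlip _ _) Sum.inr (E + 1) b τ => hJ h'.joined),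
          zero_add]
        exact if_congr (and_iff_left hJ).symm rfl rfl
    rw [sum_congr rfl fun τ₀ _ => h3 τ₀, sum_add_distrib, mul_add, ← hbar_edgeSum,
      sum_induces_not_joined, mul_sum]
    congr 1
    refine sum_congr rfl fun T _ => ?_
    rw [mul_ite, mul_zero]
    refine if_congr Iff.rfl ?_ rfl
    exact sum_joinGraphs hm E b τ T (cons_mem (cons_mem ha (w.vec_mem j)) (w.dual_mem j))
  rw [sum_congr rfl fun j _ => h2 j, laplacian_eq w hmul]
  simp only [bracket_eq w (fun _ σ => edgeSum_isMultilinear σ)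
    (fun _ σ => edgeSum_isMultilinear σ) σ ha]
  -- Cuts produce ordered pairs of ends, so the `½` in the definition of `Δ` is cancelled by the
  -- explicit factor `2`.
  rw [← mul_assoc, mul_inv_cancel₀ two_ne_zero, one_mul, sum_comm,
    sum_congr rfl fun c _ => sum_comm, sum_comm (s := antidiagonal b), ← sum_add_distrib]
  refine sum_congr rfl fun τ _ => ?_
  by_cases hG : Glues τ σ
  · simp only [if_pos hG]
    rw [sum_add_distrib, sum_comm (s := (univ : Finset _)) (t := univ),
      sum_congr rfl fun c _ => sum_comm, sum_comm (s := antidiagonal b)]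
    congr 1
    refine sum_congr rfl fun T _ => ?_
    by_cases hT : IsUnionOfWords τ T ∧ 0 ∈ T ∧ 1 ∉ T
    · simp only [if_pos hT]
      rw [sum_comm]
      exact sum_congr rfl fun c _ => sum_comm
    · simp only [if_neg hT, sum_const_zero]
  · simp only [if_neg hG, sum_const_zero, add_zero]

end

end

section

variable {k : Type*} [Field k] {V : Type*} [AddCommGroup V] [Module k V]
  {𝒱 : ZMod 2 → Submodule k V}

/-! ### Linearity of the operators -/

theorem dualAction_isMultilinear [DirectSum.Decomposition 𝒱] {n : ℕ} (I : Module.End k V)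
    {f : Functional k V} (hf : ∀ n σ, IsMultilinear (f n σ)) (σ : Perm (Fin n)) :
    IsMultilinear (dualAction 𝒱 I f n σ) := by
  refine (IsMultilinear.sum _ fun i _ => ?_).neg
  have := (hf n σ).comp_linear fun j =>
    if j < i then piSignMap 𝒱 else if j = i then I else LinearMap.id
  convert this using 4 with a j
  split_ifs <;> rfl

section

variable [FiniteDimensional k V] {β : OddScalarProduct 𝒱} {n : ℕ}

theorem laplacian_isMultilinear {f : Functional k V} (hf : ∀ n σ, IsMultilinear (f n σ))
    (σ : Perm (Fin n)) : IsMultilinear (laplacian β f n σ) := by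
  classical
  exact (IsMultilinear.sum _ fun τ _ => IsMultilinear.ite_zero _ fun _ =>
    IsMultilinear.sum _ fun j _ => ((hf _ τ).cons _).cons _).const_mul _

theorem bracket_isMultilinear [DirectSum.Decomposition 𝒱] {f g : Functional k V}
    (hf : ∀ n σ, IsMultilinear (f n σ)) (hg : ∀ n σ, IsMultilinear (g n σ)) (σ : Perm (Fin n)) :
    IsMultilinear (bracket β f g n σ) := by
  classical
  exact IsMultilinear.sum _ fun τ _ => IsMultilinear.ite_zero _ fun _ =>
    IsMultilinear.sum _ fun T _ => IsMultilinear.ite_zero _ fun _ =>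
    IsMultilinear.sum _ fun j _ =>
      ((IsMultilinear.splitProduct τ T (hf _ _) (hg _ _)).cons _).cons _

/-- Equality is demanded only at `n + 2` letters, so the series may be replaced by a finite sum over
numbers of edges that is correct just in this range. -/
theorem laplacian_sum {ι : Type*} {s : Finset ι} {f : Functional k V} {F : ι → Functional k V}
    (h : ∀ τ a, f (n + 2) τ a = ∑ i ∈ s, F i (n + 2) τ a) (σ : Perm (Fin n)) (a : Fin n → V) :
    laplacian β f n σ a = ∑ i ∈ s, laplacian β (F i) n σ a := by
  classical
  unfold laplacian
  rw [← mul_sum, sum_comm]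
  congr 1
  refine sum_congr rfl fun τ _ => ?_
  split_ifs
  · rw [sum_comm]
    exact sum_congr rfl fun j _ => h _ _
  · exact sum_const_zero.symm

theorem bracket_sum [DirectSum.Decomposition 𝒱] {ι κ : Type*} {s : Finset ι} {t : Finset κ}
    {f g : Functional k V} {F : ι → Functional k V} {G : κ → Functional k V}
    (hf : ∀ N ≤ n + 2, ∀ τ a, f N τ a = ∑ i ∈ s, F i N τ a)
    (hg : ∀ N ≤ n + 2, ∀ τ a, g N τ a = ∑ i ∈ t, G i N τ a) (σ : Perm (Fin n)) (a : Fin n → V) :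
    bracket β f g n σ a = ∑ i ∈ s, ∑ j ∈ t, bracket β (F i) (G j) n σ a := by
  classical
  have h1 : ∀ (τ : Perm (Fin (n + 2))) (T : Finset (Fin (n + 2))) (a : Fin (n + 2) → V),
      splitProduct 𝒱 f g τ T a = ∑ x ∈ s ×ˢ t, splitProduct 𝒱 (F x.1) (G x.2) τ T a := by
    intro τ T a
    unfold splitProduct
    rw [sum_comm]
    refine sum_congr rfl fun p _ => ?_
    rw [hf _ ((card_le_univ T).trans (by simp)), hg _ ((card_le_univ Tᶜ).trans (by simp)),
      mul_assoc, sum_mul_sum, sum_product, mul_sum]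
    refine sum_congr rfl fun i _ => ?_
    rw [mul_sum]
    exact sum_congr rfl fun j _ => (mul_assoc _ _ _).symm
  rw [← sum_product']
  unfold bracket
  rw [sum_comm]
  refine sum_congr rfl fun τ _ => ?_
  split_ifs
  · rw [sum_comm]
    refine sum_congr rfl fun T _ => ?_
    split_ifs
    · rw [sum_comm]
      exact sum_congr rfl fun j _ => h1 _ _ _
    · exact sum_const_zero.symm
  · exact sum_const_zero.symm

/-- The square of pairs with both entries at most `K` lies in the antidiagonals up to `2 * K`, and
outside this square the terms vanish. -/
theorem sum_range_antidiagonal (K : ℕ) {X : ℕ → ℕ → k} (h₁ : ∀ i j, K < i → X i j = 0)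
    (h₂ : ∀ i j, K < j → X i j = 0) :
    ∑ E ∈ range (2 * K + 1), ∑ d ∈ antidiagonal E, X d.1 d.2 =
      ∑ i ∈ range (K + 1), ∑ j ∈ range (K + 1), X i j := by
  rw [← sum_product', ← sum_fiberwise_of_maps_to (g := fun x : ℕ × ℕ => x.1 + x.2)
    (t := range (2 * K + 1))]
  · refine sum_congr rfl fun E _ => (sum_subset (fun x hx => ?_) fun x hx hx' => ?_).symm
    · exact HasAntidiagonal.mem_antidiagonal.2 (mem_filter.1 hx).2
    · by_contra hne
      refine hx' (mem_filter.2 ⟨mem_product.2 ⟨mem_range.2 ?_, mem_range.2 ?_⟩,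
        HasAntidiagonal.mem_antidiagonal.1 hx⟩)
      · exact Nat.lt_succ_of_le (not_lt.1 fun h => hne (h₁ _ _ h))
      · exact Nat.lt_succ_of_le (not_lt.1 fun h => hne (h₂ _ _ h))
  · intro x hx
    simp only [mem_product, mem_range] at hx ⊢
    omega

end

/-! ### The sums over the graphs with a given number of edges -/

section

variable [DirectSum.Decomposition 𝒱] {β : OddScalarProduct 𝒱} {I : OddSymmetry β} {ι : Type*}
  [Fintype ι] {h : OddHomotopy I} {m : CyclicTensors 𝒱} {u : HomogeneousBasis β ι}

theorem edgeSum_eq_zero (hm : m.IsReduced) {E b n : ℕ} (hE : 3 * b + n < E) (σ : Perm (Fin n))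
    (a : Fin n → h.image) : edgeSum h m u E b n σ a = 0 := by
  classical
  unfold edgeSum labelledSum
  rw [sum_eq_zero, mul_zero]
  intro τ _
  split_ifs with hτ
  · by_contra hne
    exact absurd (le_of_valence hτ (three_le_of_contractEdges hm hne)) (by omega)
  · rfl

/-- Renumbering of the legs of a graph. -/
def relabelLegs (E : ℕ) {n : ℕ} (ρ : Perm (Fin n)) : Perm (Flag E n) :=
  sumCongr (prodCongr (Equiv.refl _) (Equiv.refl _)) ρ

theorem surfaceCond_relabelLegs {E b n : ℕ} {τ : Perm (Flag E n)} {σ : Perm (Fin n)}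
    (ρ : Perm (Fin n)) : SurfaceCond ((relabelLegs E ρ).permCongr τ) (edgeFlip _ _) Sum.inr E b
      (ρ.permCongr σ) ↔ SurfaceCond τ (edgeFlip _ _) Sum.inr E b σ := by
  have hg : (relabelLegs E ρ).permCongr (edgeFlip _ _) = edgeFlip (Fin E) (Fin n) := by
    refine Equiv.ext fun x => ?_
    obtain ⟨x, rfl⟩ := (relabelLegs E ρ).surjective x
    rw [permCongr_apply, symm_apply_apply]
    obtain x | i := x <;> rfl
  have hleg : relabelLegs E ρ ∘ Sum.inr ∘ ρ.symm = (Sum.inr : Fin n → Flag E n) := by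
    funext i
    simp [relabelLegs]
  have h := SurfaceCond.congr_iff (relabelLegs E ρ) ρ (τ := τ) (ψ := edgeFlip _ _) (leg := Sum.inr)
    (c := E) (b := b) (σ := σ)
  rwa [hg, hleg] at h

theorem contractEdges_relabelLegs (hm : m.IsReduced) (u : HomogeneousBasis β ι)
    {H : Module.End k V} (hH : ∀ ε, ∀ a ∈ 𝒱 ε, H a ∈ 𝒱 (ε + 1)) {E n : ℕ} (ρ : Perm (Fin n))
    (τ : Perm (Flag E n)) {p : Fin n → ZMod 2} {a : Fin n → V} (ha : ∀ i, a i ∈ 𝒱 (p i)) :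
    contractEdges m u H (flagNumbering E n) ((relabelLegs E ρ).permCongr τ) a =
      koszul (fun i => p i + 1) (fun i => (ρ⁻¹ i : ℕ)) *
        contractEdges m u H (flagNumbering E n) τ (a ∘ ρ) := by
  have hstd : IsStandard ((relabelLegs E ρ).trans (flagNumbering E n)) :=
    { lt := fun x => by simp [relabelLegs, flagNumbering_inl]
      pairRank := fun x z hz0 hz1 => by
        have h := (isStandard_flagNumbering E n).pairRank x (relabelLegs E ρ z)
          (fun h' => hz0 ((relabelLegs E ρ).injective h'))
          (fun h' => hz1 ((relabelLegs E ρ).injective h'))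
        exact h }
  rw [relabelLegs, contractEdges_permCongr, ← relabelLegs,
    contractEdges_reorder hm hH hstd (isStandard_flagNumbering _ _) τ (p := p ∘ ρ)
      (a := a ∘ ρ) (fun i => ha (ρ i))]
  congr 1
  rw [koszul_eq_reorderSign, ← reorderSign_comp ρ (fun i => p i + 1) fun i => (i : ℕ)]
  refine reorderSign_congr (k := k) (fun i => p (ρ i) + 1) fun x y => ?_
  simp [relabelLegs, flagNumbering_inr]

theorem labelledSum_permCongr (hm : m.IsReduced) (u : HomogeneousBasis β ι)
    {H : Module.End k V} (hH : ∀ ε, ∀ a ∈ 𝒱 ε, H a ∈ 𝒱 (ε + 1)) (E b : ℕ) {n : ℕ}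
    (σ ρ : Perm (Fin n)) {p : Fin n → ZMod 2} {a : Fin n → V} (ha : ∀ i, a i ∈ 𝒱 (p i)) :
    labelledSum m u H E b n (ρ.permCongr σ) a =
      koszul (fun i => p i + 1) (fun i => (ρ⁻¹ i : ℕ)) *
        labelledSum m u H E b n σ (a ∘ ρ) := by
  classical
  unfold labelledSum
  rw [← (relabelLegs E ρ).permCongr.sum_comp, mul_sum]
  refine sum_congr rfl fun τ _ => ?_
  rw [mul_ite, mul_zero, contractEdges_relabelLegs hm u hH ρ τ ha]
  exact if_congr (surfaceCond_relabelLegs ρ) rfl rfl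

theorem isEvenFunctional_edgeSum (hm : m.IsReduced) (E b : ℕ) :
    IsEvenFunctional h.grading (edgeSum h m u E b) where
  multilinear n σ := edgeSum_isMultilinear σ
  even n σ p a ha hp := by
    classical
    unfold edgeSum labelledSum
    rw [sum_eq_zero, mul_zero]
    intro τ _
    rw [contractEdges_eq_zero hm h.odd _ τ (p := p) (a := fun i => (a i : V)) ha hp, ite_self]
  equivariant n σ ρ p a ha := by
    classical
    have hρ : ρ * σ * ρ⁻¹ = ρ.permCongr σ := rfl
    unfold edgeSum
    rw [hρ, labelledSum_permCongr hm u h.odd E b σ ρ (p := p) (a := fun i => (a i : V)) ha,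
      mul_left_comm]
    rfl

open Classical in
/-- The contributions of the vertices. -/
def vertexSum (h : OddHomotopy I) (m : CyclicTensors 𝒱) (u : HomogeneousBasis β ι) (E b : ℕ)
    {n : ℕ} (σ : Perm (Fin n)) (a : Fin n → h.image) : k :=
  (relabelCount E : k)⁻¹ * ∑ τ : Perm (Flag E n),
    if SurfaceCond τ (edgeFlip _ _) Sum.inr E b σ then
      vertexTerm m u h.H I.I τ (fun i => (a i : V)) else 0

theorem vertexSum_eq_zero (hm : m.IsReduced) {E b n : ℕ} (hE : 3 * b + n < E) (σ : Perm (Fin n))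
    {p : Fin n → ZMod 2} {a : Fin n → h.image} (ha : ∀ i, a i ∈ h.grading (p i)) :
    vertexSum h m u E b σ a = 0 := by
  classical
  unfold vertexSum vertexTerm
  rw [sum_eq_zero, mul_zero]
  intro τ _
  split_ifs with hτ
  · refine sum_eq_zero fun j _ => ?_
    rw [evalOn_dualAction I.I (f := m.expFunctional) (fun n σ => m.vertexProduct_isMultilinear σ) (flagNumbering E n) τ
      (edgeLetters_mem u h.odd j (p := p) (a := fun i => (a i : V)) ha), neg_eq_zero]
    refine sum_eq_zero fun y _ => mul_eq_zero_of_right _ ?_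
    by_contra hne
    exact absurd (le_of_valence hτ (m.three_le_minimalPeriod hm _ hne)) (by omega)
  · rfl

variable [FiniteDimensional k V]

open Classical in
theorem dualAction_edgeSum (E b : ℕ) {n : ℕ} (σ : Perm (Fin n)) {p : Fin n → ZMod 2}
    {a : Fin n → h.image} (ha : ∀ i, a i ∈ h.grading (p i)) :
    dualAction h.grading h.restrictI.I (edgeSum h m u E b) n σ a =
      vertexSum h m u E b σ a + (relabelCount E : k)⁻¹ * ∑ τ : Perm (Flag E n),
        if SurfaceCond τ (edgeFlip _ _) Sum.inr E b σ then
          ∑ e, (edgeTerm m u h.H 1 e τ (fun i => (a i : V)) -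
            edgeTerm m u h.H h.proj e τ (fun i => (a i : V))) else 0 := by
  rw [dualAction_eq _ _ σ (edgeSum_isMultilinear σ) ha]
  unfold vertexSum edgeSum labelledSum
  have hup : ∀ i, (fun j => ((Function.update a i (h.restrictI.I (a i)) j : h.image) : V)) =
      Function.update (fun j => (a j : V)) i (I.I (a i)) := fun i => by
    funext j
    by_cases hj : j = i
    · subst hj
      rw [Function.update_self, Function.update_self]
      rfl
    · rw [Function.update_of_ne hj, Function.update_of_ne hj]
  simp only [hup]
  rw [← mul_add, ← sum_add_distrib, sum_congr rfl fun i _ => mul_left_comm _ _ _, ← mul_sum,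
    ← mul_neg, sum_congr rfl fun i _ => mul_sum _ _ _, sum_comm, ← sum_neg_distrib]
  congr 1
  refine sum_congr rfl fun τ _ => ?_
  split_ifs
  · exact dualAction_contractEdges m u h τ (a := fun i => (a i : V)) ha
  · simp

theorem dualAction_edgeSum_zero (b : ℕ) {n : ℕ} (σ : Perm (Fin n)) {p : Fin n → ZMod 2}
    {a : Fin n → h.image} (ha : ∀ i, a i ∈ h.grading (p i)) :
    dualAction h.grading h.restrictI.I (edgeSum h m u 0 b) n σ a = vertexSum h m u 0 b σ a := by
  simp [dualAction_edgeSum 0 b σ ha]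

/-- The telescoping identity. Of the two terms at an edge of a graph with `E + 1` edges, the one
with `1` gives minus the vertex terms at `E` edges, and the one with `P` gives `Δ` and the bracket.
-/
theorem dualAction_edgeSum_succ [CharZero k] (hm : m.IsReduced)
    (hI : dualAction 𝒱 I.I m.functional + (2 : k)⁻¹ • bracket β m.functional m.functional = 0)
    (hΔ : laplacian β m.functional = 0) (E b : ℕ) {n : ℕ} (σ : Perm (Fin n)) {p : Fin n → ZMod 2}
    {a : Fin n → h.image} (ha : ∀ i, a i ∈ h.grading (p i)) :
    dualAction h.grading h.restrictI.I (edgeSum h m u (E + 1) b) n σ a +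
      laplacian h.form (hbar (edgeSum h m u E) b) n σ a +
      (2 : k)⁻¹ * ∑ c ∈ antidiagonal b, ∑ d ∈ antidiagonal E,
        bracket h.form (edgeSum h m u d.1 c.1) (edgeSum h m u d.2 c.2) n σ a =
      vertexSum h m u (E + 1) b σ a - vertexSum h m u E b σ a := by
  classical
  -- From $(E+1)!\,2^{E+1}=2(E+1)\cdot E!\,2^E$: the factor `E + 1` is the choice of the marked
  -- edge, and the remaining `½` is its orientation.
  have key : ∀ T : Module.End k V, (∀ ε, ∀ a ∈ 𝒱 ε, T a ∈ 𝒱 ε) →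
      (relabelCount (E + 1) : k)⁻¹ * (∑ τ : Perm (Flag (E + 1) n),
        if SurfaceCond τ (edgeFlip _ _) Sum.inr (E + 1) b σ then
          ∑ e, edgeTerm m u h.H T e τ (fun i => (a i : V)) else 0) =
      (2 : k)⁻¹ * ((relabelCount E : k)⁻¹ * ∑ τ : Perm (Flag E (n + 2)),
        if MarkedCond E b τ σ then markedTerm m u h.H T τ (fun i => (a i : V)) else 0) := by
    intro T hT
    have h1 := sum_markedCond b σ fun τ : Perm (Flag E (n + 2)) =>
      markedTerm m u h.H T τ (fun i => (a i : V))
    have h2 : ∀ (τ : Perm (Flag (E + 1) n)) (e : Fin (E + 1)),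
        markedTerm m u h.H T ((unmark n e).symm.permCongr τ) (fun i => (a i : V)) =
          edgeTerm m u h.H T e τ (fun i => (a i : V)) := by
      intro τ e
      rw [← edgeTerm_unmark e hm u h.odd hT _ (p := p) (a := fun i => (a i : V)) ha]
      congr 1
      exact (unmark n e).permCongr.apply_symm_apply τ
    simp only [h2] at h1
    have h3 : relabelCount (E + 1) = (E + 1) * (2 * relabelCount E) := by
      unfold relabelCount
      rw [Nat.factorial_succ, pow_succ]
      ring
    have h4 := relabelCount_ne_zero (k := k) E
    have h5 : (E + 1 : k) ≠ 0 := Nat.cast_add_one_ne_zero E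
    rw [h1, h3]
    push_cast
    field_simp
  have h1 := sum_markedTerm_proj (h := h) (u := u) hm E b σ ha
  have h2 := sum_markedTerm_one hm u I hI hΔ h.odd E b σ (p := p) (a := fun i => (a i : V)) ha
  have h3 : vertexSum h m u E b σ a = (relabelCount E : k)⁻¹ * ∑ τ : Perm (Flag E n),
    if SurfaceCond τ (edgeFlip _ _) Sum.inr E b σ then
      vertexTerm m u h.H I.I τ (fun i => (a i : V)) else 0 := rfl
  have h4 := key 1 fun _ _ h => h
  have h5 := key h.proj h.proj_mem
  rw [dualAction_edgeSum (E + 1) b σ ha]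
  have h6 : (∑ τ : Perm (Flag (E + 1) n),
      if SurfaceCond τ (edgeFlip _ _) Sum.inr (E + 1) b σ then
        ∑ e, (edgeTerm m u h.H 1 e τ (fun i => (a i : V)) -
          edgeTerm m u h.H h.proj e τ (fun i => (a i : V))) else 0) =
      (∑ τ : Perm (Flag (E + 1) n), if SurfaceCond τ (edgeFlip _ _) Sum.inr (E + 1) b σ then
        ∑ e, edgeTerm m u h.H 1 e τ (fun i => (a i : V)) else 0) -
      ∑ τ : Perm (Flag (E + 1) n), if SurfaceCond τ (edgeFlip _ _) Sum.inr (E + 1) b σ then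
        ∑ e, edgeTerm m u h.H h.proj e τ (fun i => (a i : V)) else 0 := by
    rw [← sum_sub_distrib]
    refine sum_congr rfl fun τ _ => ?_
    split_ifs
    · exact sum_sub_distrib _ _
    · simp
  rw [h6, mul_sub, h4, h5, h1, h2, h3]
  field_simp
  ring

end

end

section

variable {k : Type*} [Field k] {V : Type*} [AddCommGroup V] [Module k V] [FiniteDimensional k V]
  {𝒱 : ZMod 2 → Submodule k V} {β : OddScalarProduct 𝒱}

/-! ### Power series -/

theorem laplacianSeries_hbar (S : Series k V) :
    hbar (laplacianSeries β S) = fun b => laplacian β (hbar S b) := by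
  funext b n σ a
  cases b with
  | zero => exact (laplacian_sum (s := (∅ : Finset ℕ)) (F := fun _ => 0) (fun _ _ => rfl) σ a).symm
  | succ b => rfl

theorem bracketSeries_apply [DirectSum.Decomposition 𝒱] (S T : Series k V) (b : ℕ) {n : ℕ} (σ : Perm (Fin n))
    (a : Fin n → V) : bracketSeries β S T b n σ a =
      ∑ c ∈ antidiagonal b, bracket β (S c.1) (T c.2) n σ a := by
  simp [bracketSeries, Finset.sum_apply]

variable [CharZero k] [DirectSum.Decomposition 𝒱] {I : OddSymmetry β} {h : OddHomotopy I} {ι : Type*} [Fintype ι]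
  {m : CyclicTensors 𝒱}

/-! ### The sum over all graphs -/

theorem graphSum_eq (u : HomogeneousBasis β ι) {b n K : ℕ} (hK : 3 * b + n ≤ K)
    (σ : Perm (Fin n)) (a : Fin n → h.image) : h.graphSum m b n σ a =
      ∑ E ∈ range (K + 1), edgeSum h m.truncate u E b n σ a :=
  sum_contributes h m u (Nat.lt_succ_of_le hK) σ _

theorem isEvenFunctional_graphSum (h : OddHomotopy I) (m : CyclicTensors 𝒱) (b : ℕ) :
    IsEvenFunctional h.grading (h.graphSum m b) := by
  obtain ⟨u⟩ := exists_homogeneousBasis β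
  have key := fun E => isEvenFunctional_edgeSum (h := h) (u := u) m.isReduced_truncate E b
  refine ⟨fun n σ => ?_, fun n σ p a ha hp => ?_, fun n σ ρ p a ha => ?_⟩
  · have : IsMultilinear (h.graphSum m b n σ) := by
      rw [show h.graphSum m b n σ = _ from funext fun a => graphSum_eq u le_rfl σ a]
      exact IsMultilinear.sum _ fun E _ => edgeSum_isMultilinear σ
    exact this
  · rw [graphSum_eq u le_rfl]
    exact sum_eq_zero fun E _ => (key E).even n σ p a ha hp
  · rw [graphSum_eq u le_rfl, graphSum_eq u le_rfl, mul_sum]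
    exact sum_congr rfl fun E _ => (key E).equivariant n σ ρ p a ha

/-- Summing the identities for all numbers of edges leaves only the vertex terms at the top, which
vanish because too many edges contradict valence three; those at zero edges cancel `I^∨` of the
graphs without edges. -/
theorem graphSum_equation_apply (hm : m.IsReduced) (u : HomogeneousBasis β ι)
    (hI : dualAction 𝒱 I.I m.functional + (2 : k)⁻¹ • bracket β m.functional m.functional = 0)
    (hΔ : laplacian β m.functional = 0) {S : Series k h.image}
    (hS : ∀ {b n K : ℕ}, 3 * b + n ≤ K → ∀ (σ : Perm (Fin n)) (a : Fin n → h.image),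
      S b n σ a = ∑ E ∈ range (K + 1), edgeSum h m u E b n σ a) (b : ℕ) {n : ℕ}
    (σ : Perm (Fin n)) {p : Fin n → ZMod 2} {a : Fin n → h.image}
    (ha : ∀ i, a i ∈ h.grading (p i)) :
    laplacian h.form (hbar S b) n σ a +
      (2 : k)⁻¹ * (∑ c ∈ antidiagonal b, bracket h.form (S c.1) (S c.2) n σ a) +
      dualAction h.grading h.restrictI.I (S b) n σ a = 0 := by
  -- The edge bound for up to `n + 2` letters, as needed in `Δ` and the bracket. A bracket joins two
  -- graphs, so the total number of edges runs up to `2 * K`.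
  set K := 3 * b + n + 2 with hK
  have h1 : laplacian h.form (hbar S b) n σ a =
      ∑ E ∈ range (2 * K + 1), laplacian h.form (hbar (edgeSum h m u E) b) n σ a := by
    refine laplacian_sum (fun τ a => ?_) σ a
    cases b with
    | zero => exact sum_const_zero.symm
    | succ b => exact hS (K := 2 * K) (by omega) τ a
  have h2 : ∀ c ∈ antidiagonal b, bracket h.form (S c.1) (S c.2) n σ a =
      ∑ E ∈ range (2 * K + 1), ∑ d ∈ antidiagonal E,
        bracket h.form (edgeSum h m u d.1 c.1) (edgeSum h m u d.2 c.2) n σ a := by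
    intro c hc
    rw [HasAntidiagonal.mem_antidiagonal] at hc
    rw [sum_range_antidiagonal K
      (X := fun i j => bracket h.form (edgeSum h m u i c.1) (edgeSum h m u j c.2) n σ a)]
    · exact bracket_sum (fun N hN τ a => hS (by omega) τ a)
        (fun N hN τ a => hS (by omega) τ a) σ a
    · intro i j hi
      exact bracket_sum (s := (∅ : Finset ℕ)) (t := {j}) (F := fun _ => 0)
        (G := fun j => edgeSum h m u j c.2)
        (fun N hN τ a => edgeSum_eq_zero hm (by omega) τ a) (fun N hN τ a => by simp) σ a
    · intro i j hj
      rw [bracket_sum (s := {i}) (t := (∅ : Finset ℕ)) (F := fun i => edgeSum h m u i c.1)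
        (G := fun _ => 0) (fun N hN τ a => by simp)
        (fun N hN τ a => edgeSum_eq_zero hm (by omega) τ a) σ a]
      simp
  have h3 : dualAction h.grading h.restrictI.I (S b) n σ a =
      ∑ E ∈ range (2 * K + 1 + 1),
        dualAction h.grading h.restrictI.I (edgeSum h m u E b) n σ a := by
    unfold dualAction
    rw [sum_neg_distrib, sum_comm]
    congr 1
    exact sum_congr rfl fun i _ => hS (by omega) _ _
  -- The term with no edges is split off, so that `I^∨` at `E + 1` edges stands next to `Δ` and the
  -- bracket at `E`.
  rw [h1, sum_congr rfl h2, sum_comm, h3, sum_range_succ' _ (2 * K + 1), dualAction_edgeSum_zero b σ ha, mul_sum]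
  have h4 : ∀ E, laplacian h.form (hbar (edgeSum h m u E) b) n σ a +
      (2 : k)⁻¹ * (∑ c ∈ antidiagonal b, ∑ d ∈ antidiagonal E,
        bracket h.form (edgeSum h m u d.1 c.1) (edgeSum h m u d.2 c.2) n σ a) +
      dualAction h.grading h.restrictI.I (edgeSum h m u (E + 1) b) n σ a =
      vertexSum h m u (E + 1) b σ a - vertexSum h m u E b σ a := fun E => by
    rw [← dualAction_edgeSum_succ hm hI hΔ E b σ ha]
    ring
  rw [← add_assoc, ← sum_add_distrib, ← sum_add_distrib, sum_congr rfl fun E _ => h4 E,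
    sum_range_sub fun E => vertexSum h m u E b σ a, sub_add_cancel,
    vertexSum_eq_zero hm (by omega) σ ha]

theorem solvesEquivariantBV_graphSum
    (hm : dualAction 𝒱 I.I m.functional + (2 : k)⁻¹ • bracket β m.functional m.functional = 0)
    (hΔ : laplacian β m.functional = 0) (h : OddHomotopy I) :
    SolvesEquivariantBV h.restrictI (h.graphSum m) := by
  obtain ⟨u⟩ := exists_homogeneousBasis β
  have hmul : ∀ b n σ, IsMultilinear (h.graphSum m b n σ) := fun b =>
    (isEvenFunctional_graphSum h m b).multilinear
  refine ⟨isEvenFunctional_graphSum h m, ?_⟩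
  rw [laplacianSeries_hbar]
  funext b n σ a
  -- The equations are now those of the reduced tensors, which have the same graph sum.
  rw [← m.truncate_functional] at hm hΔ
  have key := fun p a ha => graphSum_equation_apply (h := h) m.isReduced_truncate u hm hΔ
    (fun hK σ a => graphSum_eq u hK σ a) b σ (p := p) (a := a) ha
  have h1 : ∀ n σ, IsMultilinear (hbar (h.graphSum m) b n σ) := by
    cases b with
    | zero => exact fun _ _ => IsMultilinear.zero
    | succ b => exact hmul b
  have := IsMultilinear.ext_homogeneous (𝒱 := h.grading)
    (((laplacian_isMultilinear (β := h.form) h1 σ).add ((IsMultilinear.sum (antidiagonal b)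
      fun c _ => bracket_isMultilinear (hmul c.1) (hmul c.2) σ).const_mul (2 : k)⁻¹)).add
      (dualAction_isMultilinear h.restrictI.I (hmul b) σ)) IsMultilinear.zero key a
  rw [← bracketSeries_apply] at this
  exact this

end

section

variable {k : Type*} [Field k] {V : Type*} [AddCommGroup V] [Module k V]
  {𝒱 : ZMod 2 → Submodule k V}

/-! ### Words of two letters -/

section

variable {n : ℕ}

/-- The letter `y` takes the place of the `j`-th letter. -/
def pairEquiv (y : Fin (n + 2)) (j : Fin n) : Fin 2 ⊕ Fin n ≃ Fin (n + 2) :=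
  (consTwo n).trans (swap y j.succ.succ)

theorem swap_succ_succ_of_ne {y : Fin (n + 2)} (hy : y = 0 ∨ y = 1) {i j : Fin n} (h : i ≠ j) :
    swap y j.succ.succ i.succ.succ = i.succ.succ := by
  refine swap_apply_of_ne_of_ne ?_ (by simpa using h)
  obtain rfl | rfl := hy
  · simp
  · simp [Fin.ext_iff]

theorem pairEquiv_inr_self (y : Fin (n + 2)) (j : Fin n) : pairEquiv y j (Sum.inr j) = y := by
  simp [pairEquiv]

theorem pairEquiv_inr_of_ne {y : Fin (n + 2)} (hy : y = 0 ∨ y = 1) {i j : Fin n} (h : i ≠ j) :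
    pairEquiv y j (Sum.inr i) = i.succ.succ := by
  simp [pairEquiv, swap_succ_succ_of_ne hy h]

theorem pairEquiv_one_inl_zero (j : Fin n) : pairEquiv 1 j (Sum.inl 0) = 0 := by
  simp only [pairEquiv, trans_apply, consTwo_zero]
  exact swap_apply_of_ne_of_ne (by simp) (by simp [Fin.ext_iff])

theorem pairEquiv_one_inl_one (j : Fin n) : pairEquiv 1 j (Sum.inl 1) = j.succ.succ := by
  simp [pairEquiv]

theorem pairEquiv_zero_inl_zero (j : Fin n) : pairEquiv 0 j (Sum.inl 0) = j.succ.succ := by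
  simp [pairEquiv]

theorem pairEquiv_zero_inl_one (j : Fin n) : pairEquiv 0 j (Sum.inl 1) = 1 := by
  simp only [pairEquiv, trans_apply, consTwo_one]
  exact swap_apply_of_ne_of_ne (by simp) (by simp [Fin.ext_iff])

/-- The words of `σ` with `y` in the place of the `j`-th letter, and a word of two letters. -/
def pairWords (y : Fin (n + 2)) (j : Fin n) (σ : Perm (Fin n)) : Perm (Fin (n + 2)) :=
  (pairEquiv y j).permCongr (sumCongr (swap 0 1) σ)

theorem pairWords_inl (y : Fin (n + 2)) (j : Fin n) (σ : Perm (Fin n)) (i : Fin 2) :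
    pairWords y j σ (pairEquiv y j (Sum.inl i)) = pairEquiv y j (Sum.inl (swap 0 1 i)) := by
  rw [pairWords, permCongr_apply, symm_apply_apply]
  rfl

theorem pairWords_inr (y : Fin (n + 2)) (j : Fin n) (σ : Perm (Fin n)) (i : Fin n) :
    pairWords y j σ (pairEquiv y j (Sum.inr i)) = pairEquiv y j (Sum.inr (σ i)) := by
  rw [pairWords, permCongr_apply, symm_apply_apply]
  rfl

theorem pairEquiv_inl {x y : Fin (n + 2)} (h : x = 0 ∧ y = 1 ∨ x = 1 ∧ y = 0) (j : Fin n)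
    (i : Fin 2) : (pairEquiv y j (Sum.inl i) = x ∧
      pairEquiv y j (Sum.inl (swap 0 1 i)) = j.succ.succ) ∨
      (pairEquiv y j (Sum.inl i) = j.succ.succ ∧
      pairEquiv y j (Sum.inl (swap 0 1 i)) = x) := by
  obtain ⟨rfl, rfl⟩ | ⟨rfl, rfl⟩ := h <;> fin_cases i <;>
    simp [pairEquiv_one_inl_zero, pairEquiv_one_inl_one, pairEquiv_zero_inl_zero,
      pairEquiv_zero_inl_one]

theorem pairWords_apply {x y : Fin (n + 2)} (h : x = 0 ∧ y = 1 ∨ x = 1 ∧ y = 0) (j : Fin n)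
    (σ : Perm (Fin n)) : pairWords y j σ x = j.succ.succ ∧ pairWords y j σ j.succ.succ = x := by
  have h0 := pairWords_inl y j σ 0
  have h1 := pairWords_inl y j σ 1
  rw [swap_apply_left] at h0
  rw [swap_apply_right] at h1
  obtain ⟨h2, h3⟩ | ⟨h2, h3⟩ := pairEquiv_inl h j 0 <;> rw [swap_apply_left] at h3 <;>
    rw [h2, h3] at h0 h1
  · exact ⟨h0, h1⟩
  · exact ⟨h1, h0⟩

/-- The word of two letters consists of `x` and the letter `j`, while `y` occupies the place of `j`
in `σ`. Gluing `x` to `y` puts `j` back into that place. -/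
theorem glues_pairWords {x y : Fin (n + 2)} (h : x = 0 ∧ y = 1 ∨ x = 1 ∧ y = 0) (j : Fin n)
    (σ : Perm (Fin n)) : Glues (pairWords y j σ) σ := by
  have hy : y = 0 ∨ y = 1 := by tauto
  obtain ⟨k1, k2⟩ := pairWords_apply h j σ
  set φ := pairWords y j σ * swap 0 1 with hφ
  have hx : x ∉ Set.range fun i : Fin n => i.succ.succ := by
    rintro ⟨i, hi⟩
    obtain ⟨rfl, -⟩ | ⟨rfl, -⟩ := h <;> simp [Fin.ext_iff] at hi
  have hy' : y ∉ Set.range fun i : Fin n => i.succ.succ := by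
    rintro ⟨i, hi⟩
    obtain ⟨-, rfl⟩ | ⟨-, rfl⟩ := h <;> simp [Fin.ext_iff] at hi
  have hsw : swap 0 1 x = y ∧ swap 0 1 y = x := by
    obtain ⟨rfl, rfl⟩ | ⟨rfl, rfl⟩ := h <;> simp
  have hs : ∀ i : Fin n, swap 0 1 i.succ.succ = (i.succ.succ : Fin (n + 2)) :=
    fun i => swap_apply_of_ne_of_ne (by simp) (by simp [Fin.ext_iff])
  have f1 : φ y = j.succ.succ := by rw [hφ, Perm.mul_apply, hsw.2, k1]
  have f2 : φ x = pairEquiv y j (Sum.inr (σ j)) := by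
    rw [hφ, Perm.mul_apply, hsw.1, ← pairWords_inr, pairEquiv_inr_self]
  have f3 : φ j.succ.succ = x := by rw [hφ, Perm.mul_apply, hs, k2]
  have f4 : ∀ i ≠ j, φ i.succ.succ = pairEquiv y j (Sum.inr (σ i)) := fun i hi => by
    rw [hφ, Perm.mul_apply, hs, ← pairWords_inr, pairEquiv_inr_of_ne hy hi]
  have hity : FirstHit φ (Set.range fun i : Fin n => i.succ.succ) y j.succ.succ :=
    f1 ▸ FirstHit.hit (f1 ▸ ⟨j, rfl⟩)
  have hit : ∀ z l, φ z = pairEquiv y j (Sum.inr l) →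
      FirstHit φ (Set.range fun i : Fin n => i.succ.succ) z l.succ.succ := by
    intro z l hz
    by_cases hl : l = j
    · subst hl
      rw [pairEquiv_inr_self] at hz
      exact FirstHit.step (hz ▸ hy') (hz ▸ hity)
    · rw [pairEquiv_inr_of_ne hy hl] at hz
      exact hz ▸ FirstHit.hit (hz ▸ ⟨l, rfl⟩)
  have hitx := hit x _ f2
  have hits : ∀ i : Fin n, FirstHit φ (Set.range fun i : Fin n => i.succ.succ) i.succ.succ
      (σ i).succ.succ := by
    intro i
    by_cases hi : i = j
    · subst hi
      exact FirstHit.step (f3 ▸ hx) (f3 ▸ hitx)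
    · exact hit _ _ (f4 i hi)
  refine glues_iff.2 ⟨?_, hits⟩
  rw [forall_fin_add_two]
  refine ⟨?_, ?_, fun i => ⟨_, hits i⟩⟩
  · obtain ⟨rfl, rfl⟩ | ⟨rfl, rfl⟩ := h
    exacts [⟨_, hitx⟩, ⟨_, hity⟩]
  · obtain ⟨rfl, rfl⟩ | ⟨rfl, rfl⟩ := h
    exacts [⟨_, hity⟩, ⟨_, hitx⟩]

/-- A two-letter word containing `x` consists of `x` and one remaining letter. The other words are
then forced, since a gluing has only one result. -/
theorem exists_pairWords {x y : Fin (n + 2)} (h : x = 0 ∧ y = 1 ∨ x = 1 ∧ y = 0)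
    {τ : Perm (Fin (n + 2))} {σ : Perm (Fin n)} (hτ : Glues τ σ) {T : Finset (Fin (n + 2))}
    (hT : IsUnionOfWords τ T) (hx : x ∈ T) (hy : y ∉ T) (hcard : T.card = 2)
    (hfix : ∀ i, restrictWords τ T i ≠ i) :
    ∃ j : Fin n, T = {x, j.succ.succ} ∧ τ = pairWords y j σ := by
  have hfix' : ∀ z ∈ T, τ z ≠ z := by
    intro z hz
    obtain ⟨i, rfl⟩ := exists_splitEquiv_inl hz
    intro h1
    rw [← splitEquiv_restrictWords hT, permCongr_apply, symm_apply_apply] at h1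
    exact hfix i (Sum.inl_injective ((splitEquiv T).injective h1))
  obtain ⟨w, hw, rfl⟩ : ∃ w, w ≠ x ∧ T = {x, w} := by
    obtain ⟨a, b, hab, rfl⟩ := card_eq_two.1 hcard
    rw [mem_insert, mem_singleton] at hx
    obtain rfl | rfl := hx
    · exact ⟨b, hab.symm, rfl⟩
    · exact ⟨a, hab, pair_comm _ _⟩
  obtain ⟨j, rfl⟩ : ∃ j : Fin n, j.succ.succ = w := by
    have h1 : ∀ w : Fin (n + 2), w ≠ x → w ≠ y → ∃ j : Fin n, j.succ.succ = w := by
      rw [forall_fin_add_two]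
      refine ⟨fun h1 h2 => ?_, fun h1 h2 => ?_, fun i _ _ => ⟨i, rfl⟩⟩ <;>
      · exfalso
        obtain ⟨rfl, rfl⟩ | ⟨rfl, rfl⟩ := h <;> contradiction
    exact h1 w hw fun h2 => hy (h2 ▸ by simp)
  refine ⟨j, rfl, ?_⟩
  have hτx : τ x = j.succ.succ := by
    have h1 := (hT x).2 hx
    rw [mem_insert, mem_singleton] at h1
    exact h1.resolve_left (hfix' x hx)
  have hτj : τ j.succ.succ = x := by
    have h1 := (hT j.succ.succ).2 (by simp)
    rw [mem_insert, mem_singleton] at h1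
    exact h1.resolve_right (hfix' _ (by simp))
  have hinl : ∀ i, τ (pairEquiv y j (Sum.inl i)) = pairEquiv y j (Sum.inl (swap 0 1 i)) := by
    intro i
    obtain ⟨h2, h3⟩ | ⟨h2, h3⟩ := pairEquiv_inl h j i <;> rw [h2, h3]
    exacts [hτx, hτj]
  have h1 : (pairEquiv y j).symm.permCongr τ ∈ (Perm.sumCongrHom _ _).range := by
    refine Perm.mem_sumCongrHom_range_of_perm_mapsTo_inl ?_
    rintro _ ⟨i, rfl⟩
    refine ⟨swap 0 1 i, ?_⟩
    rw [permCongr_apply, symm_symm, hinl, symm_apply_apply]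
  obtain ⟨⟨τ₁, τ₂⟩, h2⟩ := h1
  change sumCongr τ₁ τ₂ = _ at h2
  have h3 : τ = (pairEquiv y j).permCongr (sumCongr τ₁ τ₂) := by
    rw [h2]
    ext x
    simp [permCongr_apply]
  have h4 : τ₁ = swap 0 1 := by
    refine Equiv.ext fun i => ?_
    have := hinl i
    rw [h3, permCongr_apply, symm_apply_apply] at this
    exact Sum.inl_injective ((pairEquiv y j).injective this)
  subst h4
  have h5 : τ₂ = σ := by
    refine Glues.unique (t := τ) ?_ hτ
    rw [h3]
    exact glues_pairWords h j τ₂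
  rw [h3, h5, pairWords]

theorem isUnionOfWords_pairWords {x y : Fin (n + 2)} (h : x = 0 ∧ y = 1 ∨ x = 1 ∧ y = 0)
    (j : Fin n) (σ : Perm (Fin n)) :
    IsUnionOfWords (pairWords y j σ) {x, j.succ.succ} := by
  obtain ⟨k1, k2⟩ := pairWords_apply h j σ
  intro z
  simp only [mem_insert, mem_singleton]
  constructor
  · rintro (h1 | h1)
    · exact Or.inr ((pairWords y j σ).injective (h1.trans k2.symm))
    · exact Or.inl ((pairWords y j σ).injective (h1.trans k1.symm))
  · rintro (rfl | rfl)
    · exact Or.inr k1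
    · exact Or.inl k2

end

/-! ### Products of functionals and numberings of the letters -/

theorem reorderSign_sumNumbering_sumNumbering {F₁ F₂ : Type*} [Fintype F₁] [Fintype F₂]
    {N₁ N₁' N₂ N₂' : ℕ} (e₁ : F₁ ≃ Fin N₁) (e₁' : F₁ ≃ Fin N₁') (e₂ : F₂ ≃ Fin N₂)
    (e₂' : F₂ ≃ Fin N₂') (q : F₁ ⊕ F₂ → ZMod 2) :
    reorderSign k q (fun i => sumNumbering e₁ e₂ i) (fun i => sumNumbering e₁' e₂' i) =
      reorderSign k (q ∘ Sum.inl) (fun i => e₁ i) (fun i => e₁' i) *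
        reorderSign k (q ∘ Sum.inr) (fun i => e₂ i) (fun i => e₂' i) := by
  have h₁ : ∀ {N : ℕ} (e : F₁ ≃ Fin N) (x : F₁) (m : ℕ), ¬ N + m < e x := fun e x m => by
    have := (e x).2
    omega
  unfold reorderSign
  simp only [Fintype.prod_sum_type, sumNumbering_inl, sumNumbering_inr, h₁, add_lt_add_iff_left,
    and_false, false_and, if_false, prod_const_one, mul_one, one_mul, Function.comp_apply]

/-- The definition numbers the letters of each factor increasingly; equivariance of `f` and `g`
absorbs the passage to any other numbering, and the signs combine by `reorderSign_trans`. -/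
theorem splitProduct_of_equiv [DirectSum.Decomposition 𝒱] {f g : Functional k V}
    (hf : IsEvenFunctional 𝒱 f) (hg : IsEvenFunctional 𝒱 g) {N₁ N₂ N : ℕ}
    (e : Fin N₁ ⊕ Fin N₂ ≃ Fin N) {T : Finset (Fin N)} (h₁ : ∀ i, e (Sum.inl i) ∈ T)
    (h₂ : ∀ i, e (Sum.inr i) ∉ T) (τ₁ : Perm (Fin N₁)) (τ₂ : Perm (Fin N₂)) {p : Fin N → ZMod 2}
    {a : Fin N → V} (ha : ∀ i, a i ∈ 𝒱 (p i)) :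
    splitProduct 𝒱 f g (e.permCongr (sumCongr τ₁ τ₂)) T a =
      reorderSign k (fun i => p (e i) + 1) (fun i => (e i : ℕ))
        (fun i => (sumNumbering (Equiv.refl (Fin N₁)) (Equiv.refl (Fin N₂)) i : ℕ)) *
      (f N₁ τ₁ (a ∘ e ∘ Sum.inl) * g N₂ τ₂ (a ∘ e ∘ Sum.inr)) := by
  have hα : ∀ i, ∃ j, splitEquiv T (Sum.inl i) = e (Sum.inl j) := fun i => by
    obtain ⟨j | j, hj⟩ := e.surjective (splitEquiv T (Sum.inl i))
    · exact ⟨j, hj.symm⟩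
    · exact absurd (hj ▸ splitEquiv_inl_mem T i) (h₂ j)
  have hγ : ∀ i, ∃ j, splitEquiv T (Sum.inr i) = e (Sum.inr j) := fun i => by
    obtain ⟨j | j, hj⟩ := e.surjective (splitEquiv T (Sum.inr i))
    · exact absurd (h₁ j) (hj ▸ splitEquiv_inr_notMem T i)
    · exact ⟨j, hj.symm⟩
  choose α hα using hα
  choose γ hγ using hγ
  have hα' : Function.Bijective α := by
    refine ⟨fun i j hij => ?_, fun j => ?_⟩
    · exact Sum.inl_injective ((splitEquiv T).injective ((hα i).trans (hij ▸ (hα j).symm)))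
    · obtain ⟨i, hi⟩ := exists_splitEquiv_inl (h₁ j)
      exact ⟨i, Sum.inl_injective (e.injective ((hα i).symm.trans hi))⟩
  have hγ' : Function.Bijective γ := by
    refine ⟨fun i j hij => ?_, fun j => ?_⟩
    · exact Sum.inr_injective ((splitEquiv T).injective ((hγ i).trans (hij ▸ (hγ j).symm)))
    · obtain ⟨i, hi⟩ := exists_splitEquiv_inr (h₂ j)
      exact ⟨i, Sum.inr_injective (e.injective ((hγ i).symm.trans hi))⟩
  let α' := Equiv.ofBijective α hα'
  let γ' := Equiv.ofBijective γ hγ'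
  have hs : (sumCongr α' γ').trans e = splitEquiv T := by
    refine Equiv.ext fun i => ?_
    obtain i | i := i
    · exact (hα i).symm
    · exact (hγ i).symm
  have hr := restrictWords_split T (α'.symm.permCongr τ₁) (γ'.symm.permCongr τ₂)
  have hτ : (splitEquiv T).permCongr (sumCongr (α'.symm.permCongr τ₁) (γ'.symm.permCongr τ₂)) =
      e.permCongr (sumCongr τ₁ τ₂) := by
    rw [← hs]
    refine Equiv.ext fun x => ?_
    obtain ⟨i | i, rfl⟩ := e.surjective x <;> simp [permCongr_apply]
  rw [hτ] at hr
  rw [splitProduct_eq _ T (hf.multilinear _ _) (hg.multilinear _ _) ha, hr.1, hr.2,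
    ← reorderSign_splitEquiv T]
  have hf' := hf.evalOn_reorder (Equiv.refl _) α' (α'.symm.permCongr τ₁)
    (x := a ∘ splitEquiv T ∘ Sum.inl) (p := p ∘ splitEquiv T ∘ Sum.inl) fun i => ha _
  have hg' := hg.evalOn_reorder (Equiv.refl _) γ' (γ'.symm.permCongr τ₂)
    (x := a ∘ splitEquiv T ∘ Sum.inr) (p := p ∘ splitEquiv T ∘ Sum.inr) fun i => ha _
  have hf2 : evalOn f α' (α'.symm.permCongr τ₁) (a ∘ splitEquiv T ∘ Sum.inl) =
      f N₁ τ₁ (a ∘ e ∘ Sum.inl) := by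
    unfold evalOn
    congr 1
    · exact α'.permCongr.apply_symm_apply τ₁
    · funext i
      obtain ⟨i, rfl⟩ := α'.surjective i
      simp only [Function.comp_apply, symm_apply_apply, hα]
      rfl
  have hg2 : evalOn g γ' (γ'.symm.permCongr τ₂) (a ∘ splitEquiv T ∘ Sum.inr) =
      g N₂ τ₂ (a ∘ e ∘ Sum.inr) := by
    unfold evalOn
    congr 1
    · exact γ'.permCongr.apply_symm_apply τ₂
    · funext i
      obtain ⟨i, rfl⟩ := γ'.surjective i
      simp only [Function.comp_apply, symm_apply_apply, hγ]
      rfl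
  rw [hf2] at hf'
  rw [hg2] at hg'
  have h3 : ∀ {N : ℕ} (τ : Perm (Fin N)), (Equiv.refl _).permCongr τ = τ := fun τ => by
    ext
    simp
  have hf3 : f T.card (α'.symm.permCongr τ₁) (a ∘ splitEquiv T ∘ Sum.inl) =
      evalOn f (Equiv.refl _) (α'.symm.permCongr τ₁) (a ∘ splitEquiv T ∘ Sum.inl) := by
    rw [evalOn, h3]
    rfl
  have hg3 : g Tᶜ.card (γ'.symm.permCongr τ₂) (a ∘ splitEquiv T ∘ Sum.inr) =
      evalOn g (Equiv.refl _) (γ'.symm.permCongr τ₂) (a ∘ splitEquiv T ∘ Sum.inr) := by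
    rw [evalOn, h3]
    rfl
  rw [hf3, hg3, hf', hg', mul_mul_mul_comm, ← mul_assoc]
  congr 1
  have h4 := reorderSign_sumNumbering_sumNumbering (k := k) (Equiv.refl _) α' (Equiv.refl _) γ'
    fun i => p (splitEquiv T i) + 1
  refine (congrArg _ h4.symm).trans ((reorderSign_trans _ ?_ ?_ ?_).symm.trans ?_)
  · exact Fin.val_injective.comp (splitEquiv T).injective
  · exact Fin.val_injective.comp (sumNumbering _ _).injective
  · exact Fin.val_injective.comp (sumNumbering _ _).injective
  · rw [← reorderSign_comp (sumCongr α' γ') fun i => p (e i) + 1, ← hs]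
    congr 1
    funext i
    obtain i | i := i
    · simp [sumNumbering_inl]
    · simp [sumNumbering_inr]

end

section

variable {k : Type*} [Field k] {V : Type*} [AddCommGroup V] [Module k V]
  {𝒱 : ZMod 2 → Submodule k V} {β : OddScalarProduct 𝒱}

/-! ### Expansions in a homogeneous basis -/

section

variable {ι : Type*} [Fintype ι] (u : HomogeneousBasis β ι)

theorem OddScalarProduct.ext_form (β : OddScalarProduct 𝒱) {v v' : V}
    (h : ∀ w, β.form v w = β.form v' w) : v = v' := by
  refine sub_eq_zero.1 (β.nondegenerate.1 _ fun w => ?_)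
  rw [map_sub, LinearMap.sub_apply, h, sub_self]

theorem HomogeneousBasis.sum_smul_vec (v : V) : ∑ i, β.form (u.dual i) v • u.vec i = v := by
  refine β.ext_form fun w => ?_
  rw [map_sum, LinearMap.sum_apply, ← u.sum_form]
  exact sum_congr rfl fun i _ => by simp

theorem HomogeneousBasis.sum_smul_dual (v : V) : ∑ i, β.form v (u.vec i) • u.dual i = v := by
  refine β.ext_form fun w => ?_
  rw [map_sum, LinearMap.sum_apply, β.symm v w, ← u.sum_form]
  exact sum_congr rfl fun i _ => by rw [map_smul, LinearMap.smul_apply, smul_eq_mul,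
    β.symm v, mul_comm]

theorem IsMultilinear.sum_update {F : Type*} [DecidableEq F] {φ : (F → V) → k}
    (h : IsMultilinear φ) (a : F → V) (j : F) (c : ι → k) (v : ι → V) :
    ∑ i, c i * φ (Function.update a j (v i)) = φ (Function.update a j (∑ i, c i • v i)) := by
  obtain ⟨g, hg⟩ := h
  simp only [hg, g.map_update_sum, g.map_update_smul, smul_eq_mul]

end

/-! ### The quadratic term -/

theorem OddSymmetry.form_apply (I : OddSymmetry β) {ε : ZMod 2} {a : V} (ha : a ∈ 𝒱 ε) (b : V) :
    β.form (I.I a) b = -(paritySign k ε * β.form a (I.I b)) := by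
  rw [← neg_one_pow_val, eq_neg_iff_add_eq_zero]
  exact I.invariant ε a ha b

theorem OddSymmetry.form_eq_zero (I : OddSymmetry β) {ε ε' : ZMod 2} {a b : V} (ha : a ∈ 𝒱 ε)
    (hb : b ∈ 𝒱 ε') (h : ε ≠ ε') : β.form (I.I a) b = 0 := by
  refine β.odd _ _ (I.odd _ _ ha) _ ?_
  rwa [(by decide : ∀ ε ε' : ZMod 2, ε ≠ ε' → ε + 1 = ε') ε ε' h]

theorem isEvenFunctional_zero : IsEvenFunctional 𝒱 (0 : Functional k V) where
  multilinear _ _ := IsMultilinear.zero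
  even _ _ _ _ _ _ := rfl
  equivariant _ _ _ _ _ _ := (mul_zero _).symm

section

variable [DirectSum.Decomposition 𝒱] (I : OddSymmetry β)

theorem quadraticTerm_of_ne {n : ℕ} (hn : n ≠ 2) (σ : Perm (Fin n)) (a : Fin n → V) :
    quadraticTerm I 0 n σ a = 0 := dif_neg hn

open Classical in
theorem quadraticTerm_two (σ : Perm (Fin 2)) (a : Fin 2 → V) :
    quadraticTerm I 0 2 σ a =
      if ∀ i, σ i ≠ i then β.form (I.I (-piSign 𝒱 (a 0))) (a 1) else 0 := rfl

theorem quadraticTerm_apply {ε : ZMod 2} {a : Fin 2 → V} (ha : a 0 ∈ 𝒱 ε) :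
    quadraticTerm I 0 2 (swap 0 1) a = paritySign k ε * β.form (I.I (a 0)) (a 1) := by
  rw [quadraticTerm_two, if_pos (by decide), piSign_of_mem 𝒱 ha, paritySign_add]
  simp

theorem quadraticTerm_isMultilinear (n : ℕ) (σ : Perm (Fin n)) :
    IsMultilinear (quadraticTerm I 0 n σ) := by
  by_cases hn : n = 2
  · subst hn
    rw [show quadraticTerm I 0 2 σ = _ from funext fun a => quadraticTerm_two I σ a]
    refine IsMultilinear.ite_zero _ fun _ => ?_
    have h1 : ∀ x y, piSign 𝒱 (x + y) = piSign 𝒱 x + piSign 𝒱 y := (piSignMap 𝒱).map_add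
    have h2 : ∀ (c : k) x, piSign 𝒱 (c • x) = c • piSign 𝒱 x := (piSignMap 𝒱).map_smul
    refine IsMultilinear.of_update (fun a i x y => ?_) fun a i c x => ?_ <;> fin_cases i <;>
      simp [h1, h2]
    all_goals ring
  · rw [show quadraticTerm I 0 n σ = fun _ => 0 from
      funext fun a => quadraticTerm_of_ne I hn σ a]
    exact IsMultilinear.zero

theorem perm_fin_two (ρ : Perm (Fin 2)) : ρ = 1 ∨ ρ = swap 0 1 := by
  revert ρ
  decide

theorem isEvenFunctional_quadraticTerm_zero : IsEvenFunctional 𝒱 (quadraticTerm I 0) where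
  multilinear := quadraticTerm_isMultilinear I
  even n σ p a ha hp := by
    by_cases hn : n = 2
    · subst hn
      obtain rfl | rfl := perm_fin_two σ
      · rw [quadraticTerm_two, if_neg (by simp)]
      · rw [quadraticTerm_apply I (ha 0), I.form_eq_zero (ha 0) (ha 1), mul_zero]
        intro h
        refine hp ?_
        rw [Fin.sum_univ_two, h, zmod_two_add_self]
    · exact quadraticTerm_of_ne I hn σ a
  equivariant n σ ρ p a ha := by
    by_cases hn : n = 2
    · subst hn
      obtain rfl | rfl := perm_fin_two σ
      · rw [quadraticTerm_two, if_neg (by simp), quadraticTerm_two, if_neg (by simp), mul_zero]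
      · obtain rfl | rfl := perm_fin_two ρ
        · rw [koszul_eq_reorderSign, reorderSign_eq_one _ _ _ fun x y h => by simpa using h.le]
          simp
        · rw [swap_inv, mul_assoc, swap_mul_self, mul_one, quadraticTerm_apply I (ha 0),
            quadraticTerm_apply I (a := fun i => a (swap 0 1 i)) (ε := p 1) (by simpa using ha 1)]
          simp only [swap_apply_left, swap_apply_right]
          rw [I.form_apply (ha 1), β.symm (a 1)]
          by_cases h : p 0 = p 1
          · have h1 : (koszul (fun i => p i + 1) (fun i => (swap 0 1 i : Fin 2).val) : k) =
                -paritySign k (p 1) := by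
              rw [koszul_eq_reorderSign, reorderSign]
              simp only [Fin.prod_univ_two, h]
              obtain h2 | h2 := zmod_two_cases (p 1) <;> simp [h2, zmod_two_add_self]
            rw [h1, h]
            linear_combination (-paritySign k (p 1) * β.form (I.I (a 0)) (a 1)) *
              paritySign_mul_self (k := k) (p 1)
          · rw [I.form_eq_zero (ha 0) (ha 1) h]
            ring
    · rw [quadraticTerm_of_ne I hn, quadraticTerm_of_ne I hn, mul_zero]

theorem isEvenFunctional_quadraticTerm (b : ℕ) : IsEvenFunctional 𝒱 (quadraticTerm I b) := by
  cases b with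
  | zero => exact isEvenFunctional_quadraticTerm_zero I
  | succ b => exact isEvenFunctional_zero

theorem eq_of_quadraticTerm_ne_zero {n : ℕ} {σ : Perm (Fin n)} {a : Fin n → V}
    (h : quadraticTerm I 0 n σ a ≠ 0) : n = 2 ∧ ∀ i, σ i ≠ i := by
  by_cases hn : n = 2
  · subst hn
    refine ⟨rfl, ?_⟩
    rw [quadraticTerm_two] at h
    by_contra h1
    exact h (if_neg h1)
  · exact absurd (quadraticTerm_of_ne I hn σ a) h

/-- Gluing may not leave a boundary without letters, so at least one further letter is present.
There are then more than two letters in all, where the quadratic term vanishes. -/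
theorem laplacian_quadraticTerm [FiniteDimensional k V] :
    laplacian β (quadraticTerm I 0) = 0 := by
  classical
  funext n σ a
  unfold laplacian
  rw [Pi.zero_apply, Pi.zero_apply, Pi.zero_apply, sum_eq_zero, mul_zero]
  intro τ _
  split_ifs with h
  · obtain ⟨-, i, -⟩ := h.1 0
    exact sum_eq_zero fun j _ => quadraticTerm_of_ne I
      (fun h => (Nat.succ_injective (Nat.succ_injective h) ▸ i).elim0) τ _
  · rfl

end

/-! ### Sums over the ways to glue a word of two letters -/

open Classical in
-- If one factor accepts only two-letter words, a gluing amounts to choosing the letter `j` that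
-- shares the word with `x`.
theorem sum_glues_pairs {n : ℕ} {x y : Fin (n + 2)} (h : x = 0 ∧ y = 1 ∨ x = 1 ∧ y = 0)
    (σ : Perm (Fin n)) {X : Perm (Fin (n + 2)) → Finset (Fin (n + 2)) → k}
    (hX : ∀ τ T, IsUnionOfWords τ T → X τ T ≠ 0 → T.card = 2 ∧ ∀ i, restrictWords τ T i ≠ i) :
    (∑ τ : Perm (Fin (n + 2)), if Glues τ σ then
      ∑ T : Finset (Fin (n + 2)), if IsUnionOfWords τ T ∧ x ∈ T ∧ y ∉ T then X τ T else 0 else 0) =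
      ∑ j : Fin n, X (pairWords y j σ) {x, j.succ.succ} := by
  have hx : ∀ j : Fin n, x ≠ j.succ.succ := fun j hj => by
    obtain ⟨rfl, -⟩ | ⟨rfl, -⟩ := h <;> simp [Fin.ext_iff] at hj
  have hy : ∀ j : Fin n, y ∉ ({x, j.succ.succ} : Finset (Fin (n + 2))) := fun j hj => by
    obtain ⟨rfl, rfl⟩ | ⟨rfl, rfl⟩ := h <;> simp [Fin.ext_iff] at hj
  trans ∑ z : Perm (Fin (n + 2)) × Finset (Fin (n + 2)),
    if Glues z.1 σ ∧ IsUnionOfWords z.1 z.2 ∧ x ∈ z.2 ∧ y ∉ z.2 then X z.1 z.2 else 0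
  · rw [Fintype.sum_prod_type]
    refine sum_congr rfl fun τ _ => ?_
    by_cases hτ : Glues τ σ <;> simp [hτ]
  symm
  refine sum_of_injOn (fun j => (pairWords y j σ, {x, j.succ.succ})) ?_ (fun _ _ => by simp) ?_ ?_
  · intro i _ j _ hij
    have h1 : i.succ.succ ∈ ({x, j.succ.succ} : Finset (Fin (n + 2))) := by
      have h2 : ({x, i.succ.succ} : Finset (Fin (n + 2))) = {x, j.succ.succ} :=
        (Prod.ext_iff.1 hij).2
      simp [← h2]
    simpa [(hx i).symm] using h1
  · rintro ⟨τ, T⟩ - hT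
    rw [ite_eq_right_iff]
    rintro ⟨h1, h2, h3, h4⟩
    by_contra h5
    obtain ⟨h6, h7⟩ := hX τ T h2 h5
    obtain ⟨j, rfl, rfl⟩ := exists_pairWords h h1 h2 h3 h4 h6 h7
    exact hT ⟨j, by simp, rfl⟩
  · intro j _
    rw [if_pos ⟨glues_pairWords h j σ, isUnionOfWords_pairWords h j σ, by simp, hy j⟩]

end

section

variable {k : Type*} [Field k]

/-! ### Signs of exchanging a letter with a word of two letters -/

section

variable {n : ℕ} (j : Fin n)

theorem prod_le_eq_mul_prod_lt (g : Fin n → k) :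
    (∏ l, if l ≤ j then g l else 1) = g j * ∏ l, if l < j then g l else 1 := by
  rw [← show (∏ l, if l = j then g l else 1) = g j by simp, ← prod_mul_distrib]
  refine prod_congr rfl fun l _ => ?_
  obtain h | rfl | h := lt_trichotomy l j
  · simp [h, h.le, h.ne]
  · simp
  · simp [h.not_ge, h.ne', h.not_gt]

/-- The letter `j` stands in front and all others in place, so it is exchanged exactly with the
letters before its proper position. -/
theorem prod_moved_letter {r : Fin n → ℕ} (hj : r j ≤ 1) (hr : ∀ l ≠ j, r l = l + 2)
    (q : Fin n → ZMod 2) :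
    (∏ x, ∏ y, if r x < r y ∧ (y : ℕ) < x then paritySign k (q x * q y) else 1) =
      ∏ l, if l < j then paritySign k (q j * q l) else 1 := by
  rw [prod_eq_single j]
  · refine prod_congr rfl fun y _ => if_congr ⟨And.right, fun h => ⟨?_, h⟩⟩ rfl rfl
    rw [hr y h.ne]
    omega
  · intro x _ hx
    refine prod_eq_one fun y _ => if_neg ?_
    rintro ⟨h1, h2⟩
    rw [hr x hx] at h1
    by_cases hy : y = j
    · subst hy
      omega
    · rw [hr y hy] at h1
      have : (y : ℕ) < x := h2
      omega
  · simp

/-- The ranks are those of the letters under `pairEquiv 1 j`: the contracted letter of `f` has rank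
one and must be moved to the place `j`, while the old `j`-th letter moves to the front. -/
theorem reorderSign_pair_left {r : Fin 2 ⊕ Fin n → ℕ} (h0 : r (Sum.inl 0) = 0)
    (h1 : r (Sum.inl 1) = j + 2) (hj : r (Sum.inr j) = 1) (hr : ∀ l ≠ j, r (Sum.inr l) = l + 2)
    (q : Fin 2 ⊕ Fin n → ZMod 2) :
    reorderSign k q r (fun i => (sumNumbering (Equiv.refl (Fin 2)) (Equiv.refl (Fin n)) i : ℕ)) =
      paritySign k (q (Sum.inr j) * q (Sum.inl 1)) *
        ∏ l, if l < j then
          paritySign k (q (Sum.inr l) * (q (Sum.inr j) + q (Sum.inl 1))) else 1 := by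
  have h2 : ∀ (y : Fin n) (x : Fin 2), ¬ (2 + (y : ℕ) < x) := fun y x => by omega
  have h3 : ∀ l, r (Sum.inr l) < j + 2 ↔ l ≤ j := fun l => by
    by_cases hl : l = j
    · subst hl
      simp only [hj, le_refl, iff_true]
      omega
    · rw [hr l hl, Fin.le_def]
      have : (l : ℕ) ≠ j := fun h => hl (Fin.ext h)
      omega
  have h4 : ∀ (y : Fin n) (x : Fin 2), (x : ℕ) < 2 + (y : ℕ) := fun y x => by omega
  have h5 := prod_moved_letter (k := k) j (r := fun l => r (Sum.inr l)) hj.le hr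
    fun l => q (Sum.inr l)
  unfold reorderSign
  simp only [Fintype.prod_sum_type, Fin.prod_univ_two, sumNumbering_inl, sumNumbering_inr,
    refl_apply, h0, h1, h2, h3, h4, add_lt_add_iff_left, Nat.not_lt_zero, and_true,
    and_false, false_and, if_false, prod_const_one, one_mul, mul_one, lt_self_iff_false,
    Fin.val_zero, prod_mul_distrib, h5]
  rw [prod_le_eq_mul_prod_lt, mul_assoc, ← prod_mul_distrib]
  congr 1
  refine prod_congr rfl fun l _ => ?_
  split_ifs
  · rw [mul_add, paritySign_add, mul_comm (q (Sum.inr j)), mul_comm]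
  · exact one_mul _

/-- The mirror situation for `pairEquiv 0 j`, with the two-letter word as the second factor. The
assumption of equal parities is the only case in which the quadratic term is nonzero. -/
theorem reorderSign_pair_right {r : Fin n ⊕ Fin 2 → ℕ} (h0 : r (Sum.inr 0) = j + 2)
    (h1 : r (Sum.inr 1) = 1) (hj : r (Sum.inl j) = 0) (hr : ∀ l ≠ j, r (Sum.inl l) = l + 2)
    {q : Fin n ⊕ Fin 2 → ZMod 2} (hq : q (Sum.inr 0) = q (Sum.inr 1)) :
    reorderSign k q r (fun i => (sumNumbering (Equiv.refl (Fin n)) (Equiv.refl (Fin 2)) i : ℕ)) =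
      paritySign k (q (Sum.inr 0)) *
        ∏ l, if l < j then
          paritySign k (q (Sum.inl l) * (q (Sum.inl j) + q (Sum.inr 0))) else 1 := by
  have h2 : ∀ (y : Fin n) (x : ℕ), ¬ (n + x < (y : ℕ)) := fun y x => by omega
  have h3 : ∀ l, (j : ℕ) + 2 < r (Sum.inl l) ↔ j < l := fun l => by
    by_cases hl : l = j
    · subst hl
      simp [hj]
    · rw [hr l hl, Fin.lt_def]
      omega
  have h4 : ∀ (y : Fin n) (x : ℕ), (y : ℕ) < n + x := fun y x => by omega
  have h6 : ∀ l, 1 < r (Sum.inl l) ↔ l ≠ j := fun l => by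
    by_cases hl : l = j
    · subst hl
      simp [hj]
    · simp [hr l hl, hl]
  have h5 := prod_moved_letter (k := k) j (r := fun l => r (Sum.inl l)) (hj.le.trans zero_le_one) hr
    fun l => q (Sum.inl l)
  have h7 : ¬ ((j : ℕ) + 2 < 1) := by omega
  have h8 : 1 < (j : ℕ) + 2 := by omega
  unfold reorderSign
  simp only [Fintype.prod_sum_type, Fin.prod_univ_two, sumNumbering_inl, sumNumbering_inr,
    refl_apply, h0, h1, h2, h3, h4, h6, h7, h8, add_lt_add_iff_left, and_true,
    and_false, false_and, if_false, prod_const_one, one_mul, mul_one, lt_self_iff_false,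
    Fin.val_zero, Fin.val_one, zero_lt_one, if_true, prod_mul_distrib, h5, ← hq]
  have h9 : paritySign k (q (Sum.inr 0) * q (Sum.inr 0)) = paritySign k (q (Sum.inr 0)) := by
    obtain h | h := zmod_two_cases (q (Sum.inr 0)) <;> simp [h]
  rw [h9, mul_comm _ (paritySign k (q (Sum.inr 0))), ← prod_mul_distrib,
    ← prod_mul_distrib]
  congr 1
  refine prod_congr rfl fun l _ => ?_
  obtain h | rfl | h := lt_trichotomy l j
  · simp [h, h.ne, h.not_gt, mul_add, paritySign_add, mul_comm]
  · simp
  · simp [h, h.ne', h.not_gt]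

end

end

section

variable {k : Type*} [Field k] {V : Type*} [AddCommGroup V] [Module k V]
  {𝒱 : ZMod 2 → Submodule k V} {β : OddScalarProduct 𝒱} [DirectSum.Decomposition 𝒱]

/-! ### Brackets with the quadratic term -/

section

variable {ι : Type*} [Fintype ι] (u : HomogeneousBasis β ι) (I : OddSymmetry β)
  {f : Functional k V} {n : ℕ}

open Classical in
theorem bracket_eq_splitProduct [FiniteDimensional k V] {g : Functional k V}
    (hf : ∀ n σ, IsMultilinear (f n σ)) (hg : ∀ n σ, IsMultilinear (g n σ))
    (σ : Perm (Fin n)) (a : Fin n → V) :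
    bracket β f g n σ a = ∑ τ : Perm (Fin (n + 2)), if Glues τ σ then
      ∑ T : Finset (Fin (n + 2)), if IsUnionOfWords τ T ∧ 0 ∈ T ∧ 1 ∉ T then
        ∑ i, splitProduct 𝒱 f g τ T (Fin.cons (u.dual i) (Fin.cons (u.vec i) a))
      else 0 else 0 := by
  unfold bracket
  refine sum_congr rfl fun τ _ => if_congr Iff.rfl ?_ rfl
  refine sum_congr rfl fun T _ => if_congr Iff.rfl ?_ rfl
  exact u.sum_eq ((IsMultilinear.splitProduct τ T (hf _ _) (hg _ _)).isBilinear_cons a)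

theorem cons_comp_pairEquiv_one_inr {X : Type*} (v w : X) (a : Fin n → X) (j : Fin n) :
    (Fin.cons v (Fin.cons w a : Fin (n + 1) → X) : Fin (n + 2) → X) ∘ pairEquiv 1 j ∘ Sum.inr =
      Function.update a j w := by
  funext l
  by_cases h : l = j
  · subst h
    simp only [Function.comp_apply, pairEquiv_inr_self, Function.update_self]
    rfl
  · simp only [Function.comp_apply, pairEquiv_inr_of_ne (Or.inr rfl) h, Function.update_of_ne h,
      Fin.cons_succ]

theorem cons_comp_pairEquiv_zero_inr {X : Type*} (v w : X) (a : Fin n → X) (j : Fin n) :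
    (Fin.cons v (Fin.cons w a : Fin (n + 1) → X) : Fin (n + 2) → X) ∘ pairEquiv 0 j ∘ Sum.inr =
      Function.update a j v := by
  funext l
  by_cases h : l = j
  · subst h
    simp only [Function.comp_apply, pairEquiv_inr_self, Function.update_self]
    rfl
  · simp only [Function.comp_apply, pairEquiv_inr_of_ne (Or.inl rfl) h, Function.update_of_ne h,
      Fin.cons_succ]

theorem ne_zero_of_splitProduct {g : Functional k V} {N : ℕ} {τ : Perm (Fin N)}
    {T : Finset (Fin N)} {a : Fin N → V} (h : splitProduct 𝒱 f g τ T a ≠ 0) :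
    (∃ x, f T.card (restrictWords τ T) x ≠ 0) ∧ ∃ y, g Tᶜ.card (restrictWords τ Tᶜ) y ≠ 0 := by
  obtain ⟨p, -, hp⟩ := exists_ne_zero_of_sum_ne_zero h
  exact ⟨⟨_, right_ne_zero_of_mul (left_ne_zero_of_mul hp)⟩, ⟨_, right_ne_zero_of_mul hp⟩⟩

/-- `β.form (u.dual i) (I.I (a j))` vanishes unless `u.vec i` has the parity of `I (a j)`. In this
case the two moved letters are odd in total, so each letter before `j` contributes its own parity,
which is the sign in `I^∨`. -/
theorem splitProduct_quadraticTerm_left (hf : IsEvenFunctional 𝒱 f) (σ : Perm (Fin n))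
    {p : Fin n → ZMod 2} {a : Fin n → V} (ha : ∀ i, a i ∈ 𝒱 (p i)) (j : Fin n) (i : ι) :
    splitProduct 𝒱 (quadraticTerm I 0) f (pairWords 1 j σ) {0, j.succ.succ}
        (Fin.cons (u.dual i) (Fin.cons (u.vec i) a)) =
      -((∏ l, if l < j then paritySign k (p l + 1) else 1) *
        (β.form (u.dual i) (I.I (a j)) * f n σ (Function.update a j (u.vec i)))) := by
  have hx := cons_mem (cons_mem ha (u.vec_mem i)) (u.dual_mem i)
  rw [pairWords, splitProduct_of_equiv (isEvenFunctional_quadraticTerm I 0) hf (pairEquiv 1 j)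
    (fun l => ?_) (fun l => ?_) _ _ hx, quadraticTerm_apply I (ε := u.parity i + 1) ?_,
    cons_comp_pairEquiv_one_inr]
  · simp only [Function.comp_apply, pairEquiv_one_inl_zero, pairEquiv_one_inl_one, Fin.cons_zero,
      Fin.cons_succ]
    rw [I.form_apply (u.dual_mem i)]
    by_cases h : u.parity i = p j
    · rw [β.odd _ _ (u.dual_mem i) _ (h ▸ I.odd _ _ (ha j))]
      ring
    · have h0 := (by decide : ∀ ε ε' : ZMod 2, ε ≠ ε' → ε = ε' + 1) _ _ h
      rw [reorderSign_pair_left j (by rw [pairEquiv_one_inl_zero]; rfl)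
        (by rw [pairEquiv_one_inl_one]; rfl) (by rw [pairEquiv_inr_self]; rfl)
        (fun l hl => by rw [pairEquiv_inr_of_ne (Or.inr rfl) hl]; rfl)]
      rw [pairEquiv_inr_self, pairEquiv_one_inl_one]
      change paritySign k ((u.parity i + 1) * (p j + 1)) *
        (∏ l, if l < j then paritySign k ((_ + 1) * (u.parity i + 1 + (p j + 1))) else 1) * _ = _
      rw [h0, (by decide : ∀ ε : ZMod 2, (ε + 1 + 1) * (ε + 1) = 0) (p j),
        (by decide : ∀ ε : ZMod 2, ε + 1 + 1 + (ε + 1) = 1) (p j)]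
      have h1 : ∀ l, (if l < j then paritySign k
          (((Fin.cons (u.parity i + 1) (Fin.cons (u.parity i) p : Fin (n + 1) → ZMod 2) :
            Fin (n + 2) → ZMod 2) (pairEquiv 1 j (Sum.inr l)) + 1) * 1) else 1) =
          if l < j then paritySign k (p l + 1) else 1 := fun l => by
        split_ifs with hl
        · rw [pairEquiv_inr_of_ne (Or.inr rfl) hl.ne, mul_one]
          rfl
        · rfl
      rw [h0] at h1
      rw [prod_congr rfl fun l _ => h1 l, paritySign_add]
      simp only [paritySign_zero, paritySign_one]
      linear_combination (-(∏ l, if l < j then paritySign k (p l + 1) else 1) *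
        (β.form (u.dual i) (I.I (a j)) * f n σ (Function.update a j (u.vec i)))) *
        paritySign_mul_self (k := k) (p j + 1)
  · rw [Function.comp_apply, Function.comp_apply, pairEquiv_one_inl_zero]
    exact u.dual_mem i
  · obtain rfl | rfl := (by decide : ∀ l : Fin 2, l = 0 ∨ l = 1) l
    · simp [pairEquiv_one_inl_zero]
    · simp [pairEquiv_one_inl_one]
  · by_cases h : l = j
    · subst h
      simp [pairEquiv_inr_self, Fin.ext_iff]
    · rw [pairEquiv_inr_of_ne (Or.inr rfl) h]
      simpa using h

/-- Again only one parity of the index `i` contributes, and for it the moved letters are jointly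
odd; the sign of the quadratic term cancels the sign of moving its word to the end. -/
theorem splitProduct_quadraticTerm_right (hf : IsEvenFunctional 𝒱 f) (σ : Perm (Fin n))
    {p : Fin n → ZMod 2} {a : Fin n → V} (ha : ∀ i, a i ∈ 𝒱 (p i)) (j : Fin n) (i : ι) :
    splitProduct 𝒱 f (quadraticTerm I 0) (pairWords 0 j σ) {1, j.succ.succ}ᶜ
        (Fin.cons (u.dual i) (Fin.cons (u.vec i) a)) =
      -((∏ l, if l < j then paritySign k (p l + 1) else 1) *
        (β.form (I.I (a j)) (u.vec i) * f n σ (Function.update a j (u.dual i)))) := by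
  have hx := cons_mem (cons_mem ha (u.vec_mem i)) (u.dual_mem i)
  have hw : pairWords 0 j σ = ((sumComm _ _).trans (pairEquiv 0 j)).permCongr
      (sumCongr σ (swap 0 1)) := by
    refine Equiv.ext fun x => ?_
    obtain ⟨l | l, rfl⟩ := (pairEquiv 0 j).surjective x <;> simp [pairWords, permCongr_apply]
  rw [hw, splitProduct_of_equiv hf (isEvenFunctional_quadraticTerm I 0)
    ((sumComm _ _).trans (pairEquiv 0 j)) (fun l => ?_) (fun l => ?_) _ _ hx,
    quadraticTerm_apply I (ε := p j) ?_]
  · have h2 := cons_comp_pairEquiv_zero_inr (u.dual i) (u.vec i) a j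
    have h3 : ∀ x, ((sumComm _ _).trans (pairEquiv 0 j)) (Sum.inl x) =
      pairEquiv 0 j (Sum.inr x) := fun _ => rfl
    have h4 : ∀ x, ((sumComm _ _).trans (pairEquiv 0 j)) (Sum.inr x) =
      pairEquiv 0 j (Sum.inl x) := fun _ => rfl
    change _ * (f n σ (_ ∘ pairEquiv 0 j ∘ Sum.inr) * _) = _
    rw [h2]
    simp only [Function.comp_apply, h4, pairEquiv_zero_inl_zero, pairEquiv_zero_inl_one,
      Fin.cons_succ]
    change _ * (_ * (_ * β.form (I.I (a j)) (u.vec i))) = _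
    by_cases h : p j = u.parity i
    · rw [reorderSign_pair_right j (by rw [h4, pairEquiv_zero_inl_zero]; rfl)
        (by rw [h4, pairEquiv_zero_inl_one]; rfl) (by rw [h3, pairEquiv_inr_self]; rfl)
        (fun l hl => by rw [h3, pairEquiv_inr_of_ne (Or.inl rfl) hl]; rfl)
        (by rw [h4, h4, pairEquiv_zero_inl_zero, pairEquiv_zero_inl_one]
            exact congrArg (· + 1) h)]
      rw [h3, h4, pairEquiv_inr_self, pairEquiv_zero_inl_zero]
      change paritySign k (p j + 1) *
        (∏ l, if l < j then paritySign k ((_ + 1) * (u.parity i + 1 + 1 + (p j + 1))) else 1) *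
          _ = _
      rw [← h, (by decide : ∀ ε : ZMod 2, ε + 1 + 1 + (ε + 1) = 1) (p j)]
      have h1 : ∀ l, (if l < j then paritySign k
          (((Fin.cons (u.parity i + 1) (Fin.cons (u.parity i) p : Fin (n + 1) → ZMod 2) :
            Fin (n + 2) → ZMod 2) (pairEquiv 0 j (Sum.inr l)) + 1) * 1) else 1) =
          if l < j then paritySign k (p l + 1) else 1 := fun l => by
        split_ifs with hl
        · rw [pairEquiv_inr_of_ne (Or.inl rfl) hl.ne, mul_one]
          rfl
        · rfl
      rw [← h] at h1
      simp only [h3, h1]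
      rw [paritySign_add (p j)]
      simp only [paritySign_one]
      linear_combination (-(∏ l, if l < j then paritySign k (p l + 1) else 1) *
        (β.form (I.I (a j)) (u.vec i) * f n σ (Function.update a j (u.dual i)))) *
        paritySign_mul_self (k := k) (p j)
    · rw [I.form_eq_zero (ha j) (u.vec_mem i) h]
      ring
  · change (Fin.cons _ (Fin.cons _ a : Fin (n + 1) → V) : Fin (n + 2) → V)
      (pairEquiv 0 j (Sum.inl 0)) ∈ _
    rw [pairEquiv_zero_inl_zero]
    exact ha j
  · rw [mem_compl]
    change pairEquiv 0 j (Sum.inr l) ∉ _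
    by_cases h : l = j
    · subst h
      simp [pairEquiv_inr_self, Fin.ext_iff]
    · rw [pairEquiv_inr_of_ne (Or.inl rfl) h]
      simpa [Fin.ext_iff] using h
  · rw [mem_compl, not_not]
    change pairEquiv 0 j (Sum.inl l) ∈ _
    obtain rfl | rfl := (by decide : ∀ l : Fin 2, l = 0 ∨ l = 1) l
    · simp [pairEquiv_zero_inl_zero]
    · simp [pairEquiv_zero_inl_one]

theorem dualAction_zero (f : Functional k V) (hf : ∀ n σ, IsMultilinear (f n σ)) :
    dualAction 𝒱 (0 : Module.End k V) f = 0 := by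
  funext n σ a
  unfold dualAction
  rw [sum_eq_zero fun i _ => ?_, neg_zero]
  · rfl
  · exact (hf n σ).eq_zero i (by simp)

/-- Invariance of `β` turns the two actions into pairings with `I²`, which is zero. -/
theorem dualAction_quadraticTerm (hI : I.I * I.I = 0) (σ : Perm (Fin n)) (a : Fin n → V) :
    dualAction 𝒱 I.I (quadraticTerm I 0) n σ a = 0 := by
  have hsq : ∀ v, I.I (I.I v) = 0 := fun v => LinearMap.congr_fun hI v
  refine IsMultilinear.ext_homogeneous (𝒱 := 𝒱)
    (dualAction_isMultilinear I.I (quadraticTerm_isMultilinear I) σ) IsMultilinear.zero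
    (fun p a ha => ?_) a
  rw [dualAction_eq I.I _ σ (quadraticTerm_isMultilinear I n σ) ha]
  by_cases hn : n = 2
  · subst hn
    obtain rfl | rfl := perm_fin_two σ
    · simp [quadraticTerm_two]
    · have h0 : Function.update a 0 (I.I (a 0)) 0 ∈ 𝒱 (p 0 + 1) := by simpa using I.odd _ _ (ha 0)
      have h1 : Function.update a 1 (I.I (a 1)) 0 ∈ 𝒱 (p 0) := by simpa using ha 0
      rw [Fin.sum_univ_two, quadraticTerm_apply I h0, quadraticTerm_apply I h1]
      simp [hsq, I.form_apply (ha 0)]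
  · simp [quadraticTerm_of_ne I hn]

variable [FiniteDimensional k V]

/-- Contraction with the two-letter word expands `I (a j)` in the basis and inserts the result at
the place `j`, so the bracket acts as the derivation `I^∨`. -/
theorem bracket_quadraticTerm_left (hf : IsEvenFunctional 𝒱 f) (σ : Perm (Fin n))
    (a : Fin n → V) : bracket β (quadraticTerm I 0) f n σ a = dualAction 𝒱 I.I f n σ a := by
  classical
  obtain ⟨u⟩ := exists_homogeneousBasis β
  refine IsMultilinear.ext_homogeneous (𝒱 := 𝒱)
    (bracket_isMultilinear (quadraticTerm_isMultilinear I) hf.multilinear σ)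
    (dualAction_isMultilinear I.I hf.multilinear σ) (fun p a ha => ?_) a
  rw [bracket_eq_splitProduct u (quadraticTerm_isMultilinear I) hf.multilinear,
    sum_glues_pairs (Or.inl ⟨rfl, rfl⟩), dualAction_eq I.I f σ (hf.multilinear n σ) ha,
    ← sum_neg_distrib]
  · refine sum_congr rfl fun j _ => ?_
    rw [sum_congr rfl fun i _ => splitProduct_quadraticTerm_left u I hf σ ha j i,
      sum_neg_distrib, ← mul_sum, IsMultilinear.sum_update (hf.multilinear n σ), u.sum_smul_vec]
  · intro τ T hT h
    obtain ⟨i, -, hi⟩ := exists_ne_zero_of_sum_ne_zero h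
    obtain ⟨⟨x, hx⟩, -⟩ := ne_zero_of_splitProduct hi
    exact eq_of_quadraticTerm_ne_zero I hx

theorem bracket_quadraticTerm_right (hf : IsEvenFunctional 𝒱 f) (σ : Perm (Fin n))
    (a : Fin n → V) : bracket β f (quadraticTerm I 0) n σ a = dualAction 𝒱 I.I f n σ a := by
  classical
  obtain ⟨u⟩ := exists_homogeneousBasis β
  refine IsMultilinear.ext_homogeneous (𝒱 := 𝒱)
    (bracket_isMultilinear hf.multilinear (quadraticTerm_isMultilinear I) σ)
    (dualAction_isMultilinear I.I hf.multilinear σ) (fun p a ha => ?_) a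
  rw [bracket_eq_splitProduct u hf.multilinear (quadraticTerm_isMultilinear I),
    dualAction_eq I.I f σ (hf.multilinear n σ) ha, ← sum_neg_distrib]
  have h1 := sum_glues_pairs (Or.inr ⟨rfl, rfl⟩) σ (X := fun τ T => ∑ i,
    splitProduct 𝒱 f (quadraticTerm I 0) τ Tᶜ (Fin.cons (u.dual i) (Fin.cons (u.vec i) a)))
    fun τ T hT h => by
      obtain ⟨i, -, hi⟩ := exists_ne_zero_of_sum_ne_zero h
      obtain ⟨-, y, hy⟩ := ne_zero_of_splitProduct hi
      have h2 := eq_of_quadraticTerm_ne_zero I hy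
      rwa [compl_compl] at h2
  have h2 : ∀ (τ : Perm (Fin (n + 2))) (T : Finset (Fin (n + 2))),
      IsUnionOfWords τ Tᶜ ↔ IsUnionOfWords τ T := fun τ T =>
    ⟨fun h => by simpa using h.compl, IsUnionOfWords.compl⟩
  refine Eq.trans (sum_congr rfl fun τ _ => if_congr Iff.rfl ?_ rfl) (h1.trans ?_)
  · rw [← Equiv.sum_comp (compl_involutive.toPerm _)]
    refine sum_congr rfl fun T _ => if_congr ?_ rfl rfl
    simp only [Function.Involutive.coe_toPerm, h2, mem_compl, not_not]
    tauto
  · refine sum_congr rfl fun j _ => ?_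
    rw [sum_congr rfl fun i _ => splitProduct_quadraticTerm_right u I hf σ ha j i,
      sum_neg_distrib, ← mul_sum, IsMultilinear.sum_update (hf.multilinear n σ), u.sum_smul_dual]

end

end

section

variable {k : Type*} [Field k] {V : Type*} [AddCommGroup V] [Module k V]
  {𝒱 : ZMod 2 → Submodule k V}

/-! ### The equation with the quadratic term -/

theorem IsEvenFunctional.add {f g : Functional k V} (hf : IsEvenFunctional 𝒱 f)
    (hg : IsEvenFunctional 𝒱 g) : IsEvenFunctional 𝒱 (f + g) where
  multilinear n σ := IsMultilinear.add (hf.multilinear n σ) (hg.multilinear n σ)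
  even n σ p a ha hp := by
    rw [Pi.add_apply, Pi.add_apply, Pi.add_apply, hf.even n σ p a ha hp, hg.even n σ p a ha hp,
      add_zero]
  equivariant n σ ρ p a ha := by
    simp only [Pi.add_apply]
    rw [hf.equivariant n σ ρ p a ha, hg.equivariant n σ ρ p a ha, mul_add]

variable [FiniteDimensional k V] {β : OddScalarProduct 𝒱}

theorem laplacian_add (f g : Functional k V) :
    laplacian β (f + g) = laplacian β f + laplacian β g := by
  funext n σ a
  have := laplacian_sum (β := β) (s := univ) (f := f + g) (F := ![f, g]) (n := n)
    (fun τ a => by simp [Fin.sum_univ_two]) σ a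
  simpa [Fin.sum_univ_two] using this

theorem bracket_add [DirectSum.Decomposition 𝒱] (f f' g g' : Functional k V) :
    bracket β (f + f') (g + g') =
      bracket β f g + bracket β f g' + (bracket β f' g + bracket β f' g') := by
  funext n σ a
  have := bracket_sum (β := β) (s := univ) (t := univ) (f := f + f') (F := ![f, f'])
    (g := g + g') (G := ![g, g']) (n := n) (fun N _ τ a => by simp [Fin.sum_univ_two])
    (fun N _ τ a => by simp [Fin.sum_univ_two]) σ a
  simpa [Fin.sum_univ_two] using this

theorem bracket_zero_left [DirectSum.Decomposition 𝒱] (g : Functional k V) :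
    bracket β 0 g = 0 := by
  funext n σ a
  exact bracket_sum (s := (∅ : Finset ℕ)) (t := {0}) (F := fun _ => 0) (G := fun _ => g)
    (fun _ _ _ _ => rfl) (fun _ _ _ _ => by simp) σ a

theorem bracket_zero_right [DirectSum.Decomposition 𝒱] (f : Functional k V) :
    bracket β f 0 = 0 := by
  funext n σ a
  refine (bracket_sum (s := {0}) (t := (∅ : Finset ℕ)) (F := fun _ : ℕ => f) (G := fun _ => 0)
    (fun _ _ _ _ => by simp) (fun _ _ _ _ => rfl) σ a).trans ?_
  simp

variable [DirectSum.Decomposition 𝒱] {I : OddSymmetry β} {S : Series k V}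

theorem SolvesEquivariantBV.solvesBV (h : SolvesEquivariantBV I S) (hI : I.I = 0) :
    SolvesBV β S := by
  refine ⟨h.1, ?_⟩
  have h1 : dualActionSeries 𝒱 I.I S = 0 := funext fun b => by
    rw [hI]
    exact dualAction_zero _ (h.1 b).multilinear
  rw [← h.2, h1, add_zero]

theorem laplacianSeries_add_quadraticTerm :
    laplacianSeries β (S + quadraticTerm I) = laplacianSeries β S := by
  funext b
  change laplacian β (S b + quadraticTerm I b) = laplacian β (S b)
  cases b with
  | zero => rw [laplacian_add, laplacian_quadraticTerm, add_zero]
  | succ b => exact congrArg _ (add_zero _)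

/-- Each mixed bracket equals `I^∨ S`, whence the factor two, and the bracket of the quadratic term
with itself is `I^∨` of that term, which is zero because `I² = 0`. -/
theorem bracketSeries_add_quadraticTerm (hS : ∀ b, IsEvenFunctional 𝒱 (S b))
    (hI : I.I * I.I = 0) :
    bracketSeries β (S + quadraticTerm I) (S + quadraticTerm I) =
      bracketSeries β S S + (2 : k) • dualActionSeries 𝒱 I.I S := by
  have h1 : ∀ b, bracket β (quadraticTerm I 0) (S b) = dualAction 𝒱 I.I (S b) := fun b => by
    funext n σ a
    exact bracket_quadraticTerm_left I (hS b) σ a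
  have h2 : ∀ b, bracket β (S b) (quadraticTerm I 0) = dualAction 𝒱 I.I (S b) := fun b => by
    funext n σ a
    exact bracket_quadraticTerm_right I (hS b) σ a
  have h3 : bracket β (quadraticTerm I 0) (quadraticTerm I 0) = 0 := by
    funext n σ a
    rw [bracket_quadraticTerm_left I (isEvenFunctional_quadraticTerm_zero I),
      dualAction_quadraticTerm I hI]
    rfl
  have h4 : ∀ b, ∑ c ∈ antidiagonal b, bracket β (quadraticTerm I c.1) (S c.2) =
      dualAction 𝒱 I.I (S b) := fun b => by
    rw [sum_eq_single (0, b)]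
    · exact h1 b
    · rintro ⟨c | c, d⟩ hc hne
      · rw [HasAntidiagonal.mem_antidiagonal] at hc
        simp_all
      · exact bracket_zero_left _
    · simp
  have h5 : ∀ b, ∑ c ∈ antidiagonal b, bracket β (S c.1) (quadraticTerm I c.2) =
      dualAction 𝒱 I.I (S b) := fun b => by
    rw [sum_eq_single (b, 0)]
    · exact h2 b
    · rintro ⟨c, d | d⟩ hc hne
      · rw [HasAntidiagonal.mem_antidiagonal] at hc
        simp_all
      · exact bracket_zero_right _
    · simp
  have h6 : ∀ b, ∑ c ∈ antidiagonal b, bracket β (quadraticTerm I c.1) (quadraticTerm I c.2) =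
      0 := fun b => by
    refine sum_eq_zero ?_
    rintro ⟨c | c, d | d⟩ -
    · exact h3
    · exact bracket_zero_right _
    · exact bracket_zero_left _
    · exact bracket_zero_left _
  funext b
  change ∑ c ∈ antidiagonal b, bracket β (S c.1 + quadraticTerm I c.1)
    (S c.2 + quadraticTerm I c.2) = bracketSeries β S S b + (2 : k) • dualAction 𝒱 I.I (S b)
  simp only [bracket_add, sum_add_distrib, h4, h5, h6, add_zero]
  rw [two_smul, add_assoc]
  rfl

theorem SolvesEquivariantBV.solvesBV_add_quadraticTerm [CharZero k]
    (h : SolvesEquivariantBV I S) (hI : I.I * I.I = 0) : SolvesBV β (S + quadraticTerm I) := by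
  refine ⟨fun b => (h.1 b).add (isEvenFunctional_quadraticTerm I b), ?_⟩
  rw [laplacianSeries_add_quadraticTerm, bracketSeries_add_quadraticTerm h.1 hI, smul_add,
    inv_smul_smul₀ two_ne_zero, ← add_assoc]
  exact h.2

end

end NCBV

end

/-! ### The theorem for the graph sum on the image of the projection. -/

open NCBV
theorem mainTheorem2 {k : Type*} [Field k] [CharZero k]
    {A : Type*} [AddCommGroup A] [Module k A] [FiniteDimensional k A]
    (𝒜 : ZMod 2 → Submodule k A) [DirectSum.Decomposition 𝒜]
    (β : OddScalarProduct 𝒜) (I : OddSymmetry β) (m : CyclicTensors 𝒜)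
    (hm : dualAction 𝒜 I.I m.functional + (2 : k)⁻¹ • bracket β m.functional m.functional = 0)
    (hΔ : laplacian β m.functional = 0) (h : OddHomotopy I) :
    SolvesEquivariantBV h.restrictI (h.graphSum m) ∧
    (h.restrictI.I = 0 → SolvesBV h.form (h.graphSum m)) ∧
    (h.restrictI.I * h.restrictI.I = 0 →
      SolvesBV h.form (h.graphSum m + quadraticTerm h.restrictI)) :=
  have hS := solvesEquivariantBV_graphSum hm hΔ h
  ⟨hS, hS.solvesBV, hS.solvesBV_add_quadraticTerm⟩
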